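/- Let $0<\alpha<2$. \emph{Random matrices.} Let $(x_{ij})_{1\le i\le j<\infty}$ be i.i.d. real random variables with $\mathbb P(|x_{ij}|\ge u)=L(u)u^{-\alpha}$ for all $u>0$, where $L$ is slowly varying at infinity. Put $x_{ji}=x_{ij}$ and $a_N=\inf\{u:\mathbb P(|x_{11}|\ge u)\le 1/N\}$. For $\sigma:[0,1]^2\to\mathbb R$ symmetric let $\mathbf A_N^\sigma$ be the symmetric $N\times N$ matrix with entries $a_N^{-1}\sigma(\frac iN,\frac jN)x_{ij}$, and let $\hat\mu_{\mathbf A_N^\sigma}=\frac1N\sum_{i=1}^N\delta_{\lambda_i}$ be the spectral measure of its eigenvalues. \emph{Classes of $\sigma$.} Let $\mathcal C_\star$ be the set of functions $\sigma$ for which there are $0=b_0<b_1<\dots<b_q=1$ and a symmetric real matrix $(\sigma_{rs})_{1\le r,s\le q}$ with $\sigma=\sigma_{rs}$ on $(b_{r-1},b_r]\times(b_{s-1},b_s]$. Put $\|f\|_\star=\limsup_{n\to\infty}\|f(n^{-1}\lceil nx\rceil,n^{-1}\lceil ny\rceil)\|_{L^2([0,1]^2)}$ and $\|f\|=\operatorname{ess\,sup}_{x\in(0,1]}\int_0^1|f(x,v)|\,dv$.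 Let $\mathcal F_\alpha$ be the set of symmetric measurable $\sigma:[0,1]^2\to\mathbb R$ with $\|\sigma\|_\star<\infty$ and $\|\,|\sigma|^\alpha\|<\infty$ for which there are $\sigma_p\in\mathcal C_\star$ with $\|\sigma_p-\sigma\|_\star\to0$ and $\|\,|\sigma_p|^\alpha-|\sigma|^\alpha\|\to0$. Then $\mathcal C_\star\subset\mathcal F_\alpha$. Call $\sigma\in\mathcal F_\alpha$ equivalent to $\tilde\sigma\in\mathcal C_\star$ if, for a partition $(b_r)$ and a matrix $(\tilde\sigma_{rs})$ representing $\tilde\sigma$ as above, $\int_{b_{s-1}}^{b_s}|\sigma(x,v)|^\alpha dv=(b_s-b_{s-1})|\tilde\sigma_{rs}|^\alpha$ for all $r,s$ and all $x\in(b_{r-1},b_r]$. \emph{Special functions.} Let $g_\alpha(y)=\int_0^\infty t^{\frac\alpha2-1}e^{-t}e^{-t^{\alpha/2}y}dt$, $h_\alpha(y)=\int_0^\infty e^{-t}e^{-t^{\alpha/2}y}dt$ for $y\in\mathbb C$, $C_\alpha=i^\alpha\,\Gamma(1-\frac\alpha2)/\Gamma(\frac\alpha2)$ (principal powers), $\mathcal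 K_\alpha=\{re^{i\theta}:r\ge0,\ |\theta|\le\frac{\alpha\pi}2\}$ and $\mathbb C^+=\{z:\Im z>0\}$. \textbf{Theorem.} For every $\sigma\in\mathcal F_\alpha$ there is a symmetric probability measure $\mu^\sigma$ on $\mathbb R$, depending only on $\alpha$ and $\sigma$, such that $\mathbb E[\hat\mu_{\mathbf A_N^\sigma}]$ converges weakly to $\mu^\sigma$ as $N\to\infty$. There is a finite $R=R(\sigma)$ such that there is exactly one analytic map $Y^\sigma:\mathbb C^+\to L^\infty((0,1];\mathcal K_\alpha)$ with the property that, for all $z\in\mathbb C^+$ with $|z|\ge R$ and almost every $x\in(0,1]$, $$z^\alpha Y^\sigma_x(z)=C_\alpha\int_0^1|\sigma(x,v)|^\alpha g_\alpha(Y^\sigma_v(z))\,dv,$$ and for all $z\in\mathbb C^+$ $$\int\frac1{z-t}\,d\mu^\sigma(t)=\frac1z\int_0^1h_\alpha(Y^\sigma_v(z))\,dv.$$ On $\mathbb R\setminus\{0\}$ the measure $\mu^\sigma$ has a density $\rho^\sigma$ (that is, some version of the density has the following properties) that is bounded outside every neighbourhood of $0$ and satisfies $t^{\alpha+1}\rho^\sigma(t)\to\frac\alpha2\int_0^1\int_0^1|\sigma(x,v)|^\alpha\,dx\,dv$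 as $t\to\infty$. Further, if $\sigma\in\mathcal F_\alpha$ is equivalent to $\tilde\sigma\in\mathcal C_\star$, then $\mu^\sigma=\mu^{\tilde\sigma}$. -/

import Mathlib

open MeasureTheory ProbabilityTheory Filter Topology Set
open scoped ENNReal BoundedContinuousFunction

noncomputable section

namespace HeavyTail

/-! ### The random matrices -/

/-- `L` is slowly varying at infinity. -/
def SlowlyVarying (L : ℝ → ℝ) : Prop :=
  Measurable L ∧ (∀ᶠ u in atTop, 0 < L u) ∧
    ∀ c : ℝ, 0 < c → Tendsto (fun u => L (c * u) / L u) atTop (𝓝 1)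

/-- The entries `x i j` with `i ≤ j` are i.i.d. real random variables with
`P(|x i j| ≥ u) = L(u) u ^ (-α)` for all `u > 0`, where `L` is slowly varying. The array is indexed
from `0`, and the values `x i j` with `j < i` are never used. -/
structure IsHeavyTailedArray {Ω : Type*} [MeasurableSpace Ω] (P : Measure Ω) (α : ℝ)
    (x : ℕ → ℕ → Ω → ℝ) : Prop where
  measurable : ∀ i j, i ≤ j → Measurable (x i j)
  indep : iIndepFun (fun p : {p : ℕ × ℕ // p.1 ≤ p.2} => x p.1.1 p.1.2) P
  identDistrib : ∀ i j, i ≤ j → IdentDistrib (x i j) (x 0 0) P P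
  tail : ∃ L : ℝ → ℝ, SlowlyVarying L ∧
    ∀ u : ℝ, 0 < u → P.real {ω | u ≤ |x 0 0 ω|} = L u * u ^ (-α)

/-- The normalizing constant `a_N = inf {u : P(|X| ≥ u) ≤ 1 / N}`. -/
def normalizingConstant {Ω : Type*} [MeasurableSpace Ω] (P : Measure Ω) (X : Ω → ℝ) (N : ℕ) : ℝ :=
  sInf {u : ℝ | P.real {ω | u ≤ |X ω|} ≤ 1 / (N : ℝ)}

/-- The normalized matrix `A_N^σ`, with entries `a_N⁻¹ σ(i/N, j/N) x_{ij}` for `1 ≤ i, j ≤ N`, where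
`x_{ij} = x_{ji}`. The index `i : Fin N` stands for the row number `i + 1`. -/
def bandMatrix {Ω : Type*} [MeasurableSpace Ω] (P : Measure Ω) (x : ℕ → ℕ → Ω → ℝ)
    (σ : ℝ → ℝ → ℝ) (N : ℕ) (ω : Ω) : Matrix (Fin N) (Fin N) ℝ :=
  Matrix.of fun i j =>
    (normalizingConstant P (x 0 0) N)⁻¹ *
      (σ (((i : ℕ) + 1 : ℝ) / N) (((j : ℕ) + 1 : ℝ) / N) *
        x (min (i : ℕ) (j : ℕ)) (max (i : ℕ) (j : ℕ)) ω)

/-- The spectral measure `N⁻¹ ∑ δ_λ`, where `λ` runs over the real eigenvalues of `A` counted with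
multiplicity (there are `N` of them when `A` is symmetric). -/
def spectralMeasure {N : ℕ} (A : Matrix (Fin N) (Fin N) ℝ) : Measure ℝ :=
  (N : ℝ≥0∞)⁻¹ • (A.charpoly.roots.map Measure.dirac).sum

/-- The expected spectral measure `B ↦ E[spectralMeasure (A_N^σ) B]`. -/
def expectedSpectralMeasure {Ω : Type*} [MeasurableSpace Ω] (P : Measure Ω) (x : ℕ → ℕ → Ω → ℝ)
    (σ : ℝ → ℝ → ℝ) (N : ℕ) : Measure ℝ :=
  P.bind fun ω => spectralMeasure (bandMatrix P x σ N ω)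

/-! ### The classes of functions `σ`

A function on the unit square is represented by a function `ℝ → ℝ → ℝ`; only its values on
`(0, 1] × (0, 1]` matter. -/

/-- `σ` takes the constant value `m r s` on `(b_{r-1}, b_r] × (b_{s-1}, b_s]`, where
`0 = b_0 < ⋯ < b_q = 1` and `m` is symmetric. -/
structure IsPiecewiseConstantWith (σ : ℝ → ℝ → ℝ) (q : ℕ) (b : Fin (q + 1) → ℝ)
    (m : Matrix (Fin q) (Fin q) ℝ) : Prop where
  strictMono : StrictMono b
  zero : b 0 = 0
  one : b (Fin.last q) = 1
  symm : m.IsSymm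
  eq : ∀ r s : Fin q, ∀ x ∈ Ioc (b r.castSucc) (b r.succ), ∀ y ∈ Ioc (b s.castSucc) (b s.succ),
    σ x y = m r s

/-- The class of symmetric piecewise constant functions. -/
def CStar : Set (ℝ → ℝ → ℝ) :=
  {σ | ∃ (q : ℕ) (b : Fin (q + 1) → ℝ) (m : Matrix (Fin q) (Fin q) ℝ),
    IsPiecewiseConstantWith σ q b m}

/-- The semi-norm `limsup_n ‖f(⌈n x⌉ / n, ⌈n y⌉ / n)‖₂`, the `L²` norm being over the unit square. -/
def starNorm (f : ℝ → ℝ → ℝ) : ℝ≥0∞ :=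
  limsup (fun n : ℕ =>
    eLpNorm (fun p : ℝ × ℝ => f ((⌈(n : ℝ) * p.1⌉ : ℝ) / n) ((⌈(n : ℝ) * p.2⌉ : ℝ) / n)) 2
      (volume.restrict (Ioc (0 : ℝ) 1 ×ˢ Ioc (0 : ℝ) 1))) atTop

/-- The operator norm `ess sup_x ∫₀¹ |f(x, v)| dv`. -/
def opNorm (f : ℝ → ℝ → ℝ) : ℝ≥0∞ :=
  essSup (fun x => ∫⁻ v in Ioc (0 : ℝ) 1, ‖f x v‖ₑ) (volume.restrict (Ioc (0 : ℝ) 1))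

/-- The class `𝓕_α`. -/
structure IsInF (α : ℝ) (σ : ℝ → ℝ → ℝ) : Prop where
  symm : ∀ x ∈ Ioc (0 : ℝ) 1, ∀ y ∈ Ioc (0 : ℝ) 1, σ x y = σ y x
  measurable : AEMeasurable (Function.uncurry σ)
    (volume.restrict (Ioc (0 : ℝ) 1 ×ˢ Ioc (0 : ℝ) 1))
  starNorm_lt_top : starNorm σ < ∞
  opNorm_lt_top : opNorm (fun x v => |σ x v| ^ α) < ∞
  approx : ∃ τ : ℕ → ℝ → ℝ → ℝ, (∀ p, τ p ∈ CStar) ∧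
    Tendsto (fun p => starNorm (fun x y => τ p x y - σ x y)) atTop (𝓝 0) ∧
    Tendsto (fun p => opNorm (fun x v => |τ p x v| ^ α - |σ x v| ^ α)) atTop (𝓝 0)

/-- `σ` is equivalent to the piecewise constant `σ'`: for the cells `(b_{r-1}, b_r]` and the values
`m r s` of `σ'`, the average over `v ∈ (b_{s-1}, b_s]` of `|σ(x, v)| ^ α` is `|m r s| ^ α` for every
`x ∈ (b_{r-1}, b_r]`. -/
def EquivalentTo (α : ℝ) (σ σ' : ℝ → ℝ → ℝ) : Prop :=
  ∃ (q : ℕ) (b : Fin (q + 1) → ℝ) (m : Matrix (Fin q) (Fin q) ℝ),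
    IsPiecewiseConstantWith σ' q b m ∧
    ∀ r s : Fin q, ∀ x ∈ Ioc (b r.castSucc) (b r.succ),
      ∫⁻ v in Ioc (b s.castSucc) (b s.succ), ENNReal.ofReal (|σ x v| ^ α) =
        ENNReal.ofReal ((b s.succ - b s.castSucc) * |m r s| ^ α)

/-! ### The limiting equations -/

/-- `g_α(y) = ∫₀^∞ t^(α/2 - 1) e^(-t) exp(-t^(α/2) y) dt`. -/
def gFun (α : ℝ) (y : ℂ) : ℂ :=
  ∫ t in Ioi (0 : ℝ),
    ((t ^ (α / 2 - 1) * Real.exp (-t) : ℝ) : ℂ) * Complex.exp (-((t ^ (α / 2) : ℝ) : ℂ) * y)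

/-- `h_α(y) = ∫₀^∞ e^(-t) exp(-t^(α/2) y) dt`. -/
def hFun (α : ℝ) (y : ℂ) : ℂ :=
  ∫ t in Ioi (0 : ℝ),
    ((Real.exp (-t) : ℝ) : ℂ) * Complex.exp (-((t ^ (α / 2) : ℝ) : ℂ) * y)

/-- `C_α = i^α Γ(1 - α/2) / Γ(α/2)`. -/
def cConst (α : ℝ) : ℂ :=
  Complex.I ^ (α : ℂ) * ((Real.Gamma (1 - α / 2) / Real.Gamma (α / 2) : ℝ) : ℂ)

/-- The closed cone `𝒦_α = {R e^(iθ) : |θ| ≤ απ/2, R ≥ 0}`. -/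
def cone (α : ℝ) : Set ℂ :=
  {y | ∃ R θ : ℝ, 0 ≤ R ∧ |θ| ≤ α * Real.pi / 2 ∧ y = R * Complex.exp (θ * Complex.I)}

/-- The open upper half-plane. -/
def upperHalf : Set ℂ := {z | 0 < z.im}

/-- Lebesgue measure on `(0, 1]`. -/
abbrev unitMeasure : Measure ℝ := volume.restrict (Ioc (0 : ℝ) 1)

/-- `Y` is an analytic map from the upper half-plane to `L^∞((0, 1]; 𝒦_α)` that satisfies
`z^α Y_x(z) = C_α ∫₀¹ |σ(x, v)|^α g_α(Y_v(z)) dv` for almost every `x`, whenever `|z| ≥ R`.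
(Values of `Y` off the upper half-plane are irrelevant.) -/
structure IsSolution (α : ℝ) (σ : ℝ → ℝ → ℝ) (R : ℝ) (Y : ℂ → Lp ℂ ∞ unitMeasure) : Prop where
  analytic : AnalyticOnNhd ℂ Y upperHalf
  mem_cone : ∀ z ∈ upperHalf, ∀ᵐ x ∂unitMeasure, Y z x ∈ cone α
  equation : ∀ z ∈ upperHalf, R ≤ ‖z‖ → ∀ᵐ x ∂unitMeasure,
    z ^ (α : ℂ) * Y z x = cConst α * ∫ v, ((|σ x v| ^ α : ℝ) : ℂ) * gFun α (Y z v) ∂unitMeasure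

end HeavyTail

end

open HeavyTail

open MeasureTheory ProbabilityTheory Filter Topology Set
open scoped ENNReal BoundedContinuousFunction

noncomputable section

namespace HeavyTail

open scoped Real ComplexConjugate
open Complex (I I_im I_mul_I I_ne_zero I_re abs_im_le_norm abs_re_le_norm add_im add_re arg_I
  conj_conj conj_ofReal continuous_conj continuous_im continuous_ofReal continuous_re cpow_add
  cpow_def_of_ne_zero cpow_neg cpow_one exp exp_add exp_ofReal_mul_I_re exp_sum im_ofReal_mul inv_im
  log_exp mul_im mul_re neg_im neg_re normSq norm_I norm_cpow_real norm_exp norm_ofNat norm_real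
  ofRealCLM ofReal_add ofReal_cpow ofReal_eq_zero ofReal_exp ofReal_im ofReal_inv ofReal_mul
  ofReal_neg ofReal_one ofReal_re ofReal_zero re_le_norm re_mul_ofReal re_ofReal_mul re_sum
  real_smul slitPlane sub_im)
open Real (Gamma Gamma_one Gamma_pos_of_pos cos inv_rpow mul_rpow norm_eq_abs norm_of_nonneg
  one_rpow pi_pos rpow_add rpow_le_rpow rpow_le_rpow_of_nonpos rpow_mul rpow_natCast rpow_neg
  rpow_one rpow_zero sin sqrt_pos zero_rpow)
open Finset (card_univ measurable_sum mul_sum prod_eq_zero prod_le_one single_le_sum sum_add_distrib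
  sum_comm sum_congr sum_const sum_eq_single sum_ite_eq' sum_le_sum sum_mul sum_nonneg
  sum_sub_distrib)
open Metric (ball ball_mem_nhds ball_subset_ball ball_subset_closedBall closedBall
  isClosed_closedBall isOpen_ball mem_ball mem_ball_self mem_closedBall)
open ENNReal (ofReal)

local notation "Λ" => unitMeasure

/-! Let `G = (z - A)⁻¹` be the resolvent and put `w_j = i G_jj`, a number with positive real part.
Schur's formula (`green_mul_schur`) writes `1 / w_i` as `-iz`, plus `i` times a diagonal entry of
`A`, plus a quadratic form of row `i` in the resolvent of the matrix with row and column `i` set to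
zero. That resolvent is independent of the row. The diagonal entry and the off-diagonal part of the
form are negligible (`IsTailLimit.eventually_integral_offDiag_le`), so `w_i` is close to the inverse
of `V_i = -iz + ∑_j (σ_ij x_ij / a_N)² w_j`.

The sum in `V_i` has heavy tails of index `α/2` and behaves like a stable variable. Insert `Γ(p)
V^(-p) = ∫ t^(p-1) e^(-tV) dt` and use `E exp(-t (σ x / a_N)² w) ≈ exp(-Γ(1 - α/2) t^(α/2) |σ|^α
w^(α/2) / N)`. This gives `E V_i^(-p) ≈ Γ(p)⁻¹ ∫ t^(p-1) exp(izt - t^(α/2) X_i) dt` with `X_i = Γ(1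
- α/2) N⁻¹ ∑_j |σ_ij|^α w_j^(α/2)` (`IsTailLimit.eventually_norm_integral_row_sub_le`). The averages
`X_i` concentrate by bounded differences (`eventually_integral_norm_rowField_sub_le`). The exponent
`p = α/2` therefore yields a closed approximate equation for `E X`, and `p = 1` recovers the
Cauchy-Stieltjes transform (`IsTailLimit.eventually_fixedPoint`).

The limiting equation is a contraction when `Im z` is large. Its iterates stay in a cone, hence are
locally bounded on the whole upper half-plane, and Vitali's theorem extends their convergence there
(`exists_tendsto_fieldIter`). Invariance of the cone (`lapInt_mem_cone`) has a probabilistic proof: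
the integral is a limit of expectations of powers `V^(-α/2)` with `Re V > 0`, up to a positive
factor.

Bounded profiles whose kernels converge in the mean are treated by
`IsTailLimit.tendsto_meanTransform`. A general `σ` is approximated by piecewise constant profiles.
The random side is stable in the discretized `L²` norm
(`IsTailLimit.exists_norm_meanTransform_sub_le`), and the limiting side is stable in the operator
norm (`norm_limitTransform_sub_le`).

Convergence of transforms far from the axis gives weak convergence
(`exists_tendsto_of_tendsto_stieltjes`). Boundedness of `z G(z)` and the expansion of `G` at
infinity give the density and its tail (`exists_limitTransform_expansion`,
`exists_density_of_stieltjes`). Uniqueness of `Y` is a contraction for large `|z|` followed by the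
identity theorem (`exists_unique_isSolution`). Equivalent profiles have the same transform because
the iterates are constant on cells and see only cell averages (`EquivalentTo.limitTransform_eq`). -/

lemma ae_mem_Ioi (a : ℝ) : ∀ᵐ t ∂volume.restrict (Ioi a), t ∈ Ioi a := ae_restrict_mem measurableSet_Ioi

lemma integral_const_add {Ω : Type*} [MeasurableSpace Ω] {μ : Measure Ω} [IsProbabilityMeasure μ] {f : Ω → ℝ}
    (hf : Integrable f μ) (c : ℝ) : ∫ x, c + f x ∂μ = c + ∫ x, f x ∂μ := by
  rw [integral_add (integrable_const _) hf]; simp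

lemma integrable_of_bound {X E : Type*} [MeasurableSpace X] {μ : Measure X} [IsFiniteMeasure μ]
    [NormedAddCommGroup E] [MeasurableSpace E] [BorelSpace E] [SecondCountableTopology E] {f : X → E}
    {C : ℝ} (hf : Measurable f) (hC : ∀ x, ‖f x‖ ≤ C) : Integrable f μ :=
  .of_bound hf.aestronglyMeasurable C (.of_forall hC)

lemma integral_congr_fun {X E : Type*} [MeasurableSpace X] {μ : Measure X} [NormedAddCommGroup E]
    [NormedSpace ℝ E] {f g : X → E} (h : ∀ x, f x = g x) : ∫ x, f x ∂μ = ∫ x, g x ∂μ :=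
  integral_congr_ae (.of_forall h)

lemma norm_integral_le_of_forall_le {X : Type*} [MeasurableSpace X] {μ : Measure X}
    [IsProbabilityMeasure μ] {f : X → ℂ} {C : ℝ} (h : ∀ x, ‖f x‖ ≤ C) : ‖∫ x, f x ∂μ‖ ≤ C := by
  simpa using norm_integral_le_of_norm_le_const (μ := μ) (.of_forall h)

lemma norm_ofReal_mul {r : ℝ} (hr : 0 ≤ r) (w : ℂ) : ‖(r : ℂ) * w‖ = r * ‖w‖ := by
  rw [norm_mul, norm_real, norm_of_nonneg hr]

/-! ### Holomorphic functions: parametric integrals and limits -/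

lemma isOpen_upperHalf : IsOpen upperHalf := isOpen_lt continuous_const continuous_im

lemma convex_upperHalf : Convex ℝ upperHalf :=
  convex_halfSpace_im_gt 0

lemma isPreconnected_upperHalf : IsPreconnected upperHalf :=
  convex_upperHalf.isPreconnected

/-- Cauchy's estimate converts the local majorant of `F` into a majorant of its derivative, so
differentiation under the integral needs no separate bound. -/
lemma differentiableOn_integral {T : Type*} [MeasurableSpace T] {μ : Measure T}
    {F : ℂ → T → ℂ} {U : Set ℂ} (hU : IsOpen U) (hmeas : ∀ z ∈ U, AEStronglyMeasurable (F z) μ)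
    (hdiff : ∀ᵐ t ∂μ, DifferentiableOn ℂ (fun z => F z t) U)
    (hbound : ∀ z₀ ∈ U, ∃ r > 0, ∃ b : T → ℝ, Integrable b μ ∧
      ∀ᵐ t ∂μ, ∀ z ∈ ball z₀ r, ‖F z t‖ ≤ b t) : DifferentiableOn ℂ (fun z => ∫ t, F z t ∂μ) U := by
  intro z₀ hz₀
  obtain ⟨r, hr, b, hb, hFb⟩ := hbound z₀ hz₀
  obtain ⟨r', hr', hr'U⟩ := Metric.isOpen_iff.1 hU z₀ hz₀
  set s := min r r' / 2 with hs
  have hs0 : 0 < s := by positivity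
  have hsr : s + s ≤ r := by rw [hs]; linarith [min_le_left r r']
  have hsr' : s + s ≤ r' := by rw [hs]; linarith [min_le_right r r']
  have hball : ball z₀ s ⊆ U := (ball_subset_ball (by linarith)).trans hr'U
  have hder : ∀ᵐ t ∂μ, ∀ z ∈ ball z₀ s,
      HasDerivAt (fun z => F z t) (deriv (fun z => F z t) z) z := by
    filter_upwards [hdiff] with t ht z hz
    exact (ht.differentiableAt (hU.mem_nhds (hball hz))).hasDerivAt
  have hderb : ∀ᵐ t ∂μ, ∀ z ∈ ball z₀ s, ‖deriv (fun z => F z t) z‖ ≤ b t / (s / 2) := by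
    filter_upwards [hdiff, hFb] with t ht hb z hz
    have hsub : closedBall z (s / 2) ⊆ ball z₀ (s + s) := by
      intro w hw; rw [mem_closedBall] at hw; rw [mem_ball] at hz ⊢
      linarith [dist_triangle w z z₀]
    refine Complex.norm_deriv_le_of_forall_mem_sphere_norm_le (by positivity) ?_ ?_
    · refine DifferentiableOn.diffContOnCl (ht.mono ?_)
      refine (closure_mono ball_subset_closedBall).trans ?_
      rw [isClosed_closedBall.closure_eq]
      exact hsub.trans ((ball_subset_ball hsr').trans hr'U)
    · intro w hw
      exact hb w (ball_subset_ball hsr (hsub (Metric.sphere_subset_closedBall hw)))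
  -- The derivative is the limit of difference quotients along `h n → 0`, each measurable in `t`.
  have hmeas' : AEStronglyMeasurable (fun t => deriv (fun z => F z t) z₀) μ := by
    set h : ℕ → ℂ := fun n => ((s / (n + 2) : ℝ) : ℂ) with hh
    have hhne : ∀ n, h n ≠ 0 := fun n => by simp only [hh, ne_eq, ofReal_eq_zero]; positivity
    have hhlim : Tendsto h atTop (𝓝[≠] 0) := by
      refine tendsto_nhdsWithin_iff.2 ⟨?_, Eventually.of_forall hhne⟩
      have h1 : Tendsto (fun n : ℕ => s / ((n : ℝ) + 2)) atTop (𝓝 0) :=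
        tendsto_const_nhds.div_atTop (tendsto_atTop_add_const_right _ _ tendsto_natCast_atTop_atTop)
      have h2 := (continuous_ofReal.tendsto 0).comp h1
      rwa [ofReal_zero] at h2
    have hhU : ∀ n, z₀ + h n ∈ U := fun n => hball <| by
      rw [mem_ball, dist_eq_norm, add_sub_cancel_left, norm_real, norm_eq_abs,
        abs_of_pos (by positivity)]
      rw [div_lt_iff₀ (by positivity)]; nlinarith [(Nat.cast_nonneg n : (0 : ℝ) ≤ n)]
    refine aestronglyMeasurable_of_tendsto_ae atTop
      (f := fun n t => (h n)⁻¹ • (F (z₀ + h n) t - F z₀ t)) (fun n => ?_) ?_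
    · exact ((hmeas _ (hhU n)).sub (hmeas _ hz₀)).const_smul (h n)⁻¹
    · filter_upwards [hder] with t ht
      have := (ht z₀ (mem_ball_self hs0))
      exact (hasDerivAt_iff_tendsto_slope_zero.1 this).comp hhlim
  have hInt : Integrable (F z₀) μ := by
    refine hb.mono' (hmeas z₀ hz₀) ?_
    filter_upwards [hFb] with t ht using ht z₀ (mem_ball_self hr)
  have := hasDerivAt_integral_of_dominated_loc_of_deriv_le (F := F)
    (F' := fun z t => deriv (fun z => F z t) z) (ball_mem_nhds z₀ hs0)
    (by filter_upwards [hU.mem_nhds hz₀] with z hz using hmeas z hz) hInt hmeas' hderb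
    (hb.div_const _) hder
  exact this.2.differentiableAt.differentiableWithinAt

/-- A locally bounded, pointwise convergent sequence of holomorphic functions converges locally
uniformly. -/
lemma tendstoLocallyUniformlyOn_of_bounded {f : ℕ → ℂ → ℂ} {g : ℂ → ℂ} {U : Set ℂ} (hU : IsOpen U)
    (hf : ∀ n, DifferentiableOn ℂ (f n) U)
    (hb : ∀ z₀ ∈ U, ∃ r > 0, ∃ M : ℝ, ∀ n, ∀ z ∈ ball z₀ r, ‖f n z‖ ≤ M)
    (hlim : ∀ z ∈ U, Tendsto (fun n => f n z) atTop (𝓝 (g z))) :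
    TendstoLocallyUniformlyOn f g atTop U := by
  rw [Metric.tendstoLocallyUniformlyOn_iff]; intro ε hε z₀ hz₀
  obtain ⟨r, hr, M, hM⟩ := hb z₀ hz₀
  obtain ⟨r', hr', hr'U⟩ := Metric.isOpen_iff.1 hU z₀ hz₀
  set s := min r r' / 2 with hs
  have hs0 : 0 < s := by positivity
  have hsr : s + s ≤ r := by rw [hs]; linarith [min_le_left r r']
  have hsr' : s + s ≤ r' := by rw [hs]; linarith [min_le_right r r']
  have hM0 : 0 ≤ M := (norm_nonneg _).trans (hM 0 z₀ (mem_ball_self hr))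
  have hball : ball z₀ s ⊆ U := (ball_subset_ball (by linarith)).trans hr'U
  -- Cauchy's estimate makes the sequence equi-Lipschitz near `z₀`, so convergence at the single
  -- point `z₀` controls a whole neighbourhood.
  have hlip : ∀ n, ∀ z ∈ ball z₀ s, ‖f n z - f n z₀‖ ≤ M / (s / 2) * ‖z - z₀‖ := by
    intro n z hz
    refine (convex_ball z₀ s).norm_image_sub_le_of_norm_deriv_le (f := f n) (𝕜 := ℂ)
      (fun w hw => (hf n).differentiableAt (hU.mem_nhds (hball hw))) ?_
      (mem_ball_self hs0) hz
    intro w hw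
    have hsub : closedBall w (s / 2) ⊆ ball z₀ (s + s) := by
      intro u hu; rw [mem_closedBall] at hu; rw [mem_ball] at hw ⊢
      linarith [dist_triangle u w z₀]
    refine Complex.norm_deriv_le_of_forall_mem_sphere_norm_le (by positivity) ?_ ?_
    · refine DifferentiableOn.diffContOnCl ((hf n).mono ?_)
      refine (closure_mono ball_subset_closedBall).trans ?_
      rw [isClosed_closedBall.closure_eq]
      exact hsub.trans ((ball_subset_ball hsr').trans hr'U)
    · intro u hu
      exact hM n u (ball_subset_ball hsr (hsub (Metric.sphere_subset_closedBall hu)))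
  have hlipg : ∀ z ∈ ball z₀ s, ‖g z - g z₀‖ ≤ M / (s / 2) * ‖z - z₀‖ := fun z hz =>
    le_of_tendsto (((hlim z (hball hz)).sub (hlim z₀ hz₀)).norm) (.of_forall fun n => hlip n z hz)
  set K := M / (s / 2)
  have hK0 : 0 ≤ K := by positivity
  refine ⟨ball z₀ (min s (ε / (4 * (K + 1)))),
    mem_nhdsWithin_of_mem_nhds (ball_mem_nhds _ (by positivity)), ?_⟩
  filter_upwards [Metric.tendsto_nhds.1 (hlim z₀ hz₀) (ε / 4) (by positivity)] with n hn z hz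
  rw [mem_ball, dist_eq_norm] at hz
  have hz1 : z ∈ ball z₀ s := by rw [mem_ball, dist_eq_norm]; exact hz.trans_le (min_le_left _ _)
  have hz2 : K * ‖z - z₀‖ ≤ ε / 4 := by
    have h2 := (hz.trans_le (min_le_right _ _)).le
    rw [le_div_iff₀ (by positivity)] at h2; nlinarith [norm_nonneg (z - z₀)]
  have h3 := hlip n z hz1
  have h4 := hlipg z hz1
  rw [dist_eq_norm] at hn ⊢
  have : g z - f n z = (g z - g z₀) - (f n z - f n z₀) - (f n z₀ - g z₀) := by ring
  rw [this]
  have h5 := norm_sub_le ((g z - g z₀) - (f n z - f n z₀)) (f n z₀ - g z₀)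
  have h6 := norm_sub_le (g z - g z₀) (f n z - f n z₀)
  linarith

/-- Vitali's theorem in the upper half-plane: if a sequence of holomorphic functions is uniformly
bounded on `{s ≤ Im z}` for every `s > 0` and converges on `{y₀ < Im z}`, it converges
everywhere. -/
lemma exists_tendsto_of_tendsto_im_gt {f : ℕ → ℂ → ℂ} {y₀ : ℝ}
    (hf : ∀ n, DifferentiableOn ℂ (f n) upperHalf)
    (hb : ∀ s > 0, ∃ M : ℝ, ∀ n, ∀ z : ℂ, s ≤ z.im → ‖f n z‖ ≤ M)
    (hlim : ∀ z : ℂ, y₀ < z.im → ∃ l, Tendsto (fun n => f n z) atTop (𝓝 l))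
    {z : ℂ} (hz : z ∈ upperHalf) : ∃ l, Tendsto (fun n => f n z) atTop (𝓝 l) := by
  have hz0 : 0 < z.im := hz
  set y₁ := max y₀ 0
  have hy₁0 : 0 ≤ y₁ := le_max_right _ _
  set V : Set ℂ := {w | y₁ < w.im} with hV
  have hVo : IsOpen V := isOpen_lt continuous_const continuous_im
  have hVU : V ⊆ upperHalf := fun w hw => hy₁0.trans_lt hw
  choose! g hg using hlim
  have hgV : ∀ w ∈ V, Tendsto (fun n => f n w) atTop (𝓝 (g w)) := fun w hw =>
    hg w ((le_max_left _ _).trans_lt hw)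
  have hunif : TendstoLocallyUniformlyOn f g atTop V := by
    refine tendstoLocallyUniformlyOn_of_bounded hVo (fun n => (hf n).mono hVU) ?_ hgV
    intro w hw
    obtain ⟨r, hr, hrV⟩ := Metric.isOpen_iff.1 hVo w hw
    have hw' : y₁ < w.im := hw
    obtain ⟨M, hM⟩ := hb (w.im / 2) (by linarith)
    refine ⟨min r (w.im / 2), lt_min hr (by linarith), M, fun n u hu => hM n u ?_⟩
    rw [mem_ball, dist_eq_norm] at hu
    have h1 := (abs_im_le_norm (u - w)).trans (hu.le.trans (min_le_right _ _))
    rw [sub_im, abs_le] at h1; linarith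
  have hiter : ∀ k, TendstoLocallyUniformlyOn (fun n => deriv^[k] (f n)) (deriv^[k] g) atTop V ∧
      ∀ n, DifferentiableOn ℂ (deriv^[k] (f n)) V := by
    intro k
    induction k with
    | zero => exact ⟨hunif, fun n => (hf n).mono hVU⟩
    | succ k ih =>
      simp only [Function.iterate_succ_apply']
      exact ⟨ih.1.deriv (.of_forall ih.2) hVo, fun n => (ih.2 n).deriv hVo⟩
  -- The centre `c` lies vertically above `z`, inside the region of known convergence. The disc of
  -- radius `Y - Im z / 2` contains `z` and stays in `{Im ≥ Im z / 2}`, where the sequence is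
  -- uniformly bounded.
  set Y := y₁ + 1 + z.im with hY
  set c : ℂ := ⟨z.re, Y⟩ with hc
  have hcV : c ∈ V := by simp only [hV, mem_ofPred_eq, hc, hY]; linarith
  set r := Y - z.im / 2 with hr
  have hr0 : 0 < r := by rw [hr, hY]; linarith
  have hsub : ∀ w ∈ closedBall c r, z.im / 2 ≤ w.im := by
    intro w hw; rw [mem_closedBall, dist_eq_norm] at hw
    have h1 := (abs_im_le_norm (w - c)).trans hw
    rw [sub_im, abs_le] at h1
    have : c.im = Y := rfl
    linarith [h1.1]
  have hzc : ‖z - c‖ < r := by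
    have : z - c = ((z.im - Y : ℝ) : ℂ) * I := by apply Complex.ext <;> simp [hc]
    rw [this, norm_mul, norm_real, norm_I, mul_one, norm_eq_abs,
      abs_of_neg (by rw [hY]; linarith), hr]
    linarith
  have hzball : z ∈ ball c r := by rwa [mem_ball, dist_eq_norm]
  have hballU : closedBall c r ⊆ upperHalf := fun w hw => by
    have := hsub w hw
    simp only [upperHalf, mem_ofPred_eq]; linarith
  obtain ⟨M, hM⟩ := hb (z.im / 2) (by linarith)
  have hseries : ∀ n, HasSum (fun k : ℕ => ((k.factorial : ℂ))⁻¹ • (z - c) ^ k •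
      iteratedDeriv k (f n) c) (f n z) := fun n =>
    Complex.hasSum_taylorSeries_on_ball ((hf n).mono (ball_subset_closedBall.trans hballU)) hzball
  refine ⟨∑' k : ℕ, ((k.factorial : ℂ))⁻¹ • (z - c) ^ k • deriv^[k] g c, ?_⟩
  have heq : (fun n => f n z) = fun n => ∑' k : ℕ, ((k.factorial : ℂ))⁻¹ • (z - c) ^ k •
      iteratedDeriv k (f n) c := funext fun n => (hseries n).tsum_eq.symm
  rw [heq]
  -- Each Taylor coefficient at `c` converges, and Cauchy's estimates supply a geometric majorant.
  refine tendsto_tsum_of_dominated_convergence (bound := fun k => M * (‖z - c‖ / r) ^ k) ?_ ?_ ?_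
  · refine (summable_geometric_of_lt_one (by positivity) ?_).mul_left M
    rwa [div_lt_one hr0]
  · intro k
    refine Tendsto.const_smul (Tendsto.const_smul ?_ _) _
    simp only [iteratedDeriv_eq_iterate]; exact (hiter k).1.tendsto_at hcV
  · refine Eventually.of_forall fun n k => ?_
    have h1 : ‖iteratedDeriv k (f n) c‖ ≤ k.factorial * M / r ^ k := by
      refine Complex.norm_iteratedDeriv_le_of_forall_mem_sphere_norm_le k hr0 ?_ ?_
      · refine DifferentiableOn.diffContOnCl ((hf n).mono ?_)
        refine (closure_mono ball_subset_closedBall).trans ?_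
        rw [isClosed_closedBall.closure_eq]; exact hballU
      · exact fun w hw => hM n w (hsub w (Metric.sphere_subset_closedBall hw))
    rw [norm_smul, norm_smul, norm_inv, norm_pow, Complex.norm_natCast]
    calc (k.factorial : ℝ)⁻¹ * (‖z - c‖ ^ k * ‖iteratedDeriv k (f n) c‖)
        ≤ (k.factorial : ℝ)⁻¹ * (‖z - c‖ ^ k * (k.factorial * M / r ^ k)) := by gcongr
      _ = M * (‖z - c‖ / r) ^ k := by
        have : (k.factorial : ℝ) ≠ 0 := by positivity
        rw [div_pow]; field_simp

/-! ### Analytic maps into `L^∞` -/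

lemma norm_deriv_le_of_norm_le {f : ℂ → ℂ} {z₀ : ℂ} {s M : ℝ} (hs : 0 < s)
    (hf : DifferentiableOn ℂ f (ball z₀ (2 * s)))
    (hb : ∀ z ∈ ball z₀ (2 * s), ‖f z‖ ≤ M) {z : ℂ} (hz : z ∈ ball z₀ s) :
    ‖deriv f z‖ ≤ M / (s / 2) := by
  have hsub : closedBall z (s / 2) ⊆ ball z₀ (2 * s) := by
    intro u hu; rw [mem_closedBall] at hu; rw [mem_ball] at hz ⊢
    linarith [dist_triangle u z z₀]
  refine Complex.norm_deriv_le_of_forall_mem_sphere_norm_le (by positivity) ?_ ?_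
  · refine DifferentiableOn.diffContOnCl (hf.mono ?_)
    refine (closure_mono ball_subset_closedBall).trans ?_
    rwa [isClosed_closedBall.closure_eq]
  · exact fun u hu => hb u (hsub (Metric.sphere_subset_closedBall hu))

/-- The constant depends only on the radius and the supremum. Hence the remainder is uniform over a
bounded family, which gives differentiability in the norm of `L^∞`. -/
lemma norm_sub_sub_deriv_mul_le {f : ℂ → ℂ} {z₀ : ℂ} {s M : ℝ} (hs : 0 < s)
    (hf : DifferentiableOn ℂ f (ball z₀ (4 * s)))
    (hb : ∀ z ∈ ball z₀ (4 * s), ‖f z‖ ≤ M) {z : ℂ} (hz : z ∈ ball z₀ s) :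
    ‖f z - f z₀ - (z - z₀) * deriv f z₀‖ ≤ 2 * M / s ^ 2 * ‖z - z₀‖ ^ 2 := by
  have e4 : 4 * s = 2 * (2 * s) := by ring
  rw [e4] at hf hb
  have hM : 0 ≤ M := (norm_nonneg _).trans (hb z₀ (mem_ball_self (by positivity)))
  have hd1 : ∀ w ∈ ball z₀ (2 * s), ‖deriv f w‖ ≤ M / s := fun w hw => by
    have := norm_deriv_le_of_norm_le (by positivity) hf hb hw
    rwa [mul_div_cancel_left₀ _ two_ne_zero] at this
  have hf' : DifferentiableOn ℂ (deriv f) (ball z₀ (2 * s)) :=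
    (hf.deriv isOpen_ball).mono (ball_subset_ball (by linarith))
  have hd2 : ∀ w ∈ ball z₀ s, ‖deriv f w - deriv f z₀‖ ≤ M / s / (s / 2) * ‖w - z₀‖ := by
    intro w hw
    refine (convex_ball z₀ s).norm_image_sub_le_of_norm_deriv_le (𝕜 := ℂ) (fun u hu => ?_)
      (fun u hu => norm_deriv_le_of_norm_le hs hf' hd1 hu) (mem_ball_self hs) hw
    exact hf'.differentiableAt (isOpen_ball.mem_nhds (ball_subset_ball (by linarith) hu))
  set g : ℂ → ℂ := fun w => f w - (w - z₀) * deriv f z₀ with hg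
  have hfd : ∀ u ∈ ball z₀ s, DifferentiableAt ℂ f u := fun u hu =>
    hf.differentiableAt (isOpen_ball.mem_nhds (ball_subset_ball (by linarith) hu))
  have hgd : ∀ u ∈ ball z₀ s, HasDerivAt g (deriv f u - deriv f z₀) u := by
    intro u hu
    have h2 := (((hasDerivAt_id u).sub_const z₀).mul_const (deriv f z₀))
    have h3 := (hfd u hu).hasDerivAt.fun_sub h2
    rw [one_mul] at h3; exact h3
  have hseg : closedBall z₀ ‖z - z₀‖ ⊆ ball z₀ s := by
    intro u hu; rw [mem_closedBall] at hu; rw [mem_ball, dist_eq_norm] at hz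
    rw [mem_ball]; linarith
  have hfin := (convex_closedBall z₀ ‖z - z₀‖).norm_image_sub_le_of_norm_deriv_le (𝕜 := ℂ)
    (f := g) (C := M / s / (s / 2) * ‖z - z₀‖) (x := z₀) (y := z)
    (fun u hu => (hgd u (hseg hu)).differentiableAt) (fun u hu => by
      rw [(hgd u (hseg hu)).deriv]
      refine (hd2 u (hseg hu)).trans ?_
      rw [mem_closedBall, dist_eq_norm] at hu
      gcongr) (Metric.mem_closedBall_self (norm_nonneg _))
    (by rw [mem_closedBall, dist_eq_norm])
  have e1 : g z - g z₀ = f z - f z₀ - (z - z₀) * deriv f z₀ := by simp only [hg]; ring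
  rw [e1] at hfin
  refine hfin.trans (le_of_eq ?_)
  field_simp

/-- A family of holomorphic functions, bounded uniformly on each `{s ≤ Im z}`, is an analytic map
into `L^∞`. -/
lemma exists_analyticOnNhd_Lp {f : ℝ → ℂ → ℂ}
    (hm : ∀ z ∈ upperHalf, AEStronglyMeasurable (fun x => f x z) Λ)
    (hd : ∀ x, DifferentiableOn ℂ (f x) upperHalf)
    (hb : ∀ s > 0, ∃ M : ℝ, ∀ x, ∀ z : ℂ, s ≤ z.im → ‖f x z‖ ≤ M) :
    ∃ Y : ℂ → Lp ℂ ∞ Λ, AnalyticOnNhd ℂ Y upperHalf ∧ ∀ z ∈ upperHalf, ∀ᵐ x ∂Λ, Y z x = f x z := by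
  have hmem : ∀ z ∈ upperHalf, MemLp (fun x => f x z) ∞ Λ := by
    intro z hz
    obtain ⟨M, hM⟩ := hb z.im hz
    exact memLp_top_of_bound (hm z hz) M (.of_forall fun x => hM x z le_rfl)
  classical
  set Y : ℂ → Lp ℂ ∞ Λ := fun z => if h : MemLp (fun x => f x z) ∞ Λ then h.toLp else 0 with hY
  have hYae : ∀ z ∈ upperHalf, ∀ᵐ x ∂Λ, Y z x = f x z := by
    intro z hz; simp only [hY, dif_pos (hmem z hz)]; exact (hmem z hz).coeFn_toLp
  refine ⟨Y, DifferentiableOn.analyticOnNhd (fun z₀ hz₀ => ?_) isOpen_upperHalf, hYae⟩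
  have hz₀' : 0 < z₀.im := hz₀
  set s := z₀.im / 8 with hs
  have hs0 : 0 < s := by positivity
  obtain ⟨M, hM⟩ := hb (z₀.im / 2) (by positivity)
  have hball : ∀ z ∈ ball z₀ (4 * s), z₀.im / 2 ≤ z.im := by
    intro z hz; rw [mem_ball, dist_eq_norm] at hz
    have h1 := (abs_im_le_norm (z - z₀)).trans hz.le
    rw [sub_im, abs_le] at h1; linarith [h1.1]
  have hballU : ball z₀ (4 * s) ⊆ upperHalf := fun z hz => by
    have := hball z hz
    simp only [upperHalf, mem_ofPred_eq]; linarith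
  have hM0 : 0 ≤ M := (norm_nonneg _).trans (hM 0 z₀ (by linarith))
  have hrem : ∀ x, ∀ z ∈ ball z₀ s,
      ‖f x z - f x z₀ - (z - z₀) * deriv (f x) z₀‖ ≤ 2 * M / s ^ 2 * ‖z - z₀‖ ^ 2 := fun x z hz =>
    norm_sub_sub_deriv_mul_le hs0 ((hd x).mono hballU) (fun w hw => hM x w (hball w hw)) hz
  have hdm : AEStronglyMeasurable (fun x => deriv (f x) z₀) Λ := by
    set h : ℕ → ℂ := fun n => ((s / (n + 2) : ℝ) : ℂ) with hh
    have hhne : ∀ n, h n ≠ 0 := fun n => by simp only [hh, ne_eq, ofReal_eq_zero]; positivity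
    have hhlim : Tendsto h atTop (𝓝[≠] 0) := by
      refine tendsto_nhdsWithin_iff.2 ⟨?_, Eventually.of_forall hhne⟩
      have h1 : Tendsto (fun n : ℕ => s / ((n : ℝ) + 2)) atTop (𝓝 0) :=
        tendsto_const_nhds.div_atTop (tendsto_atTop_add_const_right _ _ tendsto_natCast_atTop_atTop)
      have h2 := (continuous_ofReal.tendsto 0).comp h1
      rwa [ofReal_zero] at h2
    have hhU : ∀ n, z₀ + h n ∈ upperHalf := fun n => by
      simp only [upperHalf, mem_ofPred_eq, hh, add_im, ofReal_im, add_zero]; exact hz₀'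
    refine aestronglyMeasurable_of_tendsto_ae atTop
      (f := fun n x => (h n)⁻¹ • (f x (z₀ + h n) - f x z₀)) (fun n => ?_) ?_
    · exact ((hm _ (hhU n)).sub (hm _ hz₀)).const_smul (h n)⁻¹
    · refine Eventually.of_forall fun x => ?_
      have := ((hd x).differentiableAt (isOpen_upperHalf.mem_nhds hz₀)).hasDerivAt
      exact (hasDerivAt_iff_tendsto_slope_zero.1 this).comp hhlim
  have hdmem : MemLp (fun x => deriv (f x) z₀) ∞ Λ := by
    refine memLp_top_of_bound hdm (M / (s / 2)) (.of_forall fun x => ?_)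
    exact norm_deriv_le_of_norm_le hs0 ((hd x).mono ((ball_subset_ball (by linarith)).trans hballU))
      (fun w hw => hM x w (hball w (ball_subset_ball (by linarith) hw)))
      (mem_ball_self hs0)
  refine HasDerivAt.differentiableAt (f' := hdmem.toLp) ?_ |>.differentiableWithinAt
  rw [hasDerivAt_iff_isLittleO]
  have hO : (fun z => Y z - Y z₀ - (z - z₀) • hdmem.toLp) =O[𝓝 z₀] fun z => (z - z₀) ^ 2 := by
    refine Asymptotics.IsBigO.of_bound (2 * M / s ^ 2) ?_
    filter_upwards [ball_mem_nhds z₀ hs0] with z hz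
    have hzU : z ∈ upperHalf := hballU (ball_subset_ball (by linarith) hz)
    have hae : ∀ᵐ x ∂Λ, ‖(Y z - Y z₀ - (z - z₀) • hdmem.toLp : Lp ℂ ∞ Λ) x‖ ≤
        2 * M / s ^ 2 * ‖z - z₀‖ ^ 2 := by
      filter_upwards [Lp.coeFn_sub (Y z - Y z₀) ((z - z₀) • hdmem.toLp), Lp.coeFn_sub (Y z) (Y z₀),
        Lp.coeFn_smul (z - z₀) hdmem.toLp, hdmem.coeFn_toLp, hYae z hzU, hYae z₀ hz₀]
        with x h1 h2 h3 h4 h5 h6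
      rw [h1, Pi.sub_apply, h2, Pi.sub_apply, h3, Pi.smul_apply, h4, h5, h6, smul_eq_mul]
      exact hrem x z hz
    have := Lp.norm_le_of_ae_bound (by positivity) hae
    simpa using this
  refine hO.trans_isLittleO ?_
  have := Asymptotics.isLittleO_pow_sub_sub z₀ (m := 2) (by norm_num)
  refine Asymptotics.isLittleO_norm_left.1 ?_
  simpa only [norm_pow] using this

/-! ### The Laplace-type integrals behind `g_α` and `h_α` -/

/-- The integral `∫₀^∞ t^(p-1) exp(-ζ t - t^β X) dt`. -/
def lapInt (β p : ℝ) (ζ X : ℂ) : ℂ :=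
  ∫ t in Ioi (0 : ℝ), ((t ^ (p - 1) : ℝ) : ℂ) * exp (-(ζ * t) - ((t ^ β : ℝ) : ℂ) * X)

lemma gFun_eq_lapInt (α : ℝ) (y : ℂ) : gFun α y = lapInt (α / 2) (α / 2) 1 y := by
  unfold gFun lapInt
  refine integral_congr_fun fun t => ?_
  rw [one_mul, sub_eq_add_neg (-(t : ℂ)), exp_add, ofReal_mul, ofReal_exp,
    ofReal_neg, neg_mul, mul_assoc]

lemma hFun_eq_lapInt (α : ℝ) (y : ℂ) : hFun α y = lapInt (α / 2) 1 1 y := by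
  unfold hFun lapInt
  refine integral_congr_fun fun t => ?_
  rw [one_mul, sub_eq_add_neg (-(t : ℂ)), exp_add, ofReal_exp, ofReal_neg,
    neg_mul, sub_self, rpow_zero, ofReal_one, one_mul]

/-- As `β < 1`, the linear term dominates beyond the point `T` where `T ^ (1 - β) = x / s`. -/
lemma exists_rpow_mul_le {β : ℝ} (hβ0 : 0 < β) (hβ1 : β < 1) {s x : ℝ} (hs : 0 < s) (hx : 0 ≤ x) :
    ∃ C : ℝ, ∀ t : ℝ, 0 ≤ t → t ^ β * x ≤ s * t + C := by
  have hq : 0 < 1 - β := by linarith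
  set T := (x / s) ^ (1 / (1 - β)) with hT
  have hT0 : 0 ≤ T := by positivity
  refine ⟨T ^ β * x, fun t ht => ?_⟩
  rcases le_total t T with h | h
  · have : t ^ β ≤ T ^ β := rpow_le_rpow ht h hβ0.le
    nlinarith [mul_nonneg hs.le ht]
  · rcases eq_or_lt_of_le ht with h0 | h0
    · rw [← h0, zero_rpow hβ0.ne']
      simp only [zero_mul, mul_zero, zero_add]; positivity
    have h1 : x / s ≤ t ^ (1 - β) := by
      have : T ^ (1 - β) ≤ t ^ (1 - β) := rpow_le_rpow hT0 h hq.le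
      rwa [hT, ← rpow_mul (by positivity), one_div, inv_mul_cancel₀ hq.ne', rpow_one] at this
    rw [div_le_iff₀ hs] at h1
    have h2 : t ^ β * t ^ (1 - β) = t := by rw [← rpow_add h0]; simp
    have h3 : t ^ β * x ≤ t ^ β * (t ^ (1 - β) * s) := by gcongr
    have h4 : 0 ≤ T ^ β * x := by positivity
    nlinarith

lemma integrableOn_rpow_mul_exp {β : ℝ} (hβ0 : 0 < β) (hβ1 : β < 1) {p s x : ℝ} (hp : 0 < p)
    (hs : 0 < s) :
    IntegrableOn (fun t : ℝ => t ^ (p - 1) * Real.exp (-(s * t) + t ^ β * x)) (Ioi 0) := by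
  obtain ⟨C, hC⟩ := exists_rpow_mul_le hβ0 hβ1 (half_pos hs) (abs_nonneg x)
  have h1 : IntegrableOn (fun t : ℝ => t ^ (p - 1) * Real.exp (-(s / 2) * t ^ (1 : ℝ))) (Ioi 0) :=
    integrableOn_rpow_mul_exp_neg_mul_rpow (by linarith) one_pos (half_pos hs)
  have h2 := h1.const_mul (Real.exp C)
  refine Integrable.mono' h2 (by fun_prop) ?_
  filter_upwards [ae_mem_Ioi 0] with t ht
  have ht0 : (0 : ℝ) < t := ht
  rw [norm_eq_abs, abs_of_nonneg (by positivity), rpow_one]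
  have := hC t ht0.le
  have : t ^ β * x ≤ t ^ β * |x| := by gcongr; exact le_abs_self x
  have : Real.exp (-(s * t) + t ^ β * x) ≤ Real.exp C * Real.exp (-(s / 2) * t) := by
    rw [← Real.exp_add]; exact Real.exp_le_exp.2 (by linarith)
  have : 0 ≤ t ^ (p - 1) := by positivity
  nlinarith

section

variable {β p : ℝ} {ζ X X' : ℂ}

lemma norm_lapInt_integrand {t : ℝ} (ht : 0 < t) :
    ‖((t ^ (p - 1) : ℝ) : ℂ) * exp (-(ζ * t) - ((t ^ β : ℝ) : ℂ) * X)‖ =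
      t ^ (p - 1) * Real.exp (-(ζ.re * t) - t ^ β * X.re) := by
  rw [norm_mul, norm_real, norm_exp, norm_eq_abs, abs_of_nonneg (by positivity)]; congr 2
  simp [mul_re]

lemma aestronglyMeasurable_lapInt_integrand :
    AEStronglyMeasurable (fun t : ℝ => ((t ^ (p - 1) : ℝ) : ℂ) *
      exp (-(ζ * t) - ((t ^ β : ℝ) : ℂ) * X)) (volume.restrict (Ioi 0)) := by
  fun_prop

lemma norm_exp_sub_exp_le {a b : ℂ} {r : ℝ} (ha : a.re ≤ r) (hb : b.re ≤ r) :
    ‖exp a - exp b‖ ≤ Real.exp r * ‖a - b‖ := by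
  refine (convex_halfSpace_re_le r).norm_image_sub_le_of_norm_deriv_le (𝕜 := ℂ)
    (f := exp) (fun u _ => Complex.differentiable_exp u) (fun u hu => ?_) hb ha
  rw [Complex.deriv_exp, norm_exp]; exact Real.exp_le_exp.2 hu

lemma integrableOn_rpow_mul_exp_neg {q s : ℝ} (hq : 0 < q) (hs : 0 < s) :
    IntegrableOn (fun t : ℝ => t ^ (q - 1) * Real.exp (-(s * t))) (Ioi 0) := by
  have := integrableOn_rpow_mul_exp_neg_mul_rpow (p := 1) (s := q - 1) (b := s)
    (by linarith) one_pos hs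
  simpa [neg_mul] using this

lemma norm_lapInt_le (hp : 0 < p) (hζ : 0 < ζ.re) (hX : 0 ≤ X.re) :
    ‖lapInt β p ζ X‖ ≤ (1 / ζ.re) ^ p * Gamma p := by
  rw [← Real.integral_rpow_mul_exp_neg_mul_Ioi hp hζ]
  refine norm_integral_le_of_norm_le (integrableOn_rpow_mul_exp_neg hp hζ) ?_
  filter_upwards [ae_mem_Ioi 0] with t ht
  have : (0 : ℝ) < t := ht
  rw [norm_lapInt_integrand ht]
  have : 0 ≤ t ^ β * X.re := by positivity
  gcongr; linarith

lemma rpow_sub_one_mul_rpow {t : ℝ} (ht : 0 < t) (p q : ℝ) :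
    t ^ (p - 1) * t ^ q = t ^ (p + q - 1) := by
  rw [← rpow_add ht]; congr 1; ring

/-- The substitution `t ↦ r t`. -/
lemma lapInt_ofReal {r : ℝ} (hr : 0 < r) (X : ℂ) :
    lapInt β p r X = ((r ^ (-p) : ℝ) : ℂ) * lapInt β p 1 (((r ^ (-β) : ℝ) : ℂ) * X) := by
  have h := integral_comp_mul_left_Ioi (fun t : ℝ => ((t ^ (p - 1) : ℝ) : ℂ) *
    exp (-(1 * t) - ((t ^ β : ℝ) : ℂ) * (((r ^ (-β) : ℝ) : ℂ) * X))) 0 hr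
  rw [mul_zero] at h
  have h2 : (∫ t in Ioi (0 : ℝ), (((r * t) ^ (p - 1) : ℝ) : ℂ) * exp (-(1 * (r * t : ℝ)) -
      (((r * t) ^ β : ℝ) : ℂ) * (((r ^ (-β) : ℝ) : ℂ) * X))) =
      ((r ^ (p - 1) : ℝ) : ℂ) * lapInt β p r X := by
    rw [lapInt, ← integral_const_mul]
    refine setIntegral_congr_fun measurableSet_Ioi fun t ht => ?_
    have ht0 : (0 : ℝ) < t := ht
    rw [mul_rpow hr.le ht0.le, mul_rpow hr.le ht0.le, ofReal_mul, mul_assoc]; congr 3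
    rw [one_mul, ofReal_mul]; congr 1; rw [← mul_assoc, ← ofReal_mul]
    congr 2; rw [mul_right_comm, ← rpow_add hr]; simp
  rw [h2] at h
  have hr1 : (r ^ (-p) : ℝ) = (r ^ (p - 1))⁻¹ * r⁻¹ := by
    rw [← rpow_neg hr.le, ← Real.rpow_neg_one r, ← rpow_add hr]; congr 1; ring
  have hne : ((r ^ (p - 1) : ℝ) : ℂ) ≠ 0 := by rw [Ne, ofReal_eq_zero]; positivity
  rw [hr1, ofReal_mul, mul_assoc, ofReal_inv, eq_inv_mul_iff_mul_eq₀ hne, h, real_smul]; rfl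

lemma isOpen_re_pos : IsOpen {ζ : ℂ | 0 < ζ.re} := isOpen_lt continuous_const continuous_re

lemma mem_slitPlane_of_re_pos (h : 0 < ζ.re) : ζ ∈ slitPlane := Or.inl h

lemma lapInt_one_zero (hp : 0 < p) : lapInt β p 1 0 = Gamma p := by
  rw [lapInt, Real.Gamma_eq_integral hp, ← integral_complex_ofReal]
  refine integral_congr_fun fun t => ?_
  rw [mul_zero, sub_zero, one_mul, mul_comm, ofReal_mul, ofReal_exp, ofReal_neg]

lemma lapInt_conj (ζ X : ℂ) : lapInt β p (conj ζ) (conj X) = conj (lapInt β p ζ X) := by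
  rw [lapInt, lapInt, ← integral_conj]
  refine integral_congr_fun fun t => ?_
  rw [map_mul, ← Complex.exp_conj, map_sub, map_neg, map_mul, map_mul, conj_ofReal,
    conj_ofReal, conj_ofReal]

variable (hβ0 : 0 < β) (hβ1 : β < 1) (hp : 0 < p)

include hβ0 hβ1 hp

lemma integrable_lapInt (hζ : 0 < ζ.re) : IntegrableOn (fun t : ℝ => ((t ^ (p - 1) : ℝ) : ℂ) *
      exp (-(ζ * t) - ((t ^ β : ℝ) : ℂ) * X)) (Ioi 0) := by
  refine Integrable.mono' (integrableOn_rpow_mul_exp hβ0 hβ1 (x := -X.re) hp hζ)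
    aestronglyMeasurable_lapInt_integrand ?_
  filter_upwards [ae_mem_Ioi 0] with t ht
  rw [norm_lapInt_integrand ht]; apply le_of_eq; congr 2; ring

/-- Varying `X` brings down a factor `t ^ β`, which raises the exponent from `p` to `p + β`. The
constant decays as `Re ζ` grows, and this is the source of the contraction far from the real axis.
-/
lemma norm_lapInt_sub_le (hζ : 0 < ζ.re)
    (hX : 0 ≤ X.re) (hX' : 0 ≤ X'.re) : ‖lapInt β p ζ X - lapInt β p ζ X'‖ ≤
      (1 / ζ.re) ^ (p + β) * Gamma (p + β) * ‖X - X'‖ := by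
  rw [← Real.integral_rpow_mul_exp_neg_mul_Ioi (by linarith) hζ, lapInt, lapInt,
    ← integral_sub (integrable_lapInt hβ0 hβ1 hp hζ) (integrable_lapInt hβ0 hβ1 hp hζ),
    ← integral_mul_const]
  refine norm_integral_le_of_norm_le
    ((integrableOn_rpow_mul_exp_neg (by linarith) hζ).mul_const _) ?_
  filter_upwards [ae_mem_Ioi 0] with t ht
  have ht0 : (0 : ℝ) < t := ht
  rw [← mul_sub, norm_ofReal_mul (by positivity)]
  have htX : 0 ≤ t ^ β * X.re := by positivity
  have htX' : 0 ≤ t ^ β * X'.re := by positivity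
  have h1 := norm_exp_sub_exp_le (a := -(ζ * t) - ((t ^ β : ℝ) : ℂ) * X)
    (b := -(ζ * t) - ((t ^ β : ℝ) : ℂ) * X') (r := -(ζ.re * t))
    (by simp [mul_re]; exact htX) (by simp [mul_re]; exact htX')
  have h2 : -(ζ * t) - ((t ^ β : ℝ) : ℂ) * X - (-(ζ * t) - ((t ^ β : ℝ) : ℂ) * X') =
    ((t ^ β : ℝ) : ℂ) * (X' - X) := by ring
  rw [h2, norm_ofReal_mul (by positivity), norm_sub_rev X' X] at h1
  calc _ ≤ t ^ (p - 1) * (Real.exp (-(ζ.re * t)) * (t ^ β * ‖X - X'‖)) := by gcongr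
    _ = _ := by rw [← rpow_sub_one_mul_rpow ht0]; ring

lemma differentiableOn_lapInt {U : Set ℂ}
    (hU : IsOpen U) {ζ X : ℂ → ℂ} (hζ : DifferentiableOn ℂ ζ U) (hX : DifferentiableOn ℂ X U)
    (hζ0 : ∀ z ∈ U, 0 < (ζ z).re) : DifferentiableOn ℂ (fun z => lapInt β p (ζ z) (X z)) U := by
  refine differentiableOn_integral hU (fun z _ => aestronglyMeasurable_lapInt_integrand)
    (.of_forall fun t => by fun_prop) fun z₀ hz₀ => ?_
  have h0 := hζ0 z₀ hz₀
  have hc1 := (hζ.continuousOn.continuousAt (hU.mem_nhds hz₀))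
  have hc2 := (hX.continuousOn.continuousAt (hU.mem_nhds hz₀))
  have he1 : ∀ᶠ z in 𝓝 z₀, (ζ z₀).re / 2 < (ζ z).re :=
    (continuous_re.continuousAt.comp hc1).eventually (lt_mem_nhds (by
      simp only [Function.comp]; linarith))
  have he2 : ∀ᶠ z in 𝓝 z₀, ‖X z‖ < ‖X z₀‖ + 1 := hc2.norm.eventually (gt_mem_nhds (by linarith))
  obtain ⟨r, hr, hball⟩ := Metric.eventually_nhds_iff_ball.1 (he1.and he2)
  refine ⟨r, hr, _, integrableOn_rpow_mul_exp hβ0 hβ1 (x := ‖X z₀‖ + 1) hp (half_pos h0), ?_⟩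
  filter_upwards [ae_mem_Ioi 0] with t ht z hz
  have : (0 : ℝ) < t := ht
  obtain ⟨h1, h2⟩ := hball z hz
  rw [norm_lapInt_integrand ht]
  have : t ^ β * -(X z).re ≤ t ^ β * (‖X z₀‖ + 1) := by
    gcongr; linarith [(abs_le.1 (abs_re_le_norm (X z))).1]
  gcongr; nlinarith

lemma continuous_lapInt (hζ : 0 < ζ.re) : Continuous fun X => lapInt β p ζ X :=
  continuousOn_univ.1 (differentiableOn_lapInt hβ0 hβ1 hp isOpen_univ
    (differentiableOn_const ζ) differentiableOn_id (fun _ _ => hζ)).continuousOn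

/-- Both sides are holomorphic in `ζ` on the right half-plane and agree on the positive axis by
`lapInt_ofReal`. The points `1 + 1 / (n + 1)` accumulate at `1`, so the identity theorem applies. -/
lemma lapInt_eq_cpow_mul (hζ : 0 < ζ.re) (X : ℂ) :
    lapInt β p ζ X = ζ ^ (-p : ℂ) * lapInt β p 1 (ζ ^ (-β : ℂ) * X) := by
  have hd : ∀ q : ℂ, DifferentiableOn ℂ (fun ζ : ℂ => ζ ^ q) {ζ : ℂ | 0 < ζ.re} := fun q =>
    DifferentiableOn.cpow_const differentiableOn_id (fun z hz => mem_slitPlane_of_re_pos hz)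
  have h1 : DifferentiableOn ℂ (fun ζ => lapInt β p ζ X) {ζ : ℂ | 0 < ζ.re} :=
    differentiableOn_lapInt hβ0 hβ1 hp isOpen_re_pos differentiableOn_id
      (differentiableOn_const X) (fun z hz => hz)
  have h2 : DifferentiableOn ℂ (fun ζ => ζ ^ (-p : ℂ) * lapInt β p 1 (ζ ^ (-β : ℂ) * X))
      {ζ : ℂ | 0 < ζ.re} :=
    (hd _).mul (differentiableOn_lapInt hβ0 hβ1 hp isOpen_re_pos (differentiableOn_const 1)
      ((hd _).mul_const X) (fun _ _ => by simp))
  refine (h1.analyticOnNhd isOpen_re_pos).eqOn_of_preconnected_of_frequently_eq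
    (h2.analyticOnNhd isOpen_re_pos) (convex_halfSpace_re_gt 0).isPreconnected
    (z₀ := 1) (by simp) ?_ hζ
  have hlim : Tendsto (fun n : ℕ => ((1 + 1 / ((n : ℝ) + 1) : ℝ) : ℂ)) atTop (𝓝[≠] 1) := by
    refine tendsto_nhdsWithin_iff.2 ⟨?_, Eventually.of_forall fun n => ?_⟩
    · have h := (continuous_ofReal.tendsto _).comp
        ((tendsto_const_nhds (x := (1 : ℝ))).add tendsto_one_div_add_atTop_nhds_zero_nat)
      rw [add_zero, ofReal_one] at h; exact h
    · have : (1 : ℝ) / ((n : ℝ) + 1) ≠ 0 := by positivity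
      rw [mem_compl_iff, mem_singleton_iff, ← ofReal_one, Complex.ofReal_inj]; simpa using this
  refine hlim.frequently (Frequently.of_forall fun n => ?_)
  have hr : (0 : ℝ) < 1 + 1 / ((n : ℝ) + 1) := by positivity
  rw [lapInt_ofReal hr, ofReal_cpow hr.le, ofReal_cpow hr.le]; push_cast; rfl

lemma lapInt_zero (hζ : 0 < ζ.re) : lapInt β p ζ 0 = ζ ^ (-p : ℂ) * Gamma p := by
  rw [lapInt_eq_cpow_mul hβ0 hβ1 hp hζ, mul_zero, lapInt_one_zero hp]

/-- No sign of the real part is assumed, because the cone of the solution `Y` leaves the right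
half-plane when `α > 1`. For `‖y‖ ≤ 1` the factor `exp (t ^ β)` is still absorbed by `e ^ (-t)`. -/
lemma exists_lipschitz_lapInt_one : ∃ C : ℝ, 0 < C ∧ ∀ y y' : ℂ, ‖y‖ ≤ 1 → ‖y'‖ ≤ 1 →
      ‖lapInt β p 1 y - lapInt β p 1 y'‖ ≤ C * ‖y - y'‖ := by
  have hInt := integrableOn_rpow_mul_exp hβ0 hβ1 (x := 1) (p := p + β) (s := 1)
    (by linarith) one_pos
  set C₀ := ∫ t in Ioi (0 : ℝ), t ^ (p + β - 1) * Real.exp (-(1 * t) + t ^ β * 1) with hC₀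
  have : 0 ≤ C₀ := setIntegral_nonneg measurableSet_Ioi fun t ht => by
    have ht0 : (0 : ℝ) < t := ht
    positivity
  refine ⟨C₀ + 1, by linarith, fun y y' hy hy' => ?_⟩
  refine le_trans (b := C₀ * ‖y - y'‖) ?_ (by gcongr; linarith)
  rw [hC₀, lapInt, lapInt, ← integral_sub (integrable_lapInt hβ0 hβ1 hp (by simp))
    (integrable_lapInt hβ0 hβ1 hp (by simp)), ← integral_mul_const]
  refine norm_integral_le_of_norm_le (hInt.mul_const _) ?_
  filter_upwards [ae_mem_Ioi 0] with t ht
  have ht0 : (0 : ℝ) < t := ht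
  rw [← mul_sub, norm_ofReal_mul (by positivity)]
  have hre : ∀ u : ℂ, ‖u‖ ≤ 1 →
      (-(1 * (t : ℂ)) - ((t ^ β : ℝ) : ℂ) * u).re ≤ -(1 * t) + t ^ β * 1 := by
    intro u hu
    have h1 : -u.re ≤ 1 := by linarith [(abs_le.1 ((abs_re_le_norm u).trans hu)).1]
    have h2 : t ^ β * -u.re ≤ t ^ β * 1 := by gcongr
    simp [mul_re]; linarith
  have h1 := norm_exp_sub_exp_le (hre y hy) (hre y' hy')
  have h2 : -(1 * (t : ℂ)) - ((t ^ β : ℝ) : ℂ) * y - (-(1 * t) - ((t ^ β : ℝ) : ℂ) * y') =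
    ((t ^ β : ℝ) : ℂ) * (y' - y) := by ring
  rw [h2, norm_ofReal_mul (by positivity), norm_sub_rev y' y] at h1
  calc _ ≤ t ^ (p - 1) * (Real.exp (-(1 * t) + t ^ β * 1) * (t ^ β * ‖y - y'‖)) := by gcongr
    _ = _ := by rw [← rpow_sub_one_mul_rpow ht0]; ring

/-- Second-order remainder of `exp (-(t ^ β) y)` under the integral; each power of `y` comes with a
factor `t ^ β`. -/
lemma exists_taylor_lapInt_one : ∃ C : ℝ, 0 ≤ C ∧ ∀ y : ℂ, ‖y‖ ≤ 1 →
      ‖lapInt β p 1 y - (Gamma p - Gamma (p + β) * y)‖ ≤ C * ‖y‖ ^ 2 := by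
  have hInt := integrableOn_rpow_mul_exp hβ0 hβ1 (x := 1) (p := p + β + β) (s := 1)
    (by linarith) one_pos
  set C₀ := ∫ t in Ioi (0 : ℝ), t ^ (p + β + β - 1) * Real.exp (-(1 * t) + t ^ β * 1) with hC₀
  have hC₀0 : 0 ≤ C₀ := setIntegral_nonneg measurableSet_Ioi fun t ht => by
    have ht0 : (0 : ℝ) < t := ht
    positivity
  refine ⟨C₀, hC₀0, fun y hy => ?_⟩
  have hG : ∀ q : ℝ, 0 < q → IntegrableOn (fun t : ℝ => ((t ^ (q - 1) : ℝ) : ℂ) *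
      exp (-(1 * t) - ((t ^ β : ℝ) : ℂ) * 0)) (Ioi 0) := fun q hq =>
    integrable_lapInt hβ0 hβ1 hq (by simp)
  have hsub : ∀ y : ℂ, IntegrableOn (fun t : ℝ => ((t ^ (p - 1) : ℝ) : ℂ) *
      exp (-(1 * t) - ((t ^ β : ℝ) : ℂ) * 0) - ((t ^ (p + β - 1) : ℝ) : ℂ) *
      exp (-(1 * t) - ((t ^ β : ℝ) : ℂ) * 0) * y) (Ioi 0) := fun y =>
    (hG p hp).sub ((hG (p + β) (by linarith)).mul_const y)
  rw [← lapInt_one_zero (β := β) hp, ← lapInt_one_zero (β := β) (p := p + β) (by linarith), hC₀,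
    lapInt, lapInt, lapInt, ← integral_mul_const, ← integral_sub (hG p hp)
      ((hG (p + β) (by linarith)).mul_const y),
    ← integral_sub (integrable_lapInt hβ0 hβ1 hp (by simp)) (hsub y), ← integral_mul_const]
  refine norm_integral_le_of_norm_le (hInt.mul_const _) ?_
  filter_upwards [ae_mem_Ioi 0] with t ht
  have ht0 : (0 : ℝ) < t := ht
  set a : ℂ := -(((t ^ β : ℝ) : ℂ) * y) with ha
  have hna : ‖a‖ = t ^ β * ‖y‖ := by
    rw [ha, norm_neg, norm_ofReal_mul (by positivity)]
  have h1 := Complex.norm_exp_sub_sum_le_norm_mul_exp a 2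
  simp only [Finset.sum_range_succ, Finset.sum_range_zero, pow_zero, Nat.factorial,
    Nat.cast_one, div_one, zero_add, pow_one, mul_one] at h1
  have h2 : ((t ^ (p - 1) : ℝ) : ℂ) * exp (-(1 * t) - ((t ^ β : ℝ) : ℂ) * y) -
      (((t ^ (p - 1) : ℝ) : ℂ) * exp (-(1 * t) - ((t ^ β : ℝ) : ℂ) * 0) -
      ((t ^ (p + β - 1) : ℝ) : ℂ) * exp (-(1 * t) - ((t ^ β : ℝ) : ℂ) * 0) * y) =
      ((t ^ (p - 1) * Real.exp (-(1 * t)) : ℝ) : ℂ) * (exp a - (1 + a)) := by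
    rw [← rpow_sub_one_mul_rpow ht0, sub_eq_add_neg (-(1 * (t : ℂ))), ← ha, exp_add, ha]; push_cast
    simp only [mul_zero, sub_zero]; ring
  rw [h2, norm_ofReal_mul (by positivity)]
  calc _ ≤ t ^ (p - 1) * Real.exp (-(1 * t)) * (‖a‖ ^ 2 * Real.exp ‖a‖) := by gcongr
    _ ≤ t ^ (p - 1) * Real.exp (-(1 * t)) * (‖a‖ ^ 2 * Real.exp (t ^ β * 1)) := by rw [hna]; gcongr
    _ = _ := by
        rw [← rpow_sub_one_mul_rpow ht0, ← rpow_sub_one_mul_rpow ht0, hna, Real.exp_add]; ring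

/-- Rotation of the contour. For `y = R e^(iθ)`, `lapInt_eq_cpow_mul` with `ζ = e^(-iθ/2)` trades
`y` for `X = R e^(iθ(1 - β/2))`. Then both `ζ` and `X` have nonnegative real part although `y` may
not. -/
lemma norm_lapInt_one_le_of_mem_cone {y : ℂ}
    (hy : y ∈ cone (2 * β)) : ‖lapInt β p 1 y‖ ≤ (1 / cos (β * π / 2)) ^ p * Gamma p := by
  obtain ⟨R, θ, hR, hθ, rfl⟩ := hy
  have hpi := pi_pos
  have hθ' : |θ| ≤ β * π := by rw [show 2 * β * π / 2 = β * π by ring] at hθ; exact hθ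
  have hβpi : β * π / 2 < π / 2 := by nlinarith
  have hcos0 : 0 < cos (β * π / 2) := Real.cos_pos_of_mem_Ioo ⟨by nlinarith, hβpi⟩
  set ζ : ℂ := exp ((-(θ / 2) : ℝ) * I) with hζ
  have hζre : ζ.re = cos (θ / 2) := by rw [hζ, exp_ofReal_mul_I_re, Real.cos_neg]
  have hcosle : cos (β * π / 2) ≤ ζ.re := by
    rw [hζre, ← Real.cos_abs (θ / 2)]
    refine Real.cos_le_cos_of_nonneg_of_le_pi (abs_nonneg _) (by linarith) ?_
    rw [abs_div, abs_two]; linarith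
  have hζ0 : 0 < ζ.re := hcos0.trans_le hcosle
  have hcpow : ∀ q : ℝ, ζ ^ (q : ℂ) = exp ((-(θ / 2) * q : ℝ) * I) := by
    intro q
    have hne : ζ ≠ 0 := Complex.exp_ne_zero _
    have hlog : Complex.log ζ = (-(θ / 2) : ℝ) * I := by
      rw [hζ, log_exp]
      · simp only [mul_im, ofReal_re, I_im, mul_one, ofReal_im, I_re, mul_zero, add_zero]
        nlinarith [(abs_le.1 hθ').2]
      · simp only [mul_im, ofReal_re, I_im, mul_one, ofReal_im, I_re, mul_zero, add_zero]
        nlinarith [(abs_le.1 hθ').1]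
    rw [cpow_def_of_ne_zero hne, hlog]; congr 1; push_cast; ring
  set X : ℂ := R * exp ((θ * (1 - β / 2) : ℝ) * I) with hX
  have hXre : 0 ≤ X.re := by
    rw [hX, re_ofReal_mul, exp_ofReal_mul_I_re]
    refine mul_nonneg hR (Real.cos_nonneg_of_mem_Icc (abs_le.1 ?_))
    rw [abs_mul, abs_of_pos (by linarith : 0 < 1 - β / 2)]
    -- The angle is at most `βπ (1 - β/2)`, and `2β - β² ≤ 1` is the inequality `0 ≤ (1 - β)²`.
    nlinarith [sq_nonneg (1 - β), abs_nonneg θ]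
  have hkey := lapInt_eq_cpow_mul hβ0 hβ1 hp hζ0 X
  have hXy : ζ ^ (-β : ℂ) * X = R * exp (θ * I) := by
    rw [← ofReal_neg, hcpow, hX, mul_left_comm, ← exp_add]; congr 2; push_cast; ring
  rw [hXy] at hkey
  have hn : ‖ζ ^ (-p : ℂ)‖ = 1 := by rw [← ofReal_neg, hcpow, Complex.norm_exp_ofReal_mul_I]
  have := congrArg norm hkey
  rw [norm_mul, hn, one_mul] at this; rw [← this]
  refine (norm_lapInt_le hp hζ0 hXre).trans ?_
  have := Gamma_pos_of_pos hp
  gcongr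

end

/-! ### Cauchy-Stieltjes transforms -/

/-- The Cauchy-Stieltjes transform `∫ (z - t)⁻¹ dμ(t)`. -/
def stieltjes (μ : Measure ℝ) (z : ℂ) : ℂ := ∫ t, 1 / (z - (t : ℂ)) ∂μ

lemma sub_ofReal_ne_zero {z : ℂ} (hz : 0 < z.im) (t : ℝ) : z - (t : ℂ) ≠ 0 := by
  intro h
  have := congrArg Complex.im h
  simp at this; linarith

lemma norm_one_div_sub_le {z : ℂ} (hz : 0 < z.im) (t : ℝ) : ‖1 / (z - (t : ℂ))‖ ≤ 1 / z.im := by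
  rw [norm_div, norm_one]
  refine one_div_le_one_div_of_le hz ?_
  have := abs_im_le_norm (z - t)
  simp only [sub_im, ofReal_im, sub_zero] at this; exact (le_abs_self _).trans this

lemma continuous_one_div_sub {z : ℂ} (hz : 0 < z.im) : Continuous fun t : ℝ => 1 / (z - (t : ℂ)) :=
  continuous_const.div (by fun_prop) (sub_ofReal_ne_zero hz)

lemma integrable_one_div_sub (μ : Measure ℝ) [IsFiniteMeasure μ] {z : ℂ} (hz : 0 < z.im) :
    Integrable (fun t : ℝ => 1 / (z - (t : ℂ))) μ :=
  Integrable.of_bound (continuous_one_div_sub hz).aestronglyMeasurable (1 / z.im)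
    (.of_forall fun t => norm_one_div_sub_le hz t)

lemma differentiableOn_stieltjes (μ : Measure ℝ) [IsFiniteMeasure μ] :
    DifferentiableOn ℂ (stieltjes μ) upperHalf := by
  refine differentiableOn_integral isOpen_upperHalf
    (fun z hz => (continuous_one_div_sub hz).aestronglyMeasurable)
    (.of_forall fun t => ?_) fun z₀ hz₀ => ?_
  · exact DifferentiableOn.div (by fun_prop) (by fun_prop) fun z hz => sub_ofReal_ne_zero hz t
  · have : 0 < z₀.im := hz₀
    refine ⟨z₀.im / 2, by positivity, fun _ => 1 / (z₀.im / 2), integrable_const _,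
      Eventually.of_forall fun t z hz => ?_⟩
    rw [mem_ball, dist_eq_norm] at hz
    have h1 := (abs_im_le_norm (z - z₀)).trans hz.le
    rw [sub_im, abs_le] at h1
    have h2 : z₀.im / 2 ≤ z.im := by linarith [h1.1]
    exact (norm_one_div_sub_le (by linarith) t).trans (one_div_le_one_div_of_le (by positivity) h2)

lemma neg_im_one_div_sub {ε : ℝ} (hε : 0 < ε) (t s : ℝ) :
    -(1 / ((t : ℂ) + ε * I - (s : ℂ))).im = ε⁻¹ * (1 + ((t - s) / ε) ^ 2)⁻¹ := by
  have : normSq ((t : ℂ) + ε * I - (s : ℂ)) = (t - s) ^ 2 + ε ^ 2 := by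
    simp [Complex.normSq_apply]; ring
  rw [one_div, inv_im, this]; simp; field_simp
  ring

/-- The integrand is `π` times the Poisson kernel of width `ε`. -/
lemma neg_im_stieltjes (μ : Measure ℝ) [IsFiniteMeasure μ] {ε : ℝ} (hε : 0 < ε) (t : ℝ) :
    -(stieltjes μ (t + ε * I)).im = ∫ s, ε⁻¹ * (1 + ((t - s) / ε) ^ 2)⁻¹ ∂μ := by
  have hz : 0 < ((t : ℂ) + ε * I).im := by simpa using hε
  have h := integral_im (integrable_one_div_sub μ hz)
  have h' : (stieltjes μ (t + ε * I)).im = ∫ s, (1 / ((t : ℂ) + ε * I - (s : ℂ))).im ∂μ := h.symm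
  rw [h', ← integral_neg]
  exact integral_congr_ae (.of_forall fun s => neg_im_one_div_sub hε t s)

lemma neg_im_stieltjes_nonneg (μ : Measure ℝ) [IsFiniteMeasure μ] {z : ℂ} (hz : 0 < z.im) :
    0 ≤ -(stieltjes μ z).im := by
  have h := neg_im_stieltjes μ hz z.re
  rw [Complex.re_add_im] at h; rw [h]; exact integral_nonneg fun s => by positivity

lemma integral_mul_poisson (f : ℝ → ℝ) {ε : ℝ} (hε : 0 < ε) (s : ℝ) :
    ∫ t, f t * (ε⁻¹ * (1 + ((t - s) / ε) ^ 2)⁻¹) = ∫ u, f (s + ε * u) * (1 + u ^ 2)⁻¹ := by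
  have h1 := integral_sub_right_eq_self (μ := (volume : Measure ℝ))
    (fun t => f (s + t) * (ε⁻¹ * (1 + (t / ε) ^ 2)⁻¹)) s
  have h2 := Measure.integral_comp_div (fun u => f (s + ε * u) * (ε⁻¹ * (1 + u ^ 2)⁻¹)) ε
  have e1 : (fun t => f (s + (t - s)) * (ε⁻¹ * (1 + ((t - s) / ε) ^ 2)⁻¹)) =
      fun t => f t * (ε⁻¹ * (1 + ((t - s) / ε) ^ 2)⁻¹) := by
    funext t; rw [add_sub_cancel]
  have e2 : (fun t => f (s + ε * (t / ε)) * (ε⁻¹ * (1 + (t / ε) ^ 2)⁻¹)) =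
      fun t => f (s + t) * (ε⁻¹ * (1 + (t / ε) ^ 2)⁻¹) := by
    funext t; rw [mul_div_cancel₀ _ hε.ne']
  rw [e1] at h1; rw [e2] at h2
  rw [h1, h2, smul_eq_mul, abs_of_pos hε, ← integral_const_mul]
  refine integral_congr_fun fun u => ?_
  field_simp

lemma integrable_mul_poisson {f : ℝ → ℝ} (hf : Continuous f) {M : ℝ} (hM : ∀ t, |f t| ≤ M)
    {ε : ℝ} (hε : 0 < ε) (s : ℝ) : Integrable fun t => f t * (ε⁻¹ * (1 + ((t - s) / ε) ^ 2)⁻¹) := by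
  have h1 : Integrable fun t : ℝ => ε⁻¹ * (1 + ((t - s) / ε) ^ 2)⁻¹ := by
    have := (integrable_inv_one_add_sq.comp_div hε.ne').comp_sub_right s
    exact this.const_mul ε⁻¹
  exact h1.bdd_mul hf.aestronglyMeasurable (c := M) (.of_forall fun t => hM t)

lemma integral_mul_neg_im_stieltjes (μ : Measure ℝ) [IsFiniteMeasure μ] {f : ℝ → ℝ}
    (hf : Continuous f) {M : ℝ} (hM : ∀ t, |f t| ≤ M) {ε : ℝ} (hε : 0 < ε) :
    ∫ t, f t * -(stieltjes μ (t + ε * I)).im =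
      ∫ s, ∫ u, f (s + ε * u) * (1 + u ^ 2)⁻¹ ∂volume ∂μ := by
  have : 0 ≤ M := (abs_nonneg _).trans (hM 0)
  have hcont : Continuous (Function.uncurry fun t s : ℝ =>
      f t * (ε⁻¹ * (1 + ((t - s) / ε) ^ 2)⁻¹)) := by
    refine (hf.comp continuous_fst).mul (continuous_const.mul (Continuous.inv₀ (by fun_prop) ?_))
    intro p; positivity
  have hInt : Integrable (Function.uncurry fun t s : ℝ =>
      f t * (ε⁻¹ * (1 + ((t - s) / ε) ^ 2)⁻¹)) ((volume : Measure ℝ).prod μ) := by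
    rw [integrable_prod_iff' hcont.aestronglyMeasurable]
    refine ⟨Eventually.of_forall fun s => integrable_mul_poisson hf hM hε s, ?_⟩
    have e : ∀ s : ℝ, (∫ t, ‖Function.uncurry (fun t s : ℝ =>
        f t * (ε⁻¹ * (1 + ((t - s) / ε) ^ 2)⁻¹)) (t, s)‖) =
        ∫ u, |f (s + ε * u)| * (1 + u ^ 2)⁻¹ := by
      intro s
      rw [← integral_mul_poisson (fun t => |f t|) hε s]
      refine integral_congr_fun fun t => ?_
      simp only [Function.uncurry, norm_eq_abs, abs_mul]
      rw [abs_of_pos (by positivity : 0 < ε⁻¹), abs_of_pos (a := (1 + ((t - s) / ε) ^ 2)⁻¹)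
        (by positivity)]
    simp_rw [e]
    refine Integrable.of_bound (C := M * π) ?_ (.of_forall fun s => ?_)
    · refine (StronglyMeasurable.integral_prod_right (f := fun s u =>
        |f (s + ε * u)| * (1 + u ^ 2)⁻¹) ?_).aestronglyMeasurable
      refine Continuous.stronglyMeasurable ?_
      refine ((hf.comp (by fun_prop : Continuous fun p : ℝ × ℝ => p.1 + ε * p.2)).abs).mul
        (Continuous.inv₀ (by fun_prop) fun p => by positivity)
    · rw [← integral_univ_inv_one_add_sq, ← integral_const_mul]
      refine norm_integral_le_of_norm_le (integrable_inv_one_add_sq.const_mul M)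
        (.of_forall fun u => ?_)
      rw [norm_eq_abs, abs_of_nonneg (by positivity)]; gcongr; exact hM _
  have h1 : ∀ t : ℝ, f t * -(stieltjes μ (t + ε * I)).im =
      ∫ s, f t * (ε⁻¹ * (1 + ((t - s) / ε) ^ 2)⁻¹) ∂μ := fun t => by
    rw [neg_im_stieltjes μ hε, ← integral_const_mul]
  simp_rw [h1]; rw [integral_integral_swap hInt]
  simp_rw [integral_mul_poisson f hε]

/-- Stieltjes inversion: after Fubini the Poisson kernel acts on `f`, and dominated convergence
applies because `f` is bounded and `1 / (1 + u²)` has integral `π`. -/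
lemma tendsto_integral_mul_neg_im_stieltjes (μ : Measure ℝ) [IsFiniteMeasure μ] {f : ℝ → ℝ}
    (hf : Continuous f) {M : ℝ} (hM : ∀ t, |f t| ≤ M) :
    Tendsto (fun n : ℕ => ∫ t, f t * -(stieltjes μ (t + ((1 / ((n : ℝ) + 1) : ℝ) : ℂ) *
      I)).im) atTop (𝓝 (π * ∫ s, f s ∂μ)) := by
  have : 0 ≤ M := (abs_nonneg _).trans (hM 0)
  have hpos : ∀ n : ℕ, (0 : ℝ) < 1 / ((n : ℝ) + 1) := fun n => by positivity
  simp_rw [fun n => integral_mul_neg_im_stieltjes μ hf hM (hpos n)]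
  have hlim : ∀ s : ℝ, Tendsto (fun n : ℕ => ∫ u, f (s + 1 / ((n : ℝ) + 1) * u) * (1 + u ^ 2)⁻¹)
      atTop (𝓝 (π * f s)) := by
    intro s
    rw [mul_comm, ← integral_univ_inv_one_add_sq, ← integral_const_mul]
    refine tendsto_integral_of_dominated_convergence (fun u => M * (1 + u ^ 2)⁻¹) (fun n => ?_)
      (integrable_inv_one_add_sq.const_mul M) (fun n => Eventually.of_forall fun u => ?_)
      (.of_forall fun u => ?_)
    · refine Continuous.aestronglyMeasurable ?_
      exact (hf.comp (by fun_prop)).mul (Continuous.inv₀ (by fun_prop) fun p => by positivity)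
    · rw [norm_eq_abs, abs_mul, abs_of_pos (a := (1 + u ^ 2)⁻¹) (by positivity)]; gcongr; exact hM _
    · refine Tendsto.mul_const _ ?_
      have h1 : Tendsto (fun n : ℕ => s + 1 / ((n : ℝ) + 1) * u) atTop (𝓝 (s + 0 * u)) :=
        tendsto_const_nhds.add (tendsto_one_div_add_atTop_nhds_zero_nat.mul_const u)
      rw [zero_mul, add_zero] at h1; exact (hf.tendsto s).comp h1
  rw [← integral_const_mul]
  refine tendsto_integral_of_dominated_convergence (fun _ => M * π) (fun n => ?_)
    (integrable_const _) (fun n => Eventually.of_forall fun s => ?_) (.of_forall hlim)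
  · refine (StronglyMeasurable.integral_prod_right (f := fun s u =>
      f (s + 1 / ((n : ℝ) + 1) * u) * (1 + u ^ 2)⁻¹) ?_).aestronglyMeasurable
    refine Continuous.stronglyMeasurable ?_
    refine ((hf.comp (by fun_prop : Continuous fun p : ℝ × ℝ => p.1 + 1 / ((n : ℝ) + 1) * p.2))).mul
      (Continuous.inv₀ (by fun_prop) fun p => by positivity)
  · rw [← integral_univ_inv_one_add_sq, ← integral_const_mul]
    refine norm_integral_le_of_norm_le (integrable_inv_one_add_sq.const_mul M)
      (.of_forall fun u => ?_)
    rw [norm_eq_abs, abs_mul, abs_of_pos (a := (1 + u ^ 2)⁻¹) (by positivity)]; gcongr; exact hM _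

lemma ext_of_stieltjes {μ ν : Measure ℝ} [IsFiniteMeasure μ] [IsFiniteMeasure ν]
    (h : EqOn (stieltjes μ) (stieltjes ν) upperHalf) : μ = ν := by
  refine ext_of_forall_integral_eq_of_IsFiniteMeasure fun f => ?_
  have hM : ∀ t, |f t| ≤ ‖f‖ := fun t => f.norm_coe_le_norm t
  have h1 := tendsto_integral_mul_neg_im_stieltjes μ f.continuous hM
  have h2 := tendsto_integral_mul_neg_im_stieltjes ν f.continuous hM
  have h3 : (fun n : ℕ => ∫ t, f t * -(stieltjes μ (t + ((1 / ((n : ℝ) + 1) : ℝ) : ℂ) *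
      I)).im) = fun n : ℕ => ∫ t, f t * -(stieltjes ν (t + ((1 / ((n : ℝ) + 1) : ℝ) : ℂ) *
      I)).im := by
    funext n
    refine integral_congr_fun fun t => ?_
    rw [h]
    have : (0 : ℝ) < 1 / ((n : ℝ) + 1) := by positivity
    simp only [upperHalf, mem_ofPred_eq, add_im, ofReal_im, zero_add, im_ofReal_mul, I_im, mul_one]
    exact this
  rw [h3] at h1
  exact mul_left_cancel₀ Real.pi_ne_zero (tendsto_nhds_unique h1 h2)

lemma eqOn_upperHalf_of_im_gt {f g : ℂ → ℂ} (hf : DifferentiableOn ℂ f upperHalf)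
    (hg : DifferentiableOn ℂ g upperHalf) {y₀ : ℝ} (h : ∀ z : ℂ, 0 < z.im → y₀ < z.im → f z = g z) :
    EqOn f g upperHalf := by
  set y := max y₀ 0 + 1
  have hy : 0 < y := by positivity
  have hmem : ((y : ℂ) * I) ∈ upperHalf := by simpa [upperHalf] using hy
  refine (hf.analyticOnNhd isOpen_upperHalf).eqOn_of_preconnected_of_eventuallyEq
    (hg.analyticOnNhd isOpen_upperHalf) isPreconnected_upperHalf hmem ?_
  have hopen : IsOpen {z : ℂ | max y₀ 0 < z.im} := isOpen_lt continuous_const continuous_im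
  filter_upwards [hopen.mem_nhds (show (y : ℂ) * I ∈ {z : ℂ | max y₀ 0 < z.im} by
    rw [mem_ofPred_eq, im_ofReal_mul, I_im, mul_one]; exact lt_add_one _)] with z hz
  exact h z ((le_max_right _ _).trans_lt hz) ((le_max_left _ _).trans_lt hz)

lemma tendsto_stieltjes {ι : Type*} {l : Filter ι} {μ : ι → ProbabilityMeasure ℝ}
    {ν : ProbabilityMeasure ℝ} (h : Tendsto μ l (𝓝 ν)) {z : ℂ} (hz : 0 < z.im) :
    Tendsto (fun n => stieltjes (μ n) z) l (𝓝 (stieltjes ν z)) := by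
  rw [ProbabilityMeasure.tendsto_iff_forall_integral_rclike_tendsto ℂ] at h
  exact h (BoundedContinuousFunction.ofNormedAddCommGroup (fun t : ℝ => 1 / (z - (t : ℂ)))
    (continuous_one_div_sub hz) (1 / z.im) (norm_one_div_sub_le hz))

/-- The real part of `iy / (iy - t)` is `y² / (y² + t²)`, which lies in `[0, 1]` and is at most
`1/2` when `|t| > y`. -/
lemma measureReal_abs_gt_le (μ : Measure ℝ) [IsProbabilityMeasure μ] {y : ℝ} (hy : 0 < y) :
    μ.real {t | y < ‖t‖} ≤ 2 * (1 - ((y * I) * stieltjes μ (y * I)).re) := by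
  have hz : 0 < ((y : ℂ) * I).im := by simpa using hy
  have hInt := (integrable_one_div_sub μ hz).const_mul ((y : ℂ) * I)
  have h1 : ((y * I) * stieltjes μ (y * I)).re =
      ∫ t, ((y * I) * (1 / ((y * I) - (t : ℂ)))).re ∂μ := by
    rw [stieltjes, ← integral_const_mul]; exact (integral_re hInt).symm
  have h2 : ∀ t : ℝ, ((y * I) * (1 / ((y * I) - (t : ℂ)))).re = y ^ 2 / (y ^ 2 + t ^ 2) := by
    intro t
    have : normSq ((y : ℂ) * I - (t : ℂ)) = y ^ 2 + t ^ 2 := by simp [Complex.normSq_apply]; ring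
    rw [one_div, mul_re, inv_im, this]; simp; ring
  have hre : Integrable (fun t : ℝ => y ^ 2 / (y ^ 2 + t ^ 2)) μ := by
    have := hInt.re
    refine this.congr (.of_forall fun t => ?_)
    exact h2 t
  have h3 : 2 * (1 - ((y * I) * stieltjes μ (y * I)).re) =
      ∫ t, 2 * (1 - y ^ 2 / (y ^ 2 + t ^ 2)) ∂μ := by
    rw [h1, integral_const_mul, integral_sub (integrable_const _) hre]
    simp_rw [h2]; simp
  rw [h3]
  have hm : MeasurableSet {t : ℝ | y < ‖t‖} := measurableSet_lt measurable_const measurable_norm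
  rw [← integral_indicator_one hm]
  refine integral_mono ((integrable_const (1 : ℝ)).indicator hm)
    (((integrable_const _).sub hre).const_mul 2) fun t => ?_
  have h0 : y ^ 2 / (y ^ 2 + t ^ 2) ≤ 1 := by
    rw [div_le_one (by positivity)]; nlinarith [sq_nonneg t]
  by_cases ht : t ∈ {t : ℝ | y < ‖t‖}
  · rw [indicator_of_mem ht]
    have ht' : y < |t| := ht
    have h4 : y ^ 2 / (y ^ 2 + t ^ 2) ≤ 1 / 2 := by
      rw [div_le_div_iff₀ (by positivity) two_pos]; nlinarith [sq_abs t, abs_nonneg t]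
    simp only [Pi.one_apply]; linarith
  · rw [indicator_of_notMem ht]; linarith

/-- Convergence of the Cauchy-Stieltjes transforms far from the real axis to a function `G` with
`z G(z) → 1` implies weak convergence. -/
lemma exists_tendsto_of_tendsto_stieltjes {μ : ℕ → ProbabilityMeasure ℝ} {G : ℂ → ℂ} {y₀ : ℝ}
    (hG : ∀ z : ℂ, 0 < z.im → y₀ < z.im → Tendsto (fun n => stieltjes (μ n) z) atTop (𝓝 (G z)))
    (hG1 : Tendsto (fun y : ℝ => (y * I) * G (y * I)) atTop (𝓝 1)) :
    ∃ ν : ProbabilityMeasure ℝ, Tendsto μ atTop (𝓝 ν) ∧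
      ∀ z : ℂ, 0 < z.im → y₀ < z.im → stieltjes ν z = G z := by
  -- Sending first `n` and then `y` to infinity, the bound of `measureReal_abs_gt_le` tends to `2 (1
  -- - 1) = 0`.
  have htight : IsTightMeasureSet (Set.range fun n => (μ n : Measure ℝ)) := by
    refine isTightMeasureSet_range_of_tendsto_limsup_measure_norm_gt ?_
    have hub : Tendsto (fun y : ℝ => ofReal (2 * (1 - ((y * I) * G (y * I)).re))) atTop (𝓝 0) := by
      have h1 := (continuous_re.tendsto _).comp hG1
      have h2 := ENNReal.tendsto_ofReal ((h1.const_sub 1).const_mul 2)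
      simpa [Function.comp_def] using h2
    refine tendsto_of_tendsto_of_tendsto_of_le_of_le' tendsto_const_nhds hub
      (.of_forall fun _ => zero_le) ?_
    filter_upwards [eventually_gt_atTop (max y₀ 0)] with y hy
    have hy0 : 0 < y := (le_max_right _ _).trans_lt hy
    have hlim : Tendsto (fun n => ofReal (2 * (1 - ((y * I) * stieltjes (μ n) (y * I)).re))) atTop
        (𝓝 (ofReal (2 * (1 - ((y * I) * G (y * I)).re)))) := by
      have h0 := hG (y * I) (by simpa using hy0) (by simpa using (le_max_left _ _).trans_lt hy)
      have h1 := (continuous_re.tendsto _).comp (h0.const_mul (y * I))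
      exact ENNReal.tendsto_ofReal ((h1.const_sub 1).const_mul 2)
    rw [← hlim.limsup_eq]
    refine limsup_le_limsup (.of_forall fun n => ?_)
    have := measureReal_abs_gt_le (μ n : Measure ℝ) hy0
    simp only
    rw [← ofReal_measureReal (μ := (μ n : Measure ℝ)) (s := {x | y < ‖x‖})]
    exact ENNReal.ofReal_le_ofReal this
  have hcomp : IsCompact (closure (Set.range μ)) := by
    refine isCompact_closure_of_isTightMeasureSet (htight.subset ?_)
    rintro _ ⟨m, ⟨n, rfl⟩, rfl⟩; exact ⟨n, rfl⟩
  have hmem : ∀ n, μ n ∈ closure (Set.range μ) := fun n => subset_closure ⟨n, rfl⟩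
  have hlimpt : ∀ (ν : ProbabilityMeasure ℝ) (φ : ℕ → ℕ), Tendsto φ atTop atTop →
      Tendsto (μ ∘ φ) atTop (𝓝 ν) → ∀ z : ℂ, 0 < z.im → y₀ < z.im → stieltjes ν z = G z := by
    intro ν φ hφ hν z hz hz'
    exact tendsto_nhds_unique (tendsto_stieltjes hν hz) ((hG z hz hz').comp hφ)
  obtain ⟨ν, -, φ, hφ, hν⟩ := hcomp.tendsto_subseq hmem
  have hνG := hlimpt ν φ hφ.tendsto_atTop hν
  refine ⟨ν, ?_, hνG⟩
  -- Every limit point has transform `G` above `y₀`. By analytic continuation and inversion all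
  -- limit points coincide with `ν`.
  refine tendsto_of_subseq_tendsto fun ns hns => ?_
  obtain ⟨ν', -, ψ, hψ, hν'⟩ := hcomp.tendsto_subseq (fun n => hmem (ns n))
  have hν'G := hlimpt ν' (ns ∘ ψ) (hns.comp hψ.tendsto_atTop) hν'
  have heq : ν' = ν := by
    apply Subtype.ext
    change (ν' : Measure ℝ) = (ν : Measure ℝ)
    exact ext_of_stieltjes (eqOn_upperHalf_of_im_gt (differentiableOn_stieltjes _)
      (differentiableOn_stieltjes _) (y₀ := y₀) fun z hz hz' =>
        (hν'G z hz hz').trans (hνG z hz hz').symm)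
  exact ⟨ψ, heq ▸ hν'⟩

/-! ### The density of a measure from its Cauchy-Stieltjes transform -/

/-- Urysohn functions and inner regularity handle open subsets of `U`. Outer regularity of `μ₂` then
reaches every subset, measurable or not. -/
lemma restrict_le_of_integral_le {μ₁ μ₂ : Measure ℝ} [IsLocallyFiniteMeasure μ₁]
    [IsLocallyFiniteMeasure μ₂] {U : Set ℝ} (hU : IsOpen U)
    (h : ∀ f : ℝ → ℝ, Continuous f → HasCompactSupport f → (∀ t, 0 ≤ f t) → (∀ t ∉ U, f t = 0) →
      ∫ t, f t ∂μ₁ ≤ ∫ t, f t ∂μ₂) {s : Set ℝ} (hsU : s ⊆ U) : μ₁ s ≤ μ₂ s := by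
  have hopen : ∀ V : Set ℝ, IsOpen V → V ⊆ U → μ₁ V ≤ μ₂ V := by
    intro V hV hVU; rw [hV.measure_eq_iSup_isCompact]
    refine iSup₂_le fun K hKV => iSup_le fun hK => ?_
    obtain ⟨f, hf1, hf0, hfc, hf01⟩ := exists_continuous_one_zero_of_isCompact hK
      hV.isClosed_compl (disjoint_compl_right_iff_subset.2 hKV)
    have hle := h f f.continuous hfc (fun t => (hf01 t).1) (fun t ht => hf0 fun h => ht (hVU h))
    have hi1 : Integrable f μ₁ := f.continuous.integrable_of_hasCompactSupport hfc
    have hi2 : Integrable f μ₂ := f.continuous.integrable_of_hasCompactSupport hfc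
    have h1 : μ₁ K ≤ ofReal (∫ t, f t ∂μ₁) := by
      rw [ofReal_integral_eq_lintegral_ofReal hi1 (.of_forall fun t => (hf01 t).1),
        ← lintegral_indicator_one hK.measurableSet]
      refine lintegral_mono fun t => ?_
      by_cases ht : t ∈ K
      · rw [indicator_of_mem ht, hf1 ht]; simp
      · rw [indicator_of_notMem ht]; exact zero_le
    have h2 : ofReal (∫ t, f t ∂μ₂) ≤ μ₂ V := by
      rw [ofReal_integral_eq_lintegral_ofReal hi2 (.of_forall fun t => (hf01 t).1),
        ← lintegral_indicator_one hV.measurableSet]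
      refine lintegral_mono fun t => ?_
      by_cases ht : t ∈ V
      · rw [indicator_of_mem ht]; simpa using (hf01 t).2
      · rw [hf0 ht]; simp
    exact h1.trans ((ENNReal.ofReal_le_ofReal hle).trans h2)
  rw [s.measure_eq_iInf_isOpen μ₂]
  refine le_iInf₂ fun V hsV => le_iInf fun hV => ?_
  exact (measure_mono (subset_inter hsV hsU)).trans
    ((hopen (V ∩ U) (hV.inter hU) inter_subset_right).trans (measure_mono inter_subset_left))

lemma integral_withDensity_ofReal {ψ f : ℝ → ℝ} (hψ : Continuous ψ) (hψ0 : ∀ t, 0 ≤ ψ t) :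
    ∫ t, f t ∂(volume.withDensity fun t => ofReal (ψ t)) = ∫ t, f t * ψ t := by
  rw [integral_withDensity_eq_integral_toReal_smul (by fun_prop)
    (.of_forall fun t => ENNReal.ofReal_lt_top)]
  refine integral_congr_fun fun t => ?_
  rw [ENNReal.toReal_ofReal (hψ0 t), smul_eq_mul, mul_comm]

lemma re_le_norm_add_mul_I (t ε : ℝ) : |t| ≤ ‖(t : ℂ) + ε * I‖ := by
  have := abs_re_le_norm ((t : ℂ) + ε * I)
  simpa using this

lemma add_mul_I_mem_upperHalf (t : ℝ) {ε : ℝ} (hε : 0 < ε) : (t : ℂ) + ε * I ∈ upperHalf := by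
  simpa [upperHalf] using hε

lemma continuous_im_stieltjes_line (μ : Measure ℝ) [IsFiniteMeasure μ] {ε : ℝ} (hε : 0 < ε) :
    Continuous fun t : ℝ => -(stieltjes μ (t + ε * I)).im :=
  (continuous_im.comp ((differentiableOn_stieltjes μ).continuousOn.comp_continuous
    (by fun_prop) fun t => add_mul_I_mem_upperHalf t hε)).neg

/-- Above points with `|t| > δ` the bound gives `-Im G ≤ C / δ`, and Stieltjes inversion divides it
by `π`. -/
lemma measure_le_of_norm_mul_stieltjes_le (μ : Measure ℝ) [IsFiniteMeasure μ] {C : ℝ}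
    (hC : ∀ z ∈ upperHalf, ‖z * stieltjes μ z‖ ≤ C) {δ : ℝ} (hδ : 0 < δ) {s : Set ℝ}
    (hs : s ⊆ {t | δ < |t|}) : μ s ≤ ofReal (C / δ / π) * volume s := by
  have : 0 ≤ C := (norm_nonneg _).trans (hC I (by simp [upperHalf]))
  have hk : 0 ≤ C / δ / π := by positivity
  have hU : IsOpen {t : ℝ | δ < |t|} := isOpen_lt continuous_const continuous_abs
  have hmain : μ s ≤ (volume.withDensity fun _ => ofReal (C / δ / π)) s := by
    have : IsLocallyFiniteMeasure ((volume : Measure ℝ).withDensity fun _ => ofReal (C / δ / π)) :=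
      IsLocallyFiniteMeasure.withDensity_ofReal (f := fun _ : ℝ => C / δ / π) continuous_const
    refine restrict_le_of_integral_le hU (fun f hf hfc hf0 hfU => ?_) hs
    rw [integral_withDensity_ofReal continuous_const fun _ => hk]
    obtain ⟨M, hM⟩ := hf.bounded_above_of_compact_support hfc
    have hlim := tendsto_integral_mul_neg_im_stieltjes μ hf (M := M) hM
    have hle : π * ∫ t, f t ∂μ ≤ ∫ t, f t * (C / δ) := by
      refine le_of_tendsto' hlim fun n => ?_
      have hn : (0 : ℝ) < 1 / ((n : ℝ) + 1) := by positivity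
      refine integral_mono_of_nonneg (.of_forall fun t => ?_)
        ((hf.integrable_of_hasCompactSupport hfc).mul_const _) (.of_forall fun t => ?_)
      · exact mul_nonneg (hf0 t) (neg_im_stieltjes_nonneg μ (add_mul_I_mem_upperHalf t hn))
      · simp only
        by_cases ht : t ∈ {t : ℝ | δ < |t|}
        · refine mul_le_mul_of_nonneg_left ?_ (hf0 t)
          set z := (t : ℂ) + ((1 / ((n : ℝ) + 1) : ℝ) : ℂ) * I
          have h1 := hC z (add_mul_I_mem_upperHalf t hn)
          rw [norm_mul] at h1
          have : δ ≤ ‖z‖ := (le_of_lt ht).trans (re_le_norm_add_mul_I t _)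
          have h3 : -(stieltjes μ z).im ≤ ‖stieltjes μ z‖ := (neg_le_abs _).trans (abs_im_le_norm _)
          refine h3.trans ?_
          rw [le_div_iff₀ hδ]; nlinarith [norm_nonneg (stieltjes μ z)]
        · rw [hfU t ht]; simp
    have hpi := pi_pos
    rw [integral_mul_const] at hle ⊢
    rw [← mul_div_assoc, le_div_iff₀ hpi]; linarith
  rw [withDensity_const, Measure.smul_apply, smul_eq_mul] at hmain; exact hmain

lemma nonneg_of_forall_norm_le {R K p : ℝ} {f : ℂ → ℂ} (hR : 0 < R)
    (h : ∀ z ∈ upperHalf, R ≤ ‖z‖ → ‖f z‖ ≤ K * ‖z‖ ^ p) : 0 ≤ K := by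
  have h1 := (norm_nonneg _).trans (h (R * I) (by simpa [upperHalf] using hR)
    (by simp [abs_of_pos hR]))
  rw [norm_ofReal_mul hR.le, norm_I, mul_one] at h1
  exact nonneg_of_mul_nonneg_left h1 (by positivity)

/-- Inversion compares `G` with `w(z) = 1/z + D z^(-1-α)`. On the positive axis `1/z` is real, so
only `D.im t^(-1-α)` survives in the imaginary part. Replacing `t` by `max t R` merely extends the
powers continuously to the line, since `f` vanishes off `(R, ∞)`. -/
lemma tail_bounds_of_stieltjes {α : ℝ} (hα : 0 < α) (μ : Measure ℝ) [IsFiniteMeasure μ]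
    {D : ℂ} {R K : ℝ} (hR : 1 ≤ R)
    (hK : ∀ z ∈ upperHalf, R ≤ ‖z‖ → ‖stieltjes μ z - (1 / z + D * z ^ (-(1 + α) : ℂ))‖ ≤
      K * ‖z‖ ^ (-(1 + 2 * α)))
    {f : ℝ → ℝ} (hf : Continuous f) (hfc : HasCompactSupport f) (hf0 : ∀ t, 0 ≤ f t)
    (hfU : ∀ t ∉ Ioi R, f t = 0) :
    |π * ∫ t, f t ∂μ - ∫ t, f t * (-D.im * (max t R) ^ (-(1 + α)))| ≤
      ∫ t, f t * (K * (max t R) ^ (-(1 + 2 * α))) := by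
  have hR0 : 0 < R := by linarith
  obtain ⟨M, hM⟩ := hf.bounded_above_of_compact_support hfc
  have hlim := tendsto_integral_mul_neg_im_stieltjes μ hf (M := M) hM
  set ε : ℕ → ℝ := fun n => 1 / ((n : ℝ) + 1) with hεdef
  have hε : ∀ n, 0 < ε n := fun n => by simp only [hεdef]; positivity
  set w : ℂ → ℂ := fun z => 1 / z + D * z ^ (-(1 + α) : ℂ) with hw
  have hcontmax : ∀ p : ℝ, Continuous fun t : ℝ => (max t R) ^ p := fun p =>
    Continuous.rpow_const (by fun_prop) fun t => Or.inl (by positivity)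
  have hfi := hf.integrable_of_hasCompactSupport hfc (μ := volume)
  have hzne : ∀ (t : ℝ) n, (t : ℂ) + ε n * I ∈ slitPlane := fun t n => by
    refine Or.inr ?_
    simpa using (hε n).ne'
  have hwcont : ∀ n, Continuous fun t : ℝ => w (t + ε n * I) := by
    intro n
    refine (continuous_const.div (by fun_prop) fun t => Complex.slitPlane_ne_zero (hzne t n)).add
      (continuous_const.mul (Continuous.cpow (by fun_prop) continuous_const fun t => hzne t n))
  have hwb : ∀ t : ℝ, R < t → ∀ n, ‖w (t + ε n * I)‖ ≤ 1 + ‖D‖ := by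
    intro t ht n
    set z := (t : ℂ) + ε n * I
    have h1 : 1 ≤ ‖z‖ := (hR.trans ht.le).trans ((le_abs_self t).trans (re_le_norm_add_mul_I t _))
    have h2 : ‖z ^ (-(1 + α) : ℂ)‖ ≤ 1 := by
      have : z ^ (-(1 + α) : ℂ) = z ^ ((-(1 + α) : ℝ) : ℂ) := by push_cast; rfl
      rw [this, norm_cpow_real]
      exact Real.rpow_le_one_of_one_le_of_nonpos h1 (by linarith)
    calc _ ≤ ‖1 / z‖ + ‖D * z ^ (-(1 + α) : ℂ)‖ := norm_add_le _ _
      _ ≤ 1 + ‖D‖ * 1 := by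
          rw [norm_mul, norm_div, norm_one]; gcongr; exact (div_le_one (by linarith)).2 h1
      _ = _ := by ring
  have hlim2 : Tendsto (fun n => ∫ t, f t * -(w (t + ε n * I)).im) atTop
      (𝓝 (∫ t, f t * (-D.im * (max t R) ^ (-(1 + α))))) := by
    refine tendsto_integral_of_dominated_convergence (fun t => f t * (1 + ‖D‖))
      (fun n => (hf.mul (continuous_im.comp (hwcont n)).neg).aestronglyMeasurable)
      (hfi.mul_const _) (fun n => Eventually.of_forall fun t => ?_)
      (.of_forall fun t => ?_)
    · rw [norm_mul, norm_eq_abs, abs_of_nonneg (hf0 t)]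
      by_cases ht : t ∈ Ioi R
      · refine mul_le_mul_of_nonneg_left ?_ (hf0 t)
        rw [norm_neg]; exact (abs_im_le_norm _).trans (hwb t ht n)
      · rw [hfU t ht]; simp
    · by_cases ht : t ∈ Ioi R
      · refine Tendsto.const_mul _ ?_
        have ht0 : 0 < t := hR0.trans ht
        have hts : (t : ℂ) ∈ slitPlane := Or.inl (by simpa using ht0)
        have hzlim : Tendsto (fun n => (t : ℂ) + ε n * I) atTop (𝓝 (t : ℂ)) := by
          have h1 := (continuous_ofReal.tendsto 0).comp tendsto_one_div_add_atTop_nhds_zero_nat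
          have h2 := (tendsto_const_nhds (x := (t : ℂ))).add (h1.mul_const I)
          simp only [Function.comp_def, ofReal_zero, zero_mul, add_zero] at h2; exact h2
        have hwc : ContinuousAt w t := by
          refine ContinuousAt.add (continuousAt_const.div continuousAt_id
            (Complex.slitPlane_ne_zero hts)) (continuousAt_const.mul ?_)
          exact continuousAt_id.cpow continuousAt_const hts
        have h3 := (continuous_im.tendsto _).comp (hwc.tendsto.comp hzlim)
        have h4 : (w t).im = D.im * t ^ (-(1 + α)) := by
          have e1 : (t : ℂ) ^ (-(1 + α) : ℂ) = ((t ^ (-(1 + α)) : ℝ) : ℂ) := by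
            rw [ofReal_cpow ht0.le]; push_cast; rfl
          have e2 : (1 / (t : ℂ)) = ((1 / t : ℝ) : ℂ) := by push_cast; rfl
          simp only [hw]
          rw [e1, e2, add_im, ofReal_im, Complex.im_mul_ofReal, zero_add]
        rw [max_eq_left (le_of_lt ht), neg_mul, ← h4]; exact h3.neg
      · simp only [hfU t ht, zero_mul]; exact tendsto_const_nhds
  refine le_of_tendsto ((hlim.sub hlim2).abs) (.of_forall fun n => ?_)
  have hi1 : Integrable fun t => f t * -(stieltjes μ (t + ε n * I)).im :=
    (hf.mul (continuous_im_stieltjes_line μ (hε n))).integrable_of_hasCompactSupport hfc.mul_right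
  have hi2 : Integrable fun t => f t * -(w (t + ε n * I)).im :=
    (hf.mul (continuous_im.comp (hwcont n)).neg).integrable_of_hasCompactSupport hfc.mul_right
  have hi3 : Integrable fun t => f t * (K * (max t R) ^ (-(1 + 2 * α))) :=
    (hf.mul (continuous_const.mul (hcontmax _))).integrable_of_hasCompactSupport hfc.mul_right
  have hK0 := nonneg_of_forall_norm_le hR0 hK
  rw [← integral_sub hi1 hi2, ← norm_eq_abs]
  refine norm_integral_le_of_norm_le hi3 (.of_forall fun t => ?_)
  rw [← mul_sub, norm_mul, norm_eq_abs, abs_of_nonneg (hf0 t)]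
  by_cases ht : t ∈ Ioi R
  · refine mul_le_mul_of_nonneg_left ?_ (hf0 t)
    have ht0 : 0 < t := hR0.trans ht
    set z := (t : ℂ) + ε n * I
    have htz : t ≤ ‖z‖ := (le_abs_self t).trans (re_le_norm_add_mul_I t _)
    have h1 := hK z (add_mul_I_mem_upperHalf t (hε n)) ((le_of_lt ht).trans htz)
    have h2 : -(stieltjes μ z).im - -(w z).im = -(stieltjes μ z - w z).im := by rw [sub_im]; ring
    rw [h2, norm_neg, max_eq_left (le_of_lt ht)]
    refine (abs_im_le_norm _).trans (h1.trans ?_)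
    refine mul_le_mul_of_nonneg_left ?_ hK0
    exact rpow_le_rpow_of_nonpos ht0 htz (by linarith)
  · rw [hfU t ht]; simp

lemma ae_le_of_forall_subset_lintegral_le {f g : ℝ → ℝ≥0∞} (hf : Measurable f) {U : Set ℝ}
    (hU : MeasurableSet U) (h : ∀ s, MeasurableSet s → s ⊆ U → ∫⁻ t in s, f t ≤ ∫⁻ t in s, g t) :
    ∀ᵐ t, t ∈ U → f t ≤ g t := by
  rw [← ae_restrict_iff' hU]
  refine ae_le_of_forall_setLIntegral_le_of_sigmaFinite hf fun s hs _ => ?_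
  rw [Measure.restrict_restrict hs]; exact h _ (hs.inter hU) inter_subset_right

lemma isLocallyFiniteMeasure_add (μ ν : Measure ℝ) [IsLocallyFiniteMeasure μ]
    [IsLocallyFiniteMeasure ν] : IsLocallyFiniteMeasure (μ + ν) := by
  refine ⟨fun x => ?_⟩
  obtain ⟨s, hs, h1⟩ := μ.finiteAt_nhds x
  obtain ⟨t, ht, h2⟩ := ν.finiteAt_nhds x
  refine ⟨s ∩ t, inter_mem hs ht, ?_⟩
  rw [Measure.add_apply, ENNReal.add_lt_top]
  exact ⟨(measure_mono inter_subset_left).trans_lt h1, (measure_mono inter_subset_right).trans_lt h2⟩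

/-- The density is a Radon-Nikodym derivative. Integrated inequalities on all sets give its bounds
almost everywhere, and a change on a null set makes them hold everywhere. -/
lemma exists_density_of_stieltjes {α : ℝ} (hα : 0 < α) (μ : Measure ℝ) [IsFiniteMeasure μ]
    {C : ℝ} (hC : ∀ z ∈ upperHalf, ‖z * stieltjes μ z‖ ≤ C) {D : ℂ} (hD : D.im ≤ 0) {R K : ℝ}
    (hR : 1 ≤ R)
    (hK : ∀ z ∈ upperHalf, R ≤ ‖z‖ → ‖stieltjes μ z - (1 / z + D * z ^ (-(1 + α) : ℂ))‖ ≤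
      K * ‖z‖ ^ (-(1 + 2 * α))) : ∃ ρ : ℝ → ℝ, Measurable ρ ∧ (∀ t, 0 ≤ ρ t) ∧
      μ.restrict {0}ᶜ = (volume.restrict {0}ᶜ).withDensity (fun t => ofReal (ρ t)) ∧
      (∀ δ : ℝ, 0 < δ → ∃ M : ℝ, ∀ t : ℝ, δ ≤ |t| → ρ t ≤ M) ∧
      Tendsto (fun t : ℝ => t ^ (α + 1) * ρ t) atTop (𝓝 (-D.im / π)) := by
  have hpi := pi_pos
  have hR0 : 0 < R := by linarith
  have hC0 : 0 ≤ C := (norm_nonneg _).trans (hC I (by simp [upperHalf]))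
  have hK0 := nonneg_of_forall_norm_le hR0 hK
  set U : ℕ → Set ℝ := fun n => {t | 1 / ((n : ℝ) + 1) < |t|}
  have hUm : ∀ n, MeasurableSet (U n) := fun n =>
    (isOpen_lt continuous_const continuous_abs).measurableSet
  have hn0 : ∀ n : ℕ, (0 : ℝ) < 1 / ((n : ℝ) + 1) := fun n => by positivity
  have hU0 : ∀ n, U n ⊆ {0}ᶜ := fun n t ht h0 => by
    rw [mem_singleton_iff] at h0
    have : 1 / ((n : ℝ) + 1) < |t| := ht
    rw [h0, abs_zero] at this; linarith [hn0 n]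
  have hUunion : ({0}ᶜ : Set ℝ) ⊆ ⋃ n, U n := by
    intro t ht
    have : 0 < |t| := abs_pos.2 ht
    obtain ⟨n, hn⟩ := exists_nat_one_div_lt this
    exact mem_iUnion.2 ⟨n, hn⟩
  set c : ℕ → ℝ := fun n => C / (1 / ((n : ℝ) + 1)) / π with hc
  have hc0 : ∀ n, 0 ≤ c n := fun n => by simp only [hc]; positivity
  have hA : ∀ n, ∀ s ⊆ U n, μ s ≤ ofReal (c n) * volume s := fun n s hs =>
    measure_le_of_norm_mul_stieltjes_le μ hC (hn0 n) hs
  set μ' := μ.restrict {0}ᶜ with hμ'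
  have hac : μ' ≪ volume := by
    refine Measure.AbsolutelyContinuous.mk fun s hs h0 => ?_
    rw [hμ', Measure.restrict_apply hs]
    refine measure_mono_null (t := ⋃ n, (s ∩ U n)) ?_ (measure_iUnion_null fun n => ?_)
    · rw [← inter_iUnion]; exact inter_subset_inter_right _ hUunion
    · refine le_antisymm ((hA n _ inter_subset_right).trans ?_) zero_le
      rw [measure_mono_null inter_subset_left h0, mul_zero]
  set r := μ'.rnDeriv volume
  have hrm : Measurable r := Measure.measurable_rnDeriv _ _
  have hwd : volume.withDensity r = μ' := Measure.withDensity_rnDeriv_eq _ _ hac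
  have hrs : ∀ s, MeasurableSet s → s ⊆ {0}ᶜ → ∫⁻ t in s, r t = μ s := by
    intro s hs hs0
    rw [← withDensity_apply _ hs, hwd, hμ', Measure.restrict_apply hs,
      inter_eq_self_of_subset_left hs0]
  have hae1 : ∀ᵐ t, ∀ n, t ∈ U n → r t ≤ ofReal (c n) := by
    rw [ae_all_iff]; intro n
    refine ae_le_of_forall_subset_lintegral_le hrm (hUm n) fun s hs hsU => ?_
    rw [hrs s hs (hsU.trans (hU0 n)), setLIntegral_const]; exact hA n s hsU
  set d := -D.im / π with hd
  have hd0 : 0 ≤ d := div_nonneg (by linarith) hpi.le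
  set κ := K / π with hκ
  have hκ0 : 0 ≤ κ := by positivity
  set φ : ℝ → ℝ := fun t => d * (max t R) ^ (-(1 + α)) with hφ
  set ψ : ℝ → ℝ := fun t => κ * (max t R) ^ (-(1 + 2 * α)) with hψ
  have hmax0 : ∀ t : ℝ, 0 < max t R := fun t => lt_max_of_lt_right hR0
  have hcontmax : ∀ p : ℝ, Continuous fun t : ℝ => (max t R) ^ p := fun p =>
    Continuous.rpow_const (by fun_prop) fun t => Or.inl (hmax0 t).ne'
  have hφc : Continuous φ := continuous_const.mul (hcontmax _)
  have hψc : Continuous ψ := continuous_const.mul (hcontmax _)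
  have hφ0 : ∀ t, 0 ≤ φ t := fun t => mul_nonneg hd0 (Real.rpow_nonneg (hmax0 t).le _)
  have hψ0 : ∀ t, 0 ≤ ψ t := fun t => mul_nonneg hκ0 (Real.rpow_nonneg (hmax0 t).le _)
  set lφ := (volume : Measure ℝ).withDensity fun t => ofReal (φ t) with hlφ
  set lψ := (volume : Measure ℝ).withDensity fun t => ofReal (ψ t) with hlψ
  have : IsLocallyFiniteMeasure lφ := IsLocallyFiniteMeasure.withDensity_ofReal hφc
  have : IsLocallyFiniteMeasure lψ := IsLocallyFiniteMeasure.withDensity_ofReal hψc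
  have := isLocallyFiniteMeasure_add lφ lψ
  have := isLocallyFiniteMeasure_add μ lψ
  have htail : ∀ f : ℝ → ℝ, Continuous f → HasCompactSupport f → (∀ t, 0 ≤ f t) →
      (∀ t ∉ Ioi R, f t = 0) → |∫ t, f t ∂μ - ∫ t, f t ∂lφ| ≤ ∫ t, f t ∂lψ := by
    intro f hf hfc hf0 hfU
    have h1 := tail_bounds_of_stieltjes hα μ hR hK hf hfc hf0 hfU
    rw [hlφ, hlψ, integral_withDensity_ofReal hφc hφ0, integral_withDensity_ofReal hψc hψ0]
    have e1 : ∫ t, f t * (-D.im * (max t R) ^ (-(1 + α))) = π * ∫ t, f t * φ t := by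
      rw [← integral_const_mul]
      refine integral_congr_fun fun t => ?_
      simp only [hφ, hd]; field_simp
    have e2 : ∫ t, f t * (K * (max t R) ^ (-(1 + 2 * α))) = π * ∫ t, f t * ψ t := by
      rw [← integral_const_mul]
      refine integral_congr_fun fun t => ?_
      simp only [hψ, hκ]; field_simp
    rw [e1, e2, ← mul_sub, abs_mul, abs_of_pos hpi] at h1; exact le_of_mul_le_mul_left h1 hpi
  have hIR : Ioi R ⊆ ({0}ᶜ : Set ℝ) := fun t ht h0 => by
    rw [mem_singleton_iff] at h0
    have : R < t := ht
    linarith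
  have hup : ∀ᵐ t, t ∈ Ioi R → r t ≤ ofReal (φ t) + ofReal (ψ t) := by
    refine ae_le_of_forall_subset_lintegral_le hrm measurableSet_Ioi fun s hs hsU => ?_
    rw [hrs s hs (hsU.trans hIR), lintegral_add_left (by fun_prop), ← withDensity_apply _ hs,
      ← withDensity_apply _ hs, ← hlφ, ← hlψ, ← Measure.add_apply]
    refine restrict_le_of_integral_le isOpen_Ioi (fun f hf hfc hf0 hfU => ?_) hsU
    rw [integral_add_measure (hf.integrable_of_hasCompactSupport hfc)
      (hf.integrable_of_hasCompactSupport hfc)]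
    linarith [(abs_le.1 (htail f hf hfc hf0 hfU)).2]
  -- The lower bound is kept in additive form because subtraction in `ℝ≥0∞` truncates.
  have hlow : ∀ᵐ t, t ∈ Ioi R → ofReal (φ t) ≤ r t + ofReal (ψ t) := by
    refine ae_le_of_forall_subset_lintegral_le (by fun_prop) measurableSet_Ioi fun s hs hsU => ?_
    rw [lintegral_add_left hrm, hrs s hs (hsU.trans hIR), ← withDensity_apply _ hs,
      ← withDensity_apply _ hs, ← hlφ, ← hlψ, ← Measure.add_apply]
    refine restrict_le_of_integral_le isOpen_Ioi (fun f hf hfc hf0 hfU => ?_) hsU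
    rw [integral_add_measure (hf.integrable_of_hasCompactSupport hfc)
      (hf.integrable_of_hasCompactSupport hfc)]
    linarith [(abs_le.1 (htail f hf hfc hf0 hfU)).1]
  have hrtop : ∀ᵐ t, r t < ∞ := Measure.rnDeriv_lt_top μ' volume
  obtain ⟨E, hEae, hEm, hE⟩ := ((hae1.and (hup.and hlow)).and hrtop).exists_measurable_mem
  classical
  -- Off the full-measure set `E` the density is replaced by the model `φ` beyond `R` and by `0`
  -- elsewhere, so boundedness and the tail limit hold at every point.
  refine ⟨fun t => if t ∈ E then (r t).toReal else if t ∈ Ioi R then φ t else 0, ?_, ?_, ?_, ?_, ?_⟩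
  · exact Measurable.ite hEm hrm.ennreal_toReal
      (Measurable.ite measurableSet_Ioi hφc.measurable measurable_const)
  · intro t
    beta_reduce
    split_ifs
    · exact ENNReal.toReal_nonneg
    · exact hφ0 t
    · exact le_rfl
  · have h0 : (volume : Measure ℝ).restrict {0}ᶜ = volume := by
      refine Measure.restrict_eq_self_of_ae_mem ?_
      rw [ae_iff]; simp
    rw [h0, ← hwd]
    refine withDensity_congr_ae ?_
    filter_upwards [hEae] with t ht
    rw [if_pos ht, ENNReal.ofReal_toReal (hE t ht).2.ne]
  · intro δ hδ
    obtain ⟨n, hn⟩ := exists_nat_one_div_lt hδ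
    refine ⟨max (c n) d, fun t ht => ?_⟩
    beta_reduce
    split_ifs with h1 h2
    · have h3 := (hE t h1).1.1 n (lt_of_lt_of_le hn ht)
      exact (ENNReal.toReal_le_of_le_ofReal (hc0 n) h3).trans (le_max_left _ _)
    · refine le_trans ?_ (le_max_right _ _)
      have : (max t R) ^ (-(1 + α)) ≤ 1 :=
        Real.rpow_le_one_of_one_le_of_nonpos (hR.trans (le_max_right _ _)) (by linarith)
      simp only [hφ]; nlinarith
    · exact hd0.trans (le_max_right _ _)
  · have hbound : ∀ t ∈ Ioi R, |(if t ∈ E then (r t).toReal else if t ∈ Ioi R then φ t else 0) -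
        φ t| ≤ ψ t := by
      intro t ht
      split_ifs with h1
      · obtain ⟨⟨-, h2, h3⟩, h4⟩ := hE t h1
        have h2' := h2 ht
        have h3' := h3 ht
        rw [← ENNReal.ofReal_add (hφ0 t) (hψ0 t)] at h2'
        have h5 := ENNReal.toReal_le_of_le_ofReal (add_nonneg (hφ0 t) (hψ0 t)) h2'
        rw [← ENNReal.ofReal_toReal h4.ne, ← ENNReal.ofReal_add ENNReal.toReal_nonneg (hψ0 t),
          ENNReal.ofReal_le_ofReal_iff (add_nonneg ENNReal.toReal_nonneg (hψ0 t))] at h3'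
        rw [abs_le]; constructor <;> linarith
      · rw [sub_self, abs_zero]; exact hψ0 t
    have hlim0 : Tendsto (fun t : ℝ => κ * t ^ (-α)) atTop (𝓝 0) := by
      simpa using (tendsto_rpow_neg_atTop hα).const_mul κ
    rw [tendsto_iff_norm_sub_tendsto_zero]
    refine squeeze_zero' (.of_forall fun t => norm_nonneg _) ?_ hlim0
    filter_upwards [eventually_gt_atTop R] with t ht
    have ht0 : 0 < t := hR0.trans ht
    have h1 := hbound t ht
    have e1 : t ^ (α + 1) * φ t = d := by
      simp only [hφ]
      rw [max_eq_left ht.le, mul_left_comm, ← rpow_add ht0]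
      rw [show α + 1 + -(1 + α) = 0 by ring, rpow_zero, mul_one]
    have e2 : t ^ (α + 1) * ψ t = κ * t ^ (-α) := by
      simp only [hψ]
      rw [max_eq_left ht.le, mul_left_comm, ← rpow_add ht0]; congr 2; ring
    rw [← e2]
    conv_lhs => rw [← e1]
    rw [← mul_sub, norm_mul, norm_eq_abs, abs_of_nonneg (by positivity)]
    exact mul_le_mul_of_nonneg_left h1 (by positivity)

/-! ### Regularly varying tails -/

/-- The tails of `ν`, normalized by `a`, converge to those of an `α`-stable law and obey a power
bound. -/
structure IsTailLimit (α : ℝ) (ν : Measure ℝ) (a : ℕ → ℝ) : Prop where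
  pos : ∀ᶠ N in atTop, 0 < a N
  tendsto : ∀ u : ℝ, 0 < u →
    Tendsto (fun N : ℕ => (N : ℝ) * ν.real {x | u * a N ≤ |x|}) atTop (𝓝 (u ^ (-α)))
  potter : ∃ C α' : ℝ, 0 ≤ C ∧ 0 < α' ∧ α' < 2 ∧ ∀ᶠ N : ℕ in atTop, ∀ u : ℝ, 0 < u →
    (N : ℝ) * ν.real {x | u * a N ≤ |x|} ≤ C * (1 + u ^ (-α'))

section TailLimit

variable {α : ℝ} {T : ℝ → ℝ}

lemma tendsto_ratio_of_slowlyVarying {L : ℝ → ℝ} (hL : SlowlyVarying L)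
    (hT : ∀ u, 0 < u → T u = L u * u ^ (-α)) {c : ℝ} (hc : 0 < c) :
    Tendsto (fun u => T (c * u) / T u) atTop (𝓝 (c ^ (-α))) := by
  have h := (hL.2.2 c hc).mul_const (c ^ (-α))
  rw [one_mul] at h
  refine h.congr' ?_
  filter_upwards [eventually_gt_atTop 0, hL.2.1] with u hu hLu
  rw [hT _ (mul_pos hc hu), hT u hu, mul_rpow hc.le hu.le]
  have : 0 < u ^ (-α) := by positivity
  field_simp

/-- Halving the argument multiplies `T` asymptotically by `2 ^ α`, hence eventually by at most `2 ^
α'` with `α' = (α + 2) / 2` strictly between `α` and `2`. Iterating the halving gives the power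
bound. -/
lemma exists_potter_bound (hα0 : 0 < α) (hα2 : α < 2) (hanti : Antitone T) (hpos : ∀ u, 0 < T u)
    (hle : ∀ u, T u ≤ 1)
    (hratio : ∀ c, 0 < c → Tendsto (fun u => T (c * u) / T u) atTop (𝓝 (c ^ (-α)))) :
    ∃ C s₀ : ℝ, 0 ≤ C ∧ ∀ s, s₀ ≤ s → ∀ u, 0 < u → u ≤ 1 →
      T (u * s) ≤ C * u ^ (-((α + 2) / 2)) * T s := by
  set α' := (α + 2) / 2 with hα'
  have hα'0 : 0 < α' := by rw [hα']; linarith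
  have hlt : ((1 : ℝ) / 2) ^ (-α) < 2 ^ α' := by
    rw [one_div, inv_rpow two_pos.le, rpow_neg two_pos.le, inv_inv]
    exact Real.rpow_lt_rpow_of_exponent_lt one_lt_two (by rw [hα']; linarith)
  obtain ⟨s₁, hs₁⟩ := eventually_atTop.1 (((hratio (1 / 2) (by norm_num)).eventually
    (gt_mem_nhds hlt)))
  set s₀ := max s₁ 1
  have hs₀0 : 0 < s₀ := lt_max_of_lt_right one_pos
  have hhalf : ∀ s, s₀ ≤ s → T (1 / 2 * s) ≤ 2 ^ α' * T s := fun s hs => by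
    have := (hs₁ s ((le_max_left _ _).trans hs)).le
    rwa [div_le_iff₀ (hpos s)] at this
  have hiter : ∀ k : ℕ, ∀ s, s₀ ≤ (1 / 2) ^ k * s →
      T ((1 / 2) ^ (k + 1) * s) ≤ (2 ^ α') ^ (k + 1) * T s := by
    intro k
    induction k with
    | zero => intro s hs; simpa using hhalf s (by simpa using hs)
    | succ k ih =>
      intro s hs
      have hs0 : 0 ≤ s := by
        by_contra h
        push Not at h
        have : (1 / 2 : ℝ) ^ (k + 1) * s ≤ 0 := mul_nonpos_of_nonneg_of_nonpos (by positivity) h.le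
        linarith
      have h1 := hhalf _ hs
      have h2 := ih s (hs.trans (by
        refine mul_le_mul_of_nonneg_right ?_ hs0
        exact pow_le_pow_of_le_one (by norm_num) (by norm_num) (Nat.le_succ k)))
      calc T ((1 / 2) ^ (k + 1 + 1) * s) = T (1 / 2 * ((1 / 2) ^ (k + 1) * s)) := by congr 1; ring
        _ ≤ 2 ^ α' * T ((1 / 2) ^ (k + 1) * s) := h1
        _ ≤ 2 ^ α' * ((2 ^ α') ^ (k + 1) * T s) := by gcongr
        _ = _ := by ring
  have hmain : ∀ s, s₀ ≤ s → ∀ u, 0 < u → u ≤ 1 → s₀ ≤ u * s →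
      T (u * s) ≤ 2 ^ α' * u ^ (-α') * T s := by
    intro s hs u hu hu1 hus
    obtain ⟨k, hk1, hk2⟩ := exists_nat_pow_near_of_lt_one hu hu1
      (by norm_num : (0 : ℝ) < 1 / 2) (by norm_num)
    have hs0 : 0 < s := hs₀0.trans_le hs
    have h1 := hiter k s (hus.trans (by gcongr))
    have h2 : T (u * s) ≤ T ((1 / 2) ^ (k + 1) * s) := hanti (by gcongr)
    have h3 : (2 ^ α') ^ (k + 1) ≤ 2 ^ α' * u ^ (-α') := by
      rw [pow_succ, mul_comm]; gcongr
      rw [rpow_neg hu.le, ← rpow_natCast, ← rpow_mul two_pos.le, mul_comm,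
        rpow_mul two_pos.le, rpow_natCast, ← inv_rpow hu.le]
      refine rpow_le_rpow (by positivity) ?_ hα'0.le
      rw [le_inv_comm₀ (by positivity) hu, ← inv_pow]; simpa using hk2
    exact h2.trans (h1.trans (mul_le_mul_of_nonneg_right h3 (hpos s).le))
  refine ⟨2 ^ α' / T s₀, s₀, by have := hpos s₀; positivity, fun s hs u hu hu1 => ?_⟩
  have hs0 : 0 < s := hs₀0.trans_le hs
  have hT0 := hpos s₀
  have hA : 0 ≤ 2 ^ α' * u ^ (-α') * T s := by have := (hpos s).le; positivity
  rcases le_total s₀ (u * s) with h | h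
  · refine (hmain s hs u hu hu1 h).trans ?_
    rw [div_mul_eq_mul_div, div_mul_eq_mul_div, le_div_iff₀ hT0]; nlinarith [hle s₀]
  -- Below the threshold `s₀` regular variation says nothing. There `T ≤ 1` is compared with the
  -- value at `s₀`, which accounts for the factor `1 / T s₀`.
  · have h1 := hmain s hs (s₀ / s) (by positivity) ((div_le_one hs0).2 hs)
      (by rw [div_mul_cancel₀ _ hs0.ne'])
    rw [div_mul_cancel₀ _ hs0.ne'] at h1
    have h2 : (s₀ / s) ^ (-α') ≤ u ^ (-α') :=
      rpow_le_rpow_of_nonpos hu ((le_div_iff₀ hs0).2 h) (by linarith)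
    rw [div_mul_eq_mul_div, div_mul_eq_mul_div, le_div_iff₀ hT0]
    have h3 : 2 ^ α' * (s₀ / s) ^ (-α') * T s ≤ 2 ^ α' * u ^ (-α') * T s := by
      have := (hpos s).le
      gcongr
    have := hle (u * s)
    nlinarith

/-- The normalizing constants of a heavy-tailed law. -/
lemma isTailLimit_of_slowlyVarying (hα0 : 0 < α) (hα2 : α < 2) (ν : Measure ℝ)
    [IsProbabilityMeasure ν] {L : ℝ → ℝ} (hL : SlowlyVarying L)
    (hT : ∀ u : ℝ, 0 < u → ν.real {x | u ≤ |x|} = L u * u ^ (-α)) :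
    IsTailLimit α ν fun N => sInf {u : ℝ | ν.real {x | u ≤ |x|} ≤ 1 / (N : ℝ)} := by
  set T : ℝ → ℝ := fun u => ν.real {x | u ≤ |x|} with hTdef
  set a : ℕ → ℝ := fun N => sInf {u : ℝ | T u ≤ 1 / (N : ℝ)}
  have hanti : Antitone T := fun u v huv => measureReal_mono fun x (hx : v ≤ |x|) => huv.trans hx
  have hle : ∀ u, T u ≤ 1 := fun u => measureReal_le_one
  have hpos : ∀ u, 0 < T u := by
    intro u
    obtain ⟨v, hv0, hv1, hv2⟩ :=
      ((eventually_gt_atTop 0).and (hL.2.1.and (eventually_ge_atTop u))).exists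
    refine lt_of_lt_of_le ?_ (hanti hv2)
    rw [hTdef]; simp only; rw [hT v hv0]
    positivity
  have hratio : ∀ c, 0 < c → Tendsto (fun u => T (c * u) / T u) atTop (𝓝 (c ^ (-α))) :=
    fun c hc => tendsto_ratio_of_slowlyVarying hL hT hc
  have hT0 : Tendsto T atTop (𝓝 0) := by
    have h1 := tendsto_measure_norm_gt_of_isTightMeasureSet (isTightMeasureSet_singleton (μ := ν))
    simp only [mem_singleton_iff, iSup_iSup_eq_left] at h1
    have h2 := (ENNReal.tendsto_toReal ENNReal.zero_ne_top).comp h1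
    have h3 := h2.comp (tendsto_atTop_add_const_right atTop (-1) tendsto_id)
    refine squeeze_zero (fun u => (hpos u).le) (fun u => ?_) h3
    refine measureReal_mono fun x (hx : u ≤ |x|) => ?_
    simp only [id, mem_ofPred_eq, norm_eq_abs]; linarith
  have hone : ∀ u ≤ 0, T u = 1 := fun u hu => by
    have : {x : ℝ | u ≤ |x|} = univ := eq_univ_of_forall fun x => hu.trans (abs_nonneg x)
    simp only [hTdef, this, probReal_univ]
  have hne : ∀ N : ℕ, 1 ≤ N → {u : ℝ | T u ≤ 1 / (N : ℝ)}.Nonempty := fun N hN => by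
    have hN0 : (0 : ℝ) < N := by exact_mod_cast hN
    exact ((hT0.eventually (gt_mem_nhds (show (0 : ℝ) < 1 / N by positivity))).mono
      fun u hu => le_of_lt hu).exists
  -- For `N = 1` the set is the whole line and its infimum is the default value `0`; `N ≥ 2` avoids
  -- this case.
  have hlb : ∀ N : ℕ, 2 ≤ N → ∀ M : ℝ, 1 / (N : ℝ) < T M → M ∈ lowerBounds
      {u : ℝ | T u ≤ 1 / (N : ℝ)} := fun N hN M hM u hu => by
    by_contra h
    push Not at h
    have : T u ≤ 1 / (N : ℝ) := hu
    linarith [hanti h.le]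
  have hone' : ∀ N : ℕ, 2 ≤ N → 1 / (N : ℝ) < T 0 := fun N hN => by
    rw [hone 0 le_rfl]
    have : (2 : ℝ) ≤ N := by exact_mod_cast hN
    rw [div_lt_one (by linarith)]; linarith
  have hlow : ∀ N : ℕ, 2 ≤ N → ∀ u < a N, 1 / (N : ℝ) < T u := fun N hN u hu => by
    by_contra h
    push Not at h
    exact absurd (csInf_le ⟨0, hlb N hN 0 (hone' N hN)⟩ h) (not_le.2 hu)
  have hhigh : ∀ N : ℕ, 1 ≤ N → ∀ u, a N < u → T u ≤ 1 / (N : ℝ) := fun N hN u hu => by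
    obtain ⟨s, hs, hsu⟩ := exists_lt_of_csInf_lt (hne N hN) hu
    exact (hanti hsu.le).trans hs
  have hainf : Tendsto a atTop atTop := by
    rw [tendsto_atTop]; intro M
    have h1 : Tendsto (fun N : ℕ => 1 / (N : ℝ)) atTop (𝓝 0) := tendsto_one_div_atTop_nhds_zero_nat
    filter_upwards [h1.eventually (gt_mem_nhds (hpos M)), eventually_ge_atTop 2] with N hN hN2
    exact le_csInf (hne N (by omega)) (hlb N hN2 M hN)
  have hlim : ∀ u : ℝ, 0 < u → Tendsto (fun N : ℕ => (N : ℝ) * T (u * a N)) atTop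
      (𝓝 (u ^ (-α))) := by
    intro u hu
    -- `T` may jump at `a N`, so it is evaluated at `c * a N` with `c` near `1`: there `T > 1 / N`
    -- for `c < 1` and `T ≤ 1 / N` for `c > 1`. The limits `(u / c) ^ (-α)` are then squeezed as `c
    -- → 1`.
    have hr : ∀ c : ℝ, 0 < c → Tendsto (fun N => T (u * a N) / T (c * a N)) atTop
        (𝓝 ((u / c) ^ (-α))) := fun c hc => by
      have h1 := (hratio (u / c) (by positivity)).comp (hainf.const_mul_atTop hc)
      refine h1.congr fun N => ?_
      simp only [Function.comp]; rw [← mul_assoc, div_mul_cancel₀ _ hc.ne']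
    have hcont : ContinuousAt (fun c : ℝ => (u / c) ^ (-α)) 1 := by
      refine ContinuousAt.rpow_const (continuousAt_const.div continuousAt_id one_ne_zero) ?_
      left; simpa using hu.ne'
    have hval : (fun c : ℝ => (u / c) ^ (-α)) 1 = u ^ (-α) := by simp
    rw [tendsto_order]
    have hN1 : ∀ᶠ N : ℕ in atTop, 2 ≤ N := eventually_ge_atTop 2
    have ha0 : ∀ᶠ N in atTop, 0 < a N := hainf.eventually_gt_atTop 0
    constructor
    · intro b hb
      have hc := (hcont.eventually (lt_mem_nhds (hval ▸ hb)))
      obtain ⟨c, hc1, hcb, hc0⟩ := ((eventually_mem_nhdsWithin.and ((hc.filter_mono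
        nhdsWithin_le_nhds).and ((lt_mem_nhds (zero_lt_one (α := ℝ))).filter_mono
          nhdsWithin_le_nhds)) : ∀ᶠ c in 𝓝[<] (1 : ℝ), c ∈ Iio 1 ∧ b < (u / c) ^ (-α) ∧ 0 < c)).exists
      filter_upwards [(hr c hc0).eventually (lt_mem_nhds hcb), hN1, ha0] with N h1 h2 h3
      have hN0 : (0 : ℝ) < N := by exact_mod_cast (by omega : 0 < N)
      have h4 := hlow N h2 (c * a N) (by
        have : c < 1 := hc1
        nlinarith)
      rw [lt_div_iff₀ (hpos _)] at h1; rw [div_lt_iff₀ hN0] at h4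
      have h5 := hpos (u * a N)
      by_cases hb0 : b ≤ 0
      · exact hb0.trans_lt (by positivity)
      · push Not at hb0; nlinarith
    · intro b hb
      have hc := (hcont.eventually (gt_mem_nhds (hval ▸ hb)))
      obtain ⟨c, hc1, hcb⟩ := ((eventually_mem_nhdsWithin.and (hc.filter_mono
        nhdsWithin_le_nhds) : ∀ᶠ c in 𝓝[>] (1 : ℝ), c ∈ Ioi 1 ∧ (u / c) ^ (-α) < b)).exists
      have hc1' : 1 < c := hc1
      have hc0 : 0 < c := by linarith
      have hb0 : 0 < b := lt_of_le_of_lt (by positivity) hcb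
      filter_upwards [(hr c hc0).eventually (gt_mem_nhds hcb), hN1, ha0] with N h1 h2 h3
      have hN0 : (0 : ℝ) < N := by exact_mod_cast (by omega : 0 < N)
      have h4 := hhigh N (by omega) (c * a N) (by nlinarith)
      rw [div_lt_iff₀ (hpos _)] at h1; rw [le_div_iff₀ hN0] at h4
      have h5 := hpos (c * a N)
      nlinarith
  refine ⟨hainf.eventually_gt_atTop 0, hlim, ?_⟩
  obtain ⟨C, s₀, hC0, hC⟩ := exists_potter_bound hα0 hα2 hanti hpos hle hratio
  refine ⟨2 * C + 2, (α + 2) / 2, by linarith, by linarith, by linarith, ?_⟩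
  have h1 := hlim 1 one_pos
  rw [one_rpow] at h1
  filter_upwards [h1.eventually (gt_mem_nhds (by norm_num : (1 : ℝ) < 2)),
    hainf.eventually_ge_atTop s₀, hainf.eventually_gt_atTop 0] with N h2 h3 h4 u hu
  rw [one_mul] at h2
  have hN0 : (0 : ℝ) ≤ N := Nat.cast_nonneg N
  have hup : 0 < u ^ (-((α + 2) / 2)) := by positivity
  rcases le_total u 1 with hu1 | hu1
  · have h5 := hC (a N) h3 u hu hu1
    calc (N : ℝ) * T (u * a N) ≤ N * (C * u ^ (-((α + 2) / 2)) * T (a N)) := by gcongr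
      _ = C * u ^ (-((α + 2) / 2)) * (N * T (a N)) := by ring
      _ ≤ C * u ^ (-((α + 2) / 2)) * 2 := by gcongr
      _ ≤ _ := by nlinarith
  · have h5 : T (u * a N) ≤ T (a N) := hanti (by nlinarith)
    have h6 : (N : ℝ) * T (u * a N) ≤ N * T (a N) := by gcongr
    have h7 : (N : ℝ) * T (u * a N) ≤ 2 := h6.trans h2.le
    have : 0 ≤ C * u ^ (-((α + 2) / 2)) := by positivity
    refine h7.trans ?_
    nlinarith

end TailLimit

/-! ### Laplace transforms of squares of heavy-tailed variables -/

section Laplace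

variable {α : ℝ} {ν : Measure ℝ} [IsProbabilityMeasure ν] {a : ℕ → ℝ}

lemma le_sq_div_iff {a : ℝ} (ha : 0 < a) (t x : ℝ) : t ≤ (x / a) ^ 2 ↔ √t * a ≤ |x| := by
  rw [← sq_abs, abs_div, abs_of_pos ha, ← Real.sqrt_le_left (by positivity), le_div_iff₀ ha]

lemma norm_exp_neg_mul_le_one {w : ℂ} (hw : 0 ≤ w.re) {t : ℝ} (ht : 0 ≤ t) :
    ‖exp (-(t * w))‖ ≤ 1 := by
  rw [norm_exp, Real.exp_le_one_iff]; simp only [neg_re, re_ofReal_mul]; nlinarith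

/-- Write `1 - e^(-mw) = ∫_0^m w e^(-tw) dt` and exchange the integrals; the tail of `ν` appears.
The cap `B` confines `t` to a bounded interval. -/
lemma integral_one_sub_exp_min {w : ℂ} (hw : 0 ≤ w.re) {B a : ℝ} (hB : 0 < B) (ha : 0 < a) :
    ∫ x, (1 - exp (-((min ((x / a) ^ 2) B : ℝ) * w))) ∂ν =
      ∫ t in Ioc 0 B, w * exp (-(t * w)) * (ν.real {x | √t * a ≤ |x|} : ℝ) := by
  have h1 : ∀ x : ℝ, 1 - exp (-((min ((x / a) ^ 2) B : ℝ) * w)) =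
      ∫ t in Ioc 0 B, {t : ℝ | t ≤ (x / a) ^ 2}.indicator (fun t : ℝ => w * exp (-(t * w))) t := by
    intro x
    have hm : MeasurableSet {t : ℝ | t ≤ (x / a) ^ 2} := measurableSet_Iic
    rw [setIntegral_indicator hm]
    have hset : Ioc 0 B ∩ {t : ℝ | t ≤ (x / a) ^ 2} = Ioc 0 (min ((x / a) ^ 2) B) := by
      ext t; simp only [mem_inter_iff, mem_Ioc, mem_ofPred_eq, le_min_iff]; tauto
    rw [hset, ← intervalIntegral.integral_of_le (by positivity)]
    have hder : ∀ t ∈ uIcc (0 : ℝ) (min ((x / a) ^ 2) B),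
        HasDerivAt (fun t : ℝ => -exp (-(t * w))) (w * exp (-(t * w))) t := by
      intro t _
      have h0 : HasDerivAt (fun t : ℝ => -((t : ℂ) * w)) (-(1 * w)) t :=
        ((ofRealCLM.hasDerivAt (x := t)).mul_const w).neg
      have e : w * exp (-(t * w)) = -(exp (-(t * w)) * -(1 * w)) := by ring
      rw [e]; exact h0.cexp.neg
    rw [intervalIntegral.integral_eq_sub_of_hasDerivAt hder]
    · simp; ring
    · exact Continuous.intervalIntegrable (by fun_prop) _ _
  simp_rw [h1]
  have hmset : MeasurableSet {p : ℝ × ℝ | p.2 ≤ (p.1 / a) ^ 2} :=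
    measurableSet_le (by fun_prop) (by fun_prop)
  rw [integral_integral_swap (f := fun x t => {t : ℝ | t ≤ (x / a) ^ 2}.indicator
        (fun t : ℝ => w * exp (-(t * w))) t)]
  · refine setIntegral_congr_fun measurableSet_Ioc fun t ht => ?_
    have e1 : ∀ x : ℝ, {t : ℝ | t ≤ (x / a) ^ 2}.indicator (fun t : ℝ => w * exp (-(t * w))) t =
        {x : ℝ | √t * a ≤ |x|}.indicator (fun _ => w * exp (-(t * w))) x := by
      intro x
      simp only [indicator_apply, mem_ofPred_eq, le_sq_div_iff ha]
    simp_rw [e1]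
    have hm : MeasurableSet {x : ℝ | √t * a ≤ |x|} := measurableSet_le (by fun_prop) (by fun_prop)
    rw [integral_indicator hm, setIntegral_const, real_smul, mul_comm]
  · refine Integrable.of_bound (C := ‖w‖) ?_ ?_
    · have : (Function.uncurry fun x t => {t : ℝ | t ≤ (x / a) ^ 2}.indicator
        (fun t : ℝ => w * exp (-(t * w))) t) = {p : ℝ × ℝ | p.2 ≤ (p.1 / a) ^ 2}.indicator
          (fun p => w * exp (-(p.2 * w))) := by
        ext p
        simp only [Function.uncurry, indicator_apply, mem_ofPred_eq]
      rw [this]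
      exact (Measurable.indicator (by fun_prop) hmset).aestronglyMeasurable
    · have hIoc : ∀ᵐ p ∂(ν.prod (volume.restrict (Ioc 0 B))), p.2 ∈ Ioc 0 B :=
        Measure.quasiMeasurePreserving_snd.ae (ae_restrict_mem measurableSet_Ioc)
      filter_upwards [hIoc] with p hp
      simp only [Function.uncurry, indicator_apply]
      split_ifs
      · rw [norm_mul]
        exact mul_le_of_le_one_right (norm_nonneg _) (norm_exp_neg_mul_le_one hw hp.1.le)
      · simp

/-- The product `Γ(1 - β) w^β` is the same integral over `(0, ∞)`. On `(B, ∞)` integration by parts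
uses that `w e^(-tw)` is the derivative of the bounded function `-e^(-tw)`, so the error does not
depend on `w`. -/
lemma norm_gamma_mul_cpow_sub_le {β : ℝ} (hβ0 : 0 < β) (hβ1 : β < 1) {w : ℂ} (hw : 0 < w.re)
    {B : ℝ} (hB : 0 < B) : ‖(Gamma (1 - β) : ℂ) * w ^ (β : ℂ) -
      ∫ t in Ioc 0 B, w * exp (-(t * w)) * ((t ^ (-β) : ℝ) : ℂ)‖ ≤ 2 * B ^ (-β) := by
  have hw0 : w ≠ 0 := fun h => by simp [h] at hw
  have hq : 0 < 1 - β := by linarith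
  have e1 : ∀ t : ℝ, w * (((t ^ (1 - β - 1) : ℝ) : ℂ) * exp (-(w * t) - ((t ^ β : ℝ) : ℂ) * 0)) =
      w * exp (-(t * w)) * ((t ^ (-β) : ℝ) : ℂ) := by
    intro t
    rw [show 1 - β - 1 = -β by ring, mul_zero, sub_zero, mul_comm w (t : ℂ)]; ring
  have hI : IntegrableOn (fun t : ℝ => w * exp (-(t * w)) * ((t ^ (-β) : ℝ) : ℂ)) (Ioi 0) :=
    ((integrable_lapInt hβ0 hβ1 hq hw (X := 0)).const_mul w).congr (.of_forall e1)
  have h1 : (Gamma (1 - β) : ℂ) * w ^ (β : ℂ) =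
      ∫ t in Ioi (0 : ℝ), w * exp (-(t * w)) * ((t ^ (-β) : ℝ) : ℂ) := by
    have h2 := lapInt_zero hβ0 hβ1 hq hw
    have h3 : w * lapInt β (1 - β) w 0 =
        ∫ t in Ioi (0 : ℝ), w * exp (-(t * w)) * ((t ^ (-β) : ℝ) : ℂ) := by
      rw [lapInt, ← integral_const_mul]
      simp_rw [e1]
    rw [← h3, h2, ← mul_assoc, mul_comm]; congr 1
    rw [Complex.ofReal_sub, ofReal_one, show (-(1 - (β : ℂ))) = (β : ℂ) - 1 by ring,
      Complex.cpow_sub _ _ hw0, cpow_one]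
    field_simp
  rw [h1, ← Ioc_union_Ioi_eq_Ioi hB.le, setIntegral_union Ioc_disjoint_Ioi_same measurableSet_Ioi
    (hI.mono_set Ioc_subset_Ioi_self) (hI.mono_set (Ioi_subset_Ioi hB.le)), add_sub_cancel_left]
  have hBpos : 0 < B ^ (-β) := by positivity
  have hrint : IntegrableOn (fun t : ℝ => t ^ (-β - 1)) (Ioi B) :=
    integrableOn_Ioi_rpow_of_lt (by linarith) hB
  set u : ℝ → ℂ := fun t => ((t ^ (-β) : ℝ) : ℂ) with hu
  set u' : ℝ → ℂ := fun t => ((-β * t ^ (-β - 1) : ℝ) : ℂ) with hu'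
  set v : ℝ → ℂ := fun t => -exp (-(t * w)) with hv
  set v' : ℝ → ℂ := fun t => w * exp (-(t * w)) with hv'
  have hdu : ∀ t ∈ Ioi B, HasDerivAt u (u' t) t := fun t ht =>
    (Real.hasDerivAt_rpow_const (Or.inl (hB.trans ht).ne')).ofReal_comp
  have hdv : ∀ t ∈ Ioi B, HasDerivAt v (v' t) t := by
    intro t _
    have h0 : HasDerivAt (fun t : ℝ => -((t : ℂ) * w)) (-(1 * w)) t :=
      ((ofRealCLM.hasDerivAt (x := t)).mul_const w).neg
    have e : v' t = -(exp (-(t * w)) * -(1 * w)) := by simp only [hv']; ring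
    rw [e]; exact h0.cexp.neg
  have hvb : ∀ t : ℝ, 0 ≤ t → ‖v t‖ ≤ 1 := fun t ht => by
    simp only [hv, norm_neg]; exact norm_exp_neg_mul_le_one hw.le ht
  have hu'b : ∀ t ∈ Ioi B, ‖u' t * v t‖ ≤ β * t ^ (-β - 1) := fun t ht => by
    have ht0 : 0 < t := hB.trans ht
    rw [norm_mul, hu', norm_real, norm_eq_abs, abs_mul, abs_neg, abs_of_pos hβ0,
      abs_of_pos (by positivity)]
    exact mul_le_of_le_one_right (by positivity) (hvb t ht0.le)
  have hu'v : IntegrableOn (u' * v) (Ioi B) := by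
    refine Integrable.mono' (hrint.const_mul β) (Measurable.aestronglyMeasurable ?_) ?_
    · simp only [hu', hv]; fun_prop
    · filter_upwards [ae_mem_Ioi _] with t ht using hu'b t ht
  have huv' : IntegrableOn (u * v') (Ioi B) := by
    refine (hI.mono_set (Ioi_subset_Ioi hB.le)).congr (.of_forall fun t => ?_)
    simp only [hu, hv', Pi.mul_apply]; ring
  have hzero : Tendsto (u * v) (𝓝[>] B) (𝓝 (u B * v B)) := by
    refine Tendsto.mul ?_ ?_
    · exact ((Real.hasDerivAt_rpow_const (p := -β)
        (Or.inl hB.ne')).ofReal_comp.continuousAt.tendsto).mono_left nhdsWithin_le_nhds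
    · have : Continuous v := by simp only [hv]; fun_prop
      exact (this.tendsto B).mono_left nhdsWithin_le_nhds
  have hinf : Tendsto (u * v) atTop (𝓝 0) := by
    refine squeeze_zero_norm' ?_ (tendsto_rpow_neg_atTop hβ0)
    filter_upwards [eventually_gt_atTop 0] with t ht
    rw [Pi.mul_apply, norm_mul, hu, norm_real, norm_eq_abs, abs_of_pos (by positivity)]
    exact mul_le_of_le_one_right (by positivity) (hvb t ht.le)
  have hibp := integral_Ioi_mul_deriv_eq_deriv_mul hdu hdv huv' hu'v hzero hinf
  have e2 : ∫ t in Ioi B, w * exp (-(t * w)) * ((t ^ (-β) : ℝ) : ℂ) = ∫ t in Ioi B, u t * v' t := by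
    refine integral_congr_fun fun t => ?_
    simp only [hu, hv']; ring
  rw [e2, hibp]
  have h4 : ‖∫ t in Ioi B, u' t * v t‖ ≤ B ^ (-β) := by
    have h5 : ∫ t in Ioi B, β * t ^ (-β - 1) = B ^ (-β) := by
      rw [integral_const_mul, integral_Ioi_rpow_of_lt (by linarith) hB]
      rw [sub_add_cancel]; field_simp
    rw [← h5]
    refine norm_integral_le_of_norm_le (hrint.const_mul β) ?_
    filter_upwards [ae_mem_Ioi _] with t ht using hu'b t ht
  have h6 : ‖u B * v B‖ ≤ B ^ (-β) := by
    rw [norm_mul, hu, norm_real, norm_eq_abs, abs_of_pos (by positivity)]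
    exact mul_le_of_le_one_right (by positivity) (hvb B hB.le)
  calc ‖0 - u B * v B - ∫ t in Ioi B, u' t * v t‖ ≤ ‖0 - u B * v B‖ + ‖∫ t in Ioi B, u' t * v t‖ :=
        norm_sub_le _ _
    _ ≤ 2 * B ^ (-β) := by rw [zero_sub, norm_neg]; linarith

lemma antitone_tail (ν : Measure ℝ) [IsProbabilityMeasure ν] {a : ℝ} (ha : 0 ≤ a) :
    Antitone fun t : ℝ => ν.real {x | √t * a ≤ |x|} := fun s t hst =>
  measureReal_mono fun x (hx : √t * a ≤ |x|) =>
    (mul_le_mul_of_nonneg_right (Real.sqrt_le_sqrt hst) ha).trans hx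

lemma sqrt_rpow_neg {t : ℝ} (ht : 0 ≤ t) (q : ℝ) : √t ^ (-q) = t ^ (-(q / 2)) := by
  rw [Real.sqrt_eq_rpow, ← rpow_mul ht]; congr 1; ring

/-- Dominated convergence. In the variable `t = u²` the Potter exponent becomes `α' / 2 < 1`, so the
majorant is integrable at `0`. -/
lemma IsTailLimit.tendsto_integral_abs (h : IsTailLimit α ν a)
    (hα2 : α < 2) {B : ℝ} (hB : 0 < B) : Tendsto (fun N : ℕ => ∫ t in Ioc 0 B,
      |(N : ℝ) * ν.real {x | √t * a N ≤ |x|} - t ^ (-(α / 2))|) atTop (𝓝 0) := by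
  obtain ⟨C, α', hC0, hα'0, hα'2, hC⟩ := h.potter
  have hInt : ∀ q : ℝ, -1 < q → IntegrableOn (fun t : ℝ => t ^ q) (Ioc 0 B) := fun q hq =>
    (intervalIntegrable_iff_integrableOn_Ioc_of_le hB.le).1
      (intervalIntegral.intervalIntegrable_rpow' hq)
  have hb : IntegrableOn (fun t : ℝ => C * (1 + t ^ (-(α' / 2))) + t ^ (-(α / 2))) (Ioc 0 B) := by
    refine Integrable.add (Integrable.const_mul (Integrable.add ?_ (hInt _ (by linarith))) C)
      (hInt _ (by linarith))
    exact integrable_const _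
  have := tendsto_integral_filter_of_dominated_convergence (μ := volume.restrict (Ioc 0 B))
    (l := atTop) (F := fun (N : ℕ) t => |(N : ℝ) * ν.real {x | √t * a N ≤ |x|} - t ^ (-(α / 2))|)
    (f := fun _ => 0) _ ?_ ?_ hb ?_
  · simpa using this
  · filter_upwards [h.pos] with N hN
    have := (antitone_tail ν hN.le).measurable
    fun_prop
  · filter_upwards [hC] with N hN
    filter_upwards [ae_restrict_mem measurableSet_Ioc] with t ht
    have ht0 : 0 < t := ht.1
    have h1 := hN (√t) (sqrt_pos.2 ht0)
    rw [sqrt_rpow_neg ht0.le] at h1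
    have h2 : 0 ≤ (N : ℝ) * ν.real {x | √t * a N ≤ |x|} := by positivity
    have h3 : 0 ≤ t ^ (-(α / 2)) := by positivity
    rw [norm_eq_abs, abs_abs, abs_le]; constructor <;> nlinarith
  · filter_upwards [ae_restrict_mem measurableSet_Ioc] with t ht
    have ht0 : 0 < t := ht.1
    have h1 := h.tendsto (√t) (sqrt_pos.2 ht0)
    rw [sqrt_rpow_neg ht0.le] at h1
    have := (h1.sub_const (t ^ (-(α / 2)))).abs
    simpa using this

/-- The uniform asymptotics `N E(1 - exp(-x² w / a_N²)) → Γ(1 - α/2) w^(α/2)`. -/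
lemma IsTailLimit.eventually_norm_laplace_sub_le
    (h : IsTailLimit α ν a) (hα0 : 0 < α) (hα2 : α < 2) (K : ℝ) {η : ℝ} (hη : 0 < η) :
    ∀ᶠ N : ℕ in atTop, ∀ w : ℂ, 0 < w.re → ‖w‖ ≤ K →
      ‖(N : ℂ) * ∫ x, (1 - exp (-(((x / a N) ^ 2 : ℝ) * w))) ∂ν -
        (Gamma (1 - α / 2) : ℂ) * w ^ ((α / 2 : ℝ) : ℂ)‖ ≤ η := by
  have hβ0 : 0 < α / 2 := by linarith
  have hβ1 : α / 2 < 1 := by linarith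
  obtain ⟨B, hB0, hBη⟩ : ∃ B : ℝ, 0 < B ∧ B ^ (-(α / 2)) < η / 16 :=
    ((eventually_gt_atTop 0).and ((tendsto_rpow_neg_atTop hβ0).eventually
      (gt_mem_nhds (by positivity)))).exists
  have hTB := h.tendsto (√B) (sqrt_pos.2 hB0)
  rw [sqrt_rpow_neg hB0.le] at hTB
  have : 0 < |K| + 1 := by positivity
  filter_upwards [h.pos, hTB.eventually (gt_mem_nhds hBη),
    (h.tendsto_integral_abs hα2 hB0).eventually
      (gt_mem_nhds (show 0 < η / (2 * (|K| + 1)) by positivity))] with N ha hTB hE w hw hwK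
  set T : ℝ → ℝ := fun t => ν.real {x | √t * a N ≤ |x|}
  have hanti : Antitone T := antitone_tail ν ha.le
  have hTm : Measurable T := hanti.measurable
  have hint1 : Integrable (fun x => 1 - exp (-(((x / a N) ^ 2 : ℝ) * w))) ν := by
    refine integrable_of_bound (C := 2) (by fun_prop) fun x => ?_
    refine (norm_sub_le _ _).trans ?_
    have := norm_exp_neg_mul_le_one hw.le (sq_nonneg (x / a N))
    rw [norm_one]; linarith
  have hint2 : Integrable (fun x => 1 - exp (-((min ((x / a N) ^ 2) B : ℝ) * w))) ν := by
    refine integrable_of_bound (C := 2) (by fun_prop) fun x => ?_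
    refine (norm_sub_le _ _).trans ?_
    have := norm_exp_neg_mul_le_one hw.le (t := min ((x / a N) ^ 2) B) (by positivity)
    rw [norm_one]; linarith
  -- Capping changes the integrand only where `|x| ≥ √B a_N`, a set whose mass times `N` is below `η
  -- / 16`.
  have : ‖(N : ℂ) * ∫ x, (1 - exp (-(((x / a N) ^ 2 : ℝ) * w))) ∂ν -
      (N : ℂ) * ∫ x, (1 - exp (-((min ((x / a N) ^ 2) B : ℝ) * w))) ∂ν‖ ≤ 2 * (η / 16) := by
    rw [← mul_sub, ← integral_sub hint1 hint2, norm_mul, Complex.norm_natCast]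
    have hms : MeasurableSet {x : ℝ | √B * a N ≤ |x|} :=
      measurableSet_le (by fun_prop) (by fun_prop)
    have : ‖∫ x, ((1 - exp (-(((x / a N) ^ 2 : ℝ) * w))) -
        (1 - exp (-((min ((x / a N) ^ 2) B : ℝ) * w)))) ∂ν‖ ≤ 2 * T B := by
      have e : 2 * T B = ∫ x, {x : ℝ | √B * a N ≤ |x|}.indicator (fun _ => (2 : ℝ)) x ∂ν := by
        rw [integral_indicator hms, setIntegral_const, smul_eq_mul, mul_comm]
      rw [e]
      refine norm_integral_le_of_norm_le ((integrable_const _).indicator hms)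
        (.of_forall fun x => ?_)
      by_cases hx : √B * a N ≤ |x|
      · rw [indicator_of_mem (show x ∈ {x : ℝ | √B * a N ≤ |x|} from hx)]
        have h1 := norm_exp_neg_mul_le_one hw.le (sq_nonneg (x / a N))
        have := norm_exp_neg_mul_le_one hw.le (t := min ((x / a N) ^ 2) B) (by positivity)
        rw [sub_sub_sub_cancel_left]; exact (norm_sub_le _ _).trans (by linarith)
      · rw [indicator_of_notMem (show x ∉ {x : ℝ | √B * a N ≤ |x|} from hx)]
        rw [← le_sq_div_iff ha, not_le] at hx; rw [min_eq_left hx.le, sub_self, norm_zero]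
    calc (N : ℝ) * _ ≤ N * (2 * T B) := by gcongr
      _ = 2 * (N * T B) := by ring
      _ ≤ _ := by gcongr
  have : ‖(N : ℂ) * ∫ x, (1 - exp (-((min ((x / a N) ^ 2) B : ℝ) * w))) ∂ν -
      ∫ t in Ioc 0 B, w * exp (-(t * w)) * ((t ^ (-(α / 2)) : ℝ) : ℂ)‖ ≤ η / 2 := by
    rw [integral_one_sub_exp_min hw.le hB0 ha, ← integral_const_mul]
    have hi0 : IntegrableOn (fun t : ℝ => t ^ (-(α / 2))) (Ioc 0 B) :=
      (intervalIntegrable_iff_integrableOn_Ioc_of_le hB0.le).1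
        (intervalIntegral.intervalIntegrable_rpow' (by linarith))
    have hiT : IntegrableOn T (Ioc 0 B) := by
      refine integrable_of_bound (C := 1) hTm fun t => ?_
      rw [norm_eq_abs, abs_of_nonneg measureReal_nonneg]; exact measureReal_le_one
    have hwb : ∀ᵐ t : ℝ ∂(volume.restrict (Ioc 0 B)), ‖w * exp (-((t : ℂ) * w))‖ ≤ |K| + 1 := by
      filter_upwards [ae_restrict_mem measurableSet_Ioc] with t ht
      rw [norm_mul]
      have h1 := mul_le_of_le_one_right (norm_nonneg w) (norm_exp_neg_mul_le_one hw.le ht.1.le)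
      linarith [le_abs_self K]
    have hi1 : IntegrableOn (fun t : ℝ => (N : ℂ) * (w * exp (-(t * w)) * (T t : ℂ))) (Ioc 0 B) :=
      (hiT.ofReal.bdd_mul (by fun_prop) hwb).const_mul _
    have hi2 : IntegrableOn (fun t : ℝ => w * exp (-(t * w)) *
        ((t ^ (-(α / 2)) : ℝ) : ℂ)) (Ioc 0 B) :=
      hi0.ofReal.bdd_mul (by fun_prop) hwb
    rw [← integral_sub hi1 hi2]
    have h3 : ‖∫ t in Ioc 0 B, ((N : ℂ) * (w * exp (-(t * w)) * (T t : ℂ)) -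
        w * exp (-(t * w)) * ((t ^ (-(α / 2)) : ℝ) : ℂ))‖ ≤
        ∫ t in Ioc 0 B, (|K| + 1) * |(N : ℝ) * T t - t ^ (-(α / 2))| := by
      refine norm_integral_le_of_norm_le ((((hiT.const_mul (N : ℝ)).sub hi0).abs).const_mul _) ?_
      filter_upwards [hwb] with t ht
      have e : (N : ℂ) * (w * exp (-(t * w)) * (T t : ℂ)) -
          w * exp (-(t * w)) * ((t ^ (-(α / 2)) : ℝ) : ℂ) =
          w * exp (-(t * w)) * (((N : ℝ) * T t - t ^ (-(α / 2)) : ℝ) : ℂ) := by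
        push_cast; ring
      rw [e, norm_mul, norm_real, norm_eq_abs]; gcongr
    refine h3.trans ?_
    rw [integral_const_mul]; rw [lt_div_iff₀ (by positivity)] at hE
    linarith
  have hstep3 := norm_gamma_mul_cpow_sub_le hβ0 hβ1 hw hB0
  rw [norm_sub_rev] at hstep3
  have hfin := norm_add₃_le (a := (N : ℂ) * ∫ x, (1 - exp (-(((x / a N) ^ 2 : ℝ) * w))) ∂ν -
      (N : ℂ) * ∫ x, (1 - exp (-((min ((x / a N) ^ 2) B : ℝ) * w))) ∂ν)
    (b := (N : ℂ) * ∫ x, (1 - exp (-((min ((x / a N) ^ 2) B : ℝ) * w))) ∂ν -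
      ∫ t in Ioc 0 B, w * exp (-(t * w)) * ((t ^ (-(α / 2)) : ℝ) : ℂ))
    (c := (∫ t in Ioc 0 B, w * exp (-(t * w)) * ((t ^ (-(α / 2)) : ℝ) : ℂ)) -
      (Gamma (1 - α / 2) : ℂ) * w ^ ((α / 2 : ℝ) : ℂ))
  rw [sub_add_sub_cancel, sub_add_sub_cancel] at hfin; linarith

end Laplace

/-! ### The row limit theorem -/

lemma ofReal_mul_cpow {r : ℝ} (hr : 0 < r) {w : ℂ} (hw : w ≠ 0) (p : ℝ) :
    ((r : ℂ) * w) ^ (p : ℂ) = ((r ^ p : ℝ) : ℂ) * w ^ (p : ℂ) := by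
  have hr' : (r : ℂ) ≠ 0 := by exact_mod_cast hr.ne'
  rw [cpow_def_of_ne_zero (mul_ne_zero hr' hw), cpow_def_of_ne_zero hw,
    Complex.log_ofReal_mul hr hw, add_mul, exp_add, Real.rpow_def_of_pos hr]
  push_cast; rfl

lemma re_cpow_nonneg {w : ℂ} (hw : 0 < w.re) {p : ℝ} (hp0 : 0 ≤ p) (hp1 : p ≤ 1) :
    0 ≤ (w ^ (p : ℂ)).re := by
  rw [Complex.cpow_ofReal_re]
  have h1 := Complex.abs_arg_le_pi_div_two_iff.2 hw.le
  refine mul_nonneg (by positivity) (Real.cos_nonneg_of_mem_Icc ?_)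
  rw [abs_le] at h1
  have := pi_pos
  constructor <;> nlinarith

lemma norm_prod_sub_prod_le {ι : Type*} (s : Finset ι) (f g : ι → ℂ) (hf : ∀ i ∈ s, ‖f i‖ ≤ 1)
    (hg : ∀ i ∈ s, ‖g i‖ ≤ 1) : ‖∏ i ∈ s, f i - ∏ i ∈ s, g i‖ ≤ ∑ i ∈ s, ‖f i - g i‖ := by
  classical
  induction s using Finset.induction_on with
  | empty => simp
  | insert j s hj ih =>
    rw [Finset.prod_insert hj, Finset.prod_insert hj, Finset.sum_insert hj]
    have := ih (fun i hi => hf i (Finset.mem_insert_of_mem hi))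
      (fun i hi => hg i (Finset.mem_insert_of_mem hi))
    have : ‖∏ i ∈ s, f i‖ ≤ 1 := (Finset.norm_prod_le _ _).trans
      (prod_le_one (fun _ _ => norm_nonneg _) fun i hi => hf i (Finset.mem_insert_of_mem hi))
    have := hg j (Finset.mem_insert_self _ _)
    calc ‖f j * ∏ i ∈ s, f i - g j * ∏ i ∈ s, g i‖
        = ‖(f j - g j) * ∏ i ∈ s, f i + g j * (∏ i ∈ s, f i - ∏ i ∈ s, g i)‖ := by ring_nf
      _ ≤ ‖f j - g j‖ * ‖∏ i ∈ s, f i‖ + ‖g j‖ * ‖∏ i ∈ s, f i - ∏ i ∈ s, g i‖ := by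
          refine (norm_add_le _ _).trans ?_
          rw [norm_mul, norm_mul]
      _ ≤ ‖f j - g j‖ * 1 + 1 * ∑ i ∈ s, ‖f i - g i‖ := by gcongr
      _ = _ := by ring

/-- The complex parameter of the limit law of `∑ j, (σ j y j / a_N)² w j`. -/
def rowField {N : ℕ} (α : ℝ) (σ : Fin N → ℝ) (w : Fin N → ℂ) : ℂ :=
  ((Gamma (1 - α / 2) / N : ℝ) : ℂ) * ∑ j, ((|σ j| ^ α : ℝ) : ℂ) * w j ^ ((α / 2 : ℝ) : ℂ)

section Row

variable {α : ℝ} {ν : Measure ℝ} [IsProbabilityMeasure ν] {a : ℕ → ℝ}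

lemma re_rowField_nonneg (hα0 : 0 < α) (hα2 : α < 2) {N : ℕ} (σ : Fin N → ℝ) {w : Fin N → ℂ}
    (hw : ∀ j, 0 < (w j).re) : 0 ≤ (rowField α σ w).re := by
  have : 0 ≤ Gamma (1 - α / 2) := (Gamma_pos_of_pos (by linarith)).le
  rw [rowField, re_ofReal_mul, re_sum]
  refine mul_nonneg (by positivity) (sum_nonneg fun j _ => ?_)
  rw [re_ofReal_mul]
  exact mul_nonneg (by positivity) (re_cpow_nonneg (hw j) (by linarith) (by linarith))

/-- With `u` the exponent on the right, the Laplace asymptotics give `1 - φ ≈ u` up to `η / (2N)`,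
while `e^(-u) - 1 + u = O(‖u‖²) = O(N⁻²)`. An error of `η / N` per factor leaves `η` for a product
of `N` factors. -/
lemma IsTailLimit.eventually_norm_factor_sub_le (h : IsTailLimit α ν a)
    (hα0 : 0 < α) (hα2 : α < 2) (s κ T : ℝ) {η : ℝ} (hη : 0 < η) :
    ∀ᶠ N : ℕ in atTop, ∀ (r t : ℝ) (w : ℂ), |r| ≤ s → 0 ≤ t → t ≤ T → 0 < w.re → ‖w‖ ≤ κ →
      ‖∫ x, exp (-((((a N)⁻¹ * (r * x)) ^ 2 * t : ℝ) * w)) ∂ν -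
        exp (-(((Gamma (1 - α / 2) / N * (t ^ (α / 2) * |r| ^ α) : ℝ) : ℂ) *
          w ^ ((α / 2 : ℝ) : ℂ)))‖ ≤ η / N := by
  set c := Gamma (1 - α / 2)
  have hc0 : 0 < c := Gamma_pos_of_pos (by linarith)
  set K := s ^ 2 * |T| * |κ| with hK
  have hK0 : 0 ≤ K := by positivity
  set D := c * K ^ (α / 2) with hD
  have hD0 : 0 ≤ D := by positivity
  have hη2 : 0 < η / 2 := by positivity
  -- As `‖u‖ ≤ D / N`, the requirement `N ≥ D` ensures `‖u‖ ≤ 1`, and `N ≥ 2 D² / η` ensures `‖u‖² ≤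
  -- η / (2N)`.
  filter_upwards [h.pos, h.eventually_norm_laplace_sub_le hα0 hα2 K hη2, eventually_gt_atTop 0,
    tendsto_natCast_atTop_atTop.eventually (eventually_ge_atTop (D + 2 * D ^ 2 / η))]
    with N ha hN hN0 hNbig r t w hr ht0 htT hw hwκ
  have hN0' : (0 : ℝ) < N := by exact_mod_cast hN0
  have hNc : (N : ℂ) ≠ 0 := by exact_mod_cast hN0.ne'
  -- The Laplace asymptotics require an argument with positive real part; in the degenerate cases
  -- both sides equal `1`.
  by_cases hrt : r = 0 ∨ t = 0
  · have e1 : ∀ x : ℝ, ((a N)⁻¹ * (r * x)) ^ 2 * t = 0 := by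
      rcases hrt with h | h <;> simp [h]
    have e2 : t ^ (α / 2) * |r| ^ α = 0 := by
      rcases hrt with h | h
      · rw [h, abs_zero, zero_rpow hα0.ne', mul_zero]
      · rw [h, zero_rpow (by linarith), zero_mul]
    simp only [e1, e2]; simp; positivity
  push Not at hrt
  have ht : 0 < t := lt_of_le_of_ne ht0 (Ne.symm hrt.2)
  have hrpos : 0 < r ^ 2 * t := mul_pos (by positivity [hrt.1]) ht
  have hw0 : w ≠ 0 := fun h => by simp [h] at hw
  have hre : 0 < (((r ^ 2 * t : ℝ) : ℂ) * w).re := by rw [re_ofReal_mul]; positivity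
  have hs : r ^ 2 ≤ s ^ 2 := sq_le_sq' (by linarith [neg_abs_le r]) ((le_abs_self r).trans hr)
  have hrtK : r ^ 2 * t * ‖w‖ ≤ K := by
    have h1 : t ≤ |T| := htT.trans (le_abs_self T)
    have h2 : ‖w‖ ≤ |κ| := hwκ.trans (le_abs_self κ)
    rw [hK]; gcongr
  have hnorm : ‖((r ^ 2 * t : ℝ) : ℂ) * w‖ ≤ K := by
    rwa [norm_ofReal_mul hrpos.le]
  have h1 := hN _ hre hnorm
  have hInt : Integrable (fun x : ℝ => exp (-((((a N)⁻¹ * (r * x)) ^ 2 * t : ℝ) * w))) ν := by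
    refine integrable_of_bound (C := 1) (by fun_prop) fun x => ?_
    exact norm_exp_neg_mul_le_one hw.le (by positivity)
  have e1 : ∫ x, (1 - exp (-(((x / a N) ^ 2 : ℝ) * (((r ^ 2 * t : ℝ) : ℂ) * w)))) ∂ν =
      1 - ∫ x, exp (-((((a N)⁻¹ * (r * x)) ^ 2 * t : ℝ) * w)) ∂ν := by
    have e : ∀ x : ℝ, exp (-(((x / a N) ^ 2 : ℝ) * (((r ^ 2 * t : ℝ) : ℂ) * w))) =
        exp (-((((a N)⁻¹ * (r * x)) ^ 2 * t : ℝ) * w)) := by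
      intro x; rw [← mul_assoc, ← ofReal_mul]; congr 4
      field_simp
    simp_rw [e]; rw [integral_sub (integrable_const _) hInt]; simp
  have hpow : (r ^ 2 * t) ^ (α / 2) = t ^ (α / 2) * |r| ^ α := by
    rw [mul_rpow (by positivity) ht0, mul_comm, ← sq_abs, ← rpow_natCast, ← rpow_mul (abs_nonneg r)]
    congr 2; push_cast; ring
  rw [e1, ofReal_mul_cpow hrpos hw0, hpow] at h1
  set φ := ∫ x, exp (-((((a N)⁻¹ * (r * x)) ^ 2 * t : ℝ) * w)) ∂ν
  set u : ℂ := ((c / N * (t ^ (α / 2) * |r| ^ α) : ℝ) : ℂ) * w ^ ((α / 2 : ℝ) : ℂ) with hu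
  have hNu : (N : ℂ) * u = (c : ℂ) * (((t ^ (α / 2) * |r| ^ α : ℝ) : ℂ) * w ^ ((α / 2 : ℝ) : ℂ)) := by
    rw [hu]; push_cast; field_simp
  rw [← hNu, ← mul_sub, norm_mul, Complex.norm_natCast] at h1
  have h2 : ‖1 - φ - u‖ ≤ η / 2 / N := by rw [le_div_iff₀ hN0']; linarith
  have hun : ‖u‖ ≤ D / N := by
    rw [hu, norm_mul, norm_real, norm_cpow_real, ← hpow,
      norm_of_nonneg (by positivity), mul_assoc, ← mul_rpow hrpos.le (norm_nonneg _), hD,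
      mul_comm_div, mul_div_assoc']
    have : 0 ≤ r ^ 2 * t * ‖w‖ := by positivity
    gcongr
  have hpos2 : 0 ≤ 2 * D ^ 2 / η := by positivity
  have hu1 : ‖-u‖ ≤ 1 := by
    rw [norm_neg]
    refine hun.trans ?_
    rw [div_le_one hN0']; linarith
  have h3 := Complex.norm_exp_sub_one_sub_id_le hu1
  have h4 : ‖u‖ ^ 2 ≤ η / 2 / N := by
    calc ‖u‖ ^ 2 ≤ (D / N) ^ 2 := by gcongr
      _ = D ^ 2 / N / N := by ring
      _ ≤ η / 2 / N := by
        refine div_le_div_of_nonneg_right ?_ hN0'.le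
        rw [div_le_iff₀ hN0']
        have : 2 * D ^ 2 / η ≤ N := by linarith
        rw [div_le_iff₀ hη] at this; linarith
  rw [norm_neg] at h3
  calc ‖φ - exp (-u)‖ = ‖-(1 - φ - u) - (exp (-u) - 1 - -u)‖ := by ring_nf
    _ ≤ ‖1 - φ - u‖ + ‖exp (-u) - 1 - -u‖ := by
        refine (norm_sub_le _ _).trans ?_
        rw [norm_neg]
    _ ≤ η / 2 / N + η / 2 / N := by linarith
    _ = η / N := by ring

lemma IsTailLimit.eventually_norm_prod_sub_le (h : IsTailLimit α ν a)
    (hα0 : 0 < α) (hα2 : α < 2) (s κ T : ℝ) {η : ℝ} (hη : 0 < η) :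
    ∀ᶠ N : ℕ in atTop, ∀ (σ : Fin N → ℝ) (w : Fin N → ℂ) (t : ℝ), (∀ j, |σ j| ≤ s) →
      (∀ j, 0 < (w j).re) → (∀ j, ‖w j‖ ≤ κ) → 0 ≤ t → t ≤ T →
      ‖∏ j, ∫ x, exp (-((((a N)⁻¹ * (σ j * x)) ^ 2 * t : ℝ) * w j)) ∂ν -
        exp (-((t ^ (α / 2) : ℝ) * rowField α σ w))‖ ≤ η := by
  have : 0 < Gamma (1 - α / 2) := Gamma_pos_of_pos (by linarith)
  filter_upwards [h.eventually_norm_factor_sub_le hα0 hα2 s κ T hη, eventually_gt_atTop 0]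
    with N hN hN0 σ w t hσ hw hwκ ht0 htT
  have : (0 : ℝ) < N := by exact_mod_cast hN0
  have e : exp (-((t ^ (α / 2) : ℝ) * rowField α σ w)) =
      ∏ j, exp (-(((Gamma (1 - α / 2) / N * (t ^ (α / 2) * |σ j| ^ α) : ℝ) : ℂ) *
          w j ^ ((α / 2 : ℝ) : ℂ))) := by
    rw [← exp_sum, rowField, Finset.sum_neg_distrib, mul_sum, mul_sum]; congr 2
    refine sum_congr rfl fun j _ => ?_
    push_cast; ring
  rw [e]
  refine (norm_prod_sub_prod_le _ _ _ (fun j _ => ?_) (fun j _ => ?_)).trans ?_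
  · refine norm_integral_le_of_forall_le fun x => ?_
    exact norm_exp_neg_mul_le_one (hw j).le (by positivity)
  · exact norm_exp_neg_mul_le_one (re_cpow_nonneg (hw j) (by linarith) (by linarith))
      (by positivity)
  · calc _ ≤ ∑ _j : Fin N, η / N :=
          sum_le_sum fun j _ => hN (σ j) t (w j) (hσ j) ht0 htT (hw j) (hwκ j)
      _ = η := by rw [sum_const, card_univ, Fintype.card_fin, nsmul_eq_mul]; field_simp

/-- The Gamma integral turns the negative power of a sum into an exponential of that sum, which
factorizes by independence of the coordinates. -/
lemma gamma_mul_integral_cpow_neg {p : ℝ} (hp : 0 < p) {ζ : ℂ}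
    (hζ : 0 < ζ.re) {N : ℕ} (c : ℝ) (σ : Fin N → ℝ) {w : Fin N → ℂ} (hw : ∀ j, 0 < (w j).re) :
    (Gamma p : ℂ) * ∫ y, (ζ + ∑ j, (((c * (σ j * y j)) ^ 2 : ℝ) : ℂ) * w j) ^ (-p : ℂ)
        ∂(Measure.pi fun _ : Fin N => ν) =
      ∫ t in Ioi (0 : ℝ), ((t ^ (p - 1) : ℝ) : ℂ) * exp (-(ζ * t)) *
        ∏ j, ∫ x, exp (-(((c * (σ j * x)) ^ 2 * t : ℝ) * w j)) ∂ν := by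
  set Q : (Fin N → ℝ) → ℂ := fun y => ∑ j, (((c * (σ j * y j)) ^ 2 : ℝ) : ℂ) * w j with hQ
  have hQre : ∀ y, 0 ≤ (Q y).re := fun y => by
    rw [hQ, re_sum]
    refine sum_nonneg fun j _ => ?_
    rw [re_ofReal_mul]; exact mul_nonneg (by positivity) (hw j).le
  have h1 : ∀ y, (Gamma p : ℂ) * (ζ + Q y) ^ (-p : ℂ) =
      ∫ t in Ioi (0 : ℝ), ((t ^ (p - 1) : ℝ) : ℂ) * exp (-(ζ * t)) *
        ∏ j, exp (-(((c * (σ j * y j)) ^ 2 * t : ℝ) * w j)) := by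
    intro y
    have hre : 0 < (ζ + Q y).re := by rw [add_re]; linarith [hQre y]
    -- At `X = 0` the exponent `β` has no effect; `1/2` is any admissible value.
    rw [mul_comm, ← lapInt_zero (β := 1 / 2) (by norm_num) (by norm_num) hp hre, lapInt]
    refine integral_congr_fun fun t => ?_
    rw [← exp_sum, mul_assoc, ← exp_add]; congr 2
    rw [mul_zero, sub_zero, hQ, add_mul, Finset.sum_neg_distrib, sum_mul, neg_add]; congr 2
    refine sum_congr rfl fun j _ => ?_
    push_cast; ring
  rw [← integral_const_mul]
  rw [integral_congr_ae (.of_forall h1), integral_integral_swap]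
  · refine integral_congr_fun fun t => ?_
    rw [integral_const_mul]; congr 1
    exact integral_fintype_prod_eq_prod (μ := fun _ => ν)
      (fun j x => exp (-(((c * (σ j * x)) ^ 2 * t : ℝ) * w j)))
  · have hb : Integrable (fun q : (Fin N → ℝ) × ℝ => (1 : ℝ) *
        (q.2 ^ (p - 1) * Real.exp (-(ζ.re * q.2))))
        ((Measure.pi fun _ : Fin N => ν).prod (volume.restrict (Ioi 0))) :=
      (integrable_const (1 : ℝ)).mul_prod (integrableOn_rpow_mul_exp_neg hp hζ)
    refine hb.mono' ?_ ?_
    · refine Measurable.aestronglyMeasurable ?_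
      fun_prop
    · have hIoi : ∀ᵐ q ∂((Measure.pi fun _ : Fin N => ν).prod (volume.restrict (Ioi (0 : ℝ)))),
          q.2 ∈ Ioi (0 : ℝ) :=
        Measure.quasiMeasurePreserving_snd.ae (ae_mem_Ioi 0)
      filter_upwards [hIoi] with q hq
      have : 0 < q.2 := hq
      simp only [Function.uncurry]
      rw [norm_mul, norm_ofReal_mul (by positivity), norm_exp, neg_re, re_mul_ofReal, one_mul]
      refine mul_le_of_le_one_right (by positivity) ((Finset.norm_prod_le _ _).trans
        (prod_le_one (fun _ _ => norm_nonneg _) fun j _ => ?_))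
      exact norm_exp_neg_mul_le_one (hw j).le (by positivity)

/-- Negative powers of the quadratic form `ζ + ∑ j, (σ j y j / a_N)² w j` of a heavy-tailed i.i.d.
row have asymptotically explicit expectations, uniformly in `σ` and `w`. -/
lemma IsTailLimit.eventually_norm_integral_row_sub_le
    (h : IsTailLimit α ν a) (hα0 : 0 < α) (hα2 : α < 2) {p : ℝ} (hp : 0 < p) {ζ : ℂ}
    (hζ : 0 < ζ.re) (s κ : ℝ) {η : ℝ} (hη : 0 < η) :
    ∀ᶠ N : ℕ in atTop, ∀ (σ : Fin N → ℝ) (w : Fin N → ℂ), (∀ j, |σ j| ≤ s) →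
      (∀ j, 0 < (w j).re) → (∀ j, ‖w j‖ ≤ κ) →
      ‖∫ y, (ζ + ∑ j, ((((a N)⁻¹ * (σ j * y j)) ^ 2 : ℝ) : ℂ) * w j) ^ (-p : ℂ)
        ∂(Measure.pi fun _ : Fin N => ν) -
        ((Gamma p)⁻¹ : ℝ) * lapInt (α / 2) p ζ (rowField α σ w)‖ ≤ η := by
  have hΓ : 0 < Gamma p := Gamma_pos_of_pos hp
  have hβ0 : 0 < α / 2 := by linarith
  have hβ1 : α / 2 < 1 := by linarith
  set x := ζ.re
  -- The product estimate is uniform only for `t ≤ T`. Beyond `T` the trivial bound `2` is used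
  -- together with `e^(-xt) ≤ (η / J) e^(-xt/2)`; `J` adds up the two resulting Gamma integrals.
  set J := (1 / x) ^ p + 2 * (1 / (x / 2)) ^ p with hJ
  have hJ0 : 0 < J := by positivity
  obtain ⟨T, hT⟩ : ∃ T : ℝ, Real.exp (-(x / 2 * T)) ≤ η / J := by
    have : Tendsto (fun T : ℝ => Real.exp (-(x / 2 * T))) atTop (𝓝 0) :=
      Real.tendsto_exp_neg_atTop_nhds_zero.comp (tendsto_id.const_mul_atTop (by positivity))
    exact ((this.eventually (gt_mem_nhds (show 0 < η / J by positivity))).mono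
      fun T hT => le_of_lt hT).exists
  filter_upwards [h.eventually_norm_prod_sub_le hα0 hα2 s κ T (show 0 < η / J by positivity)]
    with N hN σ w hσ hw hwκ
  set Φ : ℝ → ℂ := fun t => ∏ j, ∫ x, exp (-((((a N)⁻¹ * (σ j * x)) ^ 2 * t : ℝ) * w j)) ∂ν with hΦ
  have hΦm : Measurable Φ := by
    refine Finset.measurable_fun_prod _ fun j _ => ?_
    have : StronglyMeasurable fun t : ℝ =>
        ∫ x, exp (-((((a N)⁻¹ * (σ j * x)) ^ 2 * t : ℝ) * w j)) ∂ν :=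
      StronglyMeasurable.integral_prod_right
        (f := fun (t : ℝ) (x : ℝ) => exp (-((((a N)⁻¹ * (σ j * x)) ^ 2 * t : ℝ) * w j)))
        (Measurable.stronglyMeasurable (by simp only [Function.uncurry_def]; fun_prop))
    exact this.measurable
  have hΦ1 : ∀ t, 0 ≤ t → ‖Φ t‖ ≤ 1 := fun t ht => by
    refine (Finset.norm_prod_le _ _).trans (prod_le_one (fun _ _ => norm_nonneg _) fun j _ => ?_)
    refine norm_integral_le_of_forall_le fun x => ?_
    exact norm_exp_neg_mul_le_one (hw j).le (by positivity)
  have hX := re_rowField_nonneg hα0 hα2 σ hw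
  set X := rowField α σ w
  have hE1 : ∀ t : ℝ, 0 ≤ t → ‖exp (-((t ^ (α / 2) : ℝ) * X))‖ ≤ 1 := fun t ht =>
    norm_exp_neg_mul_le_one hX (by positivity)
  have hrep := gamma_mul_integral_cpow_neg (ν := ν) hp hζ (a N)⁻¹ σ hw
  set E := ∫ y, (ζ + ∑ j, ((((a N)⁻¹ * (σ j * y j)) ^ 2 : ℝ) : ℂ) * w j) ^ (-p : ℂ)
        ∂(Measure.pi fun _ : Fin N => ν)
  have hdiff : (Gamma p : ℂ) * E - lapInt (α / 2) p ζ X =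
      ∫ t in Ioi (0 : ℝ), ((t ^ (p - 1) : ℝ) : ℂ) * exp (-(ζ * t)) *
        (Φ t - exp (-((t ^ (α / 2) : ℝ) * X))) := by
    have e : ∀ t : ℝ, ((t ^ (p - 1) : ℝ) : ℂ) * exp (-(ζ * t) - ((t ^ (α / 2) : ℝ) : ℂ) * X)
        = ((t ^ (p - 1) : ℝ) : ℂ) * exp (-(ζ * t)) * exp (-((t ^ (α / 2) : ℝ) * X)) := by
      intro t; rw [sub_eq_add_neg (-(ζ * t)), exp_add, mul_assoc]
    rw [hrep, lapInt, ← integral_sub]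
    · refine integral_congr_fun fun t => ?_
      simp only [e, hΦ]; ring
    · refine Integrable.mono' (integrableOn_rpow_mul_exp_neg hp hζ)
        (Measurable.aestronglyMeasurable (Measurable.mul (by fun_prop) hΦm)) ?_
      filter_upwards [ae_mem_Ioi 0] with t ht
      have ht0 : 0 < t := ht
      rw [norm_mul, norm_ofReal_mul (by positivity), norm_exp, neg_re, re_mul_ofReal]
      exact mul_le_of_le_one_right (by positivity) (hΦ1 t ht0.le)
    · exact integrable_lapInt hβ0 hβ1 hp hζ
  have hbound : ‖(Gamma p : ℂ) * E - lapInt (α / 2) p ζ X‖ ≤ η * Gamma p := by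
    rw [hdiff]
    have hi1 := (integrableOn_rpow_mul_exp_neg hp hζ).const_mul (η / J)
    have hi2 := (integrableOn_rpow_mul_exp_neg hp (show 0 < x / 2 by positivity)).const_mul
      (2 * (η / J))
    have hval : ∫ t in Ioi (0 : ℝ), (η / J * (t ^ (p - 1) * Real.exp (-(x * t))) +
        2 * (η / J) * (t ^ (p - 1) * Real.exp (-(x / 2 * t)))) = η * Gamma p := by
      rw [integral_add hi1 hi2, integral_const_mul, integral_const_mul,
        Real.integral_rpow_mul_exp_neg_mul_Ioi hp hζ,
        Real.integral_rpow_mul_exp_neg_mul_Ioi hp (by positivity)]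
      calc _ = η * Gamma p * (J / J) := by rw [hJ]; ring
        _ = _ := by rw [div_self hJ0.ne', mul_one]
    rw [← hval]
    refine norm_integral_le_of_norm_le (hi1.add hi2) ?_
    filter_upwards [ae_mem_Ioi 0] with t ht
    have ht0 : 0 < t := ht
    rw [norm_mul, norm_ofReal_mul (by positivity), norm_exp, neg_re, re_mul_ofReal]
    have hpow : 0 < t ^ (p - 1) := by positivity
    rcases le_total t T with htT | htT
    · have h1 := hN σ w t hσ hw hwκ ht0.le htT
      have h2 : 0 ≤ 2 * (η / J) * (t ^ (p - 1) * Real.exp (-(x / 2 * t))) := by positivity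
      calc _ ≤ t ^ (p - 1) * Real.exp (-(x * t)) * (η / J) := by gcongr
        _ ≤ _ := by linarith
    · have h1 : ‖Φ t - exp (-((t ^ (α / 2) : ℝ) * X))‖ ≤ 2 :=
        (norm_sub_le _ _).trans (by linarith [hΦ1 t ht0.le, hE1 t ht0.le])
      have h2 : Real.exp (-(x * t)) ≤ η / J * Real.exp (-(x / 2 * t)) := by
        calc Real.exp (-(x * t)) = Real.exp (-(x / 2 * t)) * Real.exp (-(x / 2 * t)) := by
              rw [← Real.exp_add]; ring_nf
          _ ≤ Real.exp (-(x / 2 * T)) * Real.exp (-(x / 2 * t)) := by gcongr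
          _ ≤ _ := by gcongr
      have h3 : 0 ≤ η / J * (t ^ (p - 1) * Real.exp (-(x * t))) := by positivity
      calc _ ≤ t ^ (p - 1) * (η / J * Real.exp (-(x / 2 * t))) * 2 := by gcongr
        _ ≤ _ := by linarith
  have hfin : E - ((Gamma p)⁻¹ : ℝ) * lapInt (α / 2) p ζ X =
      ((Gamma p)⁻¹ : ℝ) * ((Gamma p : ℂ) * E - lapInt (α / 2) p ζ X) := by
    have : (Gamma p : ℂ) ≠ 0 := by exact_mod_cast hΓ.ne'
    push_cast; field_simp
  rw [hfin, norm_ofReal_mul (by positivity), inv_mul_le_iff₀ hΓ]; linarith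

end Row

/-! ### Off-diagonal quadratic forms of a heavy-tailed row -/

section Orthogonal

lemma integral_norm_sq_sum_le {Ω ι : Type*} [MeasurableSpace Ω] {P : Measure Ω}
    (s : Finset ι) (c : ι → ℂ) (e : ι → Ω → ℝ)
    (he : ∀ p ∈ s, ∀ q ∈ s, Integrable (fun ω => e p ω * e q ω) P) :
    ∫ ω, ‖∑ p ∈ s, c p * (e p ω : ℂ)‖ ^ 2 ∂P ≤
      ∑ p ∈ s, ∑ q ∈ s, ‖c p‖ * ‖c q‖ * |∫ ω, e p ω * e q ω ∂P| := by
  have h1 : ∀ ω, ‖∑ p ∈ s, c p * (e p ω : ℂ)‖ ^ 2 =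
      ∑ p ∈ s, ∑ q ∈ s, (c p * conj (c q)).re * (e p ω * e q ω) := by
    intro ω
    rw [← Complex.normSq_eq_norm_sq, ← ofReal_re (normSq _),
      Complex.normSq_eq_conj_mul_self, map_sum, mul_comm, Finset.sum_mul_sum, re_sum]
    refine sum_congr rfl fun p _ => ?_
    rw [re_sum]
    refine sum_congr rfl fun q _ => ?_
    rw [map_mul, conj_ofReal, ← re_mul_ofReal]; congr 1; push_cast; ring
  simp_rw [h1]
  rw [integral_finsetSum _ fun p hp => integrable_finsetSum _ fun q hq =>
    (he p hp q hq).const_mul _]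
  refine sum_le_sum fun p hp => ?_
  rw [integral_finsetSum _ fun q hq => (he p hp q hq).const_mul _]
  refine sum_le_sum fun q hq => ?_
  rw [integral_const_mul]
  refine (le_abs_self _).trans ?_
  rw [abs_mul]; gcongr
  calc _ ≤ ‖c p * conj (c q)‖ := abs_re_le_norm _
    _ = _ := by rw [norm_mul, RCLike.norm_conj]

variable {ι : Type*} [Fintype ι] {ν : Measure ℝ} [IsProbabilityMeasure ν] {g : ℝ → ℝ}

lemma integral_prod_pow (ν : Measure ℝ) [IsProbabilityMeasure ν] (g : ℝ → ℝ) (n : ι → ℕ) :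
    ∫ y, ∏ i, g (y i) ^ n i ∂(Measure.pi fun _ : ι => ν) = ∏ i, ∫ x, g x ^ n i ∂ν :=
  integral_fintype_prod_eq_prod (μ := fun _ => ν) fun i x => g x ^ n i

variable [DecidableEq ι]

lemma integral_mul_eval (hg0 : ∫ x, g x ∂ν = 0) (j k : ι) :
    ∫ y, g (y j) * g (y k) ∂(Measure.pi fun _ : ι => ν) = if j = k then ∫ x, g x ^ 2 ∂ν else 0 := by
  set n : ι → ℕ := fun i => (if i = j then 1 else 0) + (if i = k then 1 else 0) with hn
  have h1 : ∀ y : ι → ℝ, g (y j) * g (y k) = ∏ i, g (y i) ^ n i := by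
    intro y
    simp only [hn, pow_add, Finset.prod_mul_distrib, pow_ite, pow_one, pow_zero,
      Finset.prod_ite_eq', Finset.mem_univ, if_true]
  simp_rw [h1]; rw [integral_prod_pow]
  split_ifs with hjk
  · subst hjk; rw [Finset.prod_eq_single j]
    · simp [hn]
    · intro i _ hi; simp [hn, hi]
    · simp
  · refine prod_eq_zero (Finset.mem_univ j) ?_
    simpa [hn, hjk] using hg0

/-- The number `n i` counts the occurrences of coordinate `i`. A coordinate that occurs exactly once
contributes the mean `0`, so only the pairings `{l, m} = {j, k}` survive. -/
lemma abs_integral_mul_four_eval_le (hg0 : ∫ x, g x ∂ν = 0) {j k l m : ι}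
    (hjk : j ≠ k) (hlm : l ≠ m) :
    |∫ y, g (y j) * g (y k) * (g (y l) * g (y m)) ∂(Measure.pi fun _ : ι => ν)| ≤
      (∫ x, g x ^ 2 ∂ν) ^ 2 * ((if (l, m) = (j, k) then 1 else 0) +
        (if (l, m) = (k, j) then 1 else 0)) := by
  have hsq : 0 ≤ ∫ x, g x ^ 2 ∂ν := integral_nonneg fun x => sq_nonneg _
  set n : ι → ℕ := fun i => (if i = j then 1 else 0) + (if i = k then 1 else 0) +
    ((if i = l then 1 else 0) + (if i = m then 1 else 0)) with hn
  have h1 : ∀ y : ι → ℝ, g (y j) * g (y k) * (g (y l) * g (y m)) = ∏ i, g (y i) ^ n i := by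
    intro y
    simp only [hn, pow_add, Finset.prod_mul_distrib, pow_ite, pow_one, pow_zero,
      Finset.prod_ite_eq', Finset.mem_univ, if_true]
  simp_rw [h1]; rw [integral_prod_pow]
  by_cases hl : l = j ∨ l = k
  · by_cases hm : m = j ∨ m = k
    · have hval : ∏ i, ∫ x, g x ^ n i ∂ν = (∫ x, g x ^ 2 ∂ν) ^ 2 := by
        rw [Fintype.prod_eq_mul j k hjk]
        · have e1 : n j = 2 := by
            rcases hl with rfl | rfl <;> rcases hm with rfl | rfl <;> simp_all
          have e2 : n k = 2 := by
            rcases hl with rfl | rfl <;> rcases hm with rfl | rfl <;> simp_all [eq_comm]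
          rw [e1, e2, sq]
        · rintro i ⟨hij, hik⟩
          have e1 : n i = 0 := by
            rcases hl with rfl | rfl <;> rcases hm with rfl | rfl <;> simp_all
          simp [e1]
      rw [hval, abs_of_nonneg (by positivity)]
      refine le_mul_of_one_le_right (by positivity) ?_
      rcases hl with rfl | rfl <;> rcases hm with rfl | rfl <;> simp_all
    · push Not at hm
      rw [prod_eq_zero (Finset.mem_univ m), abs_zero]
      · positivity
      · have : n m = 1 := by simp [hn, hm.1, hm.2, hlm.symm]
        simpa [this] using hg0
  · push Not at hl
    rw [prod_eq_zero (Finset.mem_univ l), abs_zero]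
    · positivity
    · have : n l = 1 := by simp [hn, hl.1, hl.2, hlm]
      simpa [this] using hg0

variable {C : ℝ}

lemma integral_norm_sq_linear_le (hgm : Measurable g) (hgb : ∀ x, |g x| ≤ C)
    (hg0 : ∫ x, g x ∂ν = 0) (u : ι → ℂ) :
    ∫ y, ‖∑ j, u j * (g (y j) : ℂ)‖ ^ 2 ∂(Measure.pi fun _ : ι => ν) ≤
      (∫ x, g x ^ 2 ∂ν) * ∑ j, ‖u j‖ ^ 2 := by
  have hsq : 0 ≤ ∫ x, g x ^ 2 ∂ν := integral_nonneg fun x => sq_nonneg _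
  refine (integral_norm_sq_sum_le Finset.univ u (fun j (y : ι → ℝ) => g (y j)) ?_).trans ?_
  · intro p _ q _
    refine integrable_of_bound (C := C * C) (by fun_prop) fun y => ?_
    rw [norm_eq_abs, abs_mul]
    exact mul_le_mul (hgb _) (hgb _) (abs_nonneg _) ((abs_nonneg _).trans (hgb 0))
  · simp_rw [integral_mul_eval hg0]; rw [mul_sum]
    refine sum_le_sum fun p _ => ?_
    rw [sum_eq_single p]
    · simp only [if_true, abs_of_nonneg hsq]; exact le_of_eq (by ring)
    · intro q _ hq; simp [Ne.symm hq]
    · simp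

/-- The two surviving pairings contribute equally by symmetry of `M`, hence the factor `2`. -/
lemma integral_norm_sq_quadratic_le (hgm : Measurable g) (hgb : ∀ x, |g x| ≤ C)
    (hg0 : ∫ x, g x ∂ν = 0) {M : Matrix ι ι ℂ} (hM : M.IsSymm) (hM0 : ∀ j, M j j = 0) :
    ∫ y, ‖∑ j, ∑ k, M j k * ((g (y j) : ℂ) * (g (y k) : ℂ))‖ ^ 2 ∂(Measure.pi fun _ : ι => ν) ≤
      2 * (∫ x, g x ^ 2 ∂ν) ^ 2 * ∑ j, ∑ k, ‖M j k‖ ^ 2 := by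
  set V := ∫ x, g x ^ 2 ∂ν
  have : 0 ≤ C := (abs_nonneg _).trans (hgb 0)
  have e1 : ∀ y : ι → ℝ, ∑ j, ∑ k, M j k * ((g (y j) : ℂ) * (g (y k) : ℂ)) =
      ∑ p : ι × ι, M p.1 p.2 * ((g (y p.1) * g (y p.2) : ℝ) : ℂ) := by
    intro y; rw [Fintype.sum_prod_type]; push_cast; rfl
  simp_rw [e1]
  refine (integral_norm_sq_sum_le Finset.univ (fun p : ι × ι => M p.1 p.2)
    (fun p (y : ι → ℝ) => g (y p.1) * g (y p.2)) ?_).trans ?_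
  · intro p _ q _
    refine integrable_of_bound (C := C * C * (C * C)) (by fun_prop) fun y => ?_
    rw [norm_eq_abs, abs_mul, abs_mul, abs_mul]; gcongr <;> exact hgb _
  · have h2 : ∀ p q : ι × ι, ‖M p.1 p.2‖ * ‖M q.1 q.2‖ *
        |∫ y, g (y p.1) * g (y p.2) * (g (y q.1) * g (y q.2)) ∂(Measure.pi fun _ : ι => ν)| ≤
        ‖M p.1 p.2‖ * ‖M q.1 q.2‖ * (V ^ 2 * ((if q = p then 1 else 0) +
          (if q = p.swap then 1 else 0))) := by
      rintro ⟨j, k⟩ ⟨l, m⟩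
      by_cases hjk : j = k
      · subst hjk; simp [hM0]
      by_cases hlm : l = m
      · subst hlm; simp [hM0]
      exact mul_le_mul_of_nonneg_left (abs_integral_mul_four_eval_le hg0 hjk hlm) (by positivity)
    calc _ ≤ ∑ p : ι × ι, ∑ q : ι × ι, ‖M p.1 p.2‖ * ‖M q.1 q.2‖ * (V ^ 2 *
          ((if q = p then 1 else 0) + (if q = p.swap then 1 else 0))) :=
          sum_le_sum fun p _ => sum_le_sum fun q _ => h2 p q
      _ = ∑ p : ι × ι, 2 * V ^ 2 * ‖M p.1 p.2‖ ^ 2 := by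
          refine sum_congr rfl fun p _ => ?_
          have hs : M p.swap.1 p.swap.2 = M p.1 p.2 := hM.apply p.1 p.2
          simp only [mul_add, mul_ite, mul_one, mul_zero, sum_add_distrib,
            sum_ite_eq', Finset.mem_univ, if_true, hs]
          ring
      _ = _ := by rw [← mul_sum, Fintype.sum_prod_type]

end Orthogonal

/-! ### Truncated heavy-tailed variables -/

section Truncation

/-- The normalized variable `x / A`, truncated at level `B`. -/
def truncated (A B x : ℝ) : ℝ := if |x| < B * A then A⁻¹ * x else 0

lemma measurable_truncated (A B : ℝ) : Measurable (truncated A B) :=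
  Measurable.ite (measurableSet_lt (by fun_prop) (by fun_prop)) (by fun_prop) (by fun_prop)

lemma abs_truncated_le {A B : ℝ} (hA : 0 < A) (hB : 0 < B) (x : ℝ) :
    |truncated A B x| ≤ min (|x| / A) B := by
  unfold truncated
  split_ifs with h
  · rw [abs_mul, abs_inv, abs_of_pos hA, inv_mul_eq_div, le_min_iff]
    exact ⟨le_rfl, by rw [div_le_iff₀ hA]; exact h.le⟩
  · rw [abs_zero]; positivity

variable {α : ℝ} {ν : Measure ℝ} [IsProbabilityMeasure ν] {a : ℕ → ℝ}

/-- The layer-cake formula with Potter's bound; `q > α'` makes `t^(-α'/q)` integrable at `0`. The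
mean estimate for the truncated variables needs `q ≥ 1`, and both of their moment estimates need `q
< 2`. -/
lemma IsTailLimit.exists_moment_bound (h : IsTailLimit α ν a) :
    ∃ q : ℝ, 1 ≤ q ∧ q < 2 ∧ ∀ B : ℝ, 0 < B → ∃ C : ℝ, 0 ≤ C ∧ ∀ᶠ N : ℕ in atTop,
      ∫ x, min (|x| / a N) B ^ q ∂ν ≤ C / N := by
  obtain ⟨C, α', hC0, hα'0, hα'2, hC⟩ := h.potter
  refine ⟨max 1 ((α' + 2) / 2), le_max_left _ _, max_lt (by norm_num) (by linarith), ?_⟩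
  set q := max 1 ((α' + 2) / 2)
  have hq0 : 0 < q := by positivity
  have hqα : α' < q := lt_of_lt_of_le (by linarith) (le_max_right _ _)
  intro B hB
  have hInt : ∀ r : ℝ, -1 < r → IntegrableOn (fun t : ℝ => t ^ r) (Ioc 0 (B ^ q)) := fun r hr =>
    (intervalIntegrable_iff_integrableOn_Ioc_of_le (by positivity)).1
      (intervalIntegral.intervalIntegrable_rpow' hr)
  have hb : IntegrableOn (fun t : ℝ => C * (1 + t ^ (-(α' / q)))) (Ioc 0 (B ^ q)) := by
    refine Integrable.const_mul (Integrable.add (integrable_const _) (hInt _ ?_)) C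
    rw [neg_lt_neg_iff, div_lt_one hq0]; exact hqα
  refine ⟨∫ t in Ioc 0 (B ^ q), C * (1 + t ^ (-(α' / q))), ?_, ?_⟩
  · exact setIntegral_nonneg measurableSet_Ioc fun t ht => by have := ht.1; positivity
  filter_upwards [hC, h.pos, eventually_gt_atTop 0] with N hN ha hN0
  have hN0' : (0 : ℝ) < N := by exact_mod_cast hN0
  have hmin : ∀ x : ℝ, 0 ≤ min (|x| / a N) B := fun x => by positivity
  have hi : Integrable (fun x => min (|x| / a N) B ^ q) ν := by
    refine integrable_of_bound (C := B ^ q) (Measurable.pow_const (by fun_prop) q) fun x => ?_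
    have := hmin x
    rw [norm_of_nonneg (by positivity)]
    exact rpow_le_rpow this (min_le_right _ _) hq0.le
  rw [hi.integral_eq_integral_meas_le (.of_forall fun x => by
    have := hmin x; positivity), le_div_iff₀ hN0', mul_comm, ← integral_const_mul]
  have hz : ∀ t ∈ Ioi (0 : ℝ), t ∉ Ioc 0 (B ^ q) →
      (N : ℝ) * ν.real {x | t ≤ min (|x| / a N) B ^ q} = 0 := by
    intro t ht ht'
    have : {x | t ≤ min (|x| / a N) B ^ q} = ∅ := by
      refine eq_empty_of_forall_notMem fun x hx => ht' ⟨ht, le_trans hx ?_⟩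
      exact rpow_le_rpow (hmin x) (min_le_right _ _) hq0.le
    simp [this]
  rw [setIntegral_eq_of_subset_of_forall_sdiff_eq_zero measurableSet_Ioi
    (s := Ioc 0 (B ^ q)) (fun t ht => ht.1) (fun t ht => hz t ht.1 ht.2)]
  refine integral_mono_of_nonneg (.of_forall fun t => by positivity) hb ?_
  filter_upwards [ae_restrict_mem measurableSet_Ioc] with t ht
  have ht0 : 0 < t := ht.1
  have h1 := hN (t ^ (1 / q)) (by positivity)
  rw [← rpow_mul ht0.le] at h1
  have e : 1 / q * -α' = -(α' / q) := by ring
  rw [e] at h1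
  refine le_trans ?_ h1
  refine mul_le_mul_of_nonneg_left (measureReal_mono fun x hx => ?_) hN0'.le
  have hx' : t ≤ min (|x| / a N) B ^ q := hx
  have h2 : t ^ (1 / q) ≤ min (|x| / a N) B := by
    calc t ^ (1 / q) ≤ (min (|x| / a N) B ^ q) ^ (1 / q) := by gcongr
      _ = _ := by rw [← rpow_mul (hmin x), mul_one_div_cancel hq0.ne', rpow_one]
  have h3 := h2.trans (min_le_left _ _)
  rw [le_div_iff₀ ha] at h3; exact h3

/-- The truncated variables have second moment `O(1 / N)` and mean `o(N ^ (-1/2))`. -/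
lemma IsTailLimit.exists_truncated_moments (h : IsTailLimit α ν a)
    {B : ℝ} (hB : 0 < B) : ∃ C : ℝ, 0 ≤ C ∧ ∀ δ : ℝ, 0 < δ → ∀ᶠ N : ℕ in atTop,
      ∫ x, truncated (a N) B x ^ 2 ∂ν ≤ C / N ∧
      (N : ℝ) * (∫ x, truncated (a N) B x ∂ν) ^ 2 ≤ δ := by
  obtain ⟨q, hq1, hq2, hq⟩ := h.exists_moment_bound
  obtain ⟨C, hC0, hC⟩ := hq B hB
  have hq0 : 0 < q := by linarith
  refine ⟨B ^ (2 - q) * C, by positivity, fun δ hδ => ?_⟩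
  have hlim : Tendsto (fun N : ℕ => (1 + C) ^ 2 * (N : ℝ) ^ (-(2 / q - 1))) atTop (𝓝 0) := by
    have h2q : 0 < 2 / q - 1 := by rw [sub_pos, lt_div_iff₀ hq0]; linarith
    have := ((tendsto_rpow_neg_atTop h2q).comp tendsto_natCast_atTop_atTop).const_mul ((1 + C) ^ 2)
    simpa using this
  filter_upwards [hC, h.pos, eventually_gt_atTop 0, hlim.eventually (gt_mem_nhds hδ)]
    with N hN ha hN0 hNδ
  have hN0' : (0 : ℝ) < N := by exact_mod_cast hN0
  have hmin : ∀ x : ℝ, 0 ≤ min (|x| / a N) B := fun x => by positivity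
  have hi : Integrable (fun x => min (|x| / a N) B ^ q) ν := by
    refine integrable_of_bound (C := B ^ q) (Measurable.pow_const (by fun_prop) q) fun x => ?_
    have := hmin x
    rw [norm_of_nonneg (by positivity)]
    exact rpow_le_rpow this (min_le_right _ _) hq0.le
  constructor
  · calc ∫ x, truncated (a N) B x ^ 2 ∂ν ≤ ∫ x, B ^ (2 - q) * min (|x| / a N) B ^ q ∂ν := by
          refine integral_mono_of_nonneg (.of_forall fun x => sq_nonneg _)
            (hi.const_mul _) (.of_forall fun x => ?_)
          have h1 := abs_truncated_le ha hB x
          have h2 := hmin x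
          calc truncated (a N) B x ^ 2 ≤ min (|x| / a N) B ^ 2 := by rw [← sq_abs]; gcongr
            _ = min (|x| / a N) B ^ ((2 - q) + q) := by
                rw [sub_add_cancel]; exact (rpow_natCast _ 2).symm
            _ = min (|x| / a N) B ^ (2 - q) * min (|x| / a N) B ^ q :=
                Real.rpow_add_of_nonneg h2 (by linarith) hq0.le
            _ ≤ B ^ (2 - q) * min (|x| / a N) B ^ q := by gcongr; exact min_le_right _ _
      _ ≤ _ := by rw [integral_const_mul, mul_div_assoc]; gcongr
  -- Split at level `l`: below it the variable is at most `l`, and above it at most `l^(1-q)` times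
  -- its `q`-th power, of mean at most `C l`. The choice of `l` balances the two, and `N l² = N^(1 -
  -- 2/q) → 0`.
  · set l : ℝ := (N : ℝ) ^ (-(1 / q)) with hl
    have hl0 : 0 < l := by positivity
    have hmean : |∫ x, truncated (a N) B x ∂ν| ≤ (1 + C) * l := by
      calc |∫ x, truncated (a N) B x ∂ν| ≤ ∫ x, (l + l ^ (1 - q) * min (|x| / a N) B ^ q) ∂ν := by
            rw [← norm_eq_abs]
            refine norm_integral_le_of_norm_le ((integrable_const _).add (hi.const_mul _))
              (.of_forall fun x => ?_)
            refine (abs_truncated_le ha hB x).trans ?_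
            have h2 := hmin x
            rcases le_total (min (|x| / a N) B) l with h3 | h3
            · have : 0 ≤ l ^ (1 - q) * min (|x| / a N) B ^ q := by positivity
              linarith
            · have h4 : 0 < min (|x| / a N) B := hl0.trans_le h3
              have : min (|x| / a N) B ≤ l ^ (1 - q) * min (|x| / a N) B ^ q := by
                calc min (|x| / a N) B = min (|x| / a N) B ^ (1 - q) * min (|x| / a N) B ^ q := by
                      rw [← rpow_add h4, sub_add_cancel, rpow_one]
                  _ ≤ _ := by
                      gcongr ?_ * _
                      exact rpow_le_rpow_of_nonpos hl0 h3 (by linarith)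
              linarith
        _ = l + l ^ (1 - q) * ∫ x, min (|x| / a N) B ^ q ∂ν := by
            rw [integral_add (integrable_const _) (hi.const_mul _), integral_const_mul]; simp
        _ ≤ l + l ^ (1 - q) * (C / N) := by gcongr
        _ = (1 + C) * l := by
            have e : l ^ (1 - q) * (C / N) = C * l := by
              rw [hl, ← rpow_mul hN0'.le,
                show -(1 / q) * (1 - q) = -(1 / q) + 1 by field_simp; ring,
                rpow_add hN0', rpow_one]
              field_simp
            rw [e]; ring
    have hfin : (N : ℝ) * ((1 + C) * l) ^ 2 = (1 + C) ^ 2 * (N : ℝ) ^ (-(2 / q - 1)) := by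
      rw [mul_pow, hl, ← rpow_natCast ((N : ℝ) ^ (-(1 / q))) 2, ← rpow_mul hN0'.le,
        show -(2 / q - 1) = 1 + -(1 / q) * ((2 : ℕ) : ℝ) by push_cast; ring,
        rpow_add hN0' 1, rpow_one]
      ring
    calc (N : ℝ) * (∫ x, truncated (a N) B x ∂ν) ^ 2 ≤ N * ((1 + C) * l) ^ 2 := by
          rw [← sq_abs]; gcongr
      _ ≤ δ := by rw [hfin]; exact hNδ.le

end Truncation

/-! ### Negligibility of off-diagonal terms and of single entries -/

section QuadraticForm

variable {α : ℝ} {ν : Measure ℝ} [IsProbabilityMeasure ν] {a : ℕ → ℝ}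

/-- The off-diagonal part of the quadratic form of `M` with weights `σ`. -/
def offDiag {N : ℕ} (σ : Fin N → ℝ) (M : Matrix (Fin N) (Fin N) ℂ) : Matrix (Fin N) (Fin N) ℂ :=
  Matrix.of fun j k => if j = k then 0 else ((σ j * σ k : ℝ) : ℂ) * M j k

section Bounds

variable {N : ℕ} {σ : Fin N → ℝ} {M : Matrix (Fin N) (Fin N) ℂ} {s κ : ℝ}

lemma isSymm_offDiag (hM : M.IsSymm) : (offDiag σ M).IsSymm := by
  ext j k
  simp only [offDiag, Matrix.transpose_apply, Matrix.of_apply, eq_comm (a := k), hM.apply k j,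
    mul_comm (σ k)]

/-- By symmetry row `j` is the image of the `j`-th basis vector. -/
lemma sum_norm_sq_row_le (hMs : M.IsSymm)
    (hM : ∀ v : Fin N → ℂ, ∑ j, ‖(M.mulVec v) j‖ ^ 2 ≤ κ ^ 2 * ∑ j, ‖v j‖ ^ 2) (j : Fin N) :
    ∑ k, ‖M j k‖ ^ 2 ≤ κ ^ 2 := by
  have h1 := hM (Pi.single j 1)
  have e1 : ∀ k, (M.mulVec (Pi.single j 1)) k = M j k := fun k => by
    rw [Matrix.mulVec_single_one, Matrix.col_apply, hMs.apply]
  have e2 : ∑ k, ‖(Pi.single j (1 : ℂ) : Fin N → ℂ) k‖ ^ 2 = 1 := by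
    rw [sum_eq_single j]
    · simp
    · intro k _ hk; simp [hk]
    · simp
  simp_rw [e1] at h1
  rwa [e2, mul_one] at h1

lemma sum_norm_sq_offDiag_le (hσ : ∀ j, |σ j| ≤ s) (hMs : M.IsSymm)
    (hM : ∀ v : Fin N → ℂ, ∑ j, ‖(M.mulVec v) j‖ ^ 2 ≤ κ ^ 2 * ∑ j, ‖v j‖ ^ 2) :
    ∑ j, ∑ k, ‖offDiag σ M j k‖ ^ 2 ≤ s ^ 4 * κ ^ 2 * N := by
  have h1 : ∀ j k, ‖offDiag σ M j k‖ ^ 2 ≤ s ^ 4 * ‖M j k‖ ^ 2 := by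
    intro j k; simp only [offDiag, Matrix.of_apply]
    split_ifs
    · simp; positivity
    · rw [norm_mul, norm_real, norm_eq_abs, abs_mul, mul_pow]
      have : |σ j| * |σ k| ≤ s * s :=
        mul_le_mul (hσ j) (hσ k) (abs_nonneg _) ((abs_nonneg _).trans (hσ j))
      calc (|σ j| * |σ k|) ^ 2 * ‖M j k‖ ^ 2 ≤ (s * s) ^ 2 * ‖M j k‖ ^ 2 := by gcongr
        _ = _ := by ring
  calc _ ≤ ∑ _j : Fin N, s ^ 4 * κ ^ 2 := by
        refine sum_le_sum fun j _ => ?_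
        calc _ ≤ ∑ k, s ^ 4 * ‖M j k‖ ^ 2 := sum_le_sum fun k _ => h1 j k
          _ = s ^ 4 * ∑ k, ‖M j k‖ ^ 2 := by rw [mul_sum]
          _ ≤ _ := by gcongr; exact sum_norm_sq_row_le hMs hM j
    _ = _ := by rw [sum_const, card_univ, Fintype.card_fin, nsmul_eq_mul]; ring

/-- The row sums are `σ j` times the entries of `M σ`, up to the diagonal term. Applying the
operator bound to the vector `σ` saves the factor `N` that Cauchy-Schwarz in each row would lose. -/
lemma sum_norm_sq_rowSum_offDiag_le (hσ : ∀ j, |σ j| ≤ s) (hMs : M.IsSymm)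
    (hM : ∀ v : Fin N → ℂ, ∑ j, ‖(M.mulVec v) j‖ ^ 2 ≤ κ ^ 2 * ∑ j, ‖v j‖ ^ 2) :
    ∑ j, ‖∑ k, offDiag σ M j k‖ ^ 2 ≤ 4 * (s ^ 4 * κ ^ 2 * N) := by
  have hσ2 : ∀ j, σ j ^ 2 ≤ s ^ 2 := fun j => by
    rw [← sq_abs]; exact pow_le_pow_left₀ (abs_nonneg _) (hσ j) 2
  have e1 : ∀ j, ∑ k, offDiag σ M j k =
      (σ j : ℂ) * ((M.mulVec fun k => (σ k : ℂ)) j - M j j * σ j) := by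
    intro j
    have h2 : ∀ k, offDiag σ M j k = (σ j : ℂ) * (M j k * σ k) -
        if j = k then (σ j : ℂ) * (M j j * σ j) else 0 := by
      intro k; simp only [offDiag, Matrix.of_apply]
      split_ifs with hjk
      · subst hjk; ring
      · push_cast; ring
    simp_rw [h2]
    rw [sum_sub_distrib, Finset.sum_ite_eq, if_pos (Finset.mem_univ j), ← mul_sum, mul_sub]; rfl
  have h3 : ∀ j, ‖∑ k, offDiag σ M j k‖ ^ 2 ≤
      2 * s ^ 2 * ‖(M.mulVec fun k => (σ k : ℂ)) j‖ ^ 2 + 2 * s ^ 2 * (κ ^ 2 * s ^ 2) := by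
    intro j
    have h4 : ‖M j j‖ ^ 2 ≤ κ ^ 2 :=
      (single_le_sum (f := fun k => ‖M j k‖ ^ 2) (fun k _ => by positivity)
        (Finset.mem_univ j)).trans (sum_norm_sq_row_le hMs hM j)
    rw [e1, norm_mul, mul_pow, norm_real, norm_eq_abs, sq_abs]
    have h5 : ‖(M.mulVec fun k => (σ k : ℂ)) j - M j j * σ j‖ ^ 2 ≤
        2 * ‖(M.mulVec fun k => (σ k : ℂ)) j‖ ^ 2 + 2 * (κ ^ 2 * s ^ 2) := by
      have h6 := norm_sub_le ((M.mulVec fun k => (σ k : ℂ)) j) (M j j * σ j)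
      have : ‖M j j * σ j‖ ^ 2 ≤ κ ^ 2 * s ^ 2 := by
        rw [norm_mul, mul_pow, norm_real, norm_eq_abs, sq_abs]
        exact mul_le_mul h4 (hσ2 j) (sq_nonneg _) (sq_nonneg _)
      have := pow_le_pow_left₀ (norm_nonneg _) h6 2
      nlinarith [sq_nonneg (‖(M.mulVec fun k => (σ k : ℂ)) j‖ - ‖M j j * σ j‖)]
    calc _ ≤ s ^ 2 * (2 * ‖(M.mulVec fun k => (σ k : ℂ)) j‖ ^ 2 + 2 * (κ ^ 2 * s ^ 2)) :=
          mul_le_mul (hσ2 j) h5 (by positivity) (by positivity)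
      _ = _ := by ring
  have : ∑ j, ‖(M.mulVec fun k => (σ k : ℂ)) j‖ ^ 2 ≤ κ ^ 2 * (s ^ 2 * N) := by
    refine (hM _).trans ?_
    gcongr
    calc _ ≤ ∑ _j : Fin N, s ^ 2 := by
          refine sum_le_sum fun j _ => ?_
          rw [norm_real, norm_eq_abs, sq_abs]; exact hσ2 j
      _ = _ := by rw [sum_const, card_univ, Fintype.card_fin, nsmul_eq_mul]; ring
  calc _ ≤ ∑ j, (2 * s ^ 2 * ‖(M.mulVec fun k => (σ k : ℂ)) j‖ ^ 2 + 2 * s ^ 2 * (κ ^ 2 * s ^ 2)) :=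
        sum_le_sum fun j _ => h3 j
    _ = 2 * s ^ 2 * ∑ j, ‖(M.mulVec fun k => (σ k : ℂ)) j‖ ^ 2 +
        2 * s ^ 2 * (κ ^ 2 * s ^ 2) * N := by
      rw [sum_add_distrib, ← mul_sum, sum_const, card_univ, Fintype.card_fin, nsmul_eq_mul]; ring
    _ ≤ 2 * s ^ 2 * (κ ^ 2 * (s ^ 2 * N)) + 2 * s ^ 2 * (κ ^ 2 * s ^ 2) * N := by gcongr
    _ = _ := by ring

/-- Second moment of an off-diagonal quadratic form in non-centred independent variables. -/
lemma integral_norm_sq_offDiag_le {g : ℝ → ℝ} {C V m : ℝ}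
    (hgm : Measurable g) (hgb : ∀ x, |g x| ≤ C) (hm : ∫ x, g x ∂ν = m) (hV : ∫ x, g x ^ 2 ∂ν ≤ V)
    (hσ : ∀ j, |σ j| ≤ s) (hMs : M.IsSymm)
    (hM : ∀ v : Fin N → ℂ, ∑ j, ‖(M.mulVec v) j‖ ^ 2 ≤ κ ^ 2 * ∑ j, ‖v j‖ ^ 2) :
    ∫ y, ‖∑ j, ∑ k, offDiag σ M j k * ((g (y j) : ℂ) * (g (y k) : ℂ))‖ ^ 2
        ∂(Measure.pi fun _ : Fin N => ν) ≤
      s ^ 4 * κ ^ 2 * (6 * V ^ 2 * N + 48 * V * (N * m ^ 2) + 12 * (N * m ^ 2) ^ 2) := by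
  set A := offDiag σ M with hA
  have hAs : A.IsSymm := isSymm_offDiag hMs
  set u : Fin N → ℂ := fun j => ∑ k, A j k with hu
  set f : ℝ → ℝ := fun x => g x - m with hf
  have hgi : Integrable g ν := integrable_of_bound hgm hgb
  have hg2i : Integrable (fun x => g x ^ 2) ν := by
    refine integrable_of_bound (C := C ^ 2) (hgm.pow_const 2) fun x => ?_
    rw [norm_pow]; exact pow_le_pow_left₀ (norm_nonneg _) (hgb x) 2
  have hfm : Measurable f := hgm.sub_const m
  have hfb : ∀ x, |f x| ≤ C + |m| := fun x => (abs_sub _ _).trans (by linarith [hgb x])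
  have hf0 : ∫ x, f x ∂ν = 0 := by rw [hf, integral_sub hgi (integrable_const _), hm]; simp
  have hfV : ∫ x, f x ^ 2 ∂ν ≤ V := by
    have e : ∀ x, f x ^ 2 = g x ^ 2 - 2 * m * g x + m ^ 2 := fun x => by simp only [hf]; ring
    simp_rw [e]
    have hi : Integrable (fun x => g x ^ 2 - 2 * m * g x) ν := hg2i.sub (hgi.const_mul _)
    rw [integral_add hi (integrable_const _),
      integral_sub hg2i (hgi.const_mul _), integral_const_mul, hm]
    simp only [integral_const, probReal_univ, one_smul]; nlinarith [sq_nonneg m]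
  have hf20 : 0 ≤ ∫ x, f x ^ 2 ∂ν := integral_nonneg fun x => sq_nonneg _
  have : 0 ≤ V := hf20.trans hfV
  -- Centring `g` splits the form into a quadratic, a linear and a constant part; symmetry of the
  -- matrix merges the two linear terms.
  have hdec : ∀ y : Fin N → ℝ, ∑ j, ∑ k, A j k * ((g (y j) : ℂ) * (g (y k) : ℂ)) =
      ∑ j, ∑ k, A j k * ((f (y j) : ℂ) * (f (y k) : ℂ)) +
        2 * m * (∑ j, u j * (f (y j) : ℂ)) + m ^ 2 * ∑ j, u j := by
    intro y
    have e1 : ∀ j k, A j k * ((g (y j) : ℂ) * (g (y k) : ℂ)) =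
        A j k * ((f (y j) : ℂ) * (f (y k) : ℂ)) + m * (A j k * f (y j)) + m * (A j k * f (y k)) +
          m ^ 2 * A j k := by
      intro j k; simp only [hf]; push_cast; ring
    have e2 : ∑ j, ∑ k, A j k * (f (y k) : ℂ) = ∑ j, u j * (f (y j) : ℂ) := by
      rw [sum_comm]
      refine sum_congr rfl fun k _ => ?_
      rw [hu, ← sum_mul]; congr 1; exact sum_congr rfl fun j _ => hAs.apply k j
    have e3 : ∑ j, ∑ k, A j k * (f (y j) : ℂ) = ∑ j, u j * (f (y j) : ℂ) :=
      sum_congr rfl fun j _ => by rw [hu, ← sum_mul]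
    simp_rw [e1, sum_add_distrib, ← mul_sum]; rw [e2, e3]; ring
  have hb1 := integral_norm_sq_quadratic_le (ν := ν) hfm hfb hf0 hAs
    (fun j => by simp [hA, offDiag])
  have hb2 := integral_norm_sq_linear_le (ν := ν) hfm hfb hf0 u
  have hA2 := sum_norm_sq_offDiag_le hσ hMs hM
  have hu2 := sum_norm_sq_rowSum_offDiag_le hσ hMs hM
  rw [← hA] at hA2 hu2
  change ∑ j, ‖u j‖ ^ 2 ≤ _ at hu2
  have : ‖∑ j, u j‖ ^ 2 ≤ N * (4 * (s ^ 4 * κ ^ 2 * N)) := by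
    calc ‖∑ j, u j‖ ^ 2 ≤ (∑ j, ‖u j‖) ^ 2 := by gcongr; exact norm_sum_le _ _
      _ ≤ (Finset.univ : Finset (Fin N)).card * ∑ j, ‖u j‖ ^ 2 := sq_sum_le_card_mul_sum_sq
      _ ≤ _ := by rw [card_univ, Fintype.card_fin]; gcongr
  set D := s ^ 4 * κ ^ 2
  have : 0 ≤ D := by positivity
  have hbd : ∀ x : ℝ, ‖(f x : ℂ)‖ ≤ C + |m| := fun x => by rw [norm_real]; exact hfb x
  have : 0 ≤ C + |m| := (abs_nonneg _).trans (hfb 0)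
  have hi1 : Integrable (fun y : Fin N → ℝ =>
      ‖∑ j, ∑ k, A j k * ((f (y j) : ℂ) * (f (y k) : ℂ))‖ ^ 2) (Measure.pi fun _ => ν) := by
    refine integrable_of_bound (C := (∑ j, ∑ k, ‖A j k‖ * ((C + |m|) * (C + |m|))) ^ 2) (by fun_prop) fun y => ?_
    rw [norm_pow, norm_norm]; gcongr
    refine (norm_sum_le _ _).trans (sum_le_sum fun j _ => (norm_sum_le _ _).trans
      (sum_le_sum fun k _ => ?_))
    rw [norm_mul, norm_mul]; gcongr <;> exact hbd _
  have hi2 : Integrable (fun y : Fin N → ℝ => ‖∑ j, u j * (f (y j) : ℂ)‖ ^ 2)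
      (Measure.pi fun _ => ν) := by
    refine integrable_of_bound (C := (∑ j, ‖u j‖ * (C + |m|)) ^ 2) (by fun_prop) fun y => ?_
    rw [norm_pow, norm_norm]; gcongr
    refine (norm_sum_le _ _).trans (sum_le_sum fun j _ => ?_)
    rw [norm_mul]; gcongr; exact hbd _
  calc _ ≤ ∫ y, (3 * ‖∑ j, ∑ k, A j k * ((f (y j) : ℂ) * (f (y k) : ℂ))‖ ^ 2 +
        12 * m ^ 2 * ‖∑ j, u j * (f (y j) : ℂ)‖ ^ 2 + 3 * m ^ 4 * ‖∑ j, u j‖ ^ 2)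
          ∂(Measure.pi fun _ : Fin N => ν) := by
        refine integral_mono_of_nonneg (.of_forall fun y => by positivity)
          (((hi1.const_mul _).add (hi2.const_mul _)).add (integrable_const _))
          (.of_forall fun y => ?_)
        simp only; rw [hdec y]
        set p := ∑ j, ∑ k, A j k * ((f (y j) : ℂ) * (f (y k) : ℂ))
        set q := ∑ j, u j * (f (y j) : ℂ)
        set r := ∑ j, u j
        have h1 := norm_add₃_le (a := p) (b := 2 * m * q) (c := m ^ 2 * r)
        have e1 : ‖2 * (m : ℂ) * q‖ = 2 * |m| * ‖q‖ := by
          rw [norm_mul, norm_mul, norm_real, norm_ofNat, norm_eq_abs]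
        have e2 : ‖(m : ℂ) ^ 2 * r‖ = m ^ 2 * ‖r‖ := by
          rw [norm_mul, norm_pow, norm_real, norm_eq_abs, sq_abs]
        rw [e1, e2] at h1
        have h2 := pow_le_pow_left₀ (norm_nonneg _) h1 2
        have h3 : (‖p‖ + 2 * |m| * ‖q‖ + m ^ 2 * ‖r‖) ^ 2 ≤
            3 * (‖p‖ ^ 2 + (2 * |m| * ‖q‖) ^ 2 + (m ^ 2 * ‖r‖) ^ 2) := by
          nlinarith [sq_nonneg (‖p‖ - 2 * |m| * ‖q‖), sq_nonneg (‖p‖ - m ^ 2 * ‖r‖),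
            sq_nonneg (2 * |m| * ‖q‖ - m ^ 2 * ‖r‖)]
        have h4 : (2 * |m| * ‖q‖) ^ 2 = 4 * m ^ 2 * ‖q‖ ^ 2 := by
          rw [mul_pow, mul_pow, sq_abs]; ring
        rw [h4] at h3
        calc _ ≤ _ := h2
          _ ≤ _ := h3
          _ = _ := by ring
    _ = 3 * ∫ y, ‖∑ j, ∑ k, A j k * ((f (y j) : ℂ) * (f (y k) : ℂ))‖ ^ 2
          ∂(Measure.pi fun _ : Fin N => ν) +
        12 * m ^ 2 * ∫ y, ‖∑ j, u j * (f (y j) : ℂ)‖ ^ 2 ∂(Measure.pi fun _ : Fin N => ν) +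
        3 * m ^ 4 * ‖∑ j, u j‖ ^ 2 := by
        rw [integral_add ((hi1.const_mul _).fun_add (hi2.const_mul _)) (integrable_const _),
          integral_add (hi1.const_mul _) (hi2.const_mul _), integral_const_mul, integral_const_mul]
        simp
    _ ≤ 3 * (2 * V ^ 2 * (D * N)) + 12 * m ^ 2 * (V * (4 * (D * N))) +
        3 * m ^ 4 * (N * (4 * (D * N))) := by
        gcongr
        · exact hb1.trans (by gcongr)
        · exact hb2.trans (by gcongr)
    _ = _ := by ring

end Bounds

omit [IsProbabilityMeasure ν] in
lemma IsTailLimit.eventually_exists_level (h : IsTailLimit α ν a)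
    (hα0 : 0 < α) {η : ℝ} (hη : 0 < η) :
    ∃ B : ℝ, 0 < B ∧ ∀ᶠ N : ℕ in atTop, (N : ℝ) * ν.real {x | B * a N ≤ |x|} ≤ η := by
  obtain ⟨B, hB0, hBη⟩ : ∃ B : ℝ, 0 < B ∧ B ^ (-α) < η :=
    ((eventually_gt_atTop 0).and ((tendsto_rpow_neg_atTop hα0).eventually (gt_mem_nhds hη))).exists
  exact ⟨B, hB0, ((h.tendsto B hB0).eventually (gt_mem_nhds hBη)).mono fun N hN => le_of_lt hN⟩

/-- The off-diagonal part of the quadratic form of a heavy-tailed row is negligible. -/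
lemma IsTailLimit.eventually_integral_offDiag_le (h : IsTailLimit α ν a)
    (hα0 : 0 < α) (s κ : ℝ) {η : ℝ} (hη : 0 < η) :
    ∀ᶠ N : ℕ in atTop, ∀ (σ : Fin N → ℝ) (M : Matrix (Fin N) (Fin N) ℂ), (∀ j, |σ j| ≤ s) →
      M.IsSymm → (∀ v : Fin N → ℂ, ∑ j, ‖(M.mulVec v) j‖ ^ 2 ≤ κ ^ 2 * ∑ j, ‖v j‖ ^ 2) →
      ∫ y, min 1 ‖∑ j, ∑ k, (((a N)⁻¹ * (σ j * y j) * ((a N)⁻¹ * (σ k * y k)) : ℝ) : ℂ) * M j k -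
        ∑ j, ((((a N)⁻¹ * (σ j * y j)) ^ 2 : ℝ) : ℂ) * M j j‖
        ∂(Measure.pi fun _ : Fin N => ν) ≤ η := by
  -- By the union bound, all `N` coordinates stay below `B a_N` except on an event of probability at
  -- most `η / 2`, where the minimum with `1` is used.
  obtain ⟨B, hB0, hB⟩ := h.eventually_exists_level hα0 (show 0 < η / 2 by positivity)
  obtain ⟨C, hC0, hC⟩ := h.exists_truncated_moments hB0
  set D := s ^ 4 * κ ^ 2
  have hD0 : 0 ≤ D := by positivity
  -- Here `δ` bounds `N m²`. Since `δ ≤ 1`, its square is again at most `δ`; the second entry makes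
  -- `12 D δ ≤ η² / 32`.
  set δ := min 1 (η ^ 2 / (384 * (D + 1)))
  have hδ0 : 0 < δ := by positivity
  have hδ1 : δ ≤ 1 := min_le_left _ _
  have hδ2 : 12 * D * δ ≤ η ^ 2 / 32 := by
    have h1 : δ ≤ η ^ 2 / (384 * (D + 1)) := min_le_right _ _
    rw [le_div_iff₀ (by positivity)] at h1; nlinarith
  filter_upwards [h.pos, hB, hC δ hδ0, eventually_gt_atTop 0, tendsto_natCast_atTop_atTop.eventually
      (eventually_ge_atTop (32 * (D * (6 * C ^ 2 + 48 * C)) / η ^ 2))]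
    with N ha hBN hCN hN0 hNbig σ M hσ hMs hM
  obtain ⟨hV, hm⟩ := hCN
  have hN0' : (0 : ℝ) < N := by exact_mod_cast hN0
  set t := truncated (a N) B with ht
  have htm : Measurable t := measurable_truncated _ _
  have htb : ∀ x, |t x| ≤ B := fun x => (abs_truncated_le ha hB0 x).trans (min_le_right _ _)
  have h2 := integral_norm_sq_offDiag_le (ν := ν) htm htb rfl hV hσ hMs hM
  set m := ∫ x, t x ∂ν
  set F : (Fin N → ℝ) → ℂ := fun y => ∑ j, ∑ k, offDiag σ M j k * ((t (y j) : ℂ) * (t (y k) : ℂ))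
    with hF
  have hFm : Measurable F := by simp only [hF]; fun_prop
  have hsmall : ∫ y, ‖F y‖ ^ 2 ∂(Measure.pi fun _ : Fin N => ν) ≤ η ^ 2 / 16 := by
    refine h2.trans ?_
    set x := (N : ℝ) * m ^ 2
    have hx0 : 0 ≤ x := by positivity
    have h3 : 6 * (C / N) ^ 2 * N + 48 * (C / N) * x + 12 * x ^ 2 ≤
        (6 * C ^ 2 + 48 * C) / N + 12 * δ := by
      have e1 : 6 * (C / N) ^ 2 * N = 6 * C ^ 2 / N := by field_simp
      have e2 : 48 * (C / N) * x ≤ 48 * C / N := by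
        rw [show 48 * C / (N : ℝ) = 48 * (C / N) * 1 by ring]; gcongr; linarith
      have e3 : 12 * x ^ 2 ≤ 12 * δ := by nlinarith
      rw [e1, add_div]; linarith
    have h4 : D * ((6 * C ^ 2 + 48 * C) / N) ≤ η ^ 2 / 32 := by
      rw [mul_div_assoc', div_le_iff₀ hN0']; rw [div_le_iff₀ (by positivity)] at hNbig
      linarith
    calc _ ≤ D * ((6 * C ^ 2 + 48 * C) / N + 12 * δ) := by gcongr
      _ = D * ((6 * C ^ 2 + 48 * C) / N) + 12 * D * δ := by ring
      _ ≤ _ := by linarith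
  set Bad : Fin N → Set (Fin N → ℝ) := fun j => {y | B * a N ≤ |y j|}
  have hBadm : ∀ j, MeasurableSet (Bad j) := fun j => measurableSet_le (by fun_prop) (by fun_prop)
  have hBadp : ∀ j, (Measure.pi fun _ : Fin N => ν).real (Bad j) = ν.real {x | B * a N ≤ |x|} := by
    intro j
    have hms : MeasurableSet {x : ℝ | B * a N ≤ |x|} := measurableSet_le (by fun_prop) (by fun_prop)
    exact (measurePreserving_eval (fun _ : Fin N => ν) j).measureReal_preimage hms.nullMeasurableSet
  have hFi : Integrable (fun y => ‖F y‖ ^ 2) (Measure.pi fun _ : Fin N => ν) := by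
    refine integrable_of_bound (C := (∑ j, ∑ k, ‖offDiag σ M j k‖ * (B * B)) ^ 2) (hFm.norm.pow_const 2) fun y => ?_
    rw [norm_pow, norm_norm]; gcongr
    refine (norm_sum_le _ _).trans (sum_le_sum fun j _ => (norm_sum_le _ _).trans
      (sum_le_sum fun k _ => ?_))
    rw [norm_mul, norm_mul, norm_real, norm_real]; gcongr <;> exact htb _
  have hindi : ∀ j, Integrable ((Bad j).indicator fun _ => (1 : ℝ))
      (Measure.pi fun _ : Fin N => ν) := fun j => (integrable_const _).indicator (hBadm j)
  calc _ ≤ ∫ y, ((∑ j, (Bad j).indicator (fun _ => (1 : ℝ)) y) + (η / 4 + 4 / η * ‖F y‖ ^ 2))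
          ∂(Measure.pi fun _ : Fin N => ν) := by
        refine integral_mono_of_nonneg (.of_forall fun y => by positivity)
          ((integrable_finsetSum _ fun j _ => hindi j).add
            ((integrable_const _).add (hFi.const_mul _))) (.of_forall fun y => ?_)
        simp only
        have hpos : 0 ≤ η / 4 + 4 / η * ‖F y‖ ^ 2 := by positivity
        by_cases hy : ∃ j, y ∈ Bad j
        · obtain ⟨j, hj⟩ := hy
          have h5 : 1 ≤ ∑ j, (Bad j).indicator (fun _ => (1 : ℝ)) y := by
            have h6 := single_le_sum (f := fun j => (Bad j).indicator (fun _ => (1 : ℝ)) y)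
              (fun k _ => indicator_nonneg (fun _ _ => zero_le_one) _) (Finset.mem_univ j)
            simpa [indicator_of_mem hj] using h6
          exact (min_le_left _ _).trans (by linarith)
        · push Not at hy
          have hty : ∀ j, (a N)⁻¹ * y j = t (y j) := fun j => by
            have : |y j| < B * a N := not_le.1 (hy j)
            simp only [ht, truncated, if_pos this]
          have hFy : ∑ j, ∑ k, (((a N)⁻¹ * (σ j * y j) * ((a N)⁻¹ * (σ k * y k)) : ℝ) : ℂ) * M j k -
              ∑ j, ((((a N)⁻¹ * (σ j * y j)) ^ 2 : ℝ) : ℂ) * M j j = F y := by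
            rw [hF, ← sum_sub_distrib]
            refine sum_congr rfl fun j _ => ?_
            have e : ∀ k, offDiag σ M j k * ((t (y j) : ℂ) * (t (y k) : ℂ)) =
                (((a N)⁻¹ * (σ j * y j) * ((a N)⁻¹ * (σ k * y k)) : ℝ) : ℂ) * M j k -
                if j = k then ((((a N)⁻¹ * (σ j * y j)) ^ 2 : ℝ) : ℂ) * M j j else 0 := by
              intro k; rw [← hty j, ← hty k]; simp only [offDiag, Matrix.of_apply]
              split_ifs with hjk
              · subst hjk; push_cast; ring
              · push_cast; ring
            simp_rw [e]
            rw [sum_sub_distrib, Finset.sum_ite_eq, if_pos (Finset.mem_univ j)]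
          rw [hFy]
          have h5 : 0 ≤ ∑ j, (Bad j).indicator (fun _ => (1 : ℝ)) y :=
            sum_nonneg fun k _ => indicator_nonneg (fun _ _ => zero_le_one) _
          -- This quadratic inequality replaces Cauchy-Schwarz in passing from the second moment to
          -- the first.
          have h6 : ‖F y‖ ≤ η / 4 + 4 / η * ‖F y‖ ^ 2 := by
            have e : η / 4 + 4 / η * ‖F y‖ ^ 2 - ‖F y‖ =
                (4 / η) * ((‖F y‖ - η / 8) ^ 2 + 3 * η ^ 2 / 64) := by
              field_simp; ring
            have : 0 ≤ (4 / η) * ((‖F y‖ - η / 8) ^ 2 + 3 * η ^ 2 / 64) := by positivity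
            linarith
          exact (min_le_right _ _).trans (by linarith)
    _ = N * ν.real {x | B * a N ≤ |x|} +
        (η / 4 + 4 / η * ∫ y, ‖F y‖ ^ 2 ∂(Measure.pi fun _ : Fin N => ν)) := by
        rw [integral_add (integrable_finsetSum _ fun j _ => hindi j)
          ((integrable_const _).fun_add (hFi.const_mul _)),
          integral_add (integrable_const _) (hFi.const_mul _), integral_const_mul,
          integral_finsetSum _ fun j _ => hindi j]
        congr 1
        · simp_rw [fun j => integral_indicator (μ := Measure.pi fun _ : Fin N => ν)
            (f := fun _ => (1 : ℝ)) (hBadm j), setIntegral_const, hBadp, smul_eq_mul, mul_one]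
          rw [sum_const, card_univ, Fintype.card_fin, nsmul_eq_mul]
        · simp
    _ ≤ η / 2 + (η / 4 + 4 / η * (η ^ 2 / 16)) := by gcongr
    _ = η := by field_simp; ring

/-- Beyond `δ a_N` the tail has mass `O(1 / N)`, and below it the entry is at most `|s| δ ≤ η / 2`.
-/
lemma IsTailLimit.eventually_integral_entry_le (h : IsTailLimit α ν a)
    (s : ℝ) {η : ℝ} (hη : 0 < η) :
    ∀ᶠ N : ℕ in atTop, ∀ r : ℝ, |r| ≤ s → ∫ x, min 1 |(a N)⁻¹ * (r * x)| ∂ν ≤ η := by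
  set δ := η / (2 * (|s| + 1)) with hδ
  have hδ0 : 0 < δ := by positivity
  have hlim : Tendsto (fun N : ℕ => ν.real {x | δ * a N ≤ |x|}) atTop (𝓝 0) := by
    have h1 := (h.tendsto δ hδ0).mul tendsto_inv_atTop_nhds_zero_nat
    rw [mul_zero] at h1
    refine h1.congr' ?_
    filter_upwards [eventually_gt_atTop 0] with N hN
    have : (N : ℝ) ≠ 0 := by exact_mod_cast hN.ne'
    field_simp
  filter_upwards [h.pos, hlim.eventually (gt_mem_nhds (show 0 < η / 2 by positivity))]
    with N ha hN r hr
  have hms : MeasurableSet {x : ℝ | δ * a N ≤ |x|} := measurableSet_le (by fun_prop) (by fun_prop)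
  have hi : Integrable ({x : ℝ | δ * a N ≤ |x|}.indicator fun _ => (1 : ℝ)) ν :=
    (integrable_const _).indicator hms
  calc _ ≤ ∫ x, ({x : ℝ | δ * a N ≤ |x|}.indicator (fun _ => (1 : ℝ)) x + η / 2) ∂ν := by
        refine integral_mono_of_nonneg (.of_forall fun y => by positivity)
          (hi.add (integrable_const _)) (.of_forall fun x => ?_)
        by_cases hx : δ * a N ≤ |x|
        · simp only [indicator_of_mem (show x ∈ {x : ℝ | δ * a N ≤ |x|} from hx)]
          exact (min_le_left _ _).trans (by linarith)
        · simp only [indicator_of_notMem (show x ∉ {x : ℝ | δ * a N ≤ |x|} from hx)]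
          refine (min_le_right _ _).trans ?_
          push Not at hx
          have h1 : |(a N)⁻¹ * (r * x)| ≤ |s| * δ := by
            rw [abs_mul, abs_mul, abs_inv, abs_of_pos ha, inv_mul_le_iff₀ ha]
            calc |r| * |x| ≤ |s| * (δ * a N) :=
                  mul_le_mul (hr.trans (le_abs_self s)) hx.le (abs_nonneg _) (abs_nonneg _)
              _ = _ := by ring
          have : |s| * δ ≤ η / 2 := by
            rw [hδ, mul_div_assoc', div_le_div_iff₀ (by positivity) (by positivity)]
            nlinarith [abs_nonneg s]
          linarith
    _ = ν.real {x | δ * a N ≤ |x|} + η / 2 := by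
        rw [integral_add hi (integrable_const _), integral_indicator hms]; simp
    _ ≤ η := by linarith

end QuadraticForm

/-! ### Cones -/

section Cone

variable {γ : ℝ}

lemma mem_cone_of_arg {u : ℂ} (h : |u.arg| ≤ γ * π / 2) : u ∈ cone γ :=
  ⟨‖u‖, u.arg, norm_nonneg _, h, (Complex.norm_mul_exp_arg_mul_I u).symm⟩

lemma re_mul_exp (R θ φ : ℝ) : ((R : ℂ) * exp (θ * I) * exp (φ * I)).re = R * cos (θ + φ) := by
  rw [mul_assoc, ← exp_add, ← add_mul, ← ofReal_add, re_ofReal_mul, exp_ofReal_mul_I_re]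

/-- A cone of opening less than `π` is an intersection of two half-planes. -/
lemma mem_cone_iff (hγ0 : 0 < γ) (hγ1 : γ ≤ 1) {u : ℂ} :
    u ∈ cone γ ↔ 0 ≤ (u * exp (((1 - γ) * π / 2 : ℝ) * I)).re ∧
      0 ≤ (u * exp ((-((1 - γ) * π / 2) : ℝ) * I)).re := by
  have hpi := pi_pos
  set φ := (1 - γ) * π / 2 with hφ
  have : 0 ≤ φ := div_nonneg (mul_nonneg (by linarith) hpi.le) two_pos.le
  have : φ < π / 2 := by rw [hφ]; nlinarith
  have hγφ : γ * π / 2 = π / 2 - φ := by rw [hφ]; ring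
  constructor
  · rintro ⟨R, θ, hR, hθ, rfl⟩; rw [hγφ, abs_le] at hθ; rw [re_mul_exp, re_mul_exp]
    exact ⟨mul_nonneg hR (Real.cos_nonneg_of_mem_Icc ⟨by linarith, by linarith⟩),
      mul_nonneg hR (Real.cos_nonneg_of_mem_Icc ⟨by linarith, by linarith⟩)⟩
  · rintro ⟨h1, h2⟩
    rcases eq_or_ne u 0 with rfl | hu
    · exact ⟨0, 0, le_rfl, by rw [abs_zero]; positivity, by simp⟩
    have hu0 : 0 < ‖u‖ := norm_pos_iff.2 hu
    rw [← Complex.norm_mul_exp_arg_mul_I u, re_mul_exp] at h1 h2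
    have h1' := nonneg_of_mul_nonneg_right h1 hu0
    have h2' := nonneg_of_mul_nonneg_right h2 hu0
    refine mem_cone_of_arg ?_
    rw [hγφ, abs_le]
    have := Complex.neg_pi_lt_arg u
    have := Complex.arg_le_pi u
    constructor
    · by_contra hlt
      push Not at hlt; rw [← Real.cos_neg] at h2'
      exact absurd (Real.cos_neg_of_pi_div_two_lt_of_lt (x := -(u.arg + -φ)) (by linarith)
        (by linarith)) (not_lt.2 h2')
    · by_contra hlt
      push Not at hlt
      exact absurd (Real.cos_neg_of_pi_div_two_lt_of_lt (x := u.arg + φ) (by linarith)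
        (by linarith)) (not_lt.2 h1')

lemma isClosed_cone (hγ0 : 0 < γ) (hγ1 : γ ≤ 1) : IsClosed (cone γ) := by
  have : cone γ = {u | 0 ≤ (u * exp (((1 - γ) * π / 2 : ℝ) * I)).re} ∩
      {u | 0 ≤ (u * exp ((-((1 - γ) * π / 2) : ℝ) * I)).re} := by
    ext u; exact mem_cone_iff hγ0 hγ1
  rw [this]
  exact (isClosed_le continuous_const (by fun_prop)).inter
    (isClosed_le continuous_const (by fun_prop))

/-- Each of the two half-planes of `mem_cone_iff` is a linear condition, which integration
preserves. -/
lemma integral_mem_cone (hγ0 : 0 < γ) (hγ1 : γ ≤ 1) {T : Type*} [MeasurableSpace T] {μ : Measure T}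
    {f : T → ℂ} (hi : Integrable f μ) (hf : ∀ᵐ t ∂μ, f t ∈ cone γ) : ∫ t, f t ∂μ ∈ cone γ := by
  have key : ∀ c : ℂ, (∀ᵐ t ∂μ, 0 ≤ (f t * c).re) → 0 ≤ ((∫ t, f t ∂μ) * c).re := by
    intro c hc
    have h1 : ((∫ t, f t ∂μ) * c).re = ∫ t, (f t * c).re ∂μ := by
      rw [← integral_mul_const]; exact (integral_re (hi.mul_const c)).symm
    rw [h1]; exact integral_nonneg_of_ae hc
  rw [mem_cone_iff hγ0 hγ1]
  exact ⟨key _ (hf.mono fun t ht => ((mem_cone_iff hγ0 hγ1).1 ht).1),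
    key _ (hf.mono fun t ht => ((mem_cone_iff hγ0 hγ1).1 ht).2)⟩

lemma ofReal_mul_mem_cone {r : ℝ} (hr : 0 ≤ r) {u : ℂ} (hu : u ∈ cone γ) : (r : ℂ) * u ∈ cone γ := by
  obtain ⟨R, θ, hR, hθ, rfl⟩ := hu
  exact ⟨r * R, θ, by positivity, hθ, by push_cast; ring⟩

lemma mul_mem_cone {γ' : ℝ} {u v : ℂ} (hu : u ∈ cone γ) (hv : v ∈ cone γ') :
    u * v ∈ cone (γ + γ') := by
  obtain ⟨R, θ, hR, hθ, rfl⟩ := hu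
  obtain ⟨R', θ', hR', hθ', rfl⟩ := hv
  refine ⟨R * R', θ + θ', by positivity, (abs_add_le _ _).trans (by linarith), ?_⟩
  rw [ofReal_add, add_mul, exp_add]; push_cast; ring

lemma zero_mem_cone (hγ0 : 0 ≤ γ) : (0 : ℂ) ∈ cone γ :=
  ⟨0, 0, le_rfl, by rw [abs_zero]; positivity, by simp⟩

lemma re_nonneg_of_mem_cone (hγ1 : γ ≤ 1) {u : ℂ} (hu : u ∈ cone γ) : 0 ≤ u.re := by
  obtain ⟨R, θ, hR, hθ, rfl⟩ := hu
  rw [re_ofReal_mul, exp_ofReal_mul_I_re]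
  have := pi_pos
  rw [abs_le] at hθ
  exact mul_nonneg hR (Real.cos_nonneg_of_mem_Icc ⟨by nlinarith, by nlinarith⟩)

lemma cpow_mem_cone {w : ℂ} (hw : 0 < w.re) {p : ℝ} (hp : |p| ≤ γ) : w ^ (p : ℂ) ∈ cone γ := by
  have hw0 : w ≠ 0 := fun h => by simp [h] at hw
  refine ⟨‖w‖ ^ p, w.arg * p, by positivity, ?_, ?_⟩
  · rw [abs_mul]
    have := Complex.abs_arg_le_pi_div_two_iff.2 hw.le
    have := pi_pos
    calc |w.arg| * |p| ≤ π / 2 * γ := by gcongr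
      _ = _ := by ring
  · have hn : 0 < ‖w‖ := norm_pos_iff.2 hw0
    rw [cpow_def_of_ne_zero hw0, Complex.log, Real.rpow_def_of_pos hn, ofReal_exp, ← exp_add]
    congr 1; push_cast; ring

/-- The interior points of the cone of opening `β π` are the powers `w ^ β` with `0 < Re w`. -/
lemma exists_cpow_eq {β R θ : ℝ} (hβ0 : 0 < β) (hR : 0 < R) (hθ : |θ| < β * π / 2) :
    ∃ w : ℂ, 0 < w.re ∧ w ^ (β : ℂ) = R * exp (θ * I) := by
  have := pi_pos
  set l : ℂ := ((Real.log R / β : ℝ) : ℂ) + ((θ / β : ℝ) : ℂ) * I with hl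
  have him : l.im = θ / β := by simp [hl]
  have habs : |θ / β| < π / 2 := by rw [abs_div, abs_of_pos hβ0, div_lt_iff₀ hβ0]; linarith
  rw [abs_lt] at habs
  have hlog : Complex.log (exp l) = l := log_exp (by rw [him]; linarith) (by rw [him]; linarith)
  refine ⟨exp l, ?_, ?_⟩
  · rw [Complex.exp_re, him]
    exact mul_pos (Real.exp_pos _) (Real.cos_pos_of_mem_Ioo ⟨habs.1, habs.2⟩)
  · rw [cpow_def_of_ne_zero (Complex.exp_ne_zero _), hlog]
    have : (β : ℂ) ≠ 0 := by exact_mod_cast hβ0.ne'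
    have e : l * β = (Real.log R : ℂ) + θ * I := by rw [hl]; push_cast; field_simp
    rw [e, exp_add, ← ofReal_exp, Real.exp_log hR]

end Cone

/-! ### A heavy-tailed law -/

/-- The Pareto law of index `α`. -/
def powerLaw (α : ℝ) : Measure ℝ := unitMeasure.map fun t => t ^ (-(1 / α))

instance : IsProbabilityMeasure Λ := ⟨by simp⟩

instance (α : ℝ) : IsProbabilityMeasure (powerLaw α) :=
  Measure.isProbabilityMeasure_map (by fun_prop)

/-- The slowly varying factor in the tail of the Pareto law. -/
def powerLawFactor (α u : ℝ) : ℝ := min 1 (u ^ (-α)) * u ^ α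

lemma slowlyVarying_powerLawFactor {α : ℝ} (hα0 : 0 < α) : SlowlyVarying (powerLawFactor α) := by
  have h1 : ∀ u : ℝ, 1 ≤ u → powerLawFactor α u = 1 := fun u hu => by
    have hu0 : 0 < u := by linarith
    rw [powerLawFactor, min_eq_right (Real.rpow_le_one_of_one_le_of_nonpos hu (by linarith)),
      ← rpow_add hu0, neg_add_cancel, rpow_zero]
  refine ⟨by unfold powerLawFactor; fun_prop, ?_, fun c hc => ?_⟩
  · filter_upwards [eventually_ge_atTop 1] with u hu
    rw [h1 u hu]; exact one_pos
  · refine tendsto_const_nhds.congr' ?_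
    filter_upwards [eventually_ge_atTop 1, eventually_ge_atTop (1 / c)] with u hu hu'
    rw [h1 u hu, h1, div_one]
    rwa [div_le_iff₀ hc, mul_comm] at hu'

lemma powerLaw_tail {α : ℝ} (hα0 : 0 < α) {u : ℝ} (hu : 0 < u) :
    (powerLaw α).real {x | u ≤ |x|} = powerLawFactor α u * u ^ (-α) := by
  have hms : MeasurableSet {x : ℝ | u ≤ |x|} := measurableSet_le (by fun_prop) (by fun_prop)
  have : 0 < u ^ (-α) := by positivity
  have hset : (fun t : ℝ => t ^ (-(1 / α))) ⁻¹' {x | u ≤ |x|} ∩ Ioc 0 1 =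
      Ioc 0 (min 1 (u ^ (-α))) := by
    ext t
    simp only [mem_inter_iff, mem_preimage, mem_ofPred_eq, mem_Ioc, le_min_iff]; constructor
    · rintro ⟨h1, h2, h3⟩; rw [abs_of_pos (by positivity)] at h1
      refine ⟨h2, h3, ?_⟩
      have h4 := rpow_le_rpow_of_nonpos hu h1 (neg_nonpos.2 hα0.le)
      rwa [← rpow_mul h2.le, show -(1 / α) * -α = 1 by field_simp, rpow_one] at h4
    · rintro ⟨h2, h3, h4⟩
      refine ⟨?_, h2, h3⟩
      rw [abs_of_pos (by positivity)]
      have h5 := rpow_le_rpow_of_nonpos h2 h4 (show -(1 / α) ≤ 0 by rw [neg_nonpos]; positivity)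
      rwa [← rpow_mul hu.le, show -α * -(1 / α) = 1 by field_simp, rpow_one] at h5
  rw [powerLaw, map_measureReal_apply (by fun_prop) hms, measureReal_restrict_apply
    (hms.preimage (by fun_prop)), hset, powerLawFactor, mul_assoc, ← rpow_add hu,
    add_neg_cancel, rpow_zero, mul_one, Real.volume_real_Ioc_of_le (by positivity), sub_zero]

/-- Supplies one random model for deterministic conclusions: the invariance of the cone, the
existence of the limiting measure, and the independence of its transform from the chosen kernel. -/
lemma exists_isTailLimit {α : ℝ} (hα0 : 0 < α) (hα2 : α < 2) :
    ∃ a : ℕ → ℝ, IsTailLimit α (powerLaw α) a :=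
  ⟨_, isTailLimit_of_slowlyVarying hα0 hα2 _ (slowlyVarying_powerLawFactor hα0)
    fun _ hu => powerLaw_tail hα0 hu⟩

/-! ### Invariance of the cone -/

/-- A power `V^(-β)` with `Re V > 0` has argument at most `βπ/2` in absolute value, and the cone is
convex. -/
lemma integral_row_mem_cone {ν : Measure ℝ} [IsProbabilityMeasure ν] {β : ℝ} (hβ0 : 0 < β)
    (hβ1 : β < 1) {ζ : ℂ} (hζ : 0 < ζ.re) {N : ℕ} (c : ℝ) (σ : Fin N → ℝ) {w : Fin N → ℂ}
    (hw : ∀ j, 0 < (w j).re) : ∫ y, (ζ + ∑ j, (((c * (σ j * y j)) ^ 2 : ℝ) : ℂ) * w j) ^ (-β : ℂ)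
        ∂(Measure.pi fun _ : Fin N => ν) ∈ cone β := by
  have hre : ∀ y : Fin N → ℝ, ζ.re ≤ (ζ + ∑ j, (((c * (σ j * y j)) ^ 2 : ℝ) : ℂ) * w j).re := by
    intro y; rw [add_re, re_sum, le_add_iff_nonneg_right]
    refine sum_nonneg fun j _ => ?_
    rw [re_ofReal_mul]; exact mul_nonneg (by positivity) (hw j).le
  rw [← ofReal_neg]
  refine integral_mem_cone hβ0 hβ1.le ?_ (.of_forall fun y =>
    cpow_mem_cone (hζ.trans_le (hre y)) (by rw [abs_neg, abs_of_pos hβ0]))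
  refine integrable_of_bound (C := ζ.re ^ (-β)) (by fun_prop) fun y => ?_
  rw [norm_cpow_real]
  exact rpow_le_rpow_of_nonpos hζ ((hre y).trans (re_le_norm _)) (by linarith)

/-- A row with profile `1` and constant field `w` has `rowField` equal to `Γ(1 - β) w^β`. The
integral is therefore the limit of `Γ(β)` times the expectations in `integral_row_mem_cone`. -/
lemma lapInt_cpow_mem_cone {β : ℝ} (hβ0 : 0 < β) (hβ1 : β < 1) {ζ w : ℂ} (hζ : 0 < ζ.re)
    (hw : 0 < w.re) : lapInt β β ζ ((Gamma (1 - β) : ℝ) * w ^ (β : ℂ)) ∈ cone β := by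
  have hα0 : 0 < 2 * β := by linarith
  have hα2 : 2 * β < 2 := by linarith
  obtain ⟨a, ha⟩ := exists_isTailLimit hα0 hα2
  have e2 : 2 * β / 2 = β := by ring
  have hΓ : 0 < Gamma β := Gamma_pos_of_pos hβ0
  set X := (Gamma (1 - β) : ℝ) * w ^ (β : ℂ) with hX
  have hrow : ∀ N : ℕ, 0 < N → rowField (2 * β) (fun _ : Fin N => 1) (fun _ => w) = X := by
    intro N hN
    have : (N : ℂ) ≠ 0 := by exact_mod_cast hN.ne'
    rw [rowField, e2, abs_one, one_rpow, ofReal_one, one_mul, sum_const,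
      card_univ, Fintype.card_fin, nsmul_eq_mul, hX]
    push_cast; field_simp
  have hlim : Tendsto (fun N : ℕ => ((Gamma β : ℝ) : ℂ) *
      ∫ y, (ζ + ∑ j, ((((a N)⁻¹ * (1 * y j)) ^ 2 : ℝ) : ℂ) * w) ^ (-β : ℂ)
        ∂(Measure.pi fun _ : Fin N => powerLaw (2 * β))) atTop (𝓝 (lapInt β β ζ X)) := by
    rw [Metric.tendsto_nhds]; intro ε hε
    have h1 := ha.eventually_norm_integral_row_sub_le hα0 hα2 hβ0 hζ 1 ‖w‖
      (show 0 < ε / (2 * Gamma β) by positivity)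
    filter_upwards [h1, eventually_gt_atTop 0] with N hN hN0
    have h2 := hN (fun _ => 1) (fun _ => w) (fun _ => by simp) (fun _ => hw) (fun _ => le_rfl)
    rw [hrow N hN0, e2] at h2
    set E := ∫ y, (ζ + ∑ j, ((((a N)⁻¹ * (1 * y j)) ^ 2 : ℝ) : ℂ) * w) ^ (-β : ℂ)
        ∂(Measure.pi fun _ : Fin N => powerLaw (2 * β))
    have e : ((Gamma β : ℝ) : ℂ) * E - lapInt β β ζ X =
        ((Gamma β : ℝ) : ℂ) * (E - ((Gamma β)⁻¹ : ℝ) * lapInt β β ζ X) := by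
      have : (Gamma β : ℂ) ≠ 0 := by exact_mod_cast hΓ.ne'
      push_cast; field_simp
    rw [dist_eq_norm, e, norm_ofReal_mul hΓ.le]
    calc _ ≤ Gamma β * (ε / (2 * Gamma β)) := by gcongr
      _ = ε / 2 := by field_simp
      _ < ε := by linarith
  refine (isClosed_cone hβ0 hβ1.le).mem_of_tendsto hlim (.of_forall fun N => ?_)
  exact ofReal_mul_mem_cone hΓ.le (integral_row_mem_cone hβ0 hβ1 hζ _ (fun _ => 1) fun _ => hw)

/-- The integral `∫ t^(β-1) exp(-ζ t - t^β X) dt` stays in the cone `|arg| ≤ β π / 2`. -/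
lemma lapInt_mem_cone {β : ℝ} (hβ0 : 0 < β) (hβ1 : β < 1) {ζ X : ℂ} (hζ : 0 < ζ.re)
    (hX : X ∈ cone β) : lapInt β β ζ X ∈ cone β := by
  obtain ⟨R, θ, hR, hθ, rfl⟩ := hX
  have hc : 0 < Gamma (1 - β) := Gamma_pos_of_pos (by linarith)
  set u : ℕ → ℝ := fun n => 1 / ((n : ℝ) + 1) with hu
  have hu0 : ∀ n, 0 < u n := fun n => by positivity
  have hu1 : ∀ n, u n ≤ 1 := fun n => by
    simp only [hu]; rw [div_le_one (by positivity)]; linarith [n.cast_nonneg (α := ℝ)]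
  have hulim : Tendsto u atTop (𝓝 0) := tendsto_one_div_add_atTop_nhds_zero_nat
  -- Enlarging the radius and shrinking the angle gives points of the open cone, to which
  -- `exists_cpow_eq` applies even if `R = 0` or `X` is on the boundary.
  have hlim : Tendsto (fun n => (((R + u n : ℝ) : ℂ) * exp (((θ * (1 - u n) : ℝ) : ℂ) * I))) atTop
      (𝓝 ((R : ℂ) * exp (θ * I))) := by
    have hcont : Continuous fun x : ℝ => (((R + x : ℝ) : ℂ) *
      exp (((θ * (1 - x) : ℝ) : ℂ) * I)) := by fun_prop
    have := (hcont.tendsto 0).comp hulim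
    simp only [add_zero, sub_zero, mul_one] at this; exact this
  refine (isClosed_cone hβ0 hβ1.le).mem_of_tendsto
    (((continuous_lapInt hβ0 hβ1 hβ0 hζ).tendsto _).comp hlim) (.of_forall fun n => ?_)
  have hθn : |θ * (1 - u n)| < β * π / 2 := by
    have hpos : 0 < β * π / 2 := by positivity
    rw [abs_mul, abs_of_nonneg (a := 1 - u n) (by linarith [hu1 n])]
    calc |θ| * (1 - u n) ≤ β * π / 2 * (1 - u n) :=
          mul_le_mul_of_nonneg_right hθ (by linarith [hu1 n])
      _ < β * π / 2 := by nlinarith [hu0 n]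
  obtain ⟨w, hw, hwβ⟩ := exists_cpow_eq hβ0 (R := (R + u n) / Gamma (1 - β))
    (div_pos (by linarith [hu0 n]) hc) hθn
  have := lapInt_cpow_mem_cone hβ0 hβ1 hζ hw
  rw [hwβ, ← mul_assoc, ← ofReal_mul, mul_div_cancel₀ _ hc.ne'] at this; exact this

/-! ### The limiting equation -/

/-- A non-negative kernel on `(0, 1]` with uniformly bounded row integrals. -/
structure IsKernel (k : ℝ → ℝ → ℝ) (K : ℝ) : Prop where
  measurable : Measurable (Function.uncurry k)
  nonneg : ∀ x v, 0 ≤ k x v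
  integrable : ∀ x, Integrable (k x) Λ
  integral_le : ∀ x, ∫ v, k x v ∂Λ ≤ K

/-- Measurable fields with values in the cone `|arg| ≤ β π / 2`. -/
structure IsField (β : ℝ) (X : ℝ → ℂ) : Prop where
  measurable : Measurable X
  mem_cone : ∀ x, X x ∈ cone β

/-- The right-hand side of the limiting equation. -/
def fieldStep (β : ℝ) (k : ℝ → ℝ → ℝ) (z : ℂ) (X : ℝ → ℂ) (x : ℝ) : ℂ :=
  ((Gamma (1 - β) / Gamma β : ℝ) : ℂ) * ∫ v, (k x v : ℂ) * lapInt β β (-(I * z)) (X v) ∂Λ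

/-- The iterates of `fieldStep` started at `0`. -/
def fieldIter (β : ℝ) (k : ℝ → ℝ → ℝ) : ℕ → ℂ → ℝ → ℂ
  | 0 => fun _ _ => 0
  | n + 1 => fun z => fieldStep β k z (fieldIter β k n z)

/-- The solution of the limiting equation. -/
def field (β : ℝ) (k : ℝ → ℝ → ℝ) (z : ℂ) (x : ℝ) : ℂ := limUnder atTop fun n => fieldIter β k n z x

/-- The Lipschitz constant of `fieldStep`. -/
def fieldLip (β K y : ℝ) : ℝ := Gamma (1 - β) / Gamma β * (K * ((1 / y) ^ (β + β) * Gamma (β + β)))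

/-- The limiting Cauchy-Stieltjes transform. -/
def limitTransform (β : ℝ) (k : ℝ → ℝ → ℝ) (z : ℂ) : ℂ :=
  -I * ∫ v, lapInt β 1 (-(I * z)) (field β k z v) ∂Λ

lemma re_neg_I_mul (z : ℂ) : (-(I * z)).re = z.im := by simp

lemma tendsto_fieldLip {β : ℝ} (hβ0 : 0 < β) (K : ℝ) : Tendsto (fieldLip β K) atTop (𝓝 0) := by
  have h1 : Tendsto (fun y : ℝ => (1 / y) ^ (β + β)) atTop (𝓝 0) := by
    refine (tendsto_rpow_neg_atTop (show 0 < β + β by linarith)).congr' ?_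
    filter_upwards [eventually_gt_atTop 0] with y hy
    rw [one_div, inv_rpow hy.le, rpow_neg hy.le]
  have h2 := ((h1.mul_const (Gamma (β + β))).const_mul K).const_mul (Gamma (1 - β) / Gamma β)
  simp only [zero_mul, mul_zero] at h2; exact h2

lemma exists_fieldLip_le_half {β : ℝ} (hβ0 : 0 < β) (K : ℝ) :
    ∃ y₀ : ℝ, 0 < y₀ ∧ ∀ y, y₀ ≤ y → fieldLip β K y ≤ 1 / 2 := by
  obtain ⟨y₁, h⟩ := eventually_atTop.1 ((tendsto_fieldLip hβ0 K).eventually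
    (gt_mem_nhds (show (0 : ℝ) < 1 / 2 by norm_num)))
  exact ⟨max y₁ 1, by positivity, fun y hy => (h y ((le_max_left _ _).trans hy)).le⟩

section Field

variable {β K : ℝ} {k : ℝ → ℝ → ℝ} {z : ℂ} {X X' : ℝ → ℂ}

lemma IsKernel.nonneg_bound (hk : IsKernel k K) : 0 ≤ K :=
  (integral_nonneg fun v => hk.nonneg 0 v).trans (hk.integral_le 0)

lemma IsField.re_nonneg (hX : IsField β X) (hβ1 : β < 1) (v : ℝ) : 0 ≤ (X v).re :=
  re_nonneg_of_mem_cone hβ1.le (hX.mem_cone v)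

lemma measurable_lapInt_comp (hβ0 : 0 < β) (hβ1 : β < 1) {p : ℝ} (hp : 0 < p) (hz : 0 < z.im)
    (hX : Measurable X) : Measurable fun v => lapInt β p (-(I * z)) (X v) :=
  (continuous_lapInt hβ0 hβ1 hp (by rwa [re_neg_I_mul])).measurable.comp hX

lemma norm_lapInt_comp_le (hβ1 : β < 1) {p : ℝ} (hp : 0 < p) (hz : 0 < z.im) (hX : IsField β X)
    (v : ℝ) : ‖lapInt β p (-(I * z)) (X v)‖ ≤ (1 / z.im) ^ p * Gamma p := by
  have := norm_lapInt_le (β := β) (p := p) (ζ := -(I * z)) (X := X v) hp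
    (by rwa [re_neg_I_mul]) (hX.re_nonneg hβ1 v)
  rwa [re_neg_I_mul] at this

lemma IsKernel.integrable_mul (hk : IsKernel k K) (hβ0 : 0 < β) (hβ1 : β < 1) (hz : 0 < z.im)
    (hX : IsField β X) (x : ℝ) :
    Integrable (fun v => (k x v : ℂ) * lapInt β β (-(I * z)) (X v)) Λ := by
  have h1 : Integrable (fun v => lapInt β β (-(I * z)) (X v) * (k x v : ℂ)) Λ :=
    (hk.integrable x).ofReal.bdd_mul
      (measurable_lapInt_comp hβ0 hβ1 hβ0 hz hX.measurable).aestronglyMeasurable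
      (.of_forall (norm_lapInt_comp_le hβ1 hβ0 hz hX))
  exact h1.congr (.of_forall fun v => mul_comm _ _)

lemma measurable_fieldStep (hk : IsKernel k K) (hβ0 : 0 < β) (hβ1 : β < 1) (hz : 0 < z.im)
    (hX : Measurable X) : Measurable (fieldStep β k z X) := by
  have h1 : StronglyMeasurable fun x =>
      ∫ v, (k x v : ℂ) * lapInt β β (-(I * z)) (X v) ∂Λ := by
    refine StronglyMeasurable.integral_prod_right
      (f := fun x v => (k x v : ℂ) * lapInt β β (-(I * z)) (X v))
      (Measurable.stronglyMeasurable ?_)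
    have h2 : Measurable fun p : ℝ × ℝ => (k p.1 p.2 : ℂ) :=
      Complex.measurable_ofReal.comp hk.measurable
    exact h2.mul ((measurable_lapInt_comp hβ0 hβ1 hβ0 hz hX).comp measurable_snd)
  exact h1.measurable.const_mul _

lemma IsField.fieldStep (hX : IsField β X) (hk : IsKernel k K) (hβ0 : 0 < β) (hβ1 : β < 1)
    (hz : 0 < z.im) : IsField β (fieldStep β k z X) where
  measurable := measurable_fieldStep hk hβ0 hβ1 hz hX.measurable
  mem_cone x := by
    have : 0 < Gamma (1 - β) := Gamma_pos_of_pos (by linarith)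
    have : 0 < Gamma β := Gamma_pos_of_pos hβ0
    refine ofReal_mul_mem_cone (by positivity) (integral_mem_cone hβ0 hβ1.le
      (hk.integrable_mul hβ0 hβ1 hz hX x) (.of_forall fun v =>
        ofReal_mul_mem_cone (hk.nonneg x v) (lapInt_mem_cone hβ0 hβ1 ?_ (hX.mem_cone v))))
    rwa [re_neg_I_mul]

lemma norm_fieldStep_le (hk : IsKernel k K) (hβ0 : 0 < β) (hβ1 : β < 1) (hz : 0 < z.im)
    (hX : IsField β X) (x : ℝ) : ‖fieldStep β k z X x‖ ≤ Gamma (1 - β) * K * (1 / z.im) ^ β := by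
  have : 0 < Gamma (1 - β) := Gamma_pos_of_pos (by linarith)
  have : 0 < Gamma β := Gamma_pos_of_pos hβ0
  have : ‖∫ v, (k x v : ℂ) * lapInt β β (-(I * z)) (X v) ∂Λ‖ ≤ K * ((1 / z.im) ^ β * Gamma β) := by
    calc _ ≤ ∫ v, k x v * ((1 / z.im) ^ β * Gamma β) ∂Λ := by
          refine norm_integral_le_of_norm_le ((hk.integrable x).mul_const _)
            (.of_forall fun v => ?_)
          rw [norm_ofReal_mul (hk.nonneg x v)]
          exact mul_le_mul_of_nonneg_left (norm_lapInt_comp_le hβ1 hβ0 hz hX v) (hk.nonneg x v)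
      _ ≤ _ := by
          rw [integral_mul_const]
          exact mul_le_mul_of_nonneg_right (hk.integral_le x) (by positivity)
  rw [fieldStep, norm_ofReal_mul (by positivity)]
  calc _ ≤ Gamma (1 - β) / Gamma β * (K * ((1 / z.im) ^ β * Gamma β)) := by gcongr
    _ = _ := by field_simp

/-- The distance between fields enters through a kernel-weighted integral, with `D` in the role of
`K`. Kernels of grid profiles converge only in the mean, so a supremum bound would be too strong. -/
lemma norm_fieldStep_sub_le_of_integral {k' : ℝ → ℝ → ℝ} {K' : ℝ} (hk : IsKernel k K) (hk' : IsKernel k' K')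
    (hβ0 : 0 < β) (hβ1 : β < 1) (hz : 0 < z.im) (hX : IsField β X) (hX' : IsField β X') {D ε x : ℝ}
    {b : ℝ → ℝ} (hb : Integrable b Λ)
    (hD : ∀ᵐ v ∂Λ, k x v * ‖X v - X' v‖ ≤ b v) (hbD : ∫ v, b v ∂Λ ≤ D)
    (hε : ∫ v, |k x v - k' x v| ∂Λ ≤ ε) : ‖fieldStep β k z X x - fieldStep β k' z X' x‖ ≤
      fieldLip β D z.im + Gamma (1 - β) * (1 / z.im) ^ β * ε := by
  have : 0 < Gamma (1 - β) := Gamma_pos_of_pos (by linarith)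
  have : 0 < Gamma β := Gamma_pos_of_pos hβ0
  have : 0 < Gamma (β + β) := Gamma_pos_of_pos (by linarith)
  have hζ : 0 < (-(I * z)).re := by rwa [re_neg_I_mul]
  set L := (1 / z.im) ^ (β + β) * Gamma (β + β) with hL
  set B := (1 / z.im) ^ β * Gamma β with hB
  have hL0 : 0 ≤ L := by positivity
  have hB0 : 0 ≤ B := by positivity
  have hdiff : Integrable (fun v => |k x v - k' x v|) Λ :=
    ((hk.integrable x).sub (hk'.integrable x)).abs
  have : ‖∫ v, ((k x v : ℂ) * lapInt β β (-(I * z)) (X v) -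
      (k' x v : ℂ) * lapInt β β (-(I * z)) (X' v)) ∂Λ‖ ≤
      D * L + ε * B := by
    calc _ ≤ ∫ v, (b v * L + |k x v - k' x v| * B) ∂Λ := by
          refine norm_integral_le_of_norm_le ((hb.mul_const _).add (hdiff.mul_const _)) ?_
          filter_upwards [hD] with v hv
          have e : (k x v : ℂ) * lapInt β β (-(I * z)) (X v) -
              (k' x v : ℂ) * lapInt β β (-(I * z)) (X' v) =
              (k x v : ℂ) * (lapInt β β (-(I * z)) (X v) - lapInt β β (-(I * z)) (X' v)) +
              ((k x v - k' x v : ℝ) : ℂ) * lapInt β β (-(I * z)) (X' v) := by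
            push_cast; ring
          rw [e]
          refine (norm_add_le _ _).trans ?_
          rw [norm_mul, norm_mul, norm_real, norm_real, norm_of_nonneg (hk.nonneg x v), norm_eq_abs]
          refine add_le_add ?_
            (mul_le_mul_of_nonneg_left (norm_lapInt_comp_le hβ1 hβ0 hz hX' v) (abs_nonneg _))
          have h5 := norm_lapInt_sub_le hβ0 hβ1 hβ0 hζ (hX.re_nonneg hβ1 v) (hX'.re_nonneg hβ1 v)
          rw [re_neg_I_mul] at h5
          refine (mul_le_mul_of_nonneg_left h5 (hk.nonneg x v)).trans ?_
          rw [mul_left_comm, mul_comm]; exact mul_le_mul_of_nonneg_right hv hL0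
      _ ≤ _ := by
          rw [integral_add (hb.mul_const _) (hdiff.mul_const _),
            integral_mul_const, integral_mul_const]
          exact add_le_add (mul_le_mul_of_nonneg_right hbD hL0) (mul_le_mul_of_nonneg_right hε hB0)
  rw [fieldStep, fieldStep, ← mul_sub, ← integral_sub (hk.integrable_mul hβ0 hβ1 hz hX x)
    (hk'.integrable_mul hβ0 hβ1 hz hX' x), norm_ofReal_mul (by positivity)]
  calc _ ≤ Gamma (1 - β) / Gamma β * (D * L + ε * B) := by gcongr
    _ = _ := by rw [fieldLip, hB, ← hL]; field_simp

lemma norm_fieldStep_sub_le {k' : ℝ → ℝ → ℝ} {K' : ℝ} (hk : IsKernel k K) (hk' : IsKernel k' K')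
    (hβ0 : 0 < β) (hβ1 : β < 1) (hz : 0 < z.im) (hX : IsField β X) (hX' : IsField β X') {D ε : ℝ}
    (hD : ∀ᵐ v ∂Λ, ‖X v - X' v‖ ≤ D) {x : ℝ} (hε : ∫ v, |k x v - k' x v| ∂Λ ≤ ε) :
    ‖fieldStep β k z X x - fieldStep β k' z X' x‖ ≤
      fieldLip β K z.im * D + Gamma (1 - β) * (1 / z.im) ^ β * ε := by
  obtain ⟨v, hv⟩ := hD.exists
  refine (norm_fieldStep_sub_le_of_integral hk hk' hβ0 hβ1 hz hX hX' (D := K * D)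
    ((hk.integrable x).mul_const D)
    (hD.mono fun v hv => mul_le_mul_of_nonneg_left hv (hk.nonneg x v)) ?_ hε).trans_eq ?_
  · rw [integral_mul_const]
    exact mul_le_mul_of_nonneg_right (hk.integral_le x) ((norm_nonneg _).trans hv)
  · rw [fieldLip, fieldLip]; ring

lemma isField_zero (hβ0 : 0 < β) : IsField β fun _ => (0 : ℂ) :=
  ⟨measurable_const, fun _ => zero_mem_cone hβ0.le⟩

/-- The reflection `z ↦ -conj z` conjugates `-iz`. This symmetry passes to the limiting transform
and makes the measure symmetric. -/
lemma fieldIter_neg_conj (n : ℕ) (x : ℝ) :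
    fieldIter β k n (-(conj z)) x = conj (fieldIter β k n z x) := by
  induction n generalizing x with
  | zero => simp [fieldIter]
  | succ n ih =>
    simp only [fieldIter, fieldStep]; rw [map_mul, conj_ofReal, ← integral_conj]; congr 1
    refine integral_congr_fun fun v => ?_
    have e : -(I * -(conj z)) = conj (-(I * z)) := by simp
    rw [ih, e, lapInt_conj, map_mul, conj_ofReal]

variable (hk : IsKernel k K) (hβ0 : 0 < β) (hβ1 : β < 1)

include hk hβ0 hβ1

lemma isField_fieldIter (hz : 0 < z.im) (n : ℕ) : IsField β (fieldIter β k n z) := by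
  induction n with
  | zero => exact isField_zero hβ0
  | succ n ih => exact ih.fieldStep hk hβ0 hβ1 hz

lemma norm_fieldIter_le (hz : 0 < z.im) (n : ℕ)
    (x : ℝ) : ‖fieldIter β k n z x‖ ≤ Gamma (1 - β) * K * (1 / z.im) ^ β := by
  have : 0 < Gamma (1 - β) := Gamma_pos_of_pos (by linarith)
  have := hk.nonneg_bound
  cases n with
  | zero => simp only [fieldIter, norm_zero]; positivity
  | succ n => exact norm_fieldStep_le hk hβ0 hβ1 hz (isField_fieldIter hk hβ0 hβ1 hz n) x

lemma differentiableOn_fieldIter (n : ℕ) (x : ℝ) :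
    DifferentiableOn ℂ (fun z => fieldIter β k n z x) upperHalf := by
  induction n generalizing x with
  | zero => exact differentiableOn_const 0
  | succ n ih =>
    refine DifferentiableOn.const_mul (differentiableOn_integral isOpen_upperHalf (fun z hz => ?_)
      (.of_forall fun v => ?_) fun z₀ hz₀ => ?_) _
    · exact (hk.integrable_mul hβ0 hβ1 hz (isField_fieldIter hk hβ0 hβ1 hz n) x).1
    · exact (differentiableOn_lapInt hβ0 hβ1 hβ0 isOpen_upperHalf (by fun_prop) (ih v)
        (fun z hz => by rw [re_neg_I_mul]; exact hz)).const_mul _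
    · have : 0 < z₀.im := hz₀
      have : 0 < Gamma β := Gamma_pos_of_pos hβ0
      refine ⟨z₀.im / 2, by positivity, _,
        (hk.integrable x).mul_const ((1 / (z₀.im / 2)) ^ β * Gamma β),
        Eventually.of_forall fun v z hz => ?_⟩
      have : z₀.im / 2 ≤ z.im := by
        have h3 := abs_im_le_norm (z - z₀)
        rw [mem_ball, dist_eq_norm] at hz; rw [sub_im, abs_le] at h3; linarith
      have hzim : 0 < z.im := by linarith
      rw [norm_ofReal_mul (hk.nonneg x v)]
      refine mul_le_mul_of_nonneg_left ((norm_lapInt_comp_le hβ1 hβ0 hzim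
        (isField_fieldIter hk hβ0 hβ1 hzim n) v).trans ?_) (hk.nonneg x v)
      gcongr

/-- For large `Im z` successive differences halve, so the iterates converge geometrically.
Invariance of the cone bounds them on each `{s ≤ Im z}`, and Vitali's theorem covers the remaining
`z`. -/
lemma exists_tendsto_fieldIter
    (hz : z ∈ upperHalf) (x : ℝ) : ∃ l, Tendsto (fun n => fieldIter β k n z x) atTop (𝓝 l) := by
  have h1 : 0 < Gamma (1 - β) := Gamma_pos_of_pos (by linarith)
  have hK := hk.nonneg_bound
  obtain ⟨y₀, hy₀, hy⟩ := exists_fieldLip_le_half hβ0 K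
  refine exists_tendsto_of_tendsto_im_gt (f := fun n z => fieldIter β k n z x) (y₀ := y₀)
    (fun n => differentiableOn_fieldIter hk hβ0 hβ1 n x) ?_ ?_ hz
  · intro s hs
    refine ⟨Gamma (1 - β) * K * (1 / s) ^ β, fun n z hz => ?_⟩
    have hz0 : 0 < z.im := hs.trans_le hz
    refine (norm_fieldIter_le hk hβ0 hβ1 hz0 n x).trans ?_
    gcongr
  · intro z hz
    have hz0 : 0 < z.im := hy₀.trans hz
    set D := Gamma (1 - β) * K * (1 / z.im) ^ β
    have hD0 : 0 ≤ D := by positivity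
    have hstep : ∀ n x, ‖fieldIter β k (n + 1) z x - fieldIter β k n z x‖ ≤ D * (1 / 2) ^ n := by
      intro n
      induction n with
      | zero =>
        intro x
        have := norm_fieldIter_le hk hβ0 hβ1 hz0 1 x
        rw [pow_zero, mul_one, show fieldIter β k 0 z x = 0 from rfl, sub_zero]; exact this
      | succ n ih =>
        intro x
        have h2 := norm_fieldStep_sub_le hk hk hβ0 hβ1 hz0
          (isField_fieldIter hk hβ0 hβ1 hz0 (n + 1)) (isField_fieldIter hk hβ0 hβ1 hz0 n)
          (.of_forall ih) (x := x) (ε := 0) (by simp)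
        rw [mul_zero, add_zero] at h2
        refine h2.trans ?_
        calc _ ≤ 1 / 2 * (D * (1 / 2) ^ n) := by gcongr; exact hy _ hz.le
          _ = _ := by ring
    refine cauchySeq_tendsto_of_complete (cauchySeq_of_le_geometric (1 / 2) D (by norm_num)
      fun n => ?_)
    rw [dist_comm, dist_eq_norm]; exact hstep n x

lemma tendsto_fieldIter (hz : z ∈ upperHalf)
    (x : ℝ) : Tendsto (fun n => fieldIter β k n z x) atTop (𝓝 (field β k z x)) :=
  tendsto_nhds_limUnder (exists_tendsto_fieldIter hk hβ0 hβ1 hz x)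

lemma isField_field (hz : z ∈ upperHalf) : IsField β (field β k z) where
  measurable := measurable_of_tendsto_metrizable
    (fun n => (isField_fieldIter hk hβ0 hβ1 hz n).measurable)
    (tendsto_pi_nhds.2 fun x => tendsto_fieldIter hk hβ0 hβ1 hz x)
  mem_cone x := (isClosed_cone hβ0 hβ1.le).mem_of_tendsto (tendsto_fieldIter hk hβ0 hβ1 hz x)
    (.of_forall fun n => (isField_fieldIter hk hβ0 hβ1 hz n).mem_cone x)

lemma norm_field_le (hz : z ∈ upperHalf) (x : ℝ) :
    ‖field β k z x‖ ≤ Gamma (1 - β) * K * (1 / z.im) ^ β :=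
  le_of_tendsto (tendsto_fieldIter hk hβ0 hβ1 hz x).norm
    (.of_forall fun n => norm_fieldIter_le hk hβ0 hβ1 hz n x)

lemma differentiableOn_field (x : ℝ) : DifferentiableOn ℂ (fun z => field β k z x) upperHalf := by
  have : 0 < Gamma (1 - β) := Gamma_pos_of_pos (by linarith)
  have := hk.nonneg_bound
  refine (tendstoLocallyUniformlyOn_of_bounded isOpen_upperHalf
    (f := fun n z => fieldIter β k n z x) (fun n => differentiableOn_fieldIter hk hβ0 hβ1 n x)
    (fun z₀ hz₀ => ?_) fun z hz => tendsto_fieldIter hk hβ0 hβ1 hz x).differentiableOn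
    (.of_forall fun n => differentiableOn_fieldIter hk hβ0 hβ1 n x) isOpen_upperHalf
  have : 0 < z₀.im := hz₀
  refine ⟨z₀.im / 2, by positivity, Gamma (1 - β) * K * (1 / (z₀.im / 2)) ^ β, fun n z hz => ?_⟩
  have : z₀.im / 2 ≤ z.im := by
    have h3 := abs_im_le_norm (z - z₀)
    rw [mem_ball, dist_eq_norm] at hz; rw [sub_im, abs_le] at h3; linarith
  have hzim : 0 < z.im := by linarith
  refine (norm_fieldIter_le hk hβ0 hβ1 hzim n x).trans ?_
  gcongr

lemma fieldStep_field (hz : z ∈ upperHalf) (x : ℝ) :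
    fieldStep β k z (field β k z) x = field β k z x := by
  have hz0 : 0 < z.im := hz
  have h1 := (tendsto_fieldIter hk hβ0 hβ1 hz x).comp (tendsto_add_atTop_nat 1)
  refine tendsto_nhds_unique (Tendsto.const_mul _ ?_) h1
  refine tendsto_integral_of_dominated_convergence
    (fun v => k x v * ((1 / z.im) ^ β * Gamma β)) (fun n => ?_)
    ((hk.integrable x).mul_const _) (fun n => Eventually.of_forall fun v => ?_)
    (.of_forall fun v => ?_)
  · exact (hk.integrable_mul hβ0 hβ1 hz0 (isField_fieldIter hk hβ0 hβ1 hz0 n) x).1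
  · rw [norm_ofReal_mul (hk.nonneg x v)]
    exact mul_le_mul_of_nonneg_left (norm_lapInt_comp_le hβ1 hβ0 hz0
        (isField_fieldIter hk hβ0 hβ1 hz0 n) v) (hk.nonneg x v)
  · exact (((continuous_lapInt hβ0 hβ1 hβ0 (by rwa [re_neg_I_mul])).tendsto _).comp
      (tendsto_fieldIter hk hβ0 hβ1 hz v)).const_mul _

lemma field_neg_conj (hz : z ∈ upperHalf) (x : ℝ) :
    field β k (-(conj z)) x = conj (field β k z x) := by
  have hz' : -(conj z) ∈ upperHalf := by
    change 0 < (-(conj z)).im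
    rw [neg_im, Complex.conj_im, neg_neg]; exact hz
  have h1 := tendsto_fieldIter hk hβ0 hβ1 hz' x
  simp_rw [fieldIter_neg_conj] at h1
  exact tendsto_nhds_unique h1
    ((continuous_conj.tendsto _).comp (tendsto_fieldIter hk hβ0 hβ1 hz x))

/-- A discrepancy `2 E` between iterates reproduces itself: one step halves it and adds at most `E`
from the change of kernel. -/
lemma ae_norm_field_sub_le {k' : ℝ → ℝ → ℝ} {K' : ℝ} (hk' : IsKernel k' K') (hz : z ∈ upperHalf)
    (hLip : fieldLip β K z.im ≤ 1 / 2) {ε : ℝ} (hε : ∀ᵐ x ∂Λ, ∫ v, |k x v - k' x v| ∂Λ ≤ ε) : ∀ᵐ x ∂Λ, ‖field β k z x - field β k' z x‖ ≤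
      2 * (Gamma (1 - β) * (1 / z.im) ^ β * ε) := by
  have hz0 : 0 < z.im := hz
  have h1 : 0 < Gamma (1 - β) := Gamma_pos_of_pos (by linarith)
  have hε0 : 0 ≤ ε := by
    obtain ⟨x, hx⟩ := hε.exists
    exact (integral_nonneg fun v => abs_nonneg _).trans hx
  set E := Gamma (1 - β) * (1 / z.im) ^ β * ε with hE
  have hE0 : 0 ≤ E := by positivity
  have hn : ∀ n, ∀ᵐ x ∂Λ, ‖fieldIter β k n z x - fieldIter β k' n z x‖ ≤ 2 * E := by
    intro n
    induction n with
    | zero => exact Eventually.of_forall fun x => by simp [fieldIter]; positivity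
    | succ n ih =>
      filter_upwards [hε] with x hx
      have := norm_fieldStep_sub_le hk hk' hβ0 hβ1 hz0 (isField_fieldIter hk hβ0 hβ1 hz0 n)
        (isField_fieldIter hk' hβ0 hβ1 hz0 n) ih hx
      refine this.trans ?_
      rw [← hE]; nlinarith
  filter_upwards [ae_all_iff.2 hn] with x hx
  exact le_of_tendsto ((tendsto_fieldIter hk hβ0 hβ1 hz x).sub
    (tendsto_fieldIter hk' hβ0 hβ1 hz x)).norm (.of_forall hx)

lemma integrable_lapInt_field (hz : z ∈ upperHalf) :
    Integrable (fun v => lapInt β 1 (-(I * z)) (field β k z v)) Λ :=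
  integrable_of_bound (measurable_lapInt_comp hβ0 hβ1 one_pos hz
      (isField_field hk hβ0 hβ1 hz).measurable) (norm_lapInt_comp_le hβ1 one_pos hz (isField_field hk hβ0 hβ1 hz))

lemma differentiableOn_limitTransform : DifferentiableOn ℂ (limitTransform β k) upperHalf := by
  refine DifferentiableOn.const_mul (differentiableOn_integral isOpen_upperHalf (fun z hz =>
    (integrable_lapInt_field hk hβ0 hβ1 hz).1) (.of_forall fun v =>
      differentiableOn_lapInt hβ0 hβ1 one_pos isOpen_upperHalf (by fun_prop)
        (differentiableOn_field hk hβ0 hβ1 v) (fun z hz => by rw [re_neg_I_mul]; exact hz))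
    fun z₀ hz₀ => ?_) _
  have : 0 < z₀.im := hz₀
  refine ⟨z₀.im / 2, by positivity, _, integrable_const ((1 / (z₀.im / 2)) ^ (1 : ℝ) * Gamma 1),
    Eventually.of_forall fun v z hz => ?_⟩
  have : z₀.im / 2 ≤ z.im := by
    have h3 := abs_im_le_norm (z - z₀)
    rw [mem_ball, dist_eq_norm] at hz; rw [sub_im, abs_le] at h3; linarith
  have hzim : 0 < z.im := by linarith
  refine (norm_lapInt_comp_le hβ1 one_pos hzim (isField_field hk hβ0 hβ1 hzim) v).trans ?_
  rw [Gamma_one, mul_one, mul_one]; gcongr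

lemma limitTransform_neg_conj (hz : z ∈ upperHalf) :
    limitTransform β k (-(conj z)) = -conj (limitTransform β k z) := by
  rw [limitTransform, limitTransform, map_mul, ← integral_conj, map_neg, Complex.conj_I, neg_neg,
    neg_mul]
  congr 2
  refine integral_congr_fun fun v => ?_
  have e : -(I * -(conj z)) = conj (-(I * z)) := by simp
  rw [field_neg_conj hk hβ0 hβ1 hz, e, lapInt_conj]

lemma norm_limitTransform_sub_le {k' : ℝ → ℝ → ℝ} {K' : ℝ} (hk' : IsKernel k' K') (hz : z ∈ upperHalf)
    (hLip : fieldLip β K z.im ≤ 1 / 2) {ε : ℝ} (hε : ∀ᵐ x ∂Λ, ∫ v, |k x v - k' x v| ∂Λ ≤ ε) :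
    ‖limitTransform β k z - limitTransform β k' z‖ ≤ (1 / z.im) ^ (1 + β) * Gamma (1 + β) *
        (2 * (Gamma (1 - β) * (1 / z.im) ^ β * ε)) := by
  have : 0 < z.im := hz
  have : 0 < Gamma (1 + β) := Gamma_pos_of_pos (by linarith)
  rw [limitTransform, limitTransform, ← mul_sub, ← integral_sub
    (integrable_lapInt_field hk hβ0 hβ1 hz) (integrable_lapInt_field hk' hβ0 hβ1 hz), norm_mul,
    norm_neg, norm_I, one_mul]
  refine (norm_integral_le_of_norm_le (integrable_const _) ?_).trans
    (le_of_eq (by rw [integral_const, probReal_univ, one_smul]))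
  filter_upwards [ae_norm_field_sub_le hk hβ0 hβ1 hk' hz hLip hε] with v hv
  have h5 := norm_lapInt_sub_le hβ0 hβ1 one_pos (show 0 < (-(I * z)).re by rwa [re_neg_I_mul])
    ((isField_field hk hβ0 hβ1 hz).re_nonneg hβ1 v) ((isField_field hk' hβ0 hβ1 hz).re_nonneg hβ1 v)
  rw [re_neg_I_mul] at h5
  exact h5.trans (mul_le_mul_of_nonneg_left hv (by positivity))

end Field

/-! ### The solution `Y` and its uniqueness -/

lemma neg_I_mul_ne_zero {z : ℂ} (hz : z ∈ upperHalf) : -(I * z) ≠ 0 := by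
  intro h
  have h1 := re_neg_I_mul z
  rw [h] at h1; exact absurd h1.symm (ne_of_gt hz)

lemma ne_zero_of_mem_upperHalf {z : ℂ} (hz : z ∈ upperHalf) : z ≠ 0 := by
  rintro rfl; exact absurd hz (by simp [upperHalf])

/-- With `z = iζ` and `Re ζ > 0` the arguments of `i` and `ζ` add up inside `(0, π)`, so principal
logarithms add. This is the origin of `i^α` in `C_α`. -/
lemma cpow_mul_neg_I_mul_cpow (α : ℝ) {z : ℂ} (hz : z ∈ upperHalf) :
    z ^ (α : ℂ) * (-(I * z)) ^ (-α : ℂ) = I ^ (α : ℂ) := by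
  set ζ := -(I * z) with hζ
  have hζ0 : ζ ≠ 0 := neg_I_mul_ne_zero hz
  have hre : 0 < ζ.re := by rw [hζ, re_neg_I_mul]; exact hz
  have hzζ : z = I * ζ := by rw [hζ, mul_neg, ← mul_assoc, I_mul_I]; ring
  have := abs_lt.1 (Complex.abs_arg_lt_pi_div_two_iff.2 (Or.inl hre))
  have := pi_pos
  have hlog : Complex.log (I * ζ) = Complex.log I + Complex.log ζ := by
    refine Complex.log_mul I_ne_zero hζ0 ?_
    rw [arg_I]; constructor <;> linarith
  rw [hzζ, cpow_def_of_ne_zero (mul_ne_zero I_ne_zero hζ0), hlog,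
    cpow_def_of_ne_zero hζ0, cpow_def_of_ne_zero I_ne_zero, ← exp_add]
  congr 1; ring

/-- The normalized solution `Y = (-i z)^(-α/2) X` of the limiting equation. -/
def normField (α : ℝ) (k : ℝ → ℝ → ℝ) (z : ℂ) (x : ℝ) : ℂ :=
  (-(I * z)) ^ (-(α / 2 : ℝ) : ℂ) * field (α / 2) k z x

/-- The two functions are `lapInt` with `β = α/2`, bounded on the cone by contour rotation; the
summand `1` makes the constant positive. -/
lemma exists_gFun_bound {α : ℝ} (hα0 : 0 < α) (hα2 : α < 2) :
    ∃ C : ℝ, 0 < C ∧ ∀ y ∈ cone α, ‖gFun α y‖ ≤ C ∧ ‖hFun α y‖ ≤ C := by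
  set b := 1 / cos (α / 2 * π / 2)
  refine ⟨max (b ^ (α / 2) * Gamma (α / 2)) (b ^ (1 : ℝ) * Gamma 1) + 1, ?_, fun y hy => ?_⟩
  · have : 0 ≤ b ^ (α / 2) * Gamma (α / 2) := (norm_nonneg _).trans
      (norm_lapInt_one_le_of_mem_cone (y := 0) (by linarith) (by linarith) (by linarith)
        (zero_mem_cone (by linarith)))
    have := le_max_left (b ^ (α / 2) * Gamma (α / 2)) (b ^ (1 : ℝ) * Gamma 1)
    linarith
  · have hy' : y ∈ cone (2 * (α / 2)) := by rwa [mul_div_cancel₀ _ two_ne_zero]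
    rw [gFun_eq_lapInt, hFun_eq_lapInt]
    have h1 := norm_lapInt_one_le_of_mem_cone (p := α / 2) (by linarith) (by linarith)
      (by linarith) hy'
    have h2 := norm_lapInt_one_le_of_mem_cone (p := 1) (by linarith) (by linarith) one_pos hy'
    exact ⟨h1.trans ((le_max_left _ _).trans (by linarith)),
      h2.trans ((le_max_right _ _).trans (by linarith))⟩

lemma continuous_gFun {α : ℝ} (hα0 : 0 < α) (hα2 : α < 2) : Continuous (gFun α) := by
  have := continuous_lapInt (β := α / 2) (p := α / 2) (ζ := 1) (by linarith) (by linarith)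
    (by linarith) (by simp)
  exact this.congr fun y => (gFun_eq_lapInt α y).symm

lemma continuous_hFun {α : ℝ} (hα0 : 0 < α) (hα2 : α < 2) : Continuous (hFun α) := by
  have := continuous_lapInt (β := α / 2) (p := 1) (ζ := 1) (by linarith) (by linarith)
    one_pos (by simp)
  exact this.congr fun y => (hFun_eq_lapInt α y).symm

section NormField

variable {α K : ℝ} {k : ℝ → ℝ → ℝ} {z : ℂ}

lemma lapInt_field_eq (hα0 : 0 < α) (hα2 : α < 2) {p : ℝ} (hp : 0 < p) (hz : z ∈ upperHalf)
    (v : ℝ) : lapInt (α / 2) p (-(I * z)) (field (α / 2) k z v) =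
      (-(I * z)) ^ (-p : ℂ) * lapInt (α / 2) p 1 (normField α k z v) := by
  rw [lapInt_eq_cpow_mul (by linarith) (by linarith) hp (by rw [re_neg_I_mul]; exact hz)]; rfl

lemma limitTransform_eq (hα0 : 0 < α) (hα2 : α < 2) (hz : z ∈ upperHalf) :
    limitTransform (α / 2) k z = 1 / z * ∫ v, hFun α (normField α k z v) ∂Λ := by
  have := ne_zero_of_mem_upperHalf hz
  rw [limitTransform]
  simp_rw [lapInt_field_eq (k := k) hα0 hα2 one_pos hz, ← hFun_eq_lapInt]
  rw [integral_const_mul, ← mul_assoc, ofReal_one, Complex.cpow_neg_one]; congr 1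
  have := I_ne_zero
  field_simp

lemma IsKernel.norm_integral_mul_le (hk : IsKernel k K) {f : ℝ → ℂ} {C : ℝ} (hC : 0 ≤ C)
    (hf : ∀ᵐ v ∂Λ, ‖f v‖ ≤ C) (x : ℝ) : ‖∫ v, (k x v : ℂ) * f v ∂Λ‖ ≤ K * C := by
  calc _ ≤ ∫ v, k x v * C ∂Λ := by
        refine norm_integral_le_of_norm_le ((hk.integrable x).mul_const _) ?_
        filter_upwards [hf] with v hv
        rw [norm_ofReal_mul (hk.nonneg x v)]
        exact mul_le_mul_of_nonneg_left hv (hk.nonneg x v)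
    _ ≤ _ := by
        rw [integral_mul_const]
        exact mul_le_mul_of_nonneg_right (hk.integral_le x) hC

/-- `k` is a version of `|σ| ^ α`. -/
abbrev IsKernelOf (α : ℝ) (σ k : ℝ → ℝ → ℝ) : Prop := ∀ᵐ x ∂Λ, ∀ᵐ v ∂Λ, |σ x v| ^ α = k x v

lemma ae_norm_le_norm_Lp_top (f : Lp ℂ ∞ Λ) : ∀ᵐ x ∂Λ, ‖f x‖ ≤ ‖f‖ := by
  have h1 := ae_le_eLpNormEssSup (f := f) (μ := Λ)
  have h2 := Lp.eLpNorm_ne_top f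
  filter_upwards [h1] with x hx
  rw [Lp.norm_def, ← toReal_enorm]
  refine ENNReal.toReal_mono h2 ?_
  rwa [eLpNorm_exponent_top]

lemma norm_Lp_top_le {f : Lp ℂ ∞ Λ} {C : ℝ} (hC : 0 ≤ C) (h : ∀ᵐ x ∂Λ, ‖f x‖ ≤ C) : ‖f‖ ≤ C := by
  have := Lp.norm_le_of_ae_bound hC h
  simpa using this

lemma exists_norm_rpow_bound (hα0 : 0 < α) (A : ℝ) :
    ∃ R : ℝ, 1 ≤ R ∧ ∀ z : ℂ, R ≤ ‖z‖ → A ≤ ‖z‖ ^ α / 2 := by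
  have h1 := (tendsto_rpow_atTop hα0).eventually (eventually_ge_atTop (2 * A))
  obtain ⟨R, hR⟩ := eventually_atTop.1 h1
  refine ⟨max R 1, le_max_right _ _, fun z hz => ?_⟩
  have := hR ‖z‖ ((le_max_left _ _).trans hz)
  linarith

/-- The coefficient of `z^(-1-α)` in the expansion of the limiting transform. -/
def tailCoeff (α S : ℝ) : ℂ :=
  -(((Gamma (1 + α / 2) * Gamma (1 - α / 2) * S : ℝ) : ℂ) * I ^ (α : ℂ))

/-- Euler's reflection formula cancels the sine in the imaginary part of `i^α`, and `Γ(1 + α/2) =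
(α/2) Γ(α/2)` supplies the factor. -/
lemma im_tailCoeff (hα0 : 0 < α) (hα2 : α < 2) (S : ℝ) : -(tailCoeff α S).im / π = α / 2 * S := by
  have hpi := pi_pos
  have hI : (I ^ (α : ℂ)).im = sin (π * (α / 2)) := by
    rw [Complex.cpow_ofReal_im, norm_I, one_rpow, one_mul, arg_I]; congr 1; ring
  have hsin : 0 < sin (π * (α / 2)) := Real.sin_pos_of_pos_of_lt_pi (by positivity) (by nlinarith)
  have hrefl := Real.Gamma_mul_Gamma_one_sub (α / 2)
  rw [tailCoeff, neg_im, neg_neg, im_ofReal_mul, hI, add_comm (1 : ℝ),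
    Real.Gamma_add_one (by linarith : α / 2 ≠ 0)]
  calc _ = α / 2 * S * (Gamma (α / 2) * Gamma (1 - α / 2)) * sin (π * (α / 2)) / π := by ring
    _ = α / 2 * S * (sin (π * (α / 2)) / sin (π * (α / 2))) * (π / π) := by rw [hrefl]; ring
    _ = _ := by rw [div_self hsin.ne', div_self hpi.ne', mul_one, mul_one]

lemma IsKernel.measurable_integral (hk : IsKernel k K) : Measurable fun x => ∫ v, k x v ∂Λ :=
  (StronglyMeasurable.integral_prod_right (f := k) hk.measurable.stronglyMeasurable).measurable

lemma IsKernel.integrable_integral (hk : IsKernel k K) : Integrable (fun x => ∫ v, k x v ∂Λ) Λ := by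
  refine integrable_of_bound (C := K) hk.measurable_integral fun x => ?_
  rw [norm_of_nonneg (integral_nonneg fun v => hk.nonneg x v)]
  exact hk.integral_le x

variable (hk : IsKernel k K) (hα0 : 0 < α) (hα2 : α < 2)

include hk hα0 hα2

lemma measurable_normField (hz : z ∈ upperHalf) : Measurable (normField α k z) :=
  (isField_field hk (by linarith) (by linarith) hz).measurable.const_mul _

lemma normField_mem_cone (hz : z ∈ upperHalf) (x : ℝ) : normField α k z x ∈ cone α := by
  have h1 : (-(I * z)) ^ (-(α / 2 : ℝ) : ℂ) ∈ cone (α / 2) := by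
    have := cpow_mem_cone (γ := α / 2) (w := -(I * z)) (by rw [re_neg_I_mul]; exact hz)
      (p := -(α / 2)) (by rw [abs_neg, abs_of_pos (by linarith)])
    rwa [ofReal_neg] at this
  have := mul_mem_cone h1 ((isField_field (β := α / 2) hk (by linarith) (by linarith) hz).mem_cone x)
  rwa [add_halves] at this

lemma norm_normField_le (hz : z ∈ upperHalf) (x : ℝ) : ‖normField α k z x‖ ≤
      z.im ^ (-(α / 2)) * (Gamma (1 - α / 2) * K * (1 / z.im) ^ (α / 2)) := by
  have hz0 : 0 < z.im := hz
  rw [normField, norm_mul, ← ofReal_neg, norm_cpow_real]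
  have h1 : z.im ≤ ‖-(I * z)‖ := by rw [← re_neg_I_mul]; exact re_le_norm _
  refine mul_le_mul (rpow_le_rpow_of_nonpos hz0 h1 (by linarith))
    (norm_field_le hk (by linarith) (by linarith) hz x) (norm_nonneg _) (by positivity)

lemma differentiableOn_normField (x : ℝ) :
    DifferentiableOn ℂ (fun z => normField α k z x) upperHalf := by
  refine DifferentiableOn.mul ?_ (differentiableOn_field hk (by linarith) (by linarith) x)
  refine DifferentiableOn.cpow_const (by fun_prop) fun z hz => ?_
  exact mem_slitPlane_of_re_pos (by rw [re_neg_I_mul]; exact hz)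

/-- Scaling extracts `(-iz)^(-α/2)` from the integral, and the normalization contributes the same
factor once more. Their product times `z^α` is `i^α`. -/
lemma normField_equation (hz : z ∈ upperHalf) (x : ℝ) : z ^ (α : ℂ) * normField α k z x =
      cConst α * ∫ v, (k x v : ℂ) * gFun α (normField α k z v) ∂Λ := by
  have h1 := fieldStep_field hk (show 0 < α / 2 by linarith) (by linarith) hz x
  have hβ : 0 < α / 2 := by linarith
  have hζ0 := neg_I_mul_ne_zero hz
  conv_lhs => rw [normField, ← h1, fieldStep]
  have e1 : ∀ v, (k x v : ℂ) * lapInt (α / 2) (α / 2) (-(I * z)) (field (α / 2) k z v) =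
      (-(I * z)) ^ (-(α / 2 : ℝ) : ℂ) * ((k x v : ℂ) * gFun α (normField α k z v)) := by
    intro v
    rw [lapInt_field_eq hα0 hα2 hβ hz, gFun_eq_lapInt]; ring
  simp_rw [e1]
  rw [integral_const_mul, cConst, ← cpow_mul_neg_I_mul_cpow α hz]
  have e2 : (-(I * z)) ^ (-α : ℂ) =
      (-(I * z)) ^ (-(α / 2 : ℝ) : ℂ) * (-(I * z)) ^ (-(α / 2 : ℝ) : ℂ) := by
    rw [← cpow_add _ _ hζ0]; congr 1; push_cast; ring
  rw [e2]; ring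

lemma exists_isSolution {σ : ℝ → ℝ → ℝ}
    (hσ : IsKernelOf α σ k) (R : ℝ) : ∃ Y : ℂ → Lp ℂ ∞ Λ, IsSolution α σ R Y ∧
      ∀ z ∈ upperHalf, ∀ᵐ x ∂Λ, Y z x = normField α k z x := by
  obtain ⟨Y, hY, hYe⟩ := exists_analyticOnNhd_Lp (f := fun x z => normField α k z x)
    (fun z hz => (measurable_normField hk hα0 hα2 hz).aestronglyMeasurable)
    (fun x => differentiableOn_normField hk hα0 hα2 x) (fun s hs => by
      have : 0 < Gamma (1 - α / 2) := Gamma_pos_of_pos (by linarith)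
      have := hk.nonneg_bound
      refine ⟨s ^ (-(α / 2)) * (Gamma (1 - α / 2) * K * (1 / s) ^ (α / 2)), fun x z hz => ?_⟩
      have hz0 : 0 < z.im := hs.trans_le hz
      refine (norm_normField_le hk hα0 hα2 hz0 x).trans ?_
      refine mul_le_mul (rpow_le_rpow_of_nonpos hs hz (by linarith)) ?_ (by positivity)
        (by positivity)
      gcongr)
  refine ⟨Y, ⟨hY, fun z hz => ?_, fun z hz _ => ?_⟩, hYe⟩
  · filter_upwards [hYe z hz] with x hx
    rw [hx]; exact normField_mem_cone hk hα0 hα2 hz x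
  · filter_upwards [hYe z hz, hσ] with x hx hσx
    rw [hx, normField_equation hk hα0 hα2 hz]; congr 1
    refine integral_congr_ae ?_
    filter_upwards [hYe z hz, hσx] with v hv hσv
    rw [hv, hσv]

/-- On the cone `g_α` is bounded by `C`, so for large `|z|` the equation forces `‖Y‖ ≤ 1`. On the
unit disc `g_α` is Lipschitz with constant `L`. The choice of `R` makes `‖C_α‖ K (C + L)` at most
`|z|^α / 2`, so two solutions are at distance at most half their distance. -/
lemma exists_unique_isSolution {σ : ℝ → ℝ → ℝ} (hσ : IsKernelOf α σ k) :
    ∃ R : ℝ, ∀ Y Y' : ℂ → Lp ℂ ∞ Λ, IsSolution α σ R Y → IsSolution α σ R Y' →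
      EqOn Y' Y upperHalf := by
  obtain ⟨C, hC0, hC⟩ := exists_gFun_bound hα0 hα2
  obtain ⟨L, hL0, hL⟩ := exists_lipschitz_lapInt_one (β := α / 2) (p := α / 2) (by linarith)
    (by linarith) (by linarith)
  have := hk.nonneg_bound
  obtain ⟨R, hR1, hR⟩ := exists_norm_rpow_bound hα0 (‖cConst α‖ * (K * (C + L)))
  refine ⟨R, fun Y Y' hY hY' => ?_⟩
  have heq : ∀ {Y : ℂ → Lp ℂ ∞ Λ}, IsSolution α σ R Y → ∀ z ∈ upperHalf, R ≤ ‖z‖ →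
      ∀ᵐ x ∂Λ, z ^ (α : ℂ) * Y z x = cConst α * ∫ v, (k x v : ℂ) * gFun α (Y z v) ∂Λ := by
    intro Y hY z hz hzR
    filter_upwards [hY.equation z hz hzR, hσ] with x hx hσx
    rw [hx]; congr 1
    refine integral_congr_ae ?_
    filter_upwards [hσx] with v hv
    rw [hv]
  have hsmall : ∀ {Y : ℂ → Lp ℂ ∞ Λ}, IsSolution α σ R Y → ∀ z ∈ upperHalf, R ≤ ‖z‖ →
      ∀ᵐ x ∂Λ, ‖Y z x‖ ≤ 1 := by
    intro Y hY z hz hzR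
    have hz0 : 0 < ‖z‖ := by linarith
    have hzp : 0 < ‖z‖ ^ α := by positivity
    filter_upwards [heq hY z hz hzR] with x hx
    have h1 := congrArg norm hx
    rw [norm_mul, norm_mul, norm_cpow_real] at h1
    have h2 := hk.norm_integral_mul_le (f := fun v => gFun α (Y z v)) hC0.le
      ((hY.mem_cone z hz).mono fun v hv => (hC _ hv).1) x
    have h3 := hR z hzR
    have h4 : ‖z‖ ^ α * ‖Y z x‖ ≤ ‖z‖ ^ α * 1 := by
      calc _ ≤ ‖cConst α‖ * (K * C) := by rw [h1]; gcongr
        _ ≤ ‖cConst α‖ * (K * (C + L)) := by gcongr; linarith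
        _ ≤ _ := by linarith
    exact le_of_mul_le_mul_left h4 hzp
  have hzero : ∀ z ∈ upperHalf, R ≤ ‖z‖ → Y' z = Y z := by
    intro z hz hzR
    have hz0 : 0 < ‖z‖ := by linarith
    have hzp : 0 < ‖z‖ ^ α := by positivity
    have hdiff : ∀ᵐ v ∂Λ, ‖Y' z v - Y z v‖ ≤ ‖Y' z - Y z‖ := by
      filter_upwards [ae_norm_le_norm_Lp_top (Y' z - Y z), Lp.coeFn_sub (Y' z) (Y z)] with v hv hs
      rwa [hs] at hv
    have hInt : ∀ {Y : ℂ → Lp ℂ ∞ Λ}, IsSolution α σ R Y → ∀ x,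
        Integrable (fun v => (k x v : ℂ) * gFun α (Y z v)) Λ := by
      intro Y hY x
      have h1 : Integrable (fun v => gFun α (Y z v) * (k x v : ℂ)) Λ :=
        (hk.integrable x).ofReal.bdd_mul (c := C)
          ((continuous_gFun hα0 hα2).comp_aestronglyMeasurable (Lp.aestronglyMeasurable _))
          ((hY.mem_cone z hz).mono fun v hv => (hC _ hv).1)
      exact h1.congr (.of_forall fun v => mul_comm _ _)
    have : ‖Y' z - Y z‖ ≤ ‖Y' z - Y z‖ / 2 := by
      refine norm_Lp_top_le (by positivity) ?_
      filter_upwards [heq hY z hz hzR, heq hY' z hz hzR, Lp.coeFn_sub (Y' z) (Y z)] with x hx hx' hs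
      rw [hs, Pi.sub_apply]
      have h1 : z ^ (α : ℂ) * (Y' z x - Y z x) = cConst α *
          ∫ v, (k x v : ℂ) * (gFun α (Y' z v) - gFun α (Y z v)) ∂Λ := by
        rw [mul_sub, hx, hx', ← mul_sub, ← integral_sub (hInt hY' x) (hInt hY x)]; congr 1
        refine integral_congr_fun fun v => ?_
        ring
      have h2 := congrArg norm h1
      rw [norm_mul, norm_mul, norm_cpow_real] at h2
      have h3 := hk.norm_integral_mul_le (f := fun v => gFun α (Y' z v) - gFun α (Y z v))
        (C := L * ‖Y' z - Y z‖) (by positivity) (by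
          filter_upwards [hdiff, hsmall hY z hz hzR, hsmall hY' z hz hzR] with v hv h1 h2
          rw [gFun_eq_lapInt, gFun_eq_lapInt]
          exact (hL _ _ h2 h1).trans (by gcongr)) x
      have h4 := hR z hzR
      have h5 : ‖z‖ ^ α * ‖Y' z x - Y z x‖ ≤ ‖z‖ ^ α * (‖Y' z - Y z‖ / 2) := by
        calc _ ≤ ‖cConst α‖ * (K * (L * ‖Y' z - Y z‖)) := by rw [h2]; gcongr
          _ = ‖cConst α‖ * (K * L) * ‖Y' z - Y z‖ := by ring
          _ ≤ ‖cConst α‖ * (K * (C + L)) * ‖Y' z - Y z‖ := by gcongr; linarith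
          _ ≤ ‖z‖ ^ α / 2 * ‖Y' z - Y z‖ := by gcongr
          _ = _ := by ring
      exact le_of_mul_le_mul_left h5 hzp
    have h0 : ‖Y' z - Y z‖ = 0 := le_antisymm (by linarith) (norm_nonneg _)
    exact sub_eq_zero.1 (norm_eq_zero.1 h0)
  -- Near a point with `|z₀| > R` the solutions agree on an open set, and the identity theorem
  -- extends this to the half-plane.
  set z₀ : ℂ := ((R + 1 : ℝ) : ℂ) * I with hz₀
  have hz₀m : z₀ ∈ upperHalf := by
    change 0 < z₀.im
    simp [hz₀]; linarith
  have hz₀n : R < ‖z₀‖ := by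
    rw [hz₀, norm_mul, norm_I, norm_real, norm_of_nonneg (by linarith)]; linarith
  refine AnalyticOnNhd.eqOn_of_preconnected_of_eventuallyEq hY'.analytic hY.analytic
    isPreconnected_upperHalf hz₀m ?_
  filter_upwards [isOpen_upperHalf.mem_nhds hz₀m,
    continuous_norm.continuousAt.eventually (lt_mem_nhds hz₀n)] with z h1 h2
  exact hzero z h1 (le_of_lt h2)

/-! ### Expansion of the limiting transform at infinity -/

/-- The product `z G(z)` is an average of values of `h_α` on the cone, where `h_α` is bounded. -/
lemma norm_mul_limitTransform_le :
    ∃ C : ℝ, ∀ z ∈ upperHalf, ‖z * limitTransform (α / 2) k z‖ ≤ C := by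
  obtain ⟨C, hC0, hC⟩ := exists_gFun_bound hα0 hα2
  refine ⟨C, fun z hz => ?_⟩
  have hz0 := ne_zero_of_mem_upperHalf hz
  rw [limitTransform_eq hα0 hα2 hz, ← mul_assoc, mul_one_div_cancel hz0, one_mul]
  exact norm_integral_le_of_forall_le fun v => (hC _ (normField_mem_cone hk hα0 hα2 hz v)).2

/-- The equation gives `Y = O(|z|^(-α))`. To first order `g_α(Y) ≈ Γ(α/2)` determines the mean of
`Y`, and `h_α(Y) = 1 - Γ(1 + α/2) Y + O(Y²)` carries it into the transform. -/
lemma exists_limitTransform_expansion :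
    ∃ R C : ℝ, 1 ≤ R ∧ ∀ z ∈ upperHalf, R ≤ ‖z‖ → ‖limitTransform (α / 2) k z - (1 / z + tailCoeff α
        (∫ x, ∫ v, k x v ∂Λ ∂Λ) * z ^ (-(1 + α) : ℂ))‖ ≤ C * ‖z‖ ^ (-(1 + 2 * α)) := by
  obtain ⟨C, hC0, hC⟩ := exists_gFun_bound hα0 hα2
  obtain ⟨L, hL0, hL⟩ := exists_lipschitz_lapInt_one (β := α / 2) (p := α / 2) (by linarith)
    (by linarith) (by linarith)
  obtain ⟨T, hT0, hT⟩ := exists_taylor_lapInt_one (β := α / 2) (p := 1) (by linarith)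
    (by linarith) one_pos
  have := hk.nonneg_bound
  have hΓ : 0 < Gamma (α / 2) := Gamma_pos_of_pos (by linarith)
  have hΓ1 : 0 < Gamma (1 + α / 2) := Gamma_pos_of_pos (by linarith)
  set A := ‖cConst α‖ * (K * C)
  have : 0 ≤ A := by positivity
  obtain ⟨R, hR1, hR⟩ := exists_norm_rpow_bound hα0 A
  set S := ∫ x, ∫ v, k x v ∂Λ ∂Λ
  refine ⟨R, T * A ^ 2 + Gamma (1 + α / 2) * (‖cConst α‖ * (K * (L * A))), hR1, fun z hz hzR => ?_⟩
  have hz0 := ne_zero_of_mem_upperHalf hz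
  have hn0 : 0 < ‖z‖ := norm_pos_iff.2 hz0
  have hzp : 0 < ‖z‖ ^ α := by positivity
  have : z ^ (α : ℂ) ≠ 0 := fun h => by simp [Complex.cpow_eq_zero_iff, hz0] at h
  set e := ‖z‖ ^ (-α) with he
  have : 0 < e := by positivity
  have heinv : e = (‖z‖ ^ α)⁻¹ := rpow_neg hn0.le _
  set Y := normField α k z with hY
  have hYm : Measurable Y := measurable_normField hk hα0 hα2 hz
  have hYc : ∀ v, Y v ∈ cone α := normField_mem_cone hk hα0 hα2 hz
  have hYn : ∀ x, ‖Y x‖ ≤ A * e := by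
    intro x
    have h1 := congrArg norm (normField_equation hk hα0 hα2 hz x)
    rw [norm_mul, norm_mul, norm_cpow_real] at h1
    have h2 := hk.norm_integral_mul_le (f := fun v => gFun α (Y v)) hC0.le
      (.of_forall fun v => (hC _ (hYc v)).1) x
    rw [heinv, ← div_eq_mul_inv, le_div_iff₀ hzp, mul_comm, h1]
    exact mul_le_mul_of_nonneg_left h2 (norm_nonneg _)
  have hAe : A * e ≤ 1 := by rw [heinv, ← div_eq_mul_inv, div_le_one hzp]; linarith [hR z hzR]
  have hY1 : ∀ x, ‖Y x‖ ≤ 1 := fun x => (hYn x).trans hAe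
  have hYi : Integrable Y Λ := integrable_of_bound hYm hY1
  have hhi : Integrable (fun v => hFun α (Y v)) Λ :=
    integrable_of_bound ((continuous_hFun hα0 hα2).measurable.comp hYm) fun v => (hC _ (hYc v)).2
  have hstepA : ‖∫ v, hFun α (Y v) ∂Λ -
      (1 - (Gamma (1 + α / 2) : ℂ) * ∫ v, Y v ∂Λ)‖ ≤ T * A ^ 2 * (e * e) := by
    have h1 : 1 - (Gamma (1 + α / 2) : ℂ) * ∫ v, Y v ∂Λ =
        ∫ v, (1 - (Gamma (1 + α / 2) : ℂ) * Y v) ∂Λ := by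
      rw [integral_sub (integrable_const _) (hYi.const_mul _), integral_const_mul]; simp
    have hi : Integrable (fun v => 1 - (Gamma (1 + α / 2) : ℂ) * Y v) Λ :=
      (integrable_const _).sub (hYi.const_mul _)
    rw [h1, ← integral_sub hhi hi]
    refine norm_integral_le_of_forall_le fun v => ?_
    have h2 := hT (Y v) (hY1 v)
    rw [← hFun_eq_lapInt, Gamma_one, ofReal_one] at h2
    refine h2.trans ?_
    calc T * ‖Y v‖ ^ 2 ≤ T * (A * e) ^ 2 := by gcongr; exact hYn v
      _ = _ := by ring
  have : ‖z ^ (α : ℂ) * ∫ x, Y x ∂Λ -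
      cConst α * ((Gamma (α / 2) * S : ℝ) : ℂ)‖ ≤ ‖cConst α‖ * (K * (L * A)) * e := by
    have hgb : ∀ x, ‖∫ v, (k x v : ℂ) * gFun α (Y v) ∂Λ -
        ((Gamma (α / 2) * ∫ v, k x v ∂Λ : ℝ) : ℂ)‖ ≤ K * (L * A * e) := by
      intro x
      have hi1 : Integrable (fun v => (k x v : ℂ) * gFun α (Y v)) Λ := by
        have h1 : Integrable (fun v => gFun α (Y v) * (k x v : ℂ)) Λ :=
          (hk.integrable x).ofReal.bdd_mul (c := C)
            ((continuous_gFun hα0 hα2).measurable.comp hYm).aestronglyMeasurable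
            (.of_forall fun v => (hC _ (hYc v)).1)
        exact h1.congr (.of_forall fun v => mul_comm _ _)
      have hi2 : Integrable (fun v => (k x v : ℂ) * (Gamma (α / 2) : ℂ)) Λ :=
        (hk.integrable x).ofReal.mul_const _
      have e1 : ((Gamma (α / 2) * ∫ v, k x v ∂Λ : ℝ) : ℂ) =
          ∫ v, (k x v : ℂ) * (Gamma (α / 2) : ℂ) ∂Λ := by
        rw [integral_mul_const, integral_complex_ofReal]; push_cast; ring
      rw [e1, ← integral_sub hi1 hi2]
      have e2 : ∀ v, (k x v : ℂ) * gFun α (Y v) - (k x v : ℂ) * (Gamma (α / 2) : ℂ) =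
          (k x v : ℂ) * (gFun α (Y v) - (Gamma (α / 2) : ℂ)) := fun v => by ring
      simp_rw [e2]
      refine hk.norm_integral_mul_le (by positivity) (.of_forall fun v => ?_) x
      have h3 := hL (Y v) 0 (hY1 v) (by simp)
      rw [lapInt_one_zero (by linarith), sub_zero, ← gFun_eq_lapInt] at h3
      refine h3.trans ?_
      rw [mul_assoc]; gcongr; exact hYn v
    have hi3 : Integrable (fun x => cConst α * ((Gamma (α / 2) * ∫ v, k x v ∂Λ : ℝ) : ℂ)) Λ :=
      ((hk.integrable_integral.const_mul _).ofReal).const_mul _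
    have e3 : cConst α * ((Gamma (α / 2) * S : ℝ) : ℂ) = ∫ x, cConst α *
        ((Gamma (α / 2) * ∫ v, k x v ∂Λ : ℝ) : ℂ) ∂Λ := by
      rw [integral_const_mul, integral_complex_ofReal, integral_const_mul]
    rw [e3, ← integral_const_mul, ← integral_sub (hYi.const_mul _) hi3]
    refine norm_integral_le_of_forall_le fun x => ?_
    rw [hY, normField_equation hk hα0 hα2 hz x, ← mul_sub, norm_mul]
    calc _ ≤ ‖cConst α‖ * (K * (L * A * e)) := by gcongr; exact hgb x
      _ = _ := by ring
  have : ‖∫ x, Y x ∂Λ - cConst α * ((Gamma (α / 2) * S : ℝ) : ℂ) / z ^ (α : ℂ)‖ ≤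
      ‖cConst α‖ * (K * (L * A)) * (e * e) := by
    have h1 : ∫ x, Y x ∂Λ - cConst α * ((Gamma (α / 2) * S : ℝ) : ℂ) / z ^ (α : ℂ) =
        (z ^ (α : ℂ) * ∫ x, Y x ∂Λ - cConst α * ((Gamma (α / 2) * S : ℝ) : ℂ)) /
          z ^ (α : ℂ) := by field_simp
    rw [h1, norm_div, norm_cpow_real, div_eq_mul_inv, ← heinv, ← mul_assoc]; gcongr
  have hcoef : tailCoeff α S = -((Gamma (1 + α / 2) : ℂ) *
      (cConst α * ((Gamma (α / 2) * S : ℝ) : ℂ))) := by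
    rw [tailCoeff, cConst]
    have : (Gamma (α / 2) : ℂ) ≠ 0 := by exact_mod_cast hΓ.ne'
    push_cast; field_simp
  have hzpow : z ^ (-(1 + α) : ℂ) = 1 / z * (1 / z ^ (α : ℂ)) := by
    rw [neg_add, cpow_add _ _ hz0, Complex.cpow_neg_one, cpow_neg, one_div, one_div]
  have hfin : limitTransform (α / 2) k z - (1 / z + tailCoeff α S * z ^ (-(1 + α) : ℂ)) =
      1 / z * ((∫ v, hFun α (Y v) ∂Λ - (1 - (Gamma (1 + α / 2) : ℂ) * ∫ v, Y v ∂Λ)) -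
      (Gamma (1 + α / 2) : ℂ) * (∫ x, Y x ∂Λ -
        cConst α * ((Gamma (α / 2) * S : ℝ) : ℂ) / z ^ (α : ℂ))) := by
    rw [limitTransform_eq hα0 hα2 hz, hzpow, hcoef]; ring
  have hpow : ‖z‖ ^ (-(1 + 2 * α)) = ‖z‖⁻¹ * (e * e) := by
    rw [he, ← Real.rpow_neg_one, ← rpow_add hn0, ← rpow_add hn0]; congr 1; ring
  rw [hfin, norm_mul, norm_div, norm_one, one_div, hpow]
  calc _ ≤ ‖z‖⁻¹ * (T * A ^ 2 * (e * e) + Gamma (1 + α / 2) *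
        (‖cConst α‖ * (K * (L * A)) * (e * e))) := by
        gcongr
        refine (norm_sub_le _ _).trans (add_le_add hstepA ?_)
        rw [norm_ofReal_mul hΓ1.le]; gcongr
    _ = _ := by ring

end NormField

/-! ### Resolvents of real symmetric matrices -/

section Green

variable {n : Type*} [Fintype n] [DecidableEq n] {A B : Matrix n n ℝ} {z : ℂ}

/-- The matrix `z - A`. -/
def shifted (A : Matrix n n ℝ) (z : ℂ) : Matrix n n ℂ :=
  Matrix.scalar n z - A.map (fun t : ℝ => (t : ℂ))

/-- The resolvent `(z - A)⁻¹`. -/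
def green (A : Matrix n n ℝ) (z : ℂ) : Matrix n n ℂ := (shifted A z)⁻¹

lemma shifted_mulVec (A : Matrix n n ℝ) (z : ℂ) (v : n → ℂ) (j : n) :
    ((shifted A z).mulVec v) j = z * v j - ∑ k, (A j k : ℂ) * v k := by
  rw [shifted, Matrix.sub_mulVec, Pi.sub_apply]; congr 1
  rw [Matrix.scalar_apply, Matrix.mulVec_diagonal]

lemma im_sum_conj_mul_shifted (hA : A.IsSymm) (v : n → ℂ) :
    (∑ j, conj (v j) * ((shifted A z).mulVec v) j).im = z.im * ∑ j, ‖v j‖ ^ 2 := by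
  have h1 : ∑ j, conj (v j) * ((shifted A z).mulVec v) j = z * ((∑ j, ‖v j‖ ^ 2 : ℝ) : ℂ) -
        ∑ j, ∑ k, conj (v j) * ((A j k : ℂ) * v k) := by
    simp_rw [shifted_mulVec, mul_sub, sum_sub_distrib, mul_sum]; congr 1; push_cast
    rw [mul_sum]
    refine sum_congr rfl fun j _ => ?_
    rw [← Complex.conj_mul']; ring
  have h2 : (∑ j, ∑ k, conj (v j) * ((A j k : ℂ) * v k)).im = 0 := by
    rw [← Complex.conj_eq_iff_im, map_sum]
    simp_rw [map_sum, map_mul, conj_conj, conj_ofReal]; rw [sum_comm]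
    refine sum_congr rfl fun k _ => sum_congr rfl fun j _ => ?_
    rw [hA.apply k j]; ring
  rw [h1, sub_im, h2, sub_zero, Complex.im_mul_ofReal]

/-- The imaginary part of `⟨v, (z - A) v⟩` is `Im z ‖v‖²`, since `A` is real symmetric;
Cauchy-Schwarz concludes. This yields both invertibility and the norm bound on the resolvent. -/
lemma sum_norm_sq_le_shifted (hA : A.IsSymm) (hz : 0 < z.im) (v : n → ℂ) :
    z.im ^ 2 * ∑ j, ‖v j‖ ^ 2 ≤ ∑ j, ‖((shifted A z).mulVec v) j‖ ^ 2 := by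
  set S := ∑ j, ‖v j‖ ^ 2 with hS
  set w := (shifted A z).mulVec v
  have hS0 : 0 ≤ S := sum_nonneg fun j _ => by positivity
  have h1 : z.im * S ≤ ∑ j, ‖v j‖ * ‖w j‖ := by
    rw [hS, ← im_sum_conj_mul_shifted hA v]
    refine (le_abs_self _).trans ((abs_im_le_norm _).trans ((norm_sum_le _ _).trans ?_))
    refine sum_le_sum fun j _ => ?_
    rw [norm_mul, RCLike.norm_conj]
  have h2 := Finset.sum_mul_sq_le_sq_mul_sq Finset.univ (fun j => ‖v j‖) (fun j => ‖w j‖)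
  rcases eq_or_lt_of_le hS0 with h0 | h0
  · rw [← h0, mul_zero]; exact sum_nonneg fun j _ => by positivity
  · have : (z.im * S) ^ 2 ≤ S * ∑ j, ‖w j‖ ^ 2 :=
      (pow_le_pow_left₀ (by positivity) h1 2).trans h2
    have h4 : S * (z.im ^ 2 * S) ≤ S * ∑ j, ‖w j‖ ^ 2 := by nlinarith
    exact le_of_mul_le_mul_left h4 h0

lemma isUnit_det_shifted (hA : A.IsSymm) (hz : 0 < z.im) : IsUnit (shifted A z).det := by
  rw [isUnit_iff_ne_zero]; intro h
  obtain ⟨v, hv, hv0⟩ := Matrix.exists_mulVec_eq_zero_iff.2 h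
  have h1 := sum_norm_sq_le_shifted hA hz v
  rw [hv0] at h1
  simp only [Pi.zero_apply, norm_zero, ne_eq, OfNat.ofNat_ne_zero, not_false_eq_true, zero_pow,
    Finset.sum_const_zero] at h1
  have h2 : ∑ j, ‖v j‖ ^ 2 ≤ 0 := by
    have : 0 < z.im ^ 2 := by positivity
    by_contra h3
    push Not at h3; nlinarith
  have h3 := (Finset.sum_eq_zero_iff_of_nonneg fun j _ => by positivity).1
    (le_antisymm h2 (sum_nonneg fun j _ => by positivity))
  refine hv (funext fun j => ?_)
  have := h3 j (Finset.mem_univ j)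
  simpa using this

lemma shifted_mulVec_green (hA : A.IsSymm) (hz : 0 < z.im) (v : n → ℂ) :
    (shifted A z).mulVec ((green A z).mulVec v) = v := by
  rw [Matrix.mulVec_mulVec, green, Matrix.mul_nonsing_inv _ (isUnit_det_shifted hA hz),
    Matrix.one_mulVec]

lemma green_mulVec_shifted (hA : A.IsSymm) (hz : 0 < z.im) (v : n → ℂ) :
    (green A z).mulVec ((shifted A z).mulVec v) = v := by
  rw [Matrix.mulVec_mulVec, green, Matrix.nonsing_inv_mul _ (isUnit_det_shifted hA hz),
    Matrix.one_mulVec]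

lemma sum_norm_sq_green_le (hA : A.IsSymm) (hz : 0 < z.im) (v : n → ℂ) :
    ∑ j, ‖((green A z).mulVec v) j‖ ^ 2 ≤ (1 / z.im) ^ 2 * ∑ j, ‖v j‖ ^ 2 := by
  have h1 := sum_norm_sq_le_shifted hA hz ((green A z).mulVec v)
  rw [shifted_mulVec_green hA hz] at h1
  rw [one_div, inv_pow, inv_mul_eq_div, le_div_iff₀ (by positivity), mul_comm]; exact h1

lemma isSymm_green (hA : A.IsSymm) : (green A z).IsSymm := by
  have h1 : (shifted A z).transpose = shifted A z := by
    rw [shifted, Matrix.transpose_sub, Matrix.scalar_apply, Matrix.diagonal_transpose,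
      ← Matrix.transpose_map, hA.eq]
  rw [Matrix.IsSymm, green, Matrix.transpose_nonsing_inv, h1]

lemma green_mulVec_single (i j : n) : ((green A z).mulVec (Pi.single i 1)) j = green A z j i := by
  rw [Matrix.mulVec_single_one, Matrix.col_apply]

/-- The Ward identity. -/
lemma neg_im_green (hA : A.IsSymm) (hz : 0 < z.im) (i : n) :
    -(green A z i i).im = z.im * ∑ j, ‖green A z j i‖ ^ 2 := by
  have h1 := im_sum_conj_mul_shifted (z := z) hA ((green A z).mulVec (Pi.single i 1))
  rw [shifted_mulVec_green hA hz] at h1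
  simp_rw [green_mulVec_single] at h1; rw [← h1, sum_eq_single i]
  · simp
  · intro j _ hj; simp [hj]
  · simp

lemma sum_norm_sq_green_col_le (hA : A.IsSymm) (hz : 0 < z.im) (i : n) :
    ∑ j, ‖green A z j i‖ ^ 2 ≤ (1 / z.im) ^ 2 := by
  have h1 := sum_norm_sq_green_le hA hz (Pi.single i 1)
  simp_rw [green_mulVec_single] at h1
  rwa [show ∑ j, ‖(Pi.single i (1 : ℂ) : n → ℂ) j‖ ^ 2 = 1 by
    rw [sum_eq_single i (fun j _ hj => by simp [hj]) (by simp)]; simp, mul_one] at h1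

lemma norm_green_le (hA : A.IsSymm) (hz : 0 < z.im) (j i : n) : ‖green A z j i‖ ≤ 1 / z.im := by
  have h1 := (single_le_sum (f := fun j => ‖green A z j i‖ ^ 2) (fun j _ => by positivity)
    (Finset.mem_univ j)).trans (sum_norm_sq_green_col_le hA hz i)
  exact (pow_le_pow_iff_left₀ (norm_nonneg _) (by positivity) two_ne_zero).1 h1

/-- By the Ward identity, equality would force column `i` of the resolvent to vanish. -/
lemma im_green_neg (hA : A.IsSymm) (hz : 0 < z.im) (i : n) : (green A z i i).im < 0 := by
  have h1 := neg_im_green hA hz i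
  have h2 : 0 ≤ ∑ j, ‖green A z j i‖ ^ 2 := sum_nonneg fun j _ => by positivity
  rcases eq_or_lt_of_le h2 with h0 | h0
  · exfalso
    have h3 := (Finset.sum_eq_zero_iff_of_nonneg fun j _ => by positivity).1 h0.symm
    have h4 := congrFun (shifted_mulVec_green (z := z) hA hz (Pi.single i 1)) i
    rw [shifted_mulVec] at h4
    simp_rw [green_mulVec_single] at h4
    have h5 : ∀ j, green A z j i = 0 := fun j => by
      have := h3 j (Finset.mem_univ j)
      simpa using this
    simp [h5] at h4
  · have : 0 < z.im * ∑ j, ‖green A z j i‖ ^ 2 := by positivity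
    linarith

lemma re_I_mul_green_pos (hA : A.IsSymm) (hz : 0 < z.im) (i : n) : 0 < (I * green A z i i).re := by
  have := im_green_neg hA hz i
  simpa using this

/-- The matrix `A` with row and column `i` set to zero. -/
def minor (A : Matrix n n ℝ) (i : n) : Matrix n n ℝ :=
  Matrix.of fun j k => if j = i ∨ k = i then 0 else A j k

lemma isSymm_minor {m : Type*} [DecidableEq m] {A : Matrix m m ℝ} (hA : A.IsSymm) (i : m) : (minor A i).IsSymm := by
  ext j k
  simp only [minor, Matrix.transpose_apply, Matrix.of_apply, or_comm, hA.apply j k]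

/-- Column `i` of `A`, without the diagonal entry. -/
def rowVec (A : Matrix n n ℝ) (i : n) : n → ℂ := fun j => if j = i then 0 else (A i j : ℂ)

lemma shifted_minor_mulVec (hA : A.IsSymm) (i : n) (w : n → ℂ) (j : n) :
    ((shifted (minor A i) z).mulVec (Function.update w i 0)) j =
      if j = i then 0 else ((shifted A z).mulVec w) j + w i * rowVec A i j := by
  rw [shifted_mulVec, shifted_mulVec]
  split_ifs with hj
  · subst hj; simp [minor]
  · have h1 : ∀ k, ((minor A i j k : ℝ) : ℂ) * Function.update w i 0 k =
        (A j k : ℂ) * w k - if k = i then (A j i : ℂ) * w i else 0 := by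
      intro k
      by_cases hk : k = i
      · subst hk; simp
      · simp [minor, hj, hk]
    simp_rw [h1]
    rw [sum_sub_distrib, sum_ite_eq' Finset.univ i, if_pos (Finset.mem_univ i),
      Function.update_of_ne hj, rowVec, if_neg hj, hA.apply i j]
    ring

/-- Erasing coordinate `i` from column `j` of the resolvent leaves a solution of the system of the
minor; the erased coordinate moves to the right-hand side as a multiple of row `i`. -/
lemma update_green_eq (hA : A.IsSymm) (hz : 0 < z.im) (i j : n) :
    Function.update (fun k => green A z k j) i 0 = (green (minor A i) z).mulVec
        (Function.update (Pi.single j 1) i 0 + green A z i j • rowVec A i) := by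
  have h1 := green_mulVec_shifted (z := z) (isSymm_minor hA i) hz
    (Function.update (fun k => green A z k j) i 0)
  rw [← h1]; congr 1; ext k
  rw [shifted_minor_mulVec hA]
  have h2 : (shifted A z).mulVec (fun k => green A z k j) = Pi.single j 1 := by
    have := shifted_mulVec_green (z := z) hA hz (Pi.single j 1)
    rwa [show (green A z).mulVec (Pi.single j 1) = fun k => green A z k j from
      funext fun k => green_mulVec_single j k] at this
  rw [h2]
  by_cases hk : k = i
  · subst hk; simp [rowVec]
  · simp [hk]

/-- The Schur complement formula. -/
lemma green_mul_schur (hA : A.IsSymm) (hz : 0 < z.im) (i : n) : green A z i i * (z - A i i -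
      ∑ j, rowVec A i j * ((green (minor A i) z).mulVec (rowVec A i)) j) = 1 := by
  have h1 := update_green_eq (z := z) hA hz i i
  have h2 : Function.update (Pi.single i (1 : ℂ) : n → ℂ) i 0 = 0 := by
    ext k; by_cases hk : k = i
    · subst hk; simp
    · simp [hk]
  rw [h2, zero_add, Matrix.mulVec_smul] at h1
  have h3 := congrFun (shifted_mulVec_green (z := z) hA hz (Pi.single i 1)) i
  rw [shifted_mulVec] at h3
  simp_rw [green_mulVec_single] at h3; rw [Pi.single_eq_same] at h3
  have h4 : ∑ k, (A i k : ℂ) * green A z k i = A i i * green A z i i +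
      ∑ k, rowVec A i k * Function.update (fun k => green A z k i) i 0 k := by
    have : ∀ k, (A i k : ℂ) * green A z k i = (if k = i then (A i i : ℂ) * green A z i i else 0) +
        rowVec A i k * Function.update (fun k => green A z k i) i 0 k := by
      intro k
      by_cases hk : k = i
      · subst hk; simp [rowVec]
      · simp [rowVec, hk]
    rw [sum_congr rfl fun k _ => this k, sum_add_distrib,
      sum_ite_eq' Finset.univ i, if_pos (Finset.mem_univ i)]
  rw [h4, h1] at h3; simp only [Pi.smul_apply, smul_eq_mul] at h3
  rw [← h3, mul_sub, mul_sub, mul_sum]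
  have h5 : ∀ k, rowVec A i k * (green A z i i *
      ((green (minor A i) z).mulVec (rowVec A i)) k) = green A z i i *
      (rowVec A i k * ((green (minor A i) z).mulVec (rowVec A i)) k) := fun k => by ring
  simp_rw [h5]; ring

/-- The columns `i` and `j` in `update_green_eq` differ from those of the minor by multiples of one
and the same vector, which can be eliminated. -/
lemma green_sub_green_minor (hA : A.IsSymm) (hz : 0 < z.im) {i j : n} (hij : j ≠ i) :
    green A z i i * (green A z j j - green (minor A i) z j j) = green A z j i ^ 2 := by
  have h1 := congrFun (update_green_eq (z := z) hA hz i i) j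
  have h2 := congrFun (update_green_eq (z := z) hA hz i j) j
  have e1 : Function.update (Pi.single i (1 : ℂ) : n → ℂ) i 0 = 0 := by
    ext k; by_cases hk : k = i
    · subst hk; simp
    · simp [hk]
  have e2 : Function.update (Pi.single j (1 : ℂ) : n → ℂ) i 0 = Pi.single j 1 := by
    ext k; by_cases hk : k = i
    · subst hk; simp [hij.symm]
    · simp [hk]
  rw [e1, zero_add, Matrix.mulVec_smul, Function.update_of_ne hij, Pi.smul_apply, smul_eq_mul] at h1
  rw [e2, Matrix.mulVec_add, Matrix.mulVec_smul, Function.update_of_ne hij, Pi.add_apply,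
    green_mulVec_single, Pi.smul_apply, smul_eq_mul] at h2
  have h3 : green A z i j = green A z j i := (isSymm_green hA).apply j i
  rw [h3] at h2; rw [h2, add_sub_cancel_left, sq]
  nth_rewrite 3 [h1]
  ring

/-- The Ward identity bounds `∑ |G_ji|² / |G_ii|` by `1 / Im z`, and the index `i` itself costs at
most `2 / Im z`. The total effect of one row is thus bounded independently of the dimension. -/
lemma sum_norm_green_sub_minor_le (hA : A.IsSymm) (hz : 0 < z.im) (i : n) :
    ∑ j, ‖green A z j j - green (minor A i) z j j‖ ≤ 3 / z.im := by
  have hpos : 0 < ‖green A z i i‖ := norm_pos_iff.2 fun h => by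
    have := im_green_neg (z := z) hA hz i
    simp [h] at this
  have h1 : ∀ j, ‖green A z j j - green (minor A i) z j j‖ ≤
      (if j = i then 2 / z.im else 0) + ‖green A z j i‖ ^ 2 / ‖green A z i i‖ := by
    intro j
    by_cases hj : j = i
    · subst hj; rw [if_pos rfl]
      have h2 := norm_green_le (z := z) hA hz j j
      have h3 := norm_green_le (z := z) (isSymm_minor hA j) hz j j
      have h4 : 0 ≤ ‖green A z j j‖ ^ 2 / ‖green A z j j‖ := by positivity
      refine (norm_sub_le _ _).trans ?_
      have : 2 / z.im = 1 / z.im + 1 / z.im := by ring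
      linarith
    · rw [if_neg hj, zero_add, le_div_iff₀ hpos, mul_comm, ← norm_mul,
        green_sub_green_minor hA hz hj, norm_pow]
  calc _ ≤ ∑ j, ((if j = i then 2 / z.im else 0) + ‖green A z j i‖ ^ 2 / ‖green A z i i‖) :=
        sum_le_sum fun j _ => h1 j
    _ = 2 / z.im + (∑ j, ‖green A z j i‖ ^ 2) / ‖green A z i i‖ := by
        rw [sum_add_distrib, sum_ite_eq' Finset.univ i, if_pos (Finset.mem_univ i), Finset.sum_div]
    _ ≤ 2 / z.im + 1 / z.im := by
        refine add_le_add le_rfl ?_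
        rw [div_le_div_iff₀ hpos hz, one_mul, mul_comm, ← neg_im_green hA hz i]
        exact (neg_le_abs _).trans (abs_im_le_norm _)
    _ = _ := by ring

lemma green_sub_green (hA : A.IsSymm) (hB : B.IsSymm) (hz : 0 < z.im) : green A z - green B z =
      green A z * (A - B).map (fun t : ℝ => (t : ℂ)) * green B z := by
  have h1 : (A - B).map (fun t : ℝ => (t : ℂ)) = shifted B z - shifted A z := by
    ext i j; simp [shifted]
  rw [h1, mul_sub, sub_mul, mul_assoc, green, green,
    Matrix.mul_nonsing_inv _ (isUnit_det_shifted hB hz), mul_one,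
    Matrix.nonsing_inv_mul _ (isUnit_det_shifted hA hz), one_mul]

/-- The resolvent identity and cyclicity of the trace give `tr ((A - B) G_B G_A)`; Cauchy-Schwarz
for the Hilbert-Schmidt norm concludes. -/
lemma norm_trace_green_sub_sq_le (hA : A.IsSymm) (hB : B.IsSymm) (hz : 0 < z.im) :
    ‖(green A z).trace - (green B z).trace‖ ^ 2 ≤
      (∑ i, ∑ j, (A i j - B i j) ^ 2) * ((1 / z.im) ^ 4 * Fintype.card n) := by
  set D := (A - B).map (fun t : ℝ => (t : ℂ)) with hD
  set W := green B z * green A z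
  have h1 : (green A z).trace - (green B z).trace = ∑ p : n × n, D p.1 p.2 * W p.2 p.1 := by
    rw [← Matrix.trace_sub, green_sub_green hA hB hz, mul_assoc, Matrix.trace_mul_comm, mul_assoc,
      Matrix.trace, Fintype.sum_prod_type]
    rfl
  have : ∑ p : n × n, ‖W p.2 p.1‖ ^ 2 ≤ (1 / z.im) ^ 4 * Fintype.card n := by
    rw [Fintype.sum_prod_type]
    calc _ ≤ ∑ _j : n, (1 / z.im) ^ 4 := by
          refine sum_le_sum fun j _ => ?_
          have h3 : ∀ k, W k j = ((green B z).mulVec fun l => green A z l j) k := fun k => rfl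
          simp_rw [h3]
          refine (sum_norm_sq_green_le hB hz _).trans ?_
          calc _ ≤ (1 / z.im) ^ 2 * (1 / z.im) ^ 2 := by
                gcongr; exact sum_norm_sq_green_col_le hA hz j
            _ = _ := by ring
      _ = _ := by rw [sum_const, card_univ, nsmul_eq_mul, mul_comm]
  rw [h1]
  calc _ ≤ (∑ p : n × n, ‖D p.1 p.2‖ * ‖W p.2 p.1‖) ^ 2 := by
        gcongr
        refine (norm_sum_le _ _).trans (le_of_eq (sum_congr rfl fun p _ => norm_mul _ _))
    _ ≤ (∑ p : n × n, ‖D p.1 p.2‖ ^ 2) * ∑ p : n × n, ‖W p.2 p.1‖ ^ 2 :=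
        Finset.sum_mul_sq_le_sq_mul_sq _ _ _
    _ ≤ (∑ p : n × n, ‖D p.1 p.2‖ ^ 2) * ((1 / z.im) ^ 4 * Fintype.card n) := by gcongr
    _ = _ := by
        rw [Fintype.sum_prod_type]; congr 1
        refine sum_congr rfl fun i _ => sum_congr rfl fun j _ => ?_
        rw [hD, Matrix.map_apply, norm_real, Matrix.sub_apply, norm_eq_abs, sq_abs]

/-- Cramer's rule: the entry is a cofactor times the inverse of the determinant, with the convention
that the inverse of `0` is `0`. -/
lemma measurable_green {Ω : Type*} [MeasurableSpace Ω] [TopologicalSpace Ω]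
    [OpensMeasurableSpace Ω] {F : Ω → Matrix n n ℝ} (hF : Continuous F) (z : ℂ) (i j : n) :
    Measurable fun ω => green (F ω) z i j := by
  have h1 : Continuous fun ω => shifted (F ω) z := by
    unfold shifted
    exact continuous_const.sub (hF.matrix_map continuous_ofReal)
  have h2 : ∀ ω, green (F ω) z i j = (shifted (F ω) z).det⁻¹ * (shifted (F ω) z).adjugate i j := by
    intro ω
    rw [green, Matrix.inv_def, Ring.inverse_eq_inv', Matrix.smul_apply, smul_eq_mul]
  simp_rw [h2]
  exact h1.matrix_det.measurable.inv.mul (h1.matrix_adjugate.matrix_elem i j).measurable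

end Green

/-! ### The spectral measure -/

section Spectral

variable {N : ℕ} {A : Matrix (Fin N) (Fin N) ℝ} {z : ℂ}

lemma isHermitian_of_isSymm (hA : A.IsSymm) : A.IsHermitian := by
  rw [Matrix.IsHermitian, Matrix.conjTranspose_eq_transpose_of_trivial]; exact hA

lemma spectralMeasure_eq (hA : A.IsSymm) : spectralMeasure A = (N : ℝ≥0∞)⁻¹ •
      ∑ i, Measure.dirac ((isHermitian_of_isSymm hA).eigenvalues i) := by
  rw [spectralMeasure, (isHermitian_of_isSymm hA).roots_charpoly_eq_eigenvalues, Multiset.map_map]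
  rfl

lemma isProbabilityMeasure_spectralMeasure (hN : 0 < N) (hA : A.IsSymm) :
    IsProbabilityMeasure (spectralMeasure A) := by
  constructor
  rw [spectralMeasure_eq hA, Measure.smul_apply, Measure.finsetSum_apply]
  simp only [measure_univ, sum_const, card_univ, Fintype.card_fin, nsmul_eq_mul,
    mul_one, smul_eq_mul]
  exact ENNReal.inv_mul_cancel (by exact_mod_cast hN.ne') (ENNReal.natCast_ne_top N)

/-- The real orthogonal diagonalization of `A` is mapped to complex matrices and inverted on the
diagonal. -/
lemma trace_green_eq (hA : A.IsSymm) (hz : 0 < z.im) :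
    (green A z).trace = ∑ i, 1 / (z - ((isHermitian_of_isSymm hA).eigenvalues i : ℂ)) := by
  set h := isHermitian_of_isSymm hA
  set c : ℝ →+* ℂ := Complex.ofRealHom
  set U : Matrix (Fin N) (Fin N) ℝ := (h.eigenvectorUnitary : Matrix (Fin N) (Fin N) ℝ)
  have hspec : A = U * Matrix.diagonal h.eigenvalues * star U := by
    have := h.spectral_theorem
    rw [Unitary.conjStarAlgAut_apply] at this; exact this
  have hUU : U * star U = 1 := Unitary.coe_mul_star_self h.eigenvectorUnitary
  have hUU' : star U * U = 1 := Unitary.coe_star_mul_self h.eigenvectorUnitary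
  set V := U.map c with hV
  set W := (star U).map c with hW
  have hVW : V * W = 1 := by
    rw [hV, hW, ← Matrix.map_mul, hUU, Matrix.map_one _ (map_zero c) (map_one c)]
  have hWV : W * V = 1 := by
    rw [hV, hW, ← Matrix.map_mul, hUU', Matrix.map_one _ (map_zero c) (map_one c)]
  have hAmap : A.map (fun t : ℝ => (t : ℂ)) =
      V * Matrix.diagonal (fun i => (h.eigenvalues i : ℂ)) * W := by
    have h1 : A.map c = _ := congrArg (fun M : Matrix (Fin N) (Fin N) ℝ => M.map c) hspec
    simp only [Matrix.map_mul, Matrix.diagonal_map (map_zero c)] at h1; exact h1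
  have hsh : shifted A z = V * Matrix.diagonal (fun i => z - (h.eigenvalues i : ℂ)) * W := by
    rw [shifted, hAmap, ← Matrix.diagonal_sub, mul_sub, sub_mul]; congr 1
    rw [Matrix.scalar_apply, ← Matrix.scalar_apply, ← Matrix.scalar_commute z (fun _ => mul_comm _ _) V,
      mul_assoc, hVW, mul_one]
  have hg : green A z = V * Matrix.diagonal (fun i => 1 / (z - (h.eigenvalues i : ℂ))) * W := by
    refine Matrix.inv_eq_right_inv ?_
    rw [hsh]
    calc _ = V * Matrix.diagonal (fun i => z - (h.eigenvalues i : ℂ)) * (W * V) *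
          Matrix.diagonal (fun i => 1 / (z - (h.eigenvalues i : ℂ))) * W := by
          simp only [mul_assoc]
      _ = V * (Matrix.diagonal (fun i => z - (h.eigenvalues i : ℂ)) *
          Matrix.diagonal (fun i => 1 / (z - (h.eigenvalues i : ℂ)))) * W := by
          rw [hWV, mul_one]; simp only [mul_assoc]
      _ = 1 := by
          rw [Matrix.diagonal_mul_diagonal]
          have : (fun i => (z - (h.eigenvalues i : ℂ)) * (1 / (z - (h.eigenvalues i : ℂ)))) =
              fun _ => (1 : ℂ) := by
            ext i; exact mul_one_div_cancel (sub_ofReal_ne_zero hz _)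
          rw [this, Matrix.diagonal_one, mul_one, hVW]
  rw [hg, Matrix.trace_mul_comm, ← mul_assoc, hWV, one_mul, Matrix.trace_diagonal]

lemma integral_spectralMeasure (hA : A.IsSymm) (f : ℝ → ℂ) : ∫ t, f t ∂(spectralMeasure A) =
      (N : ℂ)⁻¹ * ∑ i, f ((isHermitian_of_isSymm hA).eigenvalues i) := by
  rw [spectralMeasure_eq hA, integral_smul_measure, integral_finsetSum_measure]
  · simp only [integral_dirac, ENNReal.toReal_inv, ENNReal.toReal_natCast, real_smul,
      ofReal_inv, Complex.ofReal_natCast]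
  · intro i _; exact integrable_dirac (by simp)

lemma stieltjes_spectralMeasure (hA : A.IsSymm) (hz : 0 < z.im) :
    stieltjes (spectralMeasure A) z = (N : ℂ)⁻¹ * (green A z).trace := by
  rw [stieltjes, integral_spectralMeasure hA, trace_green_eq hA hz]

end Spectral

/-! ### Product spaces: resampling and bounded differences -/

section Product

variable {ι κ : Type*} [Fintype ι] [Fintype κ] (ν : Measure ℝ) [IsProbabilityMeasure ν]

/-- Resampling the coordinates in the range of an injection preserves a product measure. -/
lemma measurePreserving_extend {e : κ → ι} (he : Function.Injective e) :
    MeasurePreserving (fun p : (κ → ℝ) × (ι → ℝ) => Function.extend e p.1 p.2)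
      ((Measure.pi fun _ => ν).prod (Measure.pi fun _ => ν)) (Measure.pi fun _ => ν) := by
  classical
  have hmeas : Measurable fun p : (κ → ℝ) × (ι → ℝ) => Function.extend e p.1 p.2 := by
    refine measurable_pi_lambda _ fun i => ?_
    by_cases hi : ∃ k, e k = i
    · obtain ⟨k, rfl⟩ := hi
      simp_rw [he.extend_apply]; fun_prop
    · simp_rw [Function.extend_apply' _ _ _ hi]; fun_prop
  refine ⟨hmeas, (Measure.pi_eq fun s hs => ?_).symm⟩
  rw [Measure.map_apply hmeas (MeasurableSet.univ_pi hs)]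
  -- The coordinates that get overwritten are unconstrained in the second factor.
  set t : ι → Set ℝ := fun i => if ∃ k, e k = i then univ else s i with ht
  have hpre : (fun p : (κ → ℝ) × (ι → ℝ) => Function.extend e p.1 p.2) ⁻¹' (univ.pi s) =
      (univ.pi fun k => s (e k)) ×ˢ univ.pi t := by
    ext ⟨y, ω⟩
    simp only [mem_preimage, mem_univ_pi, mem_prod]; constructor
    · intro h
      refine ⟨fun k => by simpa [he.extend_apply] using h (e k), fun i => ?_⟩
      by_cases hi : ∃ k, e k = i
      · simp [ht, hi]
      · have := h i
        rw [Function.extend_apply' _ _ _ hi] at this; simpa only [ht, if_neg hi] using this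
    · rintro ⟨h1, h2⟩ i
      by_cases hi : ∃ k, e k = i
      · obtain ⟨k, rfl⟩ := hi
        rw [he.extend_apply]; exact h1 k
      · rw [Function.extend_apply' _ _ _ hi]
        have := h2 i
        simpa only [ht, if_neg hi] using this
  rw [hpre, Measure.prod_prod, Measure.pi_pi, Measure.pi_pi]
  have h1 : ∏ k, ν (s (e k)) = ∏ i, if ∃ k, e k = i then ν (s i) else 1 := by
    rw [Finset.prod_ite, Finset.prod_const_one, mul_one]
    have : (Finset.univ.filter fun i => ∃ k, e k = i) = Finset.univ.image e := by ext i; simp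
    rw [this, Finset.prod_image fun a _ b _ h => he h]
  rw [h1, ← Finset.prod_mul_distrib]
  refine Finset.prod_congr rfl fun i _ => ?_
  by_cases hi : ∃ k, e k = i
  · simp [ht, hi]
  · simp only [ht, if_neg hi, one_mul]

lemma integral_extend {e : κ → ι} (he : Function.Injective e) {E : Type*} [NormedAddCommGroup E]
    [NormedSpace ℝ E] {F : (ι → ℝ) → E} (hF : Integrable F (Measure.pi fun _ => ν)) :
    ∫ ω, F ω ∂(Measure.pi fun _ => ν) =
      ∫ ω, ∫ y, F (Function.extend e y ω) ∂(Measure.pi fun _ => ν) ∂(Measure.pi fun _ => ν) := by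
  have hmp := measurePreserving_extend ν he
  have h1 := hmp.integrable_comp_of_integrable hF
  have h2 := integral_map (μ := (Measure.pi fun _ => ν).prod (Measure.pi fun _ => ν))
    hmp.measurable.aemeasurable (by rw [hmp.map_eq]; exact hF.1)
  rw [hmp.map_eq] at h2; rw [h2]; exact integral_prod_symm _ h1

/-! ### A variance bound by exchange of independent copies -/

section BoundedDifferences

variable {n : ℕ} (b : ι → Fin n)

/-- The hybrid of the two components of `p`: the blocks before `k` are taken from the second. -/
def hybrid (k : ℕ) (p : ι → ℝ × ℝ) (i : ι) : ℝ := if (b i : ℕ) < k then (p i).2 else (p i).1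

/-- The exchange of the two components of `p` on the block `k`. -/
def exchange (k : ℕ) (p : ι → ℝ × ℝ) (i : ι) : ℝ × ℝ := if (b i : ℕ) = k then (p i).swap else p i

omit [Fintype ι] in
lemma measurable_hybrid (k : ℕ) : Measurable (hybrid b k) := by
  refine measurable_pi_lambda _ fun i => ?_
  by_cases h : (b i : ℕ) < k
  · simp only [hybrid, if_pos h]; fun_prop
  · simp only [hybrid, if_neg h]; fun_prop

lemma measurePreserving_exchange (k : ℕ) :
    MeasurePreserving (exchange b k) (Measure.pi fun _ => ν.prod ν)
      (Measure.pi fun _ => ν.prod ν) := by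
  refine measurePreserving_pi (μ := fun _ => ν.prod ν) (ν := fun _ => ν.prod ν)
    (f := fun i q => if (b i : ℕ) = k then q.swap else q) fun i => ?_
  by_cases h : (b i : ℕ) = k
  · simp only [if_pos h]; exact Measure.measurePreserving_swap
  · simp only [if_neg h]; exact MeasurePreserving.id _

omit [Fintype ι] in
lemma hybrid_exchange (k : ℕ) (p : ι → ℝ × ℝ) :
    hybrid b k (exchange b k p) = hybrid b (k + 1) p := by
  ext i; simp only [hybrid, exchange]
  rcases lt_trichotomy (b i : ℕ) k with h | h | h
  · rw [if_pos h, if_neg h.ne, if_pos (by omega)]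
  · rw [if_neg h.not_lt, if_pos h, if_pos (by omega)]; rfl
  · rw [if_neg (by omega), if_neg h.ne', if_neg (by omega)]

omit [Fintype ι] in
lemma hybrid_succ_exchange (k : ℕ) (p : ι → ℝ × ℝ) :
    hybrid b (k + 1) (exchange b k p) = hybrid b k p := by
  ext i; simp only [hybrid, exchange]
  rcases lt_trichotomy (b i : ℕ) k with h | h | h
  · rw [if_pos (by omega), if_neg h.ne, if_pos h]
  · rw [if_pos (by omega), if_pos h, if_neg h.not_lt]; rfl
  · rw [if_neg (by omega), if_neg h.ne', if_neg (by omega)]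

/-- The bounded differences inequality for the variance. -/
lemma integral_norm_sub_integral_sq_le {F : (ι → ℝ) → ℂ} (hF : Measurable F) {M D : ℝ}
    (hM : ∀ ω, ‖F ω‖ ≤ M)
    (hD : ∀ (k : ℕ) (ω ω' : ι → ℝ), (∀ i, (b i : ℕ) ≠ k → ω i = ω' i) → ‖F ω - F ω'‖ ≤ D) :
    ∫ ω, ‖F ω - ∫ ω', F ω' ∂(Measure.pi fun _ => ν)‖ ^ 2 ∂(Measure.pi fun _ => ν) ≤ n * D ^ 2 := by
  set P := Measure.pi fun _ : ι => ν
  set Q := Measure.pi fun _ : ι => ν.prod ν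
  set m := ∫ ω, F ω ∂P with hm
  have hFi : Integrable F P := integrable_of_bound hF hM
  have hD0 : 0 ≤ D := (norm_nonneg _).trans (hD 0 0 0 fun _ _ => rfl)
  have hM0 : 0 ≤ M := (norm_nonneg _).trans (hM 0)
  have hfst : MeasurePreserving (hybrid b 0) Q P := by
    refine measurePreserving_pi (μ := fun _ => ν.prod ν) (ν := fun _ => ν)
      (f := fun i q => if (b i : ℕ) < 0 then q.2 else q.1) fun i => ?_
    simp only [Nat.not_lt_zero, if_false]; exact measurePreserving_fst
  have hpair : MeasurePreserving (fun p : ι → ℝ × ℝ => (hybrid b 0 p, hybrid b n p)) Q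
      (P.prod P) := by
    have h1 := measurePreserving_arrowProdEquivProdArrow ℝ ℝ ι (fun _ => ν) (fun _ => ν)
    have h2 : (fun p : ι → ℝ × ℝ => (hybrid b 0 p, hybrid b n p)) =
        MeasurableEquiv.arrowProdEquivProdArrow ℝ ℝ ι := by
      funext p
      refine Prod.ext (funext fun i => ?_) (funext fun i => ?_)
      · simp [hybrid, MeasurableEquiv.arrowProdEquivProdArrow, Equiv.arrowProdEquivProdArrow]
      · simp [hybrid, MeasurableEquiv.arrowProdEquivProdArrow, Equiv.arrowProdEquivProdArrow]
    rw [h2]; exact h1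
  have hInt : ∀ {f g : (ι → ℝ × ℝ) → ℂ}, Measurable f → Measurable g → (∀ p, ‖f p‖ ≤ 2 * M) →
      (∀ p, ‖g p‖ ≤ 2 * M) → Integrable (fun p => f p * conj (g p)) Q := by
    intro f g hf hg hfb hgb
    refine Integrable.of_bound (C := 2 * M * (2 * M)) ?_ (.of_forall fun p => ?_)
    · exact (hf.mul (continuous_conj.measurable.comp hg)).aestronglyMeasurable
    · rw [norm_mul, RCLike.norm_conj]
      exact mul_le_mul (hfb p) (hgb p) (norm_nonneg _) (by positivity)
  set f : ℕ → (ι → ℝ × ℝ) → ℂ := fun k p => F (hybrid b k p) with hf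
  have hfm : ∀ k, Measurable (f k) := fun k => hF.comp (measurable_hybrid b k)
  have hfb : ∀ k p, ‖f k p‖ ≤ 2 * M := fun k p => (hM _).trans (by linarith)
  have hdm : ∀ k, Measurable fun p => f k p - f (k + 1) p := fun k => (hfm k).sub (hfm _)
  have hdb : ∀ k p, ‖f k p - f (k + 1) p‖ ≤ 2 * M := fun k p =>
    (norm_sub_le _ _).trans (by linarith [hM (hybrid b k p), hM (hybrid b (k + 1) p)])
  -- Exchanging block `k` preserves the law and swaps `f k` with `f (k + 1)`. Averaging the integral
  -- with its exchanged form puts a difference on the factor `f 0` too, so both factors are at most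
  -- `D`.
  have hterm : ∀ k, ‖∫ p, f 0 p * conj (f k p - f (k + 1) p) ∂Q‖ ≤ D ^ 2 := by
    intro k
    set I := ∫ p, f 0 p * conj (f k p - f (k + 1) p) ∂Q with hI
    have hmp := measurePreserving_exchange ν b k
    have h1 : I = ∫ p, f 0 (exchange b k p) * conj (f (k + 1) p - f k p) ∂Q := by
      have h2 := integral_map (μ := Q) hmp.measurable.aemeasurable
        (f := fun p => f 0 p * conj (f k p - f (k + 1) p))
        (by rw [hmp.map_eq]; exact (hInt (hfm 0) (hdm k) (hfb 0) (hdb k)).1)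
      rw [hmp.map_eq] at h2; rw [hI, h2]
      refine integral_congr_fun fun p => ?_
      simp only [hf, hybrid_exchange, hybrid_succ_exchange]
    have h3 : 2 * I = ∫ p, (f 0 p - f 0 (exchange b k p)) * conj (f k p - f (k + 1) p) ∂Q := by
      have h4 : 2 * I = I + I := by ring
      rw [h4]
      nth_rewrite 2 [h1]
      have hi2 : Integrable (fun p => f 0 (exchange b k p) * conj (f (k + 1) p - f k p)) Q :=
        hInt (f := fun p => f 0 (exchange b k p)) (g := fun p => f (k + 1) p - f k p)
          ((hfm 0).comp hmp.measurable) ((hfm _).sub (hfm _)) (fun p => hfb 0 _)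
          (fun p => by rw [norm_sub_rev]; exact hdb k p)
      rw [hI, ← integral_add (hInt (hfm 0) (hdm k) (hfb 0) (hdb k)) hi2]
      refine integral_congr_fun fun p => ?_
      simp only [map_sub]; ring
    have h5 : ‖2 * I‖ ≤ D ^ 2 := by
      rw [h3]
      refine norm_integral_le_of_forall_le fun p => ?_
      rw [norm_mul, RCLike.norm_conj, sq]
      refine mul_le_mul (hD k _ _ fun i hi => ?_) (hD k _ _ fun i hi => ?_) (norm_nonneg _) hD0
      · simp only [hybrid, exchange, if_neg hi]
      · simp only [hybrid]
        rcases lt_or_gt_of_ne hi with h | h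
        · rw [if_pos h, if_pos (by omega)]
        · rw [if_neg (by omega), if_neg (by omega)]
    rw [norm_mul, norm_ofNat] at h5
    have := norm_nonneg I
    linarith
  -- The hybrid with index `n` is an independent copy of the hybrid with index `0`, so the variance
  -- is `E F(ω) conj (F(ω) - F(ω'))`, which telescopes over hybrids.
  have hvar : ((∫ ω, ‖F ω - m‖ ^ 2 ∂P : ℝ) : ℂ) = ∫ p, f 0 p * conj (f 0 p - f n p) ∂Q := by
    have hFsq : Integrable (fun ω => F ω * conj (F ω)) P := by
      refine Integrable.of_bound (C := M * M) ?_ (.of_forall fun p => ?_)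
      · exact (hF.mul (continuous_conj.measurable.comp hF)).aestronglyMeasurable
      · rw [norm_mul, RCLike.norm_conj]
        exact mul_le_mul (hM p) (hM p) (norm_nonneg _) hM0
    have hFc : Integrable (fun ω => conj (F ω)) P :=
      integrable_of_bound (C := M) (continuous_conj.measurable.comp hF) fun ω => by rw [RCLike.norm_conj]; exact hM ω
    have hmc : ∫ ω, conj (F ω) ∂P = conj m := integral_conj
    have e1 : ((∫ ω, ‖F ω - m‖ ^ 2 ∂P : ℝ) : ℂ) = ∫ ω, F ω * conj (F ω) ∂P - m * conj m := by
      rw [← integral_complex_ofReal]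
      have e2 : ∀ ω, ((‖F ω - m‖ ^ 2 : ℝ) : ℂ) = F ω * conj (F ω) -
          conj m * F ω - m * conj (F ω) + m * conj m := by
        intro ω; push_cast; rw [← Complex.mul_conj', map_sub]; ring
      simp_rw [e2]
      have hi1 : Integrable (fun ω => F ω * conj (F ω) - conj m * F ω) P :=
        hFsq.sub (hFi.const_mul _)
      have hi2 : Integrable (fun ω => F ω * conj (F ω) - conj m * F ω -
          m * conj (F ω)) P := hi1.sub (hFc.const_mul _)
      rw [integral_add hi2 (integrable_const _), integral_sub hi1 (hFc.const_mul _),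
        integral_sub hFsq (hFi.const_mul _), integral_const_mul, integral_const_mul, hmc]
      simp only [integral_const, probReal_univ, one_smul, ← hm]; ring
    have e3 : ∫ p, f 0 p * conj (f 0 p) ∂Q = ∫ ω, F ω * conj (F ω) ∂P := by
      have h2 := integral_map (μ := Q) hfst.measurable.aemeasurable
        (f := fun ω => F ω * conj (F ω)) (by rw [hfst.map_eq]; exact hFsq.1)
      rw [hfst.map_eq] at h2; rw [h2]
    have e4 : ∫ p, f 0 p * conj (f n p) ∂Q = m * conj m := by
      have h2 := integral_map (μ := Q) hpair.measurable.aemeasurable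
        (f := fun q : (ι → ℝ) × (ι → ℝ) => F q.1 * conj (F q.2))
        (by
          rw [hpair.map_eq]
          exact (hFi.mul_prod hFc).1)
      rw [hpair.map_eq, integral_prod_mul (fun ω => F ω) (fun ω => conj (F ω)), hmc] at h2
      rw [h2]
    rw [e1, ← e3, ← e4, ← integral_sub (hInt (hfm 0) (hfm 0) (hfb 0) (hfb 0))
      (hInt (hfm 0) (hfm n) (hfb 0) (hfb n))]
    refine integral_congr_fun fun p => ?_
    simp only [map_sub]; ring
  have htel : ∫ p, f 0 p * conj (f 0 p - f n p) ∂Q =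
      ∑ k ∈ Finset.range n, ∫ p, f 0 p * conj (f k p - f (k + 1) p) ∂Q := by
    rw [← integral_finsetSum _ fun k _ => hInt (hfm 0) (hdm k) (hfb 0) (hdb k)]
    refine integral_congr_fun fun p => ?_
    rw [← mul_sum, ← map_sum, Finset.sum_range_sub' (fun k => f k p)]
  have hnn : 0 ≤ ∫ ω, ‖F ω - m‖ ^ 2 ∂P := integral_nonneg fun ω => by positivity
  calc ∫ ω, ‖F ω - m‖ ^ 2 ∂P = ‖((∫ ω, ‖F ω - m‖ ^ 2 ∂P : ℝ) : ℂ)‖ := by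
        rw [norm_real, norm_of_nonneg hnn]
    _ ≤ ∑ _k ∈ Finset.range n, D ^ 2 := by
        rw [hvar, htel]
        exact (norm_sum_le _ _).trans (sum_le_sum fun k _ => hterm k)
    _ = n * D ^ 2 := by rw [sum_const, Finset.card_range, nsmul_eq_mul]

end BoundedDifferences

end Product

/-! ### Resolvents of symmetric matrices with a variance profile -/

lemma norm_cpow_sub_cpow_le_of_le_norm {p m : ℝ} (hp0 : 0 < p) (hp1 : p ≤ 1) (hm : 0 < m)
    {S : Set ℂ} (hS : Convex ℝ S) (hre : ∀ u ∈ S, 0 < u.re) (hn : ∀ u ∈ S, m ≤ ‖u‖) {v w : ℂ}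
    (hv : v ∈ S) (hw : w ∈ S) : ‖w ^ (p : ℂ) - v ^ (p : ℂ)‖ ≤ m ^ (p - 1) * ‖w - v‖ := by
  refine hS.norm_image_sub_le_of_norm_hasDerivWithin_le (𝕜 := ℂ)
    (f := fun u : ℂ => u ^ (p : ℂ)) (f' := fun u => (p : ℂ) * u ^ ((p : ℂ) - 1))
    (fun u hu => ?_) (fun u hu => ?_) hv hw
  · exact (Complex.hasStrictDerivAt_cpow_const
      (mem_slitPlane_of_re_pos (hre u hu))).hasDerivAt.hasDerivWithinAt
  · have h1 : ((p : ℂ) - 1) = ((p - 1 : ℝ) : ℂ) := by push_cast; rfl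
    rw [norm_mul, h1, norm_cpow_real, norm_real, norm_of_nonneg hp0.le]
    have := rpow_le_rpow_of_nonpos hm (hn u hu) (show p - 1 ≤ 0 by linarith)
    have : 0 ≤ ‖u‖ ^ (p - 1) := by positivity
    nlinarith

/-- Powers are Hölder continuous on the right half-plane. -/
lemma norm_cpow_sub_cpow_le {p : ℝ} (hp0 : 0 < p) (hp1 : p ≤ 1) {v w : ℂ} (hv : 0 < v.re)
    (hw : 0 < w.re) : ‖w ^ (p : ℂ) - v ^ (p : ℂ)‖ ≤ 4 * ‖w - v‖ ^ p := by
  wlog h : ‖v‖ ≤ ‖w‖ generalizing v w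
  · rw [norm_sub_rev, norm_sub_rev w]; exact this hw hv (not_le.1 h).le
  have hw0 : 0 < ‖w‖ := norm_pos_iff.2 fun h0 => by simp [h0] at hw
  -- If `v` is close to `w` relative to `‖w‖`, the derivative bound applies on a convex region away
  -- from `0`. Otherwise `‖w‖ ^ p` is itself at most `2 ‖w - v‖ ^ p`.
  rcases lt_or_ge ‖w - v‖ (‖w‖ / 2) with h1 | h1
  · rcases eq_or_ne w v with rfl | hne
    · simp only [sub_self, norm_zero]; positivity
    have hd : 0 < ‖w - v‖ := norm_pos_iff.2 (sub_ne_zero.2 hne)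
    have h2 := norm_cpow_sub_cpow_le_of_le_norm hp0 hp1 (half_pos hw0)
      (S := {u : ℂ | 0 < u.re} ∩ ball w (‖w‖ / 2))
      ((convex_halfSpace_re_gt 0).inter (convex_ball _ _)) (fun u hu => hu.1) (fun u hu => by
        have h3 : ‖u - w‖ < ‖w‖ / 2 := mem_ball_iff_norm.1 hu.2
        have h4 := norm_sub_norm_le w u
        rw [norm_sub_rev] at h4
        linarith) (v := v) (w := w)
      ⟨hv, by rw [mem_ball_iff_norm, norm_sub_rev]; exact h1⟩
      ⟨hw, mem_ball_self (half_pos hw0)⟩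
    have h3 := rpow_le_rpow_of_nonpos hd h1.le (show p - 1 ≤ 0 by linarith)
    have h4 : ‖w - v‖ ^ (p - 1) * ‖w - v‖ = ‖w - v‖ ^ p := by
      rw [← Real.rpow_add_one hd.ne', sub_add_cancel]
    have h5 : 0 ≤ ‖w - v‖ ^ p := by positivity
    nlinarith [mul_le_mul_of_nonneg_right h3 hd.le]
  · have h2 : ‖w‖ ^ p ≤ 2 * ‖w - v‖ ^ p := by
      calc ‖w‖ ^ p ≤ (2 * ‖w - v‖) ^ p := rpow_le_rpow hw0.le (by linarith) hp0.le
        _ = 2 ^ p * ‖w - v‖ ^ p := mul_rpow (by norm_num) (norm_nonneg _)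
        _ ≤ 2 * ‖w - v‖ ^ p := by
          refine mul_le_mul_of_nonneg_right ?_ (by positivity)
          exact (Real.rpow_le_rpow_of_exponent_le one_le_two hp1).trans_eq (rpow_one 2)
    have h3 : ‖v‖ ^ p ≤ ‖w‖ ^ p := rpow_le_rpow (norm_nonneg _) h hp0.le
    refine (norm_sub_le _ _).trans ?_
    rw [norm_cpow_real, norm_cpow_real]; linarith

lemma rpow_le_rpow_add_mul {p δ t : ℝ} (hp0 : 0 < p) (hp1 : p ≤ 1) (hδ : 0 < δ) (ht : 0 ≤ t) :
    t ^ p ≤ δ ^ p + δ ^ (p - 1) * t := by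
  rcases le_or_gt t δ with h | h
  · have := rpow_le_rpow ht h hp0.le
    have : 0 ≤ δ ^ (p - 1) * t := by positivity
    linarith
  · have h1 := rpow_le_rpow_of_nonpos hδ h.le (show p - 1 ≤ 0 by linarith)
    have : t ^ (p - 1) * t = t ^ p := by
      rw [← Real.rpow_add_one (hδ.trans h).ne', sub_add_cancel]
    have : 0 ≤ δ ^ p := by positivity
    nlinarith [mul_le_mul_of_nonneg_right h1 ht]

/-- For a Hölder exponent `p`, a small constant plus a multiple of `t` dominates `4 t ^ p`. -/
lemma exists_four_mul_rpow_le {p ε : ℝ} (hp0 : 0 < p) (hp1 : p ≤ 1) (hε : 0 < ε) :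
    ∃ C : ℝ, 0 ≤ C ∧ ∀ t : ℝ, 0 ≤ t → 4 * t ^ p ≤ ε + C * t := by
  set δ := (ε / 4) ^ (1 / p) with hδ
  have hδ0 : 0 < δ := by positivity
  have h1 : δ ^ p = ε / 4 := by
    rw [hδ, ← rpow_mul (by positivity), one_div_mul_cancel hp0.ne', rpow_one]
  refine ⟨4 * δ ^ (p - 1), by positivity, fun t ht => ?_⟩
  have := rpow_le_rpow_add_mul hp0 hp1 hδ0 ht
  rw [h1] at this; linarith

section Profile

variable {N : ℕ}

/-- The symmetric matrix with independent entries `ω` and profile `σ`, scaled by `a⁻¹`. -/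
def profileMatrix (a : ℝ) (σ : Fin N → Fin N → ℝ) (ω : Sym2 (Fin N) → ℝ) :
    Matrix (Fin N) (Fin N) ℝ :=
  Matrix.of fun i j => a⁻¹ * (σ i j * ω s(i, j))

/-- The diagonal of the resolvent, rotated to the right half-plane. -/
def rotDiag (A : Matrix (Fin N) (Fin N) ℝ) (z : ℂ) (j : Fin N) : ℂ := I * green A z j j

variable {a : ℝ} {σ : Fin N → Fin N → ℝ} {ω : Sym2 (Fin N) → ℝ} {z : ℂ}
  {A B : Matrix (Fin N) (Fin N) ℝ}

lemma isSymm_profileMatrix (hσ : ∀ i j, σ i j = σ j i) : (profileMatrix a σ ω).IsSymm := by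
  ext i j
  simp only [profileMatrix, Matrix.transpose_apply, Matrix.of_apply, hσ i j, Sym2.eq_swap]

lemma continuous_profileMatrix : Continuous (profileMatrix a σ) :=
  continuous_matrix fun i j => by simp only [profileMatrix, Matrix.of_apply]; fun_prop

lemma re_rotDiag_pos (hA : A.IsSymm) (hz : 0 < z.im) (j : Fin N) : 0 < (rotDiag A z j).re :=
  re_I_mul_green_pos hA hz j

lemma norm_rotDiag_le (hA : A.IsSymm) (hz : 0 < z.im) (j : Fin N) : ‖rotDiag A z j‖ ≤ 1 / z.im := by
  rw [rotDiag, norm_mul, norm_I, one_mul]; exact norm_green_le hA hz j j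

lemma norm_rotDiag_cpow_le (hA : A.IsSymm) (hz : 0 < z.im) {p : ℝ} (hp : 0 ≤ p) (j : Fin N) :
    ‖rotDiag A z j ^ (p : ℂ)‖ ≤ (1 / z.im) ^ p := by
  rw [norm_cpow_real]
  exact rpow_le_rpow (norm_nonneg _) (norm_rotDiag_le hA hz j) hp

lemma sum_norm_rotDiag_sub_minor_le (hA : A.IsSymm) (hz : 0 < z.im) (i : Fin N) :
    ∑ j, ‖rotDiag A z j - rotDiag (minor A i) z j‖ ≤ 3 / z.im := by
  simp_rw [rotDiag, ← mul_sub, norm_mul, norm_I, one_mul]; exact sum_norm_green_sub_minor_le hA hz i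

/-- Both matrices are compared with their common minor. -/
lemma sum_norm_rotDiag_sub_le (hA : A.IsSymm) (hB : B.IsSymm) (hz : 0 < z.im) {i : Fin N}
    (h : minor A i = minor B i) : ∑ j, ‖rotDiag A z j - rotDiag B z j‖ ≤ 6 / z.im := by
  have h1 := sum_norm_rotDiag_sub_minor_le (z := z) hA hz i
  have h2 := sum_norm_rotDiag_sub_minor_le (z := z) hB hz i
  calc ∑ j, ‖rotDiag A z j - rotDiag B z j‖ ≤ ∑ j, (‖rotDiag A z j - rotDiag (minor A i) z j‖ +
        ‖rotDiag B z j - rotDiag (minor B i) z j‖) := by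
        refine sum_le_sum fun j _ => ?_
        rw [h, norm_sub_rev (rotDiag B z j)]; exact norm_sub_le_norm_sub_add_norm_sub _ _ _
    _ ≤ 3 / z.im + 3 / z.im := by rw [sum_add_distrib]; exact add_le_add h1 h2
    _ = 6 / z.im := by ring

lemma measurable_rotDiag (j : Fin N) : Measurable fun ω => rotDiag (profileMatrix a σ ω) z j :=
  (measurable_green continuous_profileMatrix z j j).const_mul _

lemma minor_profileMatrix_congr {ω' : Sym2 (Fin N) → ℝ} {i : Fin N}
    (h : ∀ j k, j ≠ i → k ≠ i → ω s(j, k) = ω' s(j, k)) :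
    minor (profileMatrix a σ ω) i = minor (profileMatrix a σ ω') i := by
  ext j k
  simp only [minor, profileMatrix, Matrix.of_apply]
  by_cases hjk : j = i ∨ k = i
  · rw [if_pos hjk, if_pos hjk]
  · rw [if_neg hjk, if_neg hjk, h j k (fun h => hjk (.inl h)) fun h => hjk (.inr h)]

lemma injective_mk_row (i : Fin N) : Function.Injective fun j => s(i, j) :=
  fun _ _ h => Sym2.congr_right.1 h

lemma minor_profileMatrix_extend (i : Fin N) (y : Fin N → ℝ) :
    minor (profileMatrix a σ (Function.extend (fun j => s(i, j)) y ω)) i =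
      minor (profileMatrix a σ ω) i := by
  refine minor_profileMatrix_congr fun j k hj hk => Function.extend_apply' _ _ _ ?_
  rintro ⟨l, hl⟩
  rcases Sym2.eq_iff.1 hl with h | h
  · exact hj h.1.symm
  · exact hk h.1.symm

/-- Resampling row `i` leaves the minor unchanged, so its resolvent is frozen while `y` varies. The
weights `r` omit the diagonal entry, which appears separately. -/
lemma rotDiag_extend_mul (hσ : ∀ i j, σ i j = σ j i) (hz : 0 < z.im) (i : Fin N)
    (y : Fin N → ℝ) {r : Fin N → ℝ} (hr : ∀ j, r j = if j = i then 0 else σ i j) :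
    rotDiag (profileMatrix a σ (Function.extend (fun j => s(i, j)) y ω)) z i *
      (-(I * z) + I * ((a⁻¹ * (σ i i * y i) : ℝ) : ℂ) +
        ∑ j, ∑ k, ((a⁻¹ * (r j * y j) * (a⁻¹ * (r k * y k)) : ℝ) : ℂ) *
          (I * green (minor (profileMatrix a σ ω) i) z j k)) = 1 := by
  have h1 := green_mul_schur (z := z) (isSymm_profileMatrix (a := a)
    (ω := Function.extend (fun j => s(i, j)) y ω) hσ) hz i
  have h2 : ∀ j, profileMatrix a σ (Function.extend (fun j => s(i, j)) y ω) i j =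
      a⁻¹ * (σ i j * y j) := by
    intro j
    rw [profileMatrix, Matrix.of_apply, (injective_mk_row i).extend_apply]
  have h3 : ∀ j, rowVec (profileMatrix a σ (Function.extend (fun j => s(i, j)) y ω)) i j =
      ((a⁻¹ * (r j * y j) : ℝ) : ℂ) := by
    intro j; rw [rowVec, hr]
    split_ifs
    · simp
    · rw [h2]
  rw [h2, minor_profileMatrix_extend] at h1
  simp_rw [h3, Matrix.mulVec, dotProduct, h3] at h1; rw [← h1, rotDiag]
  have h4 : ∑ j, ∑ k, ((a⁻¹ * (r j * y j) * (a⁻¹ * (r k * y k)) : ℝ) : ℂ) *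
      (I * green (minor (profileMatrix a σ ω) i) z j k) =
      I * ∑ j, ((a⁻¹ * (r j * y j) : ℝ) : ℂ) *
        ∑ k, green (minor (profileMatrix a σ ω) i) z j k * ((a⁻¹ * (r k * y k) : ℝ) : ℂ) := by
    simp_rw [mul_sum]
    refine sum_congr rfl fun j _ => sum_congr rfl fun k _ => ?_
    push_cast; ring
  rw [h4]
  linear_combination (-(green (profileMatrix a σ (Function.extend (fun j => s(i, j)) y ω)) z i i *
    (z - ((a⁻¹ * (σ i i * y i) : ℝ) : ℂ) - ∑ j, ((a⁻¹ * (r j * y j) : ℝ) : ℂ) *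
        ∑ k, green (minor (profileMatrix a σ ω) i) z j k *
          ((a⁻¹ * (r k * y k) : ℝ) : ℂ)))) * I_mul_I

/-- The resolvent entry and its diagonal approximation. -/
lemma norm_rotDiag_extend_sub_le (hσ : ∀ i j, σ i j = σ j i) (hz : 0 < z.im) (i : Fin N)
    (y : Fin N → ℝ) {r : Fin N → ℝ} (hr : ∀ j, r j = if j = i then 0 else σ i j) {V : ℂ}
    (hV : V = -(I * z) + ∑ j, (((a⁻¹ * (r j * y j)) ^ 2 : ℝ) : ℂ) *
      rotDiag (minor (profileMatrix a σ ω) i) z j) : z.im ≤ V.re ∧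
    ‖rotDiag (profileMatrix a σ (Function.extend (fun j => s(i, j)) y ω)) z i - V⁻¹‖ ≤
      (2 / z.im + 1 / z.im ^ 2) * (min 1 |a⁻¹ * (σ i i * y i)| +
        min 1 ‖∑ j, ∑ k, ((a⁻¹ * (r j * y j) * (a⁻¹ * (r k * y k)) : ℝ) : ℂ) *
          (I * green (minor (profileMatrix a σ ω) i) z j k) -
          ∑ j, (((a⁻¹ * (r j * y j)) ^ 2 : ℝ) : ℂ) *
            (I * green (minor (profileMatrix a σ ω) i) z j j)‖) := by
  have h1 := rotDiag_extend_mul (a := a) (ω := ω) hσ hz i y hr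
  set w := rotDiag (profileMatrix a σ (Function.extend (fun j => s(i, j)) y ω)) z i
  set Q := ∑ j, ∑ k, ((a⁻¹ * (r j * y j) * (a⁻¹ * (r k * y k)) : ℝ) : ℂ) *
          (I * green (minor (profileMatrix a σ ω) i) z j k)
  set d := a⁻¹ * (σ i i * y i)
  set T := ∑ j, (((a⁻¹ * (r j * y j)) ^ 2 : ℝ) : ℂ) *
      (I * green (minor (profileMatrix a σ ω) i) z j j) with hT
  change V = -(I * z) + T at hV
  have hw1 : ‖w‖ ≤ 1 / z.im := norm_rotDiag_le (isSymm_profileMatrix hσ) hz i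
  have hVre : z.im ≤ V.re := by
    rw [hV, add_re, re_neg_I_mul, hT, re_sum]
    have : 0 ≤ ∑ j, ((((a⁻¹ * (r j * y j)) ^ 2 : ℝ) : ℂ) *
      (I * green (minor (profileMatrix a σ ω) i) z j j)).re :=
      sum_nonneg fun j _ => by
        rw [re_ofReal_mul]
        exact mul_nonneg (sq_nonneg _)
          (re_I_mul_green_pos (isSymm_minor (isSymm_profileMatrix hσ) i) hz j).le
    linarith
  have hVn : z.im ≤ ‖V‖ := hVre.trans (re_le_norm V)
  have hV0 : V ≠ 0 := norm_pos_iff.1 (hz.trans_le hVn)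
  have hVi : ‖V⁻¹‖ ≤ 1 / z.im := by rw [norm_inv, ← one_div]; exact one_div_le_one_div_of_le hz hVn
  refine ⟨hVre, ?_⟩
  have h2 : w - V⁻¹ = -(w * V⁻¹ * (I * d + (Q - T))) := by
    have h3 : w - V⁻¹ = w * V * V⁻¹ - w * (-(I * z) + I * d + Q) * V⁻¹ := by
      rw [h1, one_mul, mul_assoc, mul_inv_cancel₀ hV0, mul_one]
    rw [h3, hV]; ring
  have h3 : ‖w - V⁻¹‖ ≤ 1 / z.im ^ 2 * (|d| + ‖Q - T‖) := by
    rw [h2, norm_neg, norm_mul, norm_mul]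
    have h4 : ‖I * (d : ℂ) + (Q - T)‖ ≤ |d| + ‖Q - T‖ := by
      refine (norm_add_le _ _).trans ?_
      rw [norm_mul, norm_I, one_mul, norm_real, norm_eq_abs]
    have h5 : (1 : ℝ) / z.im ^ 2 = 1 / z.im * (1 / z.im) := by ring
    rw [h5]; gcongr
  have h4 : ‖w - V⁻¹‖ ≤ 2 / z.im := (norm_sub_le _ _).trans (by
    rw [show (2 : ℝ) / z.im = 1 / z.im + 1 / z.im by ring]; exact add_le_add hw1 hVi)
  have : 0 < 2 / z.im := by positivity
  have : 0 < 1 / z.im ^ 2 := by positivity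
  have := abs_nonneg d
  have := norm_nonneg (Q - T)
  -- If one of the errors exceeds `1`, the trivial bound `2 / Im z` suffices; this is what allows
  -- the minima with `1`.
  rcases le_total 1 |d| with hd1 | hd1
  · rw [min_eq_left hd1]
    have : 0 ≤ min 1 ‖Q - T‖ := by positivity
    nlinarith
  · rcases le_total 1 ‖Q - T‖ with hq1 | hq1
    · rw [min_eq_left hq1]
      have : 0 ≤ min 1 |d| := by positivity
      nlinarith
    · rw [min_eq_right hd1, min_eq_right hq1]; nlinarith

end Profile

/-! ### The approximate fixed point equation -/

lemma integrable_integral_extend {ι κ : Type*} [Fintype ι] [Fintype κ] (ν : Measure ℝ)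
    [IsProbabilityMeasure ν] {e : κ → ι} (he : Function.Injective e) {F : (ι → ℝ) → ℂ}
    (hF : Integrable F (Measure.pi fun _ => ν)) :
    Integrable (fun ω => ∫ y, F (Function.extend e y ω) ∂(Measure.pi fun _ => ν))
      (Measure.pi fun _ => ν) :=
  ((measurePreserving_extend ν he).integrable_comp_of_integrable hF).integral_prod_right

lemma eventually_div_natCast_le (C : ℝ) {η : ℝ} (hη : 0 < η) : ∀ᶠ N : ℕ in atTop, C / N ≤ η :=
  ((tendsto_const_div_atTop_nhds_zero_nat C).eventually (gt_mem_nhds hη)).mono fun _ h => le_of_lt h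

section FixedPoint

variable {α : ℝ} {ν : Measure ℝ} [IsProbabilityMeasure ν] {a : ℕ → ℝ} {z : ℂ}

lemma integrable_rotDiag_cpow {N : ℕ} {c : ℝ} {σ : Fin N → Fin N → ℝ}
    (hσ : ∀ i j, σ i j = σ j i) (hz : 0 < z.im) {p : ℝ} (hp : 0 ≤ p) (j : Fin N) :
    Integrable (fun ω => rotDiag (profileMatrix c σ ω) z j ^ (p : ℂ)) (Measure.pi fun _ => ν) :=
  integrable_of_bound ((measurable_rotDiag j).pow_const _) fun _ => norm_rotDiag_cpow_le (isSymm_profileMatrix hσ) hz hp j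

/-- The average runs over row `i` only, with the minor frozen. Hölder continuity of the power,
linearized by `exists_four_mul_rpow_le`, reduces the error to means of the negligible terms. The row
limit theorem evaluates the rest. -/
lemma IsTailLimit.eventually_norm_integral_rotDiag_sub_le
    (h : IsTailLimit α ν a) (hα0 : 0 < α) (hα2 : α < 2) {p : ℝ} (hp0 : 0 < p) (hp1 : p ≤ 1)
    (hz : 0 < z.im) (s : ℝ) {η : ℝ} (hη : 0 < η) :
    ∀ᶠ N : ℕ in atTop, ∀ σ : Fin N → Fin N → ℝ, (∀ i j, σ i j = σ j i) → (∀ i j, |σ i j| ≤ s) →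
      ∀ (i : Fin N) (ω : Sym2 (Fin N) → ℝ),
      ‖∫ y, rotDiag (profileMatrix (a N) σ (Function.extend (fun j => s(i, j)) y ω)) z i ^ (p : ℂ)
        ∂(Measure.pi fun _ : Fin N => ν) - ((Gamma p)⁻¹ : ℝ) *
        lapInt (α / 2) p (-(I * z)) (rowField α (fun j => if j = i then 0 else σ i j)
          (rotDiag (minor (profileMatrix (a N) σ ω) i) z))‖ ≤ η := by
  obtain ⟨C, hC0, hC⟩ := exists_four_mul_rpow_le hp0 hp1 (show 0 < η / 4 by positivity)
  set K := 2 / z.im + 1 / z.im ^ 2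
  have : 0 < K := by positivity
  set η' := η / (8 * (C * K + 1)) with hη'
  have hη'0 : 0 < η' := by positivity
  have : C * K * (η' + η') ≤ η / 4 := by
    have : (C * K + 1) * η' = η / 8 := by rw [hη']; field_simp
    nlinarith
  filter_upwards [h.eventually_integral_offDiag_le hα0 s (1 / z.im) hη'0,
    h.eventually_integral_entry_le s hη'0,
    h.eventually_norm_integral_row_sub_le hα0 hα2 hp0 (ζ := -(I * z))
      (by rwa [re_neg_I_mul]) s (1 / z.im) (half_pos hη)] with N hoff hent hrow σ hσ hs i ω
  set r : Fin N → ℝ := fun j => if j = i then 0 else σ i j with hr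
  set A := profileMatrix (a N) σ ω
  have hAs : (minor A i).IsSymm := isSymm_minor (isSymm_profileMatrix hσ) i
  have hs0 : 0 ≤ s := (abs_nonneg _).trans (hs i i)
  have hrs : ∀ j, |r j| ≤ s := by
    intro j; simp only [hr]; split_ifs
    · simpa using hs0
    · exact hs i j
  set M : Matrix (Fin N) (Fin N) ℂ := Matrix.of fun j k => I * green (minor A i) z j k with hM
  have hMs : M.IsSymm := by
    ext j k; simp only [hM, Matrix.transpose_apply, Matrix.of_apply, (isSymm_green hAs).apply j k]
  have hMv : ∀ v : Fin N → ℂ, ∑ j, ‖(M.mulVec v) j‖ ^ 2 ≤ (1 / z.im) ^ 2 * ∑ j, ‖v j‖ ^ 2 := by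
    intro v
    have h1 : ∀ j, (M.mulVec v) j = I * ((green (minor A i) z).mulVec v) j := by
      intro j
      simp only [hM, Matrix.mulVec, dotProduct, Matrix.of_apply, mul_sum, mul_assoc]
    simp_rw [h1, norm_mul, norm_I, one_mul]; exact sum_norm_sq_green_le hAs hz v
  have := hoff r M hrs hMs hMv
  have e2 := hent (σ i i) (hs i i)
  have e3 := hrow r (rotDiag (minor A i) z) hrs (re_rotDiag_pos hAs hz) (norm_rotDiag_le hAs hz)
  set Q := Measure.pi fun _ : Fin N => ν
  set V : (Fin N → ℝ) → ℂ := fun y => -(I * z) +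
    ∑ j, ((((a N)⁻¹ * (r j * y j)) ^ 2 : ℝ) : ℂ) * rotDiag (minor A i) z j with hV
  set W : (Fin N → ℝ) → ℂ := fun y =>
    rotDiag (profileMatrix (a N) σ (Function.extend (fun j => s(i, j)) y ω)) z i
  set m₁ : (Fin N → ℝ) → ℝ := fun y => min 1 |(a N)⁻¹ * (σ i i * y i)|
  set m₂ : (Fin N → ℝ) → ℝ := fun y =>
    min 1 ‖∑ j, ∑ k, (((a N)⁻¹ * (r j * y j) * ((a N)⁻¹ * (r k * y k)) : ℝ) : ℂ) * M j k -
        ∑ j, ((((a N)⁻¹ * (r j * y j)) ^ 2 : ℝ) : ℂ) * M j j‖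
  have hkey : ∀ y, z.im ≤ (V y).re ∧ ‖W y - (V y)⁻¹‖ ≤ K * (m₁ y + m₂ y) := fun y =>
    norm_rotDiag_extend_sub_le (a := a N) (ω := ω) hσ hz i y (r := r) (fun j => rfl) (V := V y) rfl
  have hVre : ∀ y, 0 < (V y).re := fun y => hz.trans_le (hkey y).1
  have hWm : Measurable W := by
    have h1 : Measurable fun y : Fin N → ℝ =>
        Function.extend (fun j => s(i, j)) y ω :=
      (measurePreserving_extend ν (injective_mk_row i)).measurable.comp measurable_prodMk_right
    exact (measurable_rotDiag i).comp h1
  have hVm : Measurable V := by simp only [hV]; fun_prop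
  have hVp : ∀ y, (V y) ^ (-p : ℂ) = ((V y)⁻¹) ^ (p : ℂ) := by
    intro y
    rw [cpow_neg, Complex.inv_cpow _ _ (Complex.mem_slitPlane_iff_arg.1
      (mem_slitPlane_of_re_pos (hVre y))).1]
  have hWre : ∀ y, 0 < (W y).re := fun y => re_rotDiag_pos (isSymm_profileMatrix hσ) hz i
  have hVire : ∀ y, 0 < ((V y)⁻¹).re := by
    intro y; rw [Complex.inv_re]
    exact div_pos (hVre y) (Complex.normSq_pos.2 fun h0 => by simpa [h0] using hVre y)
  have hWi : Integrable (fun y => W y ^ (p : ℂ)) Q :=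
    integrable_of_bound (hWm.pow_const _) fun y => norm_rotDiag_cpow_le (isSymm_profileMatrix hσ) hz hp0.le i
  have hVi : Integrable (fun y => V y ^ (-p : ℂ)) Q := by
    refine integrable_of_bound (C := (1 / z.im) ^ p) (hVm.pow_const _) fun y => ?_
    rw [hVp, norm_cpow_real]
    refine rpow_le_rpow (norm_nonneg _) ?_ hp0.le
    rw [norm_inv, ← one_div]
    exact one_div_le_one_div_of_le hz ((hkey y).1.trans (re_le_norm _))
  have hm₁i : Integrable m₁ Q := by
    refine integrable_of_bound (C := 1) (by fun_prop) fun y => ?_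
    rw [norm_of_nonneg (by positivity)]; exact min_le_left _ _
  have hm₂i : Integrable m₂ Q := by
    refine integrable_of_bound (C := 1) (by fun_prop) fun y => ?_
    rw [norm_of_nonneg (by positivity)]; exact min_le_left _ _
  have : ∫ y, m₁ y ∂Q ≤ η' := by
    refine le_trans (le_of_eq ?_) e2
    have hmp := measurePreserving_eval (fun _ : Fin N => ν) i
    conv_rhs => rw [← hmp.map_eq]
    rw [integral_map hmp.measurable.aemeasurable (Measurable.aestronglyMeasurable (by fun_prop))]
  have h1 : ‖∫ y, W y ^ (p : ℂ) ∂Q - ∫ y, V y ^ (-p : ℂ) ∂Q‖ ≤ η / 2 := by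
    rw [← integral_sub hWi hVi]
    have hb : Integrable (fun y => η / 4 + C * (K * (m₁ y + m₂ y))) Q :=
      (integrable_const _).add (((hm₁i.fun_add hm₂i).const_mul K).const_mul C)
    refine (norm_integral_le_of_norm_le hb (.of_forall fun y => ?_)).trans ?_
    · rw [hVp]
      refine (norm_cpow_sub_cpow_le hp0 hp1 (hVire y) (hWre y)).trans
        ((hC _ (norm_nonneg _)).trans (add_le_add le_rfl ?_))
      exact mul_le_mul_of_nonneg_left (hkey y).2 hC0
    · rw [integral_const_add (((hm₁i.fun_add hm₂i).const_mul K).const_mul C),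
        integral_const_mul, integral_const_mul, integral_add hm₁i hm₂i]
      have : C * (K * (∫ y, m₁ y ∂Q + ∫ y, m₂ y ∂Q)) ≤ C * K * (η' + η') := by
        rw [mul_assoc]; gcongr
      linarith
  calc _ ≤ _ := norm_sub_le_norm_sub_add_norm_sub _ (∫ y, V y ^ (-p : ℂ) ∂Q) _
    _ ≤ η / 2 + η / 2 := add_le_add h1 e3
    _ = η := by ring

lemma norm_rowField_sub_le (hα2 : α < 2) {N : ℕ} (hN : 0 < N) {θ θ' : Fin N → ℝ}
    {w w' : Fin N → ℂ} {b : Fin N → ℝ} (h : ∀ j, ‖((|θ j| ^ α : ℝ) : ℂ) * w j ^ ((α / 2 : ℝ) : ℂ) -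
      ((|θ' j| ^ α : ℝ) : ℂ) * w' j ^ ((α / 2 : ℝ) : ℂ)‖ ≤ b j) :
    ‖rowField α θ w - rowField α θ' w'‖ ≤ Gamma (1 - α / 2) / N * ∑ j, b j := by
  have : 0 < Gamma (1 - α / 2) := Gamma_pos_of_pos (by linarith)
  have : (0 : ℝ) < N := by exact_mod_cast hN
  rw [rowField, rowField, ← mul_sub, norm_ofReal_mul (by positivity), ← sum_sub_distrib]
  exact mul_le_mul_of_nonneg_left ((norm_sum_le _ _).trans (sum_le_sum fun j _ => h j))
    (by positivity)

/-- The entries change by at most `3 / Im z` in total, so the average over `N` indices changes by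
`O(1 / N)` plus the linearization error of the power; the index `i` contributes one further term
over `N`. -/
lemma eventually_norm_rowField_minor_sub_le (hα0 : 0 < α) (hα2 : α < 2) (hz : 0 < z.im) (s : ℝ)
    {η : ℝ} (hη : 0 < η) :
    ∀ᶠ N : ℕ in atTop, ∀ (σ : Fin N → Fin N → ℝ) (A : Matrix (Fin N) (Fin N) ℝ), A.IsSymm →
      (∀ i j, |σ i j| ≤ s) → ∀ i : Fin N,
      ‖rowField α (fun j => if j = i then 0 else σ i j) (rotDiag (minor A i) z) -
        rowField α (σ i) (rotDiag A z)‖ ≤ η := by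
  have hβ0 : 0 < α / 2 := by linarith
  have hβ1 : α / 2 ≤ 1 := by linarith
  have : 0 < Gamma (1 - α / 2) := Gamma_pos_of_pos (by linarith)
  set S := Gamma (1 - α / 2) * |s| ^ α with hS
  have : 0 ≤ S := by positivity
  obtain ⟨C, hC0, hC⟩ := exists_four_mul_rpow_le hβ0 hβ1 (show 0 < η / (2 * (S + 1)) by positivity)
  filter_upwards [eventually_gt_atTop 0, eventually_div_natCast_le
    (S * ((1 / z.im) ^ (α / 2) + C * (3 / z.im))) (half_pos hη)] with N hN hN2 σ A hA hs i
  have : 0 ≤ s := (abs_nonneg _).trans (hs i i)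
  have : (0 : ℝ) < N := by exact_mod_cast hN
  have hσα : ∀ j, |σ i j| ^ α ≤ |s| ^ α := fun j =>
    rpow_le_rpow (abs_nonneg _) ((hs i j).trans (le_abs_self s)) hα0.le
  set ε := η / (2 * (S + 1)) with hε
  have : 0 < ε := by positivity
  set b : Fin N → ℝ := fun j => |s| ^ α * ((if j = i then (1 / z.im) ^ (α / 2) else 0) +
    (ε + C * ‖rotDiag A z j - rotDiag (minor A i) z j‖)) with hb
  refine (norm_rowField_sub_le (b := b) hα2 hN fun j => ?_).trans ?_
  · by_cases hj : j = i
    · simp only [hb, if_pos hj]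
      rw [abs_zero, zero_rpow hα0.ne', ofReal_zero, zero_mul, zero_sub, norm_neg,
        norm_ofReal_mul (by positivity)]
      refine mul_le_mul (hσα j) ?_ (norm_nonneg _) (by positivity)
      have h1 := norm_rotDiag_cpow_le (z := z) hA hz hβ0.le j
      have h2 : 0 ≤ C * ‖rotDiag A z j - rotDiag (minor A i) z j‖ := by positivity
      linarith
    · simp only [hb, if_neg hj]
      rw [← mul_sub, norm_ofReal_mul (by positivity), zero_add]
      refine mul_le_mul (hσα j) ?_ (norm_nonneg _) (by positivity)
      rw [norm_sub_rev]
      exact (norm_cpow_sub_cpow_le hβ0 hβ1 (re_rotDiag_pos (isSymm_minor hA i) hz j)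
        (re_rotDiag_pos hA hz j)).trans (hC _ (norm_nonneg _))
  · have h1 := sum_norm_rotDiag_sub_minor_le (z := z) hA hz i
    have h2 : ∑ j, b j ≤ |s| ^ α * ((1 / z.im) ^ (α / 2) + (N * ε + C * (3 / z.im))) := by
      simp only [hb]
      rw [← mul_sum, sum_add_distrib, sum_add_distrib, ← mul_sum,
        sum_ite_eq', if_pos (Finset.mem_univ _), sum_const, card_univ,
        Fintype.card_fin, nsmul_eq_mul]
      gcongr
    have : S * ε ≤ η / 2 := by
      have : (S + 1) * ε = η / 2 := by rw [hε]; field_simp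
      nlinarith
    calc _ ≤ Gamma (1 - α / 2) / N *
          (|s| ^ α * ((1 / z.im) ^ (α / 2) + (N * ε + C * (3 / z.im)))) :=
          mul_le_mul_of_nonneg_left h2 (by positivity)
      _ = S * ε + S * ((1 / z.im) ^ (α / 2) + C * (3 / z.im)) / N := by rw [hS]; field_simp; ring
      _ ≤ η := by linarith

lemma integrable_rowField (hα0 : 0 < α) (hz : 0 < z.im) {N : ℕ} {c : ℝ}
    {σ : Fin N → Fin N → ℝ} (hσ : ∀ i j, σ i j = σ j i) (θ : Fin N → ℝ) :
    Integrable (fun ω => rowField α θ (rotDiag (profileMatrix c σ ω) z))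
      (Measure.pi fun _ => ν) := by
  unfold rowField
  exact (integrable_finsetSum _ fun j _ =>
    (integrable_rotDiag_cpow hσ hz (by linarith) j).const_mul _).const_mul _

/-- The row averages of powers of resolvent entries concentrate. -/
lemma eventually_integral_norm_rowField_sub_le (hα0 : 0 < α) (hα2 : α < 2)
    (hz : 0 < z.im) (s : ℝ) {η : ℝ} (hη : 0 < η) :
    ∀ᶠ N : ℕ in atTop, ∀ (c : ℝ) (σ : Fin N → Fin N → ℝ) (θ : Fin N → ℝ),
      (∀ i j, σ i j = σ j i) → (∀ j, |θ j| ≤ s) →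
      ∫ ω, ‖rowField α θ (rotDiag (profileMatrix c σ ω) z) -
        ∫ ω', rowField α θ (rotDiag (profileMatrix c σ ω') z) ∂(Measure.pi fun _ => ν)‖
        ∂(Measure.pi fun _ => ν) ≤ η := by
  have hβ0 : 0 < α / 2 := by linarith
  have hβ1 : α / 2 ≤ 1 := by linarith
  have hc : 0 < Gamma (1 - α / 2) := Gamma_pos_of_pos (by linarith)
  set S := Gamma (1 - α / 2) * |s| ^ α with hS
  have hS0 : 0 ≤ S := by positivity
  -- A shift by `ε` moves the resolvent entries into `{Re ≥ ε}`, where the power is Lipschitz. By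
  -- Hölder continuity its cost is at most `4 ε^(α/2)` per entry, uniformly in `N`.
  set ε := (η / (16 * (S + 1))) ^ (1 / (α / 2)) with hε
  have hε0 : 0 < ε := by positivity
  have hεβ : S * (4 * ε ^ (α / 2)) ≤ η / 4 := by
    have h1 : ε ^ (α / 2) = η / (16 * (S + 1)) := by
      rw [hε, ← rpow_mul (by positivity), one_div_mul_cancel hβ0.ne', rpow_one]
    have h2 : (S + 1) * ε ^ (α / 2) = η / 16 := by rw [h1]; field_simp
    have : 0 ≤ ε ^ (α / 2) := by positivity
    nlinarith
  set D := S * (ε ^ (α / 2 - 1) * (6 / z.im)) with hD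
  filter_upwards [eventually_gt_atTop 0, eventually_div_natCast_le (D ^ 2)
    (show 0 < η ^ 2 / 4 by positivity)] with N hN hN2 c σ θ hσ hθ
  have hN' : (0 : ℝ) < N := by exact_mod_cast hN
  have hθα : ∀ j, |θ j| ^ α ≤ |s| ^ α := fun j =>
    rpow_le_rpow (abs_nonneg _) ((hθ j).trans (le_abs_self s)) hα0.le
  set P := Measure.pi fun _ : Sym2 (Fin N) => ν
  have hA : ∀ ω, (profileMatrix c σ ω).IsSymm := fun ω => isSymm_profileMatrix hσ
  set R : (Sym2 (Fin N) → ℝ) → ℂ := fun ω => rowField α θ (rotDiag (profileMatrix c σ ω) z)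
  set F : (Sym2 (Fin N) → ℝ) → ℂ := fun ω =>
    rowField α θ (fun j => rotDiag (profileMatrix c σ ω) z j + ε) with hF
  have hcard : ∀ t : ℝ, Gamma (1 - α / 2) / N * ∑ _j : Fin N, |s| ^ α * t = S * t := by
    intro t
    rw [sum_const, card_univ, Fintype.card_fin, nsmul_eq_mul, hS]; field_simp
  have hre : ∀ ω j, ε ≤ (rotDiag (profileMatrix c σ ω) z j + ε).re := fun ω j => by
    have := re_rotDiag_pos (hA ω) hz j
    rw [add_re, ofReal_re]; linarith
  have hRF : ∀ ω, ‖R ω - F ω‖ ≤ η / 4 := by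
    intro ω
    refine (norm_rowField_sub_le hα2 hN (b := fun _ => |s| ^ α * (4 * ε ^ (α / 2)))
      fun j => ?_).trans ((hcard _).trans_le hεβ)
    rw [← mul_sub, norm_ofReal_mul (by positivity)]
    refine mul_le_mul (hθα j) ?_ (norm_nonneg _) (by positivity)
    refine (norm_cpow_sub_cpow_le hβ0 hβ1 (hε0.trans_le (hre ω j))
      (re_rotDiag_pos (hA ω) hz j)).trans_eq ?_
    rw [sub_add_cancel_left, norm_neg, norm_real, norm_of_nonneg hε0.le]
  have hFm : Measurable F := by
    simp only [hF, rowField]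
    exact (measurable_sum _ fun j _ =>
      (((measurable_rotDiag j).add_const _).pow_const _).const_mul _).const_mul _
  have hRi : Integrable R P := integrable_rowField hα0 hz hσ θ
  have hRb : ∀ ω, ‖R ω‖ ≤ S * (1 / z.im) ^ (α / 2) := by
    intro ω
    have h1 := norm_rowField_sub_le hα2 hN (θ := θ) (θ' := fun _ => 0)
      (w := rotDiag (profileMatrix c σ ω) z) (w' := fun _ => 0)
      (b := fun _ => |s| ^ α * (1 / z.im) ^ (α / 2)) fun j => by
        rw [abs_zero, zero_rpow hα0.ne', ofReal_zero, zero_mul, sub_zero, norm_mul,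
          norm_real, norm_of_nonneg (by positivity)]
        exact mul_le_mul (hθα j) (norm_rotDiag_cpow_le (hA ω) hz hβ0.le j) (norm_nonneg _)
          (by positivity)
    have h2 : rowField α (fun _ : Fin N => (0 : ℝ)) (fun _ => 0) = 0 := by
      simp [rowField, zero_rpow hα0.ne']
    rwa [h2, sub_zero, hcard] at h1
  have hFb : ∀ ω, ‖F ω‖ ≤ S * (1 / z.im) ^ (α / 2) + η / 4 := fun ω => by
    have h1 := norm_sub_norm_le (F ω) (R ω)
    rw [norm_sub_rev] at h1; linarith [hRb ω, hRF ω]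
  have hFi : Integrable F P := integrable_of_bound hFm hFb
  -- The entries are grouped by their larger index. Block `k` touches only row and column `k` and
  -- moves `F` by at most `D / N`, so the `N` blocks give variance at most `D² / N`.
  have hvar := integral_norm_sub_integral_sq_le ν (fun e : Sym2 (Fin N) => e.sup) hFm hFb
    (D := D / N) fun k ω ω' hk => by
      by_cases hkN : k < N
      · have hmin : minor (profileMatrix c σ ω) ⟨k, hkN⟩ = minor (profileMatrix c σ ω') ⟨k, hkN⟩ :=
          minor_profileMatrix_congr fun j l hj hl => hk _ fun h => by
            rw [Sym2.sup_mk] at h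
            rcases max_choice j l with h' | h'
            · exact hj (Fin.ext (by rw [h'] at h; exact h))
            · exact hl (Fin.ext (by rw [h'] at h; exact h))
        have h1 := sum_norm_rotDiag_sub_le (z := z) (hA ω) (hA ω') hz hmin
        refine (norm_rowField_sub_le hα2 hN (b := fun j => |s| ^ α * (ε ^ (α / 2 - 1) *
          ‖rotDiag (profileMatrix c σ ω) z j - rotDiag (profileMatrix c σ ω') z j‖))
          fun j => ?_).trans ?_
        · rw [← mul_sub, norm_ofReal_mul (by positivity)]
          refine mul_le_mul (hθα j) ?_ (norm_nonneg _) (by positivity)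
          have h2 := norm_cpow_sub_cpow_le_of_le_norm hβ0 hβ1 hε0 (S := {u : ℂ | ε ≤ u.re})
            (convex_halfSpace_re_ge ε) (fun u hu => hε0.trans_le hu)
            (fun u hu => (show ε ≤ u.re from hu).trans (re_le_norm u))
            (hre ω' j) (hre ω j)
          rwa [add_sub_add_right_eq_sub] at h2
        · rw [← mul_sum, ← mul_sum]
          calc _ ≤ Gamma (1 - α / 2) / N * (|s| ^ α * (ε ^ (α / 2 - 1) * (6 / z.im))) := by gcongr
            _ = D / N := by rw [hD, hS]; ring
      · have : ω = ω' := funext fun e => hk e fun h => hkN (h ▸ Fin.is_lt _)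
        rw [this, sub_self, norm_zero, hD]; positivity
  have hFsub : Integrable (fun ω => ‖F ω - ∫ ω', F ω' ∂P‖) P := (hFi.sub (integrable_const _)).norm
  have hFsq : Integrable (fun ω => ‖F ω - ∫ ω', F ω' ∂P‖ ^ 2) P :=
    integrable_of_bound (C := (S * (1 / z.im) ^ (α / 2) + η / 4 + ‖∫ ω', F ω' ∂P‖) ^ 2) ((hFm.sub_const _).norm.pow_const 2) fun ω => by
      rw [norm_pow, norm_norm]; gcongr
      exact (norm_sub_le _ _).trans (add_le_add (hFb ω) le_rfl)
  have hmain : ∫ ω, ‖F ω - ∫ ω', F ω' ∂P‖ ∂P ≤ η / 2 := by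
    have hb : Integrable (fun ω => η / 4 + η⁻¹ * ‖F ω - ∫ ω', F ω' ∂P‖ ^ 2) P :=
      (integrable_const _).add (hFsq.const_mul _)
    refine (integral_mono hFsub hb fun ω => ?_).trans ?_
    · have h1 := sq_nonneg (‖F ω - ∫ ω', F ω' ∂P‖ - η / 2)
      have h2 : η / 4 + η⁻¹ * ‖F ω - ∫ ω', F ω' ∂P‖ ^ 2 - ‖F ω - ∫ ω', F ω' ∂P‖ =
          η⁻¹ * (‖F ω - ∫ ω', F ω' ∂P‖ - η / 2) ^ 2 := by field_simp; ring
      have h3 : 0 ≤ η⁻¹ * (‖F ω - ∫ ω', F ω' ∂P‖ - η / 2) ^ 2 := by positivity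
      simp only; linarith
    · rw [integral_const_add (hFsq.const_mul _), integral_const_mul]
      have h1 : ∫ ω, ‖F ω - ∫ ω', F ω' ∂P‖ ^ 2 ∂P ≤ η ^ 2 / 4 :=
        (hvar.trans_eq (by field_simp)).trans hN2
      have h2 : η⁻¹ * ∫ ω, ‖F ω - ∫ ω', F ω' ∂P‖ ^ 2 ∂P ≤ η⁻¹ * (η ^ 2 / 4) := by gcongr
      have h3 : η⁻¹ * (η ^ 2 / 4) = η / 4 := by field_simp
      linarith
  have hmean : ‖∫ ω', F ω' ∂P - ∫ ω', R ω' ∂P‖ ≤ η / 4 := by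
    rw [← integral_sub hFi hRi]
    refine norm_integral_le_of_forall_le fun ω => ?_
    rw [norm_sub_rev]; exact hRF ω
  calc ∫ ω, ‖R ω - ∫ ω', R ω' ∂P‖ ∂P ≤ ∫ ω, (η / 2 + ‖F ω - ∫ ω', F ω' ∂P‖) ∂P := by
        refine integral_mono (hRi.sub (integrable_const _)).norm ((integrable_const _).add hFsub)
          fun ω => ?_
        have h1 : R ω - ∫ ω', R ω' ∂P = (R ω - F ω) + (F ω - ∫ ω', F ω' ∂P) +
          (∫ ω', F ω' ∂P - ∫ ω', R ω' ∂P) := by ring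
        simp only; rw [h1]
        have := norm_add₃_le (a := R ω - F ω) (b := F ω - ∫ ω', F ω' ∂P)
          (c := ∫ ω', F ω' ∂P - ∫ ω', R ω' ∂P)
        linarith [hRF ω]
    _ ≤ η := by
        rw [integral_const_add hFsub]
        linarith

/-- The expected resolvent entries satisfy the limiting equation up to a small error. -/
theorem IsTailLimit.eventually_fixedPoint (h : IsTailLimit α ν a)
    (hα0 : 0 < α) (hα2 : α < 2) {p : ℝ} (hp0 : 0 < p) (hp1 : p ≤ 1) (hz : 0 < z.im) (s : ℝ)
    {η : ℝ} (hη : 0 < η) :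
    ∀ᶠ N : ℕ in atTop, ∀ σ : Fin N → Fin N → ℝ, (∀ i j, σ i j = σ j i) → (∀ i j, |σ i j| ≤ s) →
      ∀ i : Fin N, ‖∫ ω, rotDiag (profileMatrix (a N) σ ω) z i ^ (p : ℂ) ∂(Measure.pi fun _ => ν) -
        ((Gamma p)⁻¹ : ℝ) * lapInt (α / 2) p (-(I * z))
          (∫ ω, rowField α (σ i) (rotDiag (profileMatrix (a N) σ ω) z)
            ∂(Measure.pi fun _ => ν))‖ ≤ η := by
  have hβ0 : 0 < α / 2 := by linarith
  have hζ : 0 < (-(I * z)).re := by rwa [re_neg_I_mul]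
  have hΓ : 0 < Gamma p := Gamma_pos_of_pos hp0
  have hΓ' : 0 < Gamma (p + α / 2) := Gamma_pos_of_pos (by linarith)
  set C := (Gamma p)⁻¹ * ((1 / z.im) ^ (p + α / 2) * Gamma (p + α / 2)) with hC
  have hC0 : 0 ≤ C := by positivity
  set η' := η / (2 * (2 * C + 1)) with hη'
  have hη'0 : 0 < η' := by positivity
  have hη'1 : C * (η' + η') ≤ η / 2 := by
    have : (2 * C + 1) * η' = η / 2 := by rw [hη']; field_simp
    nlinarith
  filter_upwards [h.eventually_norm_integral_rotDiag_sub_le hα0 hα2 hp0 hp1 hz s (half_pos hη),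
    eventually_norm_rowField_minor_sub_le hα0 hα2 hz s hη'0,
    eventually_integral_norm_rowField_sub_le (ν := ν) hα0 hα2 hz s hη'0] with N h1 h2 h3 σ hσ hs i
  set P := Measure.pi fun _ : Sym2 (Fin N) => ν
  set R : (Sym2 (Fin N) → ℝ) → ℂ := fun ω => rowField α (σ i) (rotDiag (profileMatrix (a N) σ ω) z)
  set E := ((Gamma p)⁻¹ : ℝ) * lapInt (α / 2) p (-(I * z)) (∫ ω, R ω ∂P) with hE
  have hA : ∀ ω, (profileMatrix (a N) σ ω).IsSymm := fun ω => isSymm_profileMatrix hσ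
  have hRi : Integrable R P := integrable_rowField hα0 hz hσ (σ i)
  have hRre : 0 ≤ (∫ ω, R ω ∂P).re := by
    have : (∫ ω, R ω ∂P).re = ∫ ω, (R ω).re ∂P := by simpa using (integral_re hRi).symm
    rw [this]
    exact integral_nonneg fun ω => re_rowField_nonneg hα0 hα2 _ (re_rotDiag_pos (hA ω) hz)
  have hi := integrable_rotDiag_cpow (ν := ν) (c := a N) hσ hz hp0.le i
  -- Row `i` is resampled, so the inner integral is the conditional expectation given the remaining
  -- entries.
  rw [integral_extend ν (injective_mk_row i) hi]
  have hE' : E = ∫ _ω, E ∂P := by simp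
  rw [hE', ← integral_sub (integrable_integral_extend ν (injective_mk_row i) hi)
    (integrable_const _)]
  have hsub : Integrable (fun ω => ‖R ω - ∫ ω', R ω' ∂P‖) P := (hRi.sub (integrable_const _)).norm
  have hb : Integrable (fun ω => (η / 2 + C * η') + C * ‖R ω - ∫ ω', R ω' ∂P‖) P :=
    (integrable_const _).add (hsub.const_mul C)
  refine (norm_integral_le_of_norm_le hb (.of_forall fun ω => ?_)).trans ?_
  · refine (norm_sub_le_norm_sub_add_norm_sub _ _ _).trans ((add_le_add (h1 σ hσ hs i ω)
      (d := C * (η' + ‖R ω - ∫ ω', R ω' ∂P‖)) ?_).trans_eq (by ring))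
    rw [hE, ← mul_sub, norm_ofReal_mul (by positivity), hC, mul_assoc]
    refine mul_le_mul_of_nonneg_left ?_ (by positivity)
    have h4 := norm_lapInt_sub_le (β := α / 2) (p := p) hβ0 (by linarith) hp0 hζ
      (re_rowField_nonneg hα0 hα2 (fun j => if j = i then 0 else σ i j)
        (re_rotDiag_pos (isSymm_minor (hA ω) i) hz)) hRre
    rw [re_neg_I_mul] at h4
    refine h4.trans (mul_le_mul_of_nonneg_left ?_ (by positivity))
    exact (norm_sub_le_norm_sub_add_norm_sub _ (R ω) _).trans
      (add_le_add (h2 σ _ (hA ω) hs i) le_rfl)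
  · rw [integral_const_add (hsub.const_mul C), integral_const_mul]
    have h5 := mul_le_mul_of_nonneg_left (h3 (a N) σ (σ i) hσ (hs i)) hC0
    linarith

end FixedPoint

/-! ### The uniform grid on the unit interval -/

section Grid

variable (N : ℕ) [NeZero N]

/-- The index `i` of the cell `(i / N, (i + 1) / N]` that contains `x ∈ (0, 1]`. -/
def gridIndex (x : ℝ) : Fin N := Fin.ofNat N (⌈(N : ℝ) * x⌉₊ - 1)

lemma measurable_gridIndex : Measurable (gridIndex N) :=
  (Measurable.of_discrete (f := fun m : ℕ => Fin.ofNat N (m - 1))).comp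
    (Nat.measurable_ceil.comp (measurable_const_mul _))

lemma gridIndex_add_one {x : ℝ} (hx : x ∈ Ioc (0 : ℝ) 1) :
    (gridIndex N x : ℕ) + 1 = ⌈(N : ℝ) * x⌉₊ := by
  have hN : (0 : ℝ) < N := by exact_mod_cast NeZero.pos N
  have : 0 < ⌈(N : ℝ) * x⌉₊ := Nat.ceil_pos.2 (mul_pos hN hx.1)
  have : ⌈(N : ℝ) * x⌉₊ ≤ N := Nat.ceil_le.2 (by nlinarith [hx.2])
  rw [gridIndex, Fin.val_ofNat, Nat.mod_eq_of_lt (by omega)]; omega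

/-- The right end point of the cell is the sampling point in the definition of `starNorm`. -/
lemma gridPoint_eq {x : ℝ} (hx : x ∈ Ioc (0 : ℝ) 1) :
    (((gridIndex N x : ℕ) : ℝ) + 1) / N = (⌈(N : ℝ) * x⌉ : ℝ) / N := by
  have hN : (0 : ℝ) < N := by exact_mod_cast NeZero.pos N
  have h1 : (((gridIndex N x : ℕ) : ℝ) + 1) = ((⌈(N : ℝ) * x⌉₊ : ℕ) : ℝ) := by
    exact_mod_cast gridIndex_add_one N hx
  rw [h1, natCast_ceil_eq_intCast_ceil (mul_pos hN hx.1).le]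

lemma measurePreserving_gridIndex :
    MeasurePreserving (gridIndex N) Λ ((N : ℝ≥0∞)⁻¹ • Measure.count) := by
  have hN : (0 : ℝ) < N := by exact_mod_cast NeZero.pos N
  refine ⟨measurable_gridIndex N, Measure.ext_of_singleton fun i => ?_⟩
  rw [Measure.map_apply (measurable_gridIndex N) (measurableSet_singleton i),
    Measure.restrict_apply (measurable_gridIndex N (measurableSet_singleton i)),
    Measure.smul_apply, Measure.count_singleton, smul_eq_mul, mul_one]
  have h1 : gridIndex N ⁻¹' {i} ∩ Ioc 0 1 = Ioc ((i : ℝ) / N) (((i : ℝ) + 1) / N) := by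
    have : ((i : ℕ) : ℝ) + 1 ≤ N := by exact_mod_cast i.2
    ext x
    rw [mem_Ioc, div_lt_iff₀ hN, le_div_iff₀ hN, mul_comm x]; constructor
    · rintro ⟨h, hx⟩
      have h2 := gridIndex_add_one N hx
      rw [show gridIndex N x = i from h] at h2
      have h3 := (Nat.ceil_eq_iff (Nat.succ_ne_zero i)).1 h2.symm
      simpa using h3
    · rintro ⟨h2, h3⟩
      have hx : x ∈ Ioc (0 : ℝ) 1 :=
        ⟨by have : (0 : ℝ) ≤ (i : ℕ) := Nat.cast_nonneg _
            by_contra hneg; nlinarith,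
          by by_contra hneg; nlinarith⟩
      refine ⟨Fin.ext ?_, hx⟩
      have h4 := gridIndex_add_one N hx
      rw [(Nat.ceil_eq_iff (Nat.succ_ne_zero i)).2 (by simpa using ⟨h2, h3⟩)] at h4
      exact Nat.succ_injective h4
  rw [h1, Real.volume_Ioc, show ((i : ℝ) + 1) / N - i / N = (N : ℝ)⁻¹ by ring,
    ENNReal.ofReal_inv_of_pos hN, ENNReal.ofReal_natCast]

lemma integral_gridIndex {E : Type*} [NormedAddCommGroup E] [NormedSpace ℝ E] [CompleteSpace E]
    (f : Fin N → E) : ∫ x, f (gridIndex N x) ∂Λ = (N : ℝ)⁻¹ • ∑ i, f i := by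
  have h := measurePreserving_gridIndex N
  have h1 := integral_map (μ := Λ) h.measurable.aemeasurable (f := f) Integrable.of_finite.1
  have : (N : ℝ≥0∞) ≠ 0 := by exact_mod_cast NeZero.ne N
  rw [← h1, h.map_eq, integral_smul_measure, integral_fintype .of_finite,
    ENNReal.toReal_inv, ENNReal.toReal_natCast]
  congr 1
  exact sum_congr rfl fun i _ => by simp [Measure.real]

end Grid

/-! ### Convergence for bounded profiles -/

section Bounded

variable {α : ℝ} {ν : Measure ℝ} [IsProbabilityMeasure ν] {a : ℕ → ℝ} {z : ℂ}

/-- The expected normalized trace of the resolvent. -/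
def meanTransform (ν : Measure ℝ) (c : ℝ) {N : ℕ} (σ : Fin N → Fin N → ℝ) (z : ℂ) : ℂ :=
  ∫ ω, (N : ℂ)⁻¹ * (green (profileMatrix c σ ω) z).trace ∂(Measure.pi fun _ => ν)

lemma measurable_grid {N : ℕ} [NeZero N] (κ : Fin N → Fin N → ℝ) :
    Measurable fun p : ℝ × ℝ => κ (gridIndex N p.1) (gridIndex N p.2) :=
  (Measurable.of_discrete (f := Function.uncurry κ)).comp
    (((measurable_gridIndex N).comp measurable_fst).prodMk
      ((measurable_gridIndex N).comp measurable_snd))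

lemma isKernel_grid {N : ℕ} [NeZero N] {κ : Fin N → Fin N → ℝ} {S : ℝ} (h0 : ∀ i j, 0 ≤ κ i j)
    (hS : ∀ i j, κ i j ≤ S) : IsKernel (fun x v => κ (gridIndex N x) (gridIndex N v)) S where
  measurable := measurable_grid κ
  nonneg _ _ := h0 _ _
  integrable x := integrable_of_bound (C := S) ((Measurable.of_discrete
      (f := κ (gridIndex N x))).comp (measurable_gridIndex N)) fun v => by rw [norm_of_nonneg (h0 _ _)]; exact hS _ _
  integral_le x := by
    rw [integral_gridIndex N (κ (gridIndex N x)), smul_eq_mul]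
    have hN : (0 : ℝ) < N := by exact_mod_cast NeZero.pos N
    rw [inv_mul_le_iff₀ hN]
    exact (sum_le_sum fun j _ => hS _ j).trans_eq (by simp)

lemma trace_green_eq_sum {N : ℕ} (A : Matrix (Fin N) (Fin N) ℝ) (z : ℂ) :
    (green A z).trace = -I * ∑ j, rotDiag A z j := by
  simp only [rotDiag, Matrix.trace, Matrix.diag_apply]
  rw [← mul_sum, ← mul_assoc, neg_mul, I_mul_I, neg_neg, one_mul]

lemma IsKernel.integral_abs_sub_le {k k' : ℝ → ℝ → ℝ} {K K' : ℝ} (hk : IsKernel k K)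
    (hk' : IsKernel k' K') (x : ℝ) : ∫ v, |k x v - k' x v| ∂Λ ≤ K + K' := by
  refine (integral_mono ((hk.integrable x).sub (hk'.integrable x)).abs
    ((hk.integrable x).add (hk'.integrable x)) fun v => ?_).trans ?_
  · refine (abs_sub _ _).trans ?_
    rw [abs_of_nonneg (hk.nonneg x v), abs_of_nonneg (hk'.nonneg x v)]; rfl
  · rw [integral_add' (hk.integrable x) (hk'.integrable x)]
    exact add_le_add (hk.integral_le x) (hk'.integral_le x)

lemma IsKernel.integrable_integral_abs_sub {k k' : ℝ → ℝ → ℝ} {K K' : ℝ} (hk : IsKernel k K)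
    (hk' : IsKernel k' K') : Integrable (fun x => ∫ v, |k x v - k' x v| ∂Λ) Λ := by
  refine Integrable.of_bound (StronglyMeasurable.integral_prod_right
    (f := fun x v => |k x v - k' x v|) (Measurable.stronglyMeasurable
      (hk.measurable.sub hk'.measurable).abs)).aestronglyMeasurable (K + K') (.of_forall fun x => ?_)
  rw [norm_of_nonneg (integral_nonneg fun v => abs_nonneg _)]
  exact hk.integral_abs_sub_le hk' x

/-- Read on the grid, the expected fields `X` satisfy the limiting equation with the grid kernel up
to `O(ε)`. For large `Im z` the contraction bounds their `L¹` distance to the true solution by that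
error and the `L¹` distance of the kernels. The fixed point relation for `p = 1` transfers this to
the transform. -/
lemma IsTailLimit.tendsto_meanTransform (h : IsTailLimit α ν a)
    (hα0 : 0 < α) (hα2 : α < 2) (hz : z ∈ upperHalf) {s : ℝ}
    (hLip : fieldLip (α / 2) (|s| ^ α) z.im ≤ 1 / 2) {k : ℝ → ℝ → ℝ}
    (hk : IsKernel k (|s| ^ α)) {σ : ∀ N : ℕ, Fin N → Fin N → ℝ}
    (hσ : ∀ N i j, σ N i j = σ N j i) (hs : ∀ N i j, |σ N i j| ≤ s)
    (hlim : ∀ ε : ℝ, 0 < ε → ∀ᶠ N : ℕ in atTop, ∀ _ : NeZero N,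
      ∫ x, ∫ v, |(|σ N (gridIndex N x) (gridIndex N v)| ^ α) - k x v| ∂Λ ∂Λ ≤ ε) :
    Tendsto (fun N => meanTransform ν (a N) (σ N) z) atTop (𝓝 (limitTransform (α / 2) k z)) := by
  have hz0 : 0 < z.im := hz
  set β := α / 2 with hβ
  have hβ0 : 0 < β := by linarith
  have hβ1 : β < 1 := by linarith
  have : 0 < Gamma (1 - β) := Gamma_pos_of_pos (by linarith)
  have : 0 < Gamma β := Gamma_pos_of_pos hβ0
  set c := Gamma (1 - β)
  set S := |s| ^ α
  have hS0 : 0 ≤ S := by positivity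
  set L := (1 / z.im) ^ (1 + β) * Gamma (1 + β)
  have : 0 < L := mul_pos (by positivity) (Gamma_pos_of_pos (by linarith))
  set T := 1 + L * (2 * (c * S + c * (1 / z.im) ^ β)) with hT
  have : 0 < T := by positivity
  rw [Metric.tendsto_atTop']
  refine fun ε' hε' => eventually_atTop.1 ?_ |>.imp fun n hn N hN => hn N hN.le
  set ε := ε' / (2 * T) with hε
  have hε0 : 0 < ε := by positivity
  filter_upwards [h.eventually_fixedPoint hα0 hα2 hβ0 hβ1.le hz0 s hε0,
    h.eventually_fixedPoint hα0 hα2 one_pos le_rfl hz0 s hε0, hlim ε hε0,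
    eventually_gt_atTop 0] with N hu hw hkN hN
  have : NeZero N := ⟨hN.ne'⟩
  have : (0 : ℝ) < N := by exact_mod_cast hN
  replace hkN := hkN inferInstance
  replace hu := hu (σ N) (hσ N) (hs N)
  replace hw := hw (σ N) (hσ N) (hs N)
  set P := Measure.pi fun _ : Sym2 (Fin N) => ν
  set κ : Fin N → Fin N → ℝ := fun i j => |σ N i j| ^ α
  have hκ0 : ∀ i j, 0 ≤ κ i j := fun i j => by positivity
  have hκS : ∀ i j, κ i j ≤ S := fun i j =>
    rpow_le_rpow (abs_nonneg _) ((hs N i j).trans (le_abs_self s)) hα0.le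
  set k' : ℝ → ℝ → ℝ := fun x v => κ (gridIndex N x) (gridIndex N v)
  have hk' : IsKernel k' S := isKernel_grid hκ0 hκS
  have hA : ∀ ω, (profileMatrix (a N) (σ N) ω).IsSymm := fun ω => isSymm_profileMatrix (hσ N)
  set u : Fin N → ℂ := fun j => ∫ ω, rotDiag (profileMatrix (a N) (σ N) ω) z j ^ (β : ℂ) ∂P
  set X : Fin N → ℂ := fun i => ∫ ω, rowField α (σ N i) (rotDiag (profileMatrix (a N) (σ N) ω) z) ∂P
    with hXdef
  have hXu : ∀ i, X i = ((c / N : ℝ) : ℂ) * ∑ j, (κ i j : ℂ) * u j := by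
    intro i; simp only [hXdef, rowField]
    rw [integral_const_mul, integral_finsetSum _ fun j _ =>
      (integrable_rotDiag_cpow (hσ N) hz0 hβ0.le j).const_mul _]
    simp_rw [integral_const_mul]; rfl
  have hXcone : ∀ i, X i ∈ cone β := by
    intro i
    rw [hXu, show ∑ j, (κ i j : ℂ) * u j = ∫ j, (κ i j : ℂ) * u j ∂Measure.count by
      rw [integral_fintype .of_finite]; simp [Measure.real]]
    refine ofReal_mul_mem_cone (by positivity) (integral_mem_cone hβ0 hβ1.le .of_finite
      (.of_forall fun j => ofReal_mul_mem_cone (hκ0 i j) (integral_mem_cone hβ0 hβ1.le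
        (integrable_rotDiag_cpow (hσ N) hz0 hβ0.le j) (.of_forall fun ω =>
          cpow_mem_cone (re_rotDiag_pos (hA ω) hz0 j) (abs_of_pos hβ0).le))))
  set Xf : ℝ → ℂ := fun x => X (gridIndex N x) with hXf
  have hXff : IsField β Xf :=
    ⟨(Measurable.of_discrete (f := X)).comp (measurable_gridIndex N), fun x => hXcone _⟩
  set F := field β k z with hF
  have hFf : IsField β F := isField_field hk hβ0 hβ1 hz
  have hXfi : Integrable Xf Λ := by
    refine integrable_of_bound (C := ∑ i, ‖X i‖) hXff.measurable fun x => ?_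
    exact single_le_sum (f := fun i => ‖X i‖) (fun i _ => norm_nonneg _) (Finset.mem_univ _)
  have hFi : Integrable F Λ :=
    integrable_of_bound hFf.measurable (norm_field_le hk hβ0 hβ1 hz)
  have hdi : Integrable (fun v => ‖Xf v - F v‖) Λ := (hXfi.sub hFi).norm
  set d := ∫ v, ‖Xf v - F v‖ ∂Λ
  have hd0 : 0 ≤ d := integral_nonneg fun v => norm_nonneg _
  have hstep : ∀ x, ‖Xf x - fieldStep β k' z Xf x‖ ≤ c * S * ε := by
    intro x
    have h1 : fieldStep β k' z Xf x = ((c / N : ℝ) : ℂ) * ∑ j, (κ (gridIndex N x) j : ℂ) *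
        (((Gamma β)⁻¹ : ℝ) * lapInt β β (-(I * z)) (X j)) := by
      rw [fieldStep, integral_gridIndex N (fun j => (κ (gridIndex N x) j : ℂ) *
        lapInt β β (-(I * z)) (X j)), real_smul, mul_sum, mul_sum, mul_sum]
      refine sum_congr rfl fun j _ => ?_
      push_cast; ring
    rw [h1, hXf]; simp only
    rw [hXu, ← mul_sub, ← sum_sub_distrib, norm_ofReal_mul (by positivity)]
    have h2 : ‖∑ j, ((κ (gridIndex N x) j : ℂ) * u j - (κ (gridIndex N x) j : ℂ) *
        (((Gamma β)⁻¹ : ℝ) * lapInt β β (-(I * z)) (X j)))‖ ≤ ∑ _j : Fin N, S * ε := by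
      refine (norm_sum_le _ _).trans (sum_le_sum fun j _ => ?_)
      rw [← mul_sub, norm_ofReal_mul (hκ0 _ _)]
      exact mul_le_mul (hκS _ _) (hu j) (norm_nonneg _) hS0
    calc _ ≤ c / N * ∑ _j : Fin N, S * ε := by gcongr
      _ = c * S * ε := by simp; field_simp
  have hki : Integrable (fun x => ∫ v, |k' x v - k x v| ∂Λ) Λ := hk'.integrable_integral_abs_sub hk
  have hpt : ∀ x, ‖Xf x - F x‖ ≤ c * S * ε + (fieldLip β (S * d) z.im +
      c * (1 / z.im) ^ β * ∫ v, |k' x v - k x v| ∂Λ) := by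
    intro x; rw [hF, ← fieldStep_field hk hβ0 hβ1 hz x]
    refine (norm_sub_le_norm_sub_add_norm_sub _ (fieldStep β k' z Xf x) _).trans
      (add_le_add (hstep x) ?_)
    refine norm_fieldStep_sub_le_of_integral hk' hk hβ0 hβ1 hz0 hXff hFf
      (hdi.const_mul S) (.of_forall fun v =>
        mul_le_mul_of_nonneg_right (hκS _ _) (norm_nonneg _)) ?_ le_rfl
    rw [integral_const_mul]
  -- Integrating the pointwise bound gives `d ≤ d / 2 + O(ε)`, and the half is absorbed.
  have : d ≤ 2 * (c * S + c * (1 / z.im) ^ β) * ε := by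
    have h1 : d ≤ ∫ x, (c * S * ε + (fieldLip β (S * d) z.im + c * (1 / z.im) ^ β *
        ∫ v, |k' x v - k x v| ∂Λ)) ∂Λ :=
      integral_mono hdi ((integrable_const _).add ((integrable_const _).add (hki.const_mul _))) hpt
    rw [integral_const_add ((integrable_const _).fun_add (hki.const_mul _)),
      integral_const_add (hki.const_mul _)] at h1
    have h2 : fieldLip β (S * d) z.im = fieldLip β S z.im * d := by rw [fieldLip, fieldLip]; ring
    have h3 : c * (1 / z.im) ^ β * ∫ x, ∫ v, |k' x v - k x v| ∂Λ ∂Λ ≤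
        c * (1 / z.im) ^ β * ε := mul_le_mul_of_nonneg_left hkN (by positivity)
    rw [h2, integral_const_mul] at h1
    have := mul_le_mul_of_nonneg_right hLip hd0
    linarith
  have hmean : meanTransform ν (a N) (σ N) z = -I *
      ∫ x, (∫ ω, rotDiag (profileMatrix (a N) (σ N) ω) z (gridIndex N x) ∂P) ∂Λ := by
    have hi : ∀ i, Integrable (fun ω => rotDiag (profileMatrix (a N) (σ N) ω) z i) P := fun i =>
      integrable_of_bound (measurable_rotDiag i) fun ω => norm_rotDiag_le (hA ω) hz0 i
    rw [integral_gridIndex N (fun i => ∫ ω, rotDiag (profileMatrix (a N) (σ N) ω) z i ∂P),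
      ← integral_finsetSum _ fun i _ => hi i, meanTransform, integral_const_mul, real_smul]
    simp_rw [trace_green_eq_sum, integral_const_mul]; push_cast; ring
  have hwi : Integrable (fun x => ∫ ω, rotDiag (profileMatrix (a N) (σ N) ω) z (gridIndex N x) ∂P)
      Λ :=
    (measurePreserving_gridIndex N).integrable_comp_of_integrable (g := fun i => ∫ ω,
      rotDiag (profileMatrix (a N) (σ N) ω) z i ∂P)
      (Integrable.of_finite.smul_measure (by simp [NeZero.ne N]))
  rw [dist_eq_norm, hmean, limitTransform, ← mul_sub, norm_mul, norm_neg, norm_I, one_mul,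
    ← integral_sub hwi (integrable_lapInt_field hk hβ0 hβ1 hz)]
  have hb : Integrable (fun x => ε + L * ‖Xf x - F x‖) Λ :=
    (integrable_const _).add (hdi.const_mul L)
  refine (norm_integral_le_of_norm_le hb (.of_forall fun x => ?_)).trans_lt ?_
  · have h1 := hw (gridIndex N x)
    simp only [ofReal_one, cpow_one, Gamma_one, inv_one, one_mul] at h1
    have h2 := norm_lapInt_sub_le (β := β) (p := 1) hβ0 hβ1 one_pos
      (show 0 < (-(I * z)).re by rwa [re_neg_I_mul])
      (hXff.re_nonneg hβ1 x) (hFf.re_nonneg hβ1 x)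
    rw [re_neg_I_mul] at h2
    exact (norm_sub_le_norm_sub_add_norm_sub _ _ _).trans (add_le_add h1 h2)
  · rw [integral_const_add (hdi.const_mul L), integral_const_mul]
    have h1 : L * d ≤ L * (2 * (c * S + c * (1 / z.im) ^ β) * ε) := by gcongr
    have h2 : T * ε = ε' / 2 := by rw [hε]; field_simp
    have h3 : ε + L * (2 * (c * S + c * (1 / z.im) ^ β) * ε) = T * ε := by rw [hT]; ring
    linarith

end Bounded

/-! ### Stability under perturbations of the profile -/

section Perturbation

variable {N : ℕ} {c : ℝ} {σ τ : Fin N → Fin N → ℝ} {z : ℂ}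

/-- The entries are switched block by block, grouped by larger index. A block with a change affects
only one row and column and costs `6 / Im z`, however large the changes are; a block without change
costs nothing. -/
lemma norm_trace_green_sub_le (hσ : ∀ i j, σ i j = σ j i) (hz : 0 < z.im)
    (ω ω' : Sym2 (Fin N) → ℝ) :
    ‖(green (profileMatrix c σ ω) z).trace - (green (profileMatrix c σ ω') z).trace‖ ≤
      6 / z.im * ∑ k, ∑ j, if ω s(k, j) = ω' s(k, j) then (0 : ℝ) else 1 := by
  classical
  set H : ℕ → Sym2 (Fin N) → ℝ := fun k e => if (e.sup : ℕ) < k then ω' e else ω e with hH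
  have h0 : H 0 = ω := by funext e; simp [hH]
  have hN : H N = ω' := by funext e; simp [hH]
  have hstep : ∀ k : Fin N, ‖(green (profileMatrix c σ (H k)) z).trace -
      (green (profileMatrix c σ (H (k + 1))) z).trace‖ ≤
      6 / z.im * ∑ j, if ω s(k, j) = ω' s(k, j) then (0 : ℝ) else 1 := by
    intro k
    by_cases hk : ∀ j, ω s(k, j) = ω' s(k, j)
    · have : H k = H (k + 1) := by
        funext e
        induction e with | _ i j
        simp only [hH]
        rcases lt_trichotomy (s(i, j).sup : ℕ) k with h | h | h
        · rw [if_pos h, if_pos (by omega)]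
        · rw [if_neg (by omega), if_pos (by omega)]; rw [Sym2.sup_mk] at h
          rcases max_choice i j with h' | h' <;> rw [h'] at h
          · rw [Fin.ext h]; exact hk j
          · rw [Fin.ext h, Sym2.eq_swap]; exact hk i
        · rw [if_neg (by omega), if_neg (by omega)]
      rw [this, sub_self, norm_zero]
      exact mul_nonneg (by positivity) (sum_nonneg fun j _ => by split_ifs <;> norm_num)
    · push Not at hk
      obtain ⟨j, hj⟩ := hk
      have h1 : (1 : ℝ) ≤ ∑ j, if ω s(k, j) = ω' s(k, j) then (0 : ℝ) else 1 := by
        have := single_le_sum (f := fun j => if ω s(k, j) = ω' s(k, j) then (0 : ℝ) else 1)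
          (fun j _ => by split_ifs <;> norm_num) (Finset.mem_univ j)
        simpa [hj] using this
      have hmin : minor (profileMatrix c σ (H k)) k = minor (profileMatrix c σ (H (k + 1))) k :=
        minor_profileMatrix_congr fun i j hi hj => by
          have : (s(i, j).sup : ℕ) ≠ k := fun h => by
            rw [Sym2.sup_mk] at h
            rcases max_choice i j with h' | h' <;> rw [h'] at h
            exacts [hi (Fin.ext h), hj (Fin.ext h)]
          simp only [hH]
          rcases lt_or_gt_of_ne this with h | h
          · rw [if_pos h, if_pos (by omega)]
          · rw [if_neg (by omega), if_neg (by omega)]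
      rw [trace_green_eq_sum, trace_green_eq_sum, ← mul_sub, ← sum_sub_distrib, norm_mul,
        norm_neg, norm_I, one_mul]
      refine ((norm_sum_le _ _).trans (sum_norm_rotDiag_sub_le (isSymm_profileMatrix hσ)
        (isSymm_profileMatrix hσ) hz hmin)).trans (le_mul_of_one_le_right (by positivity) h1)
  have htel := Finset.sum_range_sub' (fun k => (green (profileMatrix c σ (H k)) z).trace) N
  rw [h0, hN] at htel; rw [← htel, Finset.sum_range, mul_sum]
  exact (norm_sum_le _ _).trans (sum_le_sum fun k _ => hstep k)

lemma integrable_trace_green {ν : Measure ℝ} [IsProbabilityMeasure ν] (hσ : ∀ i j, σ i j = σ j i)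
    (hz : 0 < z.im) : Integrable (fun ω => (N : ℂ)⁻¹ * (green (profileMatrix c σ ω) z).trace)
      (Measure.pi fun _ => ν) :=
  (integrable_finsetSum _ fun i _ => Integrable.of_bound
    (measurable_green continuous_profileMatrix z i i).aestronglyMeasurable _
    (.of_forall fun _ => norm_green_le (isSymm_profileMatrix hσ) hz i i)).const_mul _

end Perturbation

/-- Entries above `B a_N` are few and are removed by the block bound, whatever their size. For the
truncated entries, of second moment `O(1 / N)`, the Hilbert-Schmidt bound applies. -/
lemma IsTailLimit.exists_norm_meanTransform_sub_le {α : ℝ} {ν : Measure ℝ} {a : ℕ → ℝ} {z : ℂ}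
    [IsProbabilityMeasure ν] (h : IsTailLimit α ν a) (hα0 : 0 < α) (hz : 0 < z.im) {η : ℝ}
    (hη : 0 < η) :
    ∃ δ : ℝ, 0 < δ ∧ ∀ᶠ N : ℕ in atTop, ∀ σ τ : Fin N → Fin N → ℝ, (∀ i j, σ i j = σ j i) →
      (∀ i j, τ i j = τ j i) → ((N : ℝ) ^ 2)⁻¹ * ∑ i, ∑ j, (σ i j - τ i j) ^ 2 ≤ δ →
      ‖meanTransform ν (a N) (σ) z - meanTransform ν (a N) τ z‖ ≤ η := by
  obtain ⟨B, hB0, hB⟩ := h.eventually_exists_level hα0 (show 0 < η * z.im / 24 by positivity)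
  obtain ⟨C, hC0, hC⟩ := h.exists_truncated_moments hB0
  -- The truncated part contributes `η⁻¹ (Im z)⁻⁴ C δ`, which this choice makes at most `η / 4`. The
  -- level `η Im z / 24` likewise turns the factor `12 / Im z` for the large entries into `η / 2`.
  refine ⟨η ^ 2 * z.im ^ 4 / (4 * (C + 1)), by positivity, ?_⟩
  set δ := η ^ 2 * z.im ^ 4 / (4 * (C + 1)) with hδ
  filter_upwards [hB, hC 1 one_pos, h.pos, eventually_gt_atTop 0] with N hBN hCN ha hN σ τ hσ hτ hστ
  have hN' : (0 : ℝ) < N := by exact_mod_cast hN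
  set P := Measure.pi fun _ : Sym2 (Fin N) => ν with hP
  set bad : Set ℝ := {x | B * a N ≤ |x|}
  have hbm : MeasurableSet bad := measurableSet_le (by fun_prop) (by fun_prop)
  set cut : ℝ → ℝ := fun x => a N * truncated (a N) B x with hcut
  have hcx : ∀ x, x ∉ bad → x = cut x := by
    intro x hx
    have hx' : |x| < B * a N := not_le.1 fun h => hx h
    simp only [hcut, truncated, if_pos hx']; field_simp
  set m := fun ω : Sym2 (Fin N) → ℝ => ∑ k, ∑ j, bad.indicator (fun _ => (1 : ℝ)) (ω s(k, j))
  set q := fun ω : Sym2 (Fin N) → ℝ =>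
    ∑ i, ∑ j, (σ i j - τ i j) ^ 2 * truncated (a N) B (ω s(i, j)) ^ 2
  have hind : Integrable (bad.indicator fun _ => (1 : ℝ)) ν := (integrable_const 1).indicator hbm
  have htr : Integrable (fun x => truncated (a N) B x ^ 2) ν :=
    integrable_of_bound (C := B ^ 2) ((measurable_truncated _ _).pow_const 2) fun x => by
      rw [norm_pow, norm_eq_abs]; gcongr; exact (abs_truncated_le ha hB0 _).trans (min_le_right _ _)
  have hev : ∀ {f : ℝ → ℝ} (e : Sym2 (Fin N)), Integrable f ν → Integrable (fun ω => f (ω e)) P :=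
    fun e hf => (measurePreserving_eval (fun _ => ν) e).integrable_comp_of_integrable hf
  have hmi : Integrable m P := integrable_finsetSum _ fun k _ => integrable_finsetSum _ fun j _ =>
    hev _ hind
  have hqi : Integrable q P := integrable_finsetSum _ fun k _ => integrable_finsetSum _ fun j _ =>
    (hev _ htr).const_mul _
  have hsum : ∀ {f : Fin N → Fin N → (Sym2 (Fin N) → ℝ) → ℝ}, (∀ i j, Integrable (f i j) P) →
      ∫ ω, ∑ i, ∑ j, f i j ω ∂P = ∑ i, ∑ j, ∫ ω, f i j ω ∂P := fun hf => by
    rw [integral_finsetSum _ fun i _ => integrable_finsetSum _ fun j _ => hf i j]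
    exact sum_congr rfl fun i _ => integral_finsetSum _ fun j _ => hf i j
  have hmE : ∫ ω, m ω ∂P = N ^ 2 * ν.real bad := by
    refine (hsum fun i j => hev s(i, j) hind).trans ?_
    simp_rw [hP, integral_comp_eval (μ := fun _ : Sym2 (Fin N) => ν) hind.1,
      integral_indicator_const _ hbm]
    simp; ring
  have hqE : ∫ ω, q ω ∂P ≤ C * (N * δ) := by
    refine le_of_eq_of_le (hsum fun i j => (hev s(i, j) htr).const_mul ((σ i j - τ i j) ^ 2)) ?_
    simp_rw [integral_const_mul]
    simp_rw [hP, integral_comp_eval (μ := fun _ : Sym2 (Fin N) => ν) htr.1, ← sum_mul]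
    rw [inv_mul_le_iff₀ (by positivity)] at hστ
    calc _ ≤ (N ^ 2 * δ) * (C / N) := mul_le_mul hστ hCN.1 (integral_nonneg fun x => sq_nonneg _)
          (by positivity)
      _ = _ := by field_simp
  have hi := integrable_trace_green (ν := ν) (c := a N) hσ hz
  have hi' := integrable_trace_green (ν := ν) (c := a N) hτ hz
  rw [meanTransform, meanTransform, ← integral_sub hi hi']
  have hbi : Integrable (fun ω => η / 4 + (12 / z.im / N * m ω +
      η⁻¹ * ((1 / z.im) ^ 4 / N) * q ω)) P :=
    (integrable_const _).add ((hmi.const_mul _).add (hqi.const_mul _))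
  refine (norm_integral_le_of_norm_le hbi (.of_forall fun ω => ?_)).trans ?_
  · have hdiff : ∀ {ρ : Fin N → Fin N → ℝ}, (∀ i j, ρ i j = ρ j i) →
        ‖(green (profileMatrix (a N) ρ ω) z).trace -
          (green (profileMatrix (a N) ρ (cut ∘ ω)) z).trace‖ ≤ 6 / z.im * m ω := by
      intro ρ hρ
      refine (norm_trace_green_sub_le hρ hz ω (cut ∘ ω)).trans
        (mul_le_mul_of_nonneg_left ?_ (by positivity))
      refine sum_le_sum fun k _ => sum_le_sum fun j _ => ?_
      by_cases hx : ω s(k, j) ∈ bad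
      · rw [indicator_of_mem hx]; split_ifs <;> norm_num
      · rw [Function.comp_apply, if_pos (hcx _ hx), indicator_of_notMem hx]
    have hHS := norm_trace_green_sub_sq_le (z := z) (isSymm_profileMatrix (a := a N)
      (ω := cut ∘ ω) hσ) (isSymm_profileMatrix (a := a N) (ω := cut ∘ ω) hτ) hz
    have hHSq : ∑ i, ∑ j, (profileMatrix (a N) σ (cut ∘ ω) i j -
        profileMatrix (a N) τ (cut ∘ ω) i j) ^ 2 = q ω :=
      sum_congr rfl fun i _ => sum_congr rfl fun j _ => by
        simp only [profileMatrix, Matrix.of_apply, Function.comp_apply, hcut]; field_simp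
    rw [hHSq, Fintype.card_fin] at hHS
    set T₁ := (green (profileMatrix (a N) σ ω) z).trace
    set T₂ := (green (profileMatrix (a N) σ (cut ∘ ω)) z).trace
    set T₃ := (green (profileMatrix (a N) τ (cut ∘ ω)) z).trace
    set T₄ := (green (profileMatrix (a N) τ ω) z).trace
    have h1 := hdiff hσ
    have h2 := hdiff hτ
    have h3 : ‖T₁ - T₄‖ ≤ 12 / z.im * m ω + ‖T₂ - T₃‖ := by
      have : T₁ - T₄ = (T₁ - T₂) + (T₂ - T₃) - (T₄ - T₃) := by ring
      rw [this]
      have h5 := norm_sub_le ((T₁ - T₂) + (T₂ - T₃)) (T₄ - T₃)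
      have h6 := norm_add_le (T₁ - T₂) (T₂ - T₃)
      linarith [show 12 / z.im * m ω = 6 / z.im * m ω + 6 / z.im * m ω by ring]
    have h4 : (N : ℝ)⁻¹ * ‖T₂ - T₃‖ ≤ η / 4 + η⁻¹ * ((1 / z.im) ^ 4 / N) * q ω := by
      have h5 : ((N : ℝ)⁻¹ * ‖T₂ - T₃‖) ^ 2 ≤ (1 / z.im) ^ 4 / N * q ω := by
        rw [mul_pow]
        calc _ ≤ ((N : ℝ)⁻¹) ^ 2 * (q ω * ((1 / z.im) ^ 4 * N)) := by gcongr
          _ = _ := by field_simp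
      have h6 : ∀ t : ℝ, t ≤ η / 4 + η⁻¹ * t ^ 2 := fun t => by
        have : η / 4 + η⁻¹ * t ^ 2 - t = η⁻¹ * (t - η / 2) ^ 2 := by field_simp; ring
        have : 0 ≤ η⁻¹ * (t - η / 2) ^ 2 := by positivity
        linarith
      refine (h6 _).trans (add_le_add le_rfl ?_)
      rw [mul_assoc]; gcongr
    rw [← mul_sub, norm_mul, norm_inv, Complex.norm_natCast]
    calc _ ≤ (N : ℝ)⁻¹ * (12 / z.im * m ω + ‖T₂ - T₃‖) := by gcongr
      _ = 12 / z.im / N * m ω + (N : ℝ)⁻¹ * ‖T₂ - T₃‖ := by ring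
      _ ≤ _ := by linarith
  · rw [integral_const_add ((hmi.const_mul _).fun_add (hqi.const_mul _)),
      integral_add (hmi.const_mul _) (hqi.const_mul _)]
    simp only [integral_const_mul]
    have h1 : 12 / z.im / N * ∫ ω, m ω ∂P ≤ η / 2 := by
      rw [hmE]
      calc _ = 12 / z.im * (N * ν.real bad) := by field_simp
        _ ≤ 12 / z.im * (η * z.im / 24) := by gcongr
        _ = _ := by field_simp; norm_num
    have h2 : η⁻¹ * ((1 / z.im) ^ 4 / N) * ∫ ω, q ω ∂P ≤ η / 4 := by
      calc _ ≤ η⁻¹ * ((1 / z.im) ^ 4 / N) * (C * (N * δ)) := by gcongr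
        _ = η / 4 * (C / (C + 1)) := by rw [hδ]; field_simp
        _ ≤ η / 4 * 1 := by gcongr; rw [div_le_one (by positivity)]; linarith
        _ = _ := mul_one _
    linarith

/-! ### Kernels of profiles -/

lemma unitMeasure_prod : unitMeasure.prod Λ = volume.restrict (Ioc (0 : ℝ) 1 ×ˢ Ioc (0 : ℝ) 1) := by
  rw [Measure.prod_restrict, Measure.volume_eq_prod]

/-- A measurable version of `|σ|^α`, set to zero on the rows that violate the integral bound,
satisfies the requirements of a kernel for every `x` rather than almost every `x`. -/
lemma exists_isKernel {α K : ℝ} (hK : 0 ≤ K) {σ : ℝ → ℝ → ℝ}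
    (hm : AEMeasurable (Function.uncurry σ) (unitMeasure.prod Λ))
    (hb : ∀ᵐ x ∂Λ, ∫⁻ v, ofReal (|σ x v| ^ α) ∂Λ ≤ ofReal K) :
    ∃ k, IsKernel k K ∧ IsKernelOf α σ k := by
  classical
  set k₀ : ℝ × ℝ → ℝ := fun p => |hm.mk _ p| ^ α with hk₀
  have hk₀m : Measurable k₀ := hm.measurable_mk.abs.pow_const α
  set T : Set ℝ := {x | ∫⁻ v, ofReal (k₀ (x, v)) ∂Λ ≤ ofReal K}
  have hTm : MeasurableSet T := measurableSet_le
    (Measurable.lintegral_prod_right' (f := fun p => ofReal (k₀ p)) hk₀m.ennreal_ofReal)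
    measurable_const
  set k : ℝ → ℝ → ℝ := fun x v => if x ∈ T then k₀ (x, v) else 0 with hk
  have hk0 : ∀ x v, 0 ≤ k x v := fun x v => by simp only [hk]; split_ifs <;> positivity
  have hkm : Measurable (Function.uncurry k) :=
    Measurable.ite (measurable_fst hTm) hk₀m measurable_const
  have hkb : ∀ x, ∫⁻ v, ofReal (k x v) ∂Λ ≤ ofReal K := by
    intro x
    by_cases hx : x ∈ T
    · simp only [hk, if_pos hx]; exact hx
    · simp [hk, if_neg hx]
  have hki : ∀ x, Integrable (k x) Λ := fun x =>
    ⟨(hkm.comp measurable_prodMk_left).aestronglyMeasurable,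
      (hasFiniteIntegral_iff_ofReal (.of_forall (hk0 x))).2
        ((hkb x).trans_lt ENNReal.ofReal_lt_top)⟩
  refine ⟨k, ⟨hkm, hk0, hki, fun x => ?_⟩, ?_⟩
  · rw [integral_eq_lintegral_of_nonneg_ae (.of_forall (hk0 x)) (hki x).1]
    exact ENNReal.toReal_le_of_le_ofReal hK (hkb x)
  · filter_upwards [Measure.ae_ae_of_ae_prod hm.ae_eq_mk, hb] with x hx hbx
    have hxT : x ∈ T := by
      refine le_trans (le_of_eq (lintegral_congr_ae ?_)) hbx
      filter_upwards [hx] with v hv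
      rw [hk₀]; simp only [← hv]; rfl
    filter_upwards [hx] with v hv
    simp only [hk, if_pos hxT, hk₀, ← hv]; rfl

/-! ### Piecewise constant profiles -/

/-- The values of a profile on the grid. -/
def gridProfile (σ : ℝ → ℝ → ℝ) (N : ℕ) (i j : Fin N) : ℝ :=
  σ (((i : ℕ) + 1 : ℝ) / N) (((j : ℕ) + 1 : ℝ) / N)

lemma gridPoint_mem {N : ℕ} (i : Fin N) : (((i : ℕ) + 1 : ℝ) / N) ∈ Ioc (0 : ℝ) 1 := by
  have hN : (0 : ℝ) < N := by exact_mod_cast i.pos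
  exact ⟨by positivity, (div_le_one hN).2 (by exact_mod_cast i.2)⟩

lemma gridProfile_gridIndex (σ : ℝ → ℝ → ℝ) (N : ℕ) [NeZero N] {x v : ℝ} (hx : x ∈ Ioc (0 : ℝ) 1)
    (hv : v ∈ Ioc (0 : ℝ) 1) : gridProfile σ N (gridIndex N x) (gridIndex N v) =
      σ ((⌈(N : ℝ) * x⌉ : ℝ) / N) ((⌈(N : ℝ) * v⌉ : ℝ) / N) := by
  rw [gridProfile, gridPoint_eq N hx, gridPoint_eq N hv]

/-- The norms in the limsup that defines `starNorm` are exactly root mean squares over the grid. -/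
lemma eventually_sum_sq_gridProfile_le {f : ℝ → ℝ → ℝ} {ε : ℝ} (hε : 0 < ε)
    (hf : starNorm f < ofReal ε) :
    ∀ᶠ N : ℕ in atTop, ((N : ℝ) ^ 2)⁻¹ * ∑ i, ∑ j, gridProfile f N i j ^ 2 ≤ ε ^ 2 := by
  filter_upwards [eventually_lt_of_limsup_lt hf, eventually_gt_atTop 0] with N hN hN0
  have : NeZero N := ⟨hN0.ne'⟩
  set G : ℝ × ℝ → ℝ := fun p => gridProfile f N (gridIndex N p.1) (gridIndex N p.2) with hG
  have hGm : Measurable G := measurable_grid (gridProfile f N)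
  have hGb : ∀ p, ‖G p‖ ≤ ∑ i, ∑ j, |gridProfile f N i j| := fun p =>
    (single_le_sum (f := fun j => |gridProfile f N (gridIndex N p.1) j|)
      (fun j _ => abs_nonneg _) (Finset.mem_univ _)).trans
      (single_le_sum (f := fun i => ∑ j, |gridProfile f N i j|)
        (fun i _ => sum_nonneg fun j _ => abs_nonneg _) (Finset.mem_univ _))
  have hGL : MemLp G 2 (unitMeasure.prod Λ) :=
    MemLp.of_bound hGm.aestronglyMeasurable _ (.of_forall hGb)
  have hae : (fun p : ℝ × ℝ => f ((⌈(N : ℝ) * p.1⌉ : ℝ) / N) ((⌈(N : ℝ) * p.2⌉ : ℝ) / N))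
      =ᵐ[volume.restrict (Ioc (0 : ℝ) 1 ×ˢ Ioc (0 : ℝ) 1)] G := by
    filter_upwards [ae_restrict_mem (measurableSet_Ioc.prod measurableSet_Ioc)] with p hp
    exact (gridProfile_gridIndex f N hp.1 hp.2).symm
  have hL := hGL.eLpNorm_eq_integral_rpow_norm two_ne_zero ENNReal.ofNat_ne_top
  rw [unitMeasure_prod] at hL
  rw [eLpNorm_congr_ae hae, hL, ENNReal.ofReal_lt_ofReal_iff hε, ← unitMeasure_prod] at hN
  simp only [ENNReal.toReal_ofNat, Real.rpow_two] at hN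
  have hI : ∫ p, ‖G p‖ ^ 2 ∂(unitMeasure.prod Λ) =
      ((N : ℝ) ^ 2)⁻¹ * ∑ i, ∑ j, gridProfile f N i j ^ 2 := by
    rw [integral_prod _ (hGL.integrable_norm_pow two_ne_zero)]; simp only [hG, norm_eq_abs, sq_abs]
    simp_rw [fun x => integral_gridIndex N (fun j => gridProfile f N (gridIndex N x) j ^ 2)]
    rw [integral_gridIndex N (fun i => (N : ℝ)⁻¹ • ∑ j, gridProfile f N i j ^ 2)]
    simp only [smul_eq_mul, ← mul_sum]; ring
  have h0 : 0 ≤ ∫ p, ‖G p‖ ^ 2 ∂(unitMeasure.prod Λ) := integral_nonneg fun p => sq_nonneg _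
  rw [← hI]
  calc _ = ((∫ p, ‖G p‖ ^ 2 ∂(unitMeasure.prod Λ)) ^ ((2 : ℝ)⁻¹)) ^ 2 := by
        rw [← Real.rpow_two, ← rpow_mul h0]; norm_num
    _ ≤ ε ^ 2 := by gcongr

section Piecewise

variable {σ : ℝ → ℝ → ℝ} {q : ℕ} {b : Fin (q + 1) → ℝ} {m : Matrix (Fin q) (Fin q) ℝ}

/-- Rounding up moves `x` by less than `1 / N`, which stays within the cell unless `x` is its right
end point. -/
lemma eventually_gridPoint_mem_cell {x : ℝ} {r : Fin q} (hx : x ∈ Ioc (b r.castSucc) (b r.succ))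
    (hx' : x ∉ range b) : ∀ᶠ N : ℕ in atTop,
      (⌈(N : ℝ) * x⌉ : ℝ) / N ∈ Ioc (b r.castSucc) (b r.succ) := by
  have hlt : x < b r.succ := hx.2.lt_of_ne fun h => hx' ⟨_, h.symm⟩
  filter_upwards [eventually_gt_atTop 0, eventually_div_natCast_le 1 (sub_pos.2 hlt)] with N hN hN1
  have hN' : (0 : ℝ) < N := by exact_mod_cast hN
  refine ⟨(lt_div_iff₀ hN').2 ?_, (div_le_iff₀ hN').2 ?_⟩
  · have := Int.le_ceil ((N : ℝ) * x)
    nlinarith [hx.1]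
  · rw [div_le_iff₀ hN'] at hN1
    have := Int.ceil_lt_add_one ((N : ℝ) * x)
    linarith

namespace IsPiecewiseConstantWith
lemma exists_cell (h : IsPiecewiseConstantWith σ q b m) {x : ℝ} (hx : x ∈ Ioc (0 : ℝ) 1) :
    ∃ r : Fin q, x ∈ Ioc (b r.castSucc) (b r.succ) := by
  classical
  obtain ⟨i, hi, hmin⟩ := Finset.exists_minimal (s := Finset.univ.filter fun i => x ≤ b i)
    ⟨Fin.last q, by simpa [h.one] using hx.2⟩
  have hi' : x ≤ b i := by simpa using hi
  obtain ⟨r, rfl⟩ := Fin.exists_succ_eq.2 (show i ≠ 0 by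
    rintro rfl; rw [h.zero] at hi'; exact absurd hx.1 (not_lt.2 hi'))
  refine ⟨r, not_le.1 fun hle => ?_, hi'⟩
  exact absurd (hmin (y := r.castSucc) (by simpa using hle) r.castSucc_lt_succ.le)
    (not_le.2 r.castSucc_lt_succ)

lemma cell_subset (h : IsPiecewiseConstantWith σ q b m) (r : Fin q) : Ioc (b r.castSucc) (b r.succ) ⊆ Ioc 0 1 :=
  Ioc_subset_Ioc (h.zero ▸ h.strictMono.monotone (Fin.zero_le _))
    (h.one ▸ h.strictMono.monotone (Fin.le_last _))

lemma abs_le (h : IsPiecewiseConstantWith σ q b m) {x y : ℝ} (hx : x ∈ Ioc (0 : ℝ) 1) (hy : y ∈ Ioc (0 : ℝ) 1) :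
    |σ x y| ≤ ∑ r, ∑ s, |m r s| := by
  obtain ⟨r, hr⟩ := h.exists_cell hx
  obtain ⟨s, hs⟩ := h.exists_cell hy
  rw [h.eq r s x hr y hs]
  exact (single_le_sum (f := fun s => |m r s|) (fun _ _ => abs_nonneg _)
    (Finset.mem_univ s)).trans (single_le_sum (f := fun r => ∑ s, |m r s|)
      (fun _ _ => sum_nonneg fun _ _ => abs_nonneg _) (Finset.mem_univ r))

lemma comm (h : IsPiecewiseConstantWith σ q b m) {x y : ℝ} (hx : x ∈ Ioc (0 : ℝ) 1) (hy : y ∈ Ioc (0 : ℝ) 1) : σ x y = σ y x := by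
  obtain ⟨r, hr⟩ := h.exists_cell hx
  obtain ⟨s, hs⟩ := h.exists_cell hy
  rw [h.eq r s x hr y hs, h.eq s r y hs x hr, h.symm.apply]

lemma aemeasurable (h : IsPiecewiseConstantWith σ q b m) : AEMeasurable (Function.uncurry σ) (unitMeasure.prod Λ) := by
  rw [unitMeasure_prod]
  refine AEMeasurable.mono_set (t := ⋃ p : Fin q × Fin q, Ioc (b p.1.castSucc) (b p.1.succ) ×ˢ
    Ioc (b p.2.castSucc) (b p.2.succ)) (fun p hp => ?_) (aemeasurable_iUnion_iff.2 fun p => ?_)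
  · obtain ⟨r, hr⟩ := h.exists_cell hp.1
    obtain ⟨s, hs⟩ := h.exists_cell hp.2
    exact mem_iUnion.2 ⟨(r, s), hr, hs⟩
  · refine (aemeasurable_const (b := m p.1 p.2)).congr ?_
    filter_upwards [ae_restrict_mem (measurableSet_Ioc.prod measurableSet_Ioc)] with y hy
    exact (h.eq _ _ _ hy.1 _ hy.2).symm

/-- Off the finitely many break points the grid values eventually equal the true ones, and dominated
convergence is applied in each variable. -/
lemma tendsto_integral_grid (h : IsPiecewiseConstantWith σ q b m) {α : ℝ} (hα : 0 < α) {k : ℝ → ℝ → ℝ} {K : ℝ} (hk : IsKernel k K)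
    (hkσ : IsKernelOf α σ k) :
    Tendsto (fun n : ℕ => ∫ x, ∫ v, |(|gridProfile σ (n + 1) (gridIndex (n + 1) x)
      (gridIndex (n + 1) v)| ^ α) - k x v| ∂Λ ∂Λ) atTop (𝓝 0) := by
  set S := (∑ r, ∑ s, |m r s|) ^ α
  have hgk : ∀ n : ℕ, IsKernel (fun x v => |gridProfile σ (n + 1) (gridIndex (n + 1) x)
      (gridIndex (n + 1) v)| ^ α) S := fun n =>
    isKernel_grid (κ := fun i j => |gridProfile σ (n + 1) i j| ^ α) (fun i j => by positivity)
      fun i j => rpow_le_rpow (abs_nonneg _) (h.abs_le (gridPoint_mem i) (gridPoint_mem j)) hα.le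
  have hnull : ∀ᵐ x ∂Λ, x ∉ range b :=
    ae_restrict_of_ae (measure_eq_zero_iff_ae_notMem.1 ((finite_range b).measure_zero _))
  have hI : ∀ᵐ x ∂Λ, x ∈ Ioc (0 : ℝ) 1 := ae_restrict_mem measurableSet_Ioc
  rw [← integral_zero ℝ ℝ (μ := Λ)]
  refine tendsto_integral_of_dominated_convergence (fun _ => S + K)
    (fun n => ((hgk n).integrable_integral_abs_sub hk).1) (integrable_const _)
    (fun n => .of_forall fun x => ?_) ?_
  · rw [norm_of_nonneg (integral_nonneg fun v => abs_nonneg _)]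
    exact (hgk n).integral_abs_sub_le hk x
  filter_upwards [hkσ, hnull, hI] with x hxk hxb hx
  rw [← integral_zero ℝ ℝ (μ := Λ)]
  refine tendsto_integral_of_dominated_convergence (fun v => S + k x v)
    (fun n => (((hgk n).integrable x).sub (hk.integrable x)).abs.1)
    ((integrable_const _).add (hk.integrable x)) (fun n => .of_forall fun v => ?_) ?_
  · rw [norm_eq_abs, abs_abs]
    refine (abs_sub _ _).trans (add_le_add ?_ (abs_of_nonneg (hk.nonneg x v)).le)
    rw [abs_of_nonneg (by positivity)]
    exact rpow_le_rpow (abs_nonneg _) (h.abs_le (gridPoint_mem _) (gridPoint_mem _)) hα.le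
  filter_upwards [hxk, hnull, hI] with v hvk hvb hv
  obtain ⟨r, hr⟩ := h.exists_cell hx
  obtain ⟨s, hs⟩ := h.exists_cell hv
  refine tendsto_const_nhds.congr' ?_
  filter_upwards [(tendsto_add_atTop_nat 1).eventually (eventually_gridPoint_mem_cell hr hxb),
    (tendsto_add_atTop_nat 1).eventually (eventually_gridPoint_mem_cell hs hvb)] with n hn1 hn2
  rw [gridProfile_gridIndex σ (n + 1) hx hv, h.eq r s _ hn1 _ hn2, ← hvk, h.eq r s x hr v hs,
    sub_self, abs_zero]

lemma exists_tendsto_meanTransform (h : IsPiecewiseConstantWith σ q b m) {α : ℝ} (hα0 : 0 < α) (hα2 : α < 2) :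
    ∃ (k : ℝ → ℝ → ℝ) (K : ℝ), IsKernel k K ∧ IsKernelOf α σ k ∧
      ∀ (ν : Measure ℝ) [IsProbabilityMeasure ν] (a : ℕ → ℝ), IsTailLimit α ν a →
        ∀ z ∈ upperHalf, fieldLip (α / 2) K z.im ≤ 1 / 2 →
        Tendsto (fun N => meanTransform ν (a N) (gridProfile σ N) z) atTop
          (𝓝 (limitTransform (α / 2) k z)) := by
  set s := ∑ r, ∑ s, |m r s|
  have hs0 : 0 ≤ s := sum_nonneg fun _ _ => sum_nonneg fun _ _ => abs_nonneg _
  obtain ⟨k, hk, hkσ⟩ := exists_isKernel (α := α) (K := |s| ^ α) (by positivity) h.aemeasurable (by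
    filter_upwards [ae_restrict_mem measurableSet_Ioc] with x hx
    refine (lintegral_mono_ae (g := fun _ => ofReal (|s| ^ α)) ?_).trans (by simp)
    filter_upwards [ae_restrict_mem measurableSet_Ioc] with v hv
    rw [abs_of_nonneg hs0]
    exact ENNReal.ofReal_le_ofReal (rpow_le_rpow (abs_nonneg _) (h.abs_le hx hv) hα0.le))
  refine ⟨k, |s| ^ α, hk, hkσ, fun ν _ a ha z hz hLip => ?_⟩
  refine ha.tendsto_meanTransform hα0 hα2 hz hLip hk
    (fun N i j => h.comm (gridPoint_mem i) (gridPoint_mem j))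
    (fun N i j => h.abs_le (gridPoint_mem i) (gridPoint_mem j)) fun ε hε => ?_
  obtain ⟨n₀, hn₀⟩ := eventually_atTop.1
    ((h.tendsto_integral_grid hα0 hk hkσ).eventually (gt_mem_nhds hε))
  filter_upwards [eventually_ge_atTop (n₀ + 1)] with N hN
  obtain ⟨n, rfl⟩ : ∃ n, N = n + 1 := ⟨N - 1, by omega⟩
  intro _; exact (hn₀ n (by omega)).le

end IsPiecewiseConstantWith

end Piecewise

/-! ### The expected spectral measure -/

/-- A family of probability measures is measurable if the Cauchy-Stieltjes transforms are. -/
lemma measurable_of_measurable_stieltjes {T : Type*} [MeasurableSpace T] {Φ : T → Measure ℝ}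
    [∀ ω, IsProbabilityMeasure (Φ ω)] (h : ∀ ε : ℝ, 0 < ε → Measurable fun p : T × ℝ =>
      stieltjes (Φ p.1) (p.2 + (ε : ℂ) * I)) : Measurable Φ := by
  have hInt : ∀ f : ℝ → ℝ, Continuous f → (∀ t, |f t| ≤ 1) → Measurable fun ω => ∫ t, f t ∂Φ ω := by
    intro f hf hf1
    -- Integrals of bounded continuous functions are limits of integrals of the transform by
    -- Stieltjes inversion, so they inherit its measurability; closed half-lines are then
    -- approximated from outside.
    have h1 : ∀ ω, Tendsto (fun n : ℕ => π⁻¹ * ∫ t, f t * -(stieltjes (Φ ω)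
        (t + ((1 / ((n : ℝ) + 1) : ℝ) : ℂ) * I)).im) atTop (𝓝 (∫ t, f t ∂Φ ω)) := by
      intro ω
      have := (tendsto_integral_mul_neg_im_stieltjes (Φ ω) hf hf1).const_mul π⁻¹
      rwa [inv_mul_cancel_left₀ Real.pi_ne_zero] at this
    refine measurable_of_tendsto_metrizable (fun n => ?_) (tendsto_pi_nhds.2 h1)
    refine Measurable.const_mul (StronglyMeasurable.measurable ?_) _
    refine StronglyMeasurable.integral_prod_right (f := fun ω t => f t * -(stieltjes (Φ ω)
        (t + ((1 / ((n : ℝ) + 1) : ℝ) : ℂ) * I)).im) (Measurable.stronglyMeasurable ?_)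
    exact (hf.measurable.comp measurable_snd).mul
      (Complex.measurable_im.comp (h _ (by positivity))).neg
  refine .measure_of_isPiSystem_of_isProbabilityMeasure (borel_eq_generateFrom_Iic ℝ)
    isPiSystem_Iic ?_
  rintro s ⟨t, rfl⟩
  refine measurable_of_tendsto_metrizable (fun n => ?_) (tendsto_pi_nhds.2 fun ω =>
    HasOuterApproxClosed.tendsto_lintegral_apprSeq (isClosed_Iic (a := t)) (Φ ω))
  have h2 : ∀ ω, ∫⁻ x, ((isClosed_Iic (a := t)).apprSeq n x : ℝ≥0∞) ∂Φ ω =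
      ofReal (∫ x, ((isClosed_Iic (a := t)).apprSeq n x : ℝ) ∂Φ ω) := fun ω =>
    lintegral_coe_eq_integral _ (BoundedContinuousFunction.integrable_of_nnreal (Φ ω) _)
  simp_rw [h2]
  refine (hInt _ (by fun_prop) fun x => ?_).ennreal_ofReal
  rw [abs_of_nonneg NNReal.zero_le_coe]
  exact_mod_cast HasOuterApproxClosed.apprSeq_apply_le_one isClosed_Iic n x

section MeanMeasure

variable {ν : Measure ℝ} {c : ℝ} {N : ℕ} {σ : Fin N → Fin N → ℝ}

/-- Measurability is read off the transforms, so no measurable choice of eigenvalues is needed.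
Moving `Re z` into the matrix leaves a fixed spectral parameter and gives joint measurability in the
matrix and `Re z`. -/
lemma measurable_spectralMeasure (hN : 0 < N) (hσ : ∀ i j, σ i j = σ j i) :
    Measurable fun ω => spectralMeasure (profileMatrix c σ ω) := by
  have hA : ∀ ω, (profileMatrix c σ ω).IsSymm := fun ω => isSymm_profileMatrix hσ
  have : ∀ ω, IsProbabilityMeasure (spectralMeasure (profileMatrix c σ ω)) := fun ω =>
    isProbabilityMeasure_spectralMeasure hN (hA ω)
  refine measurable_of_measurable_stieltjes fun ε hε => ?_
  have h1 : ∀ p : (Sym2 (Fin N) → ℝ) × ℝ, stieltjes (spectralMeasure (profileMatrix c σ p.1))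
      (p.2 + (ε : ℂ) * I) = (N : ℂ)⁻¹ *
        ∑ i, green (profileMatrix c σ p.1 - Matrix.scalar (Fin N) p.2) (ε * I) i i := by
    intro p
    rw [stieltjes_spectralMeasure (hA _) (by simpa using hε), Matrix.trace]
    have h2 : shifted (profileMatrix c σ p.1) (p.2 + (ε : ℂ) * I) =
        shifted (profileMatrix c σ p.1 - Matrix.scalar (Fin N) p.2) (ε * I) := by
      ext i j
      by_cases hij : i = j
      · subst hij; simp [shifted]; ring
      · simp [shifted, hij]
    simp only [green, h2, Matrix.diag_apply]
  simp_rw [h1]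
  refine (measurable_sum _ fun i _ => measurable_green ?_ _ i i).const_mul _
  refine (continuous_profileMatrix.comp continuous_fst).sub (continuous_matrix fun i j => ?_)
  by_cases hij : i = j
  · subst hij; simpa using continuous_snd
  · simpa [hij] using continuous_const

/-- The expected spectral measure for independent entries with law `ν`. -/
def meanMeasure (ν : Measure ℝ) (c : ℝ) (σ : Fin N → Fin N → ℝ) : Measure ℝ :=
  (Measure.pi fun _ => ν).bind fun ω => spectralMeasure (profileMatrix c σ ω)

variable [IsProbabilityMeasure ν]

lemma isProbabilityMeasure_meanMeasure (hN : 0 < N) (hσ : ∀ i j, σ i j = σ j i) :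
    IsProbabilityMeasure (meanMeasure ν c σ) :=
  isProbabilityMeasure_bind (measurable_spectralMeasure hN hσ).aemeasurable
    (.of_forall fun _ => isProbabilityMeasure_spectralMeasure hN (isSymm_profileMatrix hσ))

lemma stieltjes_meanMeasure (hN : 0 < N) (hσ : ∀ i j, σ i j = σ j i) {z : ℂ} (hz : 0 < z.im) :
    stieltjes (meanMeasure ν c σ) z = meanTransform ν c σ z := by
  have := isProbabilityMeasure_meanMeasure (ν := ν) (c := c) hN hσ
  obtain ⟨κ, hκ⟩ : ∃ κ : Kernel (Sym2 (Fin N) → ℝ) ℝ,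
      ∀ ω, κ ω = spectralMeasure (profileMatrix c σ ω) :=
    ⟨⟨_, measurable_spectralMeasure hN hσ⟩, fun _ => rfl⟩
  have h1 : meanMeasure ν c σ = (κ ∘ₖ Kernel.const Unit (Measure.pi fun _ => ν)) () := by
    rw [← Measure.comp_eq_comp_const_apply, meanMeasure]
    exact congrArg _ (funext fun ω => (hκ ω).symm)
  have h2 := integrable_one_div_sub (meanMeasure ν c σ) hz
  rw [h1] at h2
  rw [stieltjes, h1, Kernel.integral_comp h2, Kernel.const_apply]
  refine integral_congr_fun fun ω => ?_
  simp_rw [hκ]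
  exact stieltjes_spectralMeasure (isSymm_profileMatrix hσ) hz

/-- The expected spectral measures of a sequence of profiles, from dimension `1` on. -/
def meanLaw (ν : Measure ℝ) [IsProbabilityMeasure ν] (a : ℕ → ℝ) {σ : ∀ N : ℕ, Fin N → Fin N → ℝ}
    (hσ : ∀ N i j, σ N i j = σ N j i) (n : ℕ) : ProbabilityMeasure ℝ :=
  ⟨meanMeasure ν (a (n + 1)) (σ (n + 1)), isProbabilityMeasure_meanMeasure n.succ_pos (hσ _)⟩

end MeanMeasure

/-- The matrices of a heavy-tailed array have the same law as those on the product space. -/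
lemma IsHeavyTailedArray.expectedSpectralMeasure_eq {Ω : Type*} [MeasurableSpace Ω] {P : Measure Ω}
    [IsProbabilityMeasure P] {α : ℝ} {x : ℕ → ℕ → Ω → ℝ} (hx : IsHeavyTailedArray P α x)
    {σ : ℝ → ℝ → ℝ} {N : ℕ} (hN : 0 < N) (hσ : ∀ i j, gridProfile σ N i j = gridProfile σ N j i) :
    expectedSpectralMeasure P x σ N = meanMeasure (P.map (x 0 0))
      (normalizingConstant P (x 0 0) N) (gridProfile σ N) := by
  set T : Ω → Sym2 (Fin N) → ℝ := fun ω e => x (e.inf : ℕ) (e.sup : ℕ) ω with hT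
  have hle : ∀ e : Sym2 (Fin N), (e.inf : ℕ) ≤ (e.sup : ℕ) := fun e => e.inf_le_sup
  have hTm : ∀ e : Sym2 (Fin N), Measurable (x (e.inf : ℕ) (e.sup : ℕ)) := fun e =>
    hx.measurable _ _ (hle e)
  have hmap : P.map T = Measure.pi fun _ => P.map (x 0 0) := by
    have h1 := hx.indep.precomp (g := fun e : Sym2 (Fin N) =>
      (⟨((e.inf : ℕ), (e.sup : ℕ)), hle e⟩ : {p : ℕ × ℕ // p.1 ≤ p.2})) (fun e e' h => by
        simp only [Subtype.mk.injEq, Prod.mk.injEq] at h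
        exact Sym2.inf_eq_inf_and_sup_eq_sup.1 ⟨Fin.ext h.1, Fin.ext h.2⟩)
    rw [hT, (iIndepFun_iff_map_fun_eq_pi_map fun e => (hTm e).aemeasurable).1 h1]
    congr 1; funext e; exact (hx.identDistrib _ _ (hle e)).map_eq
  have hb : ∀ ω, bandMatrix P x σ N ω =
      profileMatrix (normalizingConstant P (x 0 0) N) (gridProfile σ N) (T ω) := fun ω => by
    ext i j
    simp only [bandMatrix, profileMatrix, gridProfile, Matrix.of_apply, hT, Sym2.inf_mk,
      Sym2.sup_mk]
    rcases le_total i j with h | h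
    · simp [h]
    · simp [h]
  rw [expectedSpectralMeasure, meanMeasure, ← hmap]
  simp_rw [hb]
  rw [Measure.bind, Measure.bind, Measure.map_map (measurable_spectralMeasure hN hσ)
    (measurable_pi_lambda _ hTm)]
  rfl

lemma IsHeavyTailedArray.isTailLimit {Ω : Type*} [MeasurableSpace Ω] {P : Measure Ω}
    [IsProbabilityMeasure P] {α : ℝ} (hα0 : 0 < α) (hα2 : α < 2) {x : ℕ → ℕ → Ω → ℝ}
    (hx : IsHeavyTailedArray P α x) :
    IsTailLimit α (P.map (x 0 0)) (normalizingConstant P (x 0 0)) := by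
  obtain ⟨L, hL, hT⟩ := hx.tail
  have hm := hx.measurable 0 0 le_rfl
  have := Measure.isProbabilityMeasure_map (μ := P) hm.aemeasurable
  have h1 : ∀ u : ℝ, (P.map (x 0 0)).real {t | u ≤ |t|} = P.real {ω | u ≤ |x 0 0 ω|} := fun u =>
    map_measureReal_apply hm (measurableSet_le (by fun_prop) (by fun_prop))
  have h2 := isTailLimit_of_slowlyVarying hα0 hα2 (P.map (x 0 0)) hL fun u hu => by
    rw [h1]; exact hT u hu
  simp_rw [h1] at h2; exact h2

/-- Convergence of the transforms far from the real axis gives the limiting measure. -/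
lemma exists_tendsto_meanMeasure {α : ℝ} (hα0 : 0 < α) (hα2 : α < 2) {ν : Measure ℝ}
    [IsProbabilityMeasure ν] {a : ℕ → ℝ} {σ : ∀ N : ℕ, Fin N → Fin N → ℝ}
    (hσ : ∀ N i j, σ N i j = σ N j i) {k : ℝ → ℝ → ℝ} {K : ℝ} (hk : IsKernel k K) {y₀ : ℝ}
    (h : ∀ z : ℂ, 0 < z.im → y₀ < z.im → Tendsto (fun N => meanTransform ν (a N) (σ N) z) atTop
      (𝓝 (limitTransform (α / 2) k z))) :
    ∃ μ : ProbabilityMeasure ℝ, EqOn (stieltjes μ) (limitTransform (α / 2) k) upperHalf ∧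
      Tendsto (meanLaw ν a hσ) atTop (𝓝 μ) := by
  obtain ⟨R, C, hR, hC⟩ := exists_limitTransform_expansion hk hα0 hα2
  set S := ∫ x, ∫ v, k x v ∂Λ ∂Λ
  -- The expansion at infinity gives `z G(z) = 1 + O(y^(-α))`, which excludes loss of mass.
  have hlim : Tendsto (fun y : ℝ => (y * I) * limitTransform (α / 2) k (y * I)) atTop (𝓝 1) := by
    rw [tendsto_iff_norm_sub_tendsto_zero]
    have hb : Tendsto (fun y : ℝ => ‖tailCoeff α S‖ * y ^ (-α) + C * y ^ (-(2 * α))) atTop (𝓝 0) := by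
      simpa using ((tendsto_rpow_neg_atTop hα0).const_mul ‖tailCoeff α S‖).add
        ((tendsto_rpow_neg_atTop (show 0 < 2 * α by linarith)).const_mul C)
    refine squeeze_zero' (.of_forall fun y => norm_nonneg _) ?_ hb
    filter_upwards [eventually_ge_atTop R] with y hy
    have hy0 : 0 < y := by linarith
    obtain ⟨z, hz⟩ : ∃ z : ℂ, z = y * I := ⟨_, rfl⟩
    have hzn : ‖z‖ = y := by rw [hz, norm_mul, norm_I, mul_one, norm_real, norm_of_nonneg hy0.le]
    have hzu : z ∈ upperHalf := by simpa [upperHalf, hz] using hy0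
    have := ne_zero_of_mem_upperHalf hzu
    have h1 := hC z hzu (by rwa [hzn])
    rw [← hz]
    have h2 : z * limitTransform (α / 2) k z - 1 = z * (limitTransform (α / 2) k z -
        (1 / z + tailCoeff α S * z ^ (-(1 + α) : ℂ))) + tailCoeff α S * (z * z ^ (-(1 + α) : ℂ)) := by
      field_simp; ring
    have hexp : (-(1 + α) : ℂ) = ((-(1 + α) : ℝ) : ℂ) := by push_cast; ring
    rw [h2]
    refine (norm_add_le _ _).trans ?_
    rw [norm_mul, norm_mul, norm_mul, hexp, norm_cpow_real, hzn, add_comm]; rw [hzn, hexp] at h1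
    have e1 : y * y ^ (-(1 + α)) = y ^ (-α) := by
      rw [← Real.rpow_one_add' hy0.le (by linarith)]; congr 1; ring
    have e2 : y * y ^ (-(1 + 2 * α)) = y ^ (-(2 * α)) := by
      rw [← Real.rpow_one_add' hy0.le (by linarith)]; congr 1; ring
    rw [e1]
    refine add_le_add le_rfl ((mul_le_mul_of_nonneg_left h1 hy0.le).trans_eq ?_)
    rw [mul_left_comm, e2]
  obtain ⟨μ, hμ, hμG⟩ := exists_tendsto_of_tendsto_stieltjes
    (μ := meanLaw ν a hσ) (G := limitTransform (α / 2) k) (y₀ := y₀) (fun z hz hzy => by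
      refine ((h z hz hzy).comp (tendsto_add_atTop_nat 1)).congr fun n => ?_
      exact (stieltjes_meanMeasure n.succ_pos (hσ _) hz).symm) hlim
  exact ⟨μ, eqOn_upperHalf_of_im_gt (differentiableOn_stieltjes _)
    (differentiableOn_limitTransform hk (by linarith) (by linarith)) hμG, hμ⟩

/-! ### Convergence for general profiles -/

/-- `k` is a kernel for `σ`, and governs the limit of the expected resolvents. -/
structure IsLimitKernel (α : ℝ) (σ k : ℝ → ℝ → ℝ) (K : ℝ) : Prop where
  isKernel : IsKernel k K
  ae_eq : IsKernelOf α σ k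
  symm : ∀ N i j, gridProfile σ N i j = gridProfile σ N j i
  tendsto : ∀ (ν : Measure ℝ) [IsProbabilityMeasure ν] (a : ℕ → ℝ), IsTailLimit α ν a →
    ∀ z ∈ upperHalf, Tendsto (fun N => meanTransform ν (a N) (gridProfile σ N) z) atTop
      (𝓝 (limitTransform (α / 2) k z))

/-- Convergence far from the axis already implies weak convergence to a measure with the right
transform, and this returns convergence at every `z`. -/
lemma isLimitKernel_of_im_gt {α : ℝ} (hα0 : 0 < α) (hα2 : α < 2) {σ k : ℝ → ℝ → ℝ} {K y₀ : ℝ}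
    (hk : IsKernel k K) (hkσ : IsKernelOf α σ k)
    (hσ : ∀ N i j, gridProfile σ N i j = gridProfile σ N j i)
    (h : ∀ (ν : Measure ℝ) [IsProbabilityMeasure ν] (a : ℕ → ℝ), IsTailLimit α ν a →
      ∀ z : ℂ, 0 < z.im → y₀ < z.im → Tendsto
        (fun N => meanTransform ν (a N) (gridProfile σ N) z) atTop (𝓝 (limitTransform (α / 2) k z))) :
    IsLimitKernel α σ k K := by
  refine ⟨hk, hkσ, hσ, fun ν _ a ha z hz => (tendsto_add_atTop_iff_nat 1).1 ?_⟩
  obtain ⟨μ, hμ, ht⟩ := exists_tendsto_meanMeasure hα0 hα2 hσ hk (h ν a ha)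
  rw [← hμ hz]
  exact (tendsto_stieltjes ht hz).congr fun n => stieltjes_meanMeasure n.succ_pos (hσ _) hz

lemma exists_isLimitKernel_of_mem_CStar {α : ℝ} (hα0 : 0 < α) (hα2 : α < 2) {σ : ℝ → ℝ → ℝ}
    (hσ : σ ∈ CStar) : ∃ k K, IsLimitKernel α σ k K := by
  obtain ⟨q, b, m, h⟩ := hσ
  obtain ⟨k, K, hk, hkσ, ht⟩ := h.exists_tendsto_meanTransform hα0 hα2
  obtain ⟨y₀, -, hy₀⟩ := exists_fieldLip_le_half (show 0 < α / 2 by linarith) K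
  exact ⟨k, K, isLimitKernel_of_im_gt hα0 hα2 hk hkσ
    (fun N i j => h.comm (gridPoint_mem i) (gridPoint_mem j))
    fun ν _ a ha z hz hzy => ht ν a ha z hz (hy₀ _ hzy.le)⟩

lemma integral_abs_sub_le_of_opNorm_lt {α : ℝ} {σ τ k k' : ℝ → ℝ → ℝ} {K K' ε : ℝ}
    (hk : IsKernel k K) (hkσ : IsKernelOf α σ k) (hk' : IsKernel k' K') (hkτ : IsKernelOf α τ k')
    (hε : 0 ≤ ε) (h : opNorm (fun x v => |τ x v| ^ α - |σ x v| ^ α) < ofReal ε) :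
    ∀ᵐ x ∂Λ, ∫ v, |k x v - k' x v| ∂Λ ≤ ε := by
  filter_upwards [hkσ, hkτ, ENNReal.ae_le_essSup (μ := Λ)
    fun x => ∫⁻ v, ‖|τ x v| ^ α - |σ x v| ^ α‖ₑ ∂Λ] with x h1 h2 h3
  rw [← ENNReal.ofReal_le_ofReal_iff hε]
  refine (ofReal_integral_eq_lintegral_ofReal ((hk.integrable x).sub (hk'.integrable x)).abs
    (.of_forall fun _ => abs_nonneg _)).trans_le
    ((lintegral_congr_ae ?_).trans_le (h3.trans h.le))
  filter_upwards [h1, h2] with v h1 h2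
  rw [h1, h2, ← ofReal_norm, Pi.sub_apply, norm_eq_abs, abs_sub_comm]

/-- A three-term comparison through one piecewise constant approximant: closeness in `starNorm`
controls the random transforms, and closeness in `opNorm` controls the limits. -/
lemma IsInF.exists_isLimitKernel {α : ℝ} (hα0 : 0 < α) (hα2 : α < 2) {σ : ℝ → ℝ → ℝ}
    (hσ : IsInF α σ) : ∃ k K, IsLimitKernel α σ k K := by
  obtain ⟨τ, hτ, hτs, hτo⟩ := hσ.approx
  have hm := hσ.measurable
  rw [← unitMeasure_prod] at hm
  have hsymm : ∀ N i j, gridProfile σ N i j = gridProfile σ N j i := fun N i j =>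
    hσ.symm _ (gridPoint_mem i) _ (gridPoint_mem j)
  obtain ⟨k, hk, hkσ⟩ := exists_isKernel (α := α)
    (K := (opNorm fun x v => |σ x v| ^ α).toReal) ENNReal.toReal_nonneg hm (by
      rw [ENNReal.ofReal_toReal hσ.opNorm_lt_top.ne]
      filter_upwards [ENNReal.ae_le_essSup (μ := Λ) fun x => ∫⁻ v, ‖|σ x v| ^ α‖ₑ ∂Λ] with x hx
      refine le_trans (le_of_eq (lintegral_congr fun v => ?_)) hx
      rw [Real.enorm_of_nonneg (by positivity)])
  obtain ⟨y₀, -, hy₀⟩ := exists_fieldLip_le_half (show 0 < α / 2 by linarith)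
    (opNorm fun x v => |σ x v| ^ α).toReal
  refine ⟨k, _, isLimitKernel_of_im_gt hα0 hα2 hk hkσ hsymm (y₀ := y₀) fun ν _ a ha z hz hzy => ?_⟩
  have : 0 < Gamma (1 - α / 2) := Gamma_pos_of_pos (by linarith)
  have : 0 < Gamma (1 + α / 2) := Gamma_pos_of_pos (by linarith)
  set C := (1 / z.im) ^ (1 + α / 2) * Gamma (1 + α / 2) *
    (2 * (Gamma (1 - α / 2) * (1 / z.im) ^ (α / 2))) with hC
  have : 0 < C := by positivity
  rw [Metric.tendsto_nhds]; intro η hη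
  obtain ⟨δ, hδ, hδN⟩ := ha.exists_norm_meanTransform_sub_le hα0 hz (show 0 < η / 4 by positivity)
  have hδ' : 0 < √δ := sqrt_pos.2 hδ
  have hε : 0 < η / (4 * C) := by positivity
  obtain ⟨p, hps, hpo⟩ := ((hτs.eventually (gt_mem_nhds (ENNReal.ofReal_pos.2 hδ'))).and
    (hτo.eventually (gt_mem_nhds (ENNReal.ofReal_pos.2 hε)))).exists
  obtain ⟨k', K', hk'⟩ := exists_isLimitKernel_of_mem_CStar hα0 hα2 (hτ p)
  have h1 := norm_limitTransform_sub_le hk (by linarith) (by linarith) hk'.isKernel hz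
    (hy₀ _ hzy.le) (integral_abs_sub_le_of_opNorm_lt hk hkσ hk'.isKernel hk'.ae_eq hε.le hpo)
  have h2 : ‖limitTransform (α / 2) k z - limitTransform (α / 2) k' z‖ ≤ η / 4 := by
    refine h1.trans_eq ?_
    trans C * (η / (4 * C))
    · rw [hC]; ring
    · field_simp
  filter_upwards [hδN, eventually_sum_sq_gridProfile_le hδ' hps,
    Metric.tendsto_nhds.1 (hk'.tendsto ν a ha z hz) (η / 4) (by positivity)] with N hN hN' hNτ
  rw [Real.sq_sqrt hδ.le] at hN'
  have h3 := hN _ _ (hk'.symm N) (hsymm N) hN'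
  rw [← dist_eq_norm, dist_comm] at h2 h3
  have := dist_triangle4 (meanTransform ν (a N) (gridProfile σ N) z)
    (meanTransform ν (a N) (gridProfile (τ p) N) z) (limitTransform (α / 2) k' z)
    (limitTransform (α / 2) k z)
  linarith

/-! ### Profiles with piecewise constant averages -/

section Equivalent

variable {α β K K' : ℝ} {σ σ' k k' : ℝ → ℝ → ℝ} {q : ℕ} {b : Fin (q + 1) → ℝ}
  {m : Matrix (Fin q) (Fin q) ℝ} {z : ℂ}

/-- On functions that are constant on cells, `fieldStep` depends only on the cell averages. -/
lemma IsPiecewiseConstantWith.fieldStep_eq (h : IsPiecewiseConstantWith σ' q b m)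
    (hk : IsKernel k K) (hkσ : IsKernelOf α σ k)
    (hE : ∀ r s : Fin q, ∀ x ∈ Ioc (b r.castSucc) (b r.succ),
      ∫⁻ v in Ioc (b s.castSucc) (b s.succ), ofReal (|σ x v| ^ α) =
        ofReal ((b s.succ - b s.castSucc) * |m r s| ^ α)) {X : ℝ → ℂ} {F : Fin q → ℂ}
    (hX : ∀ᵐ v ∂Λ, ∀ s, v ∈ Ioc (b s.castSucc) (b s.succ) → X v = F s) :
    ∀ᵐ x ∂Λ, ∀ r, x ∈ Ioc (b r.castSucc) (b r.succ) → fieldStep β k z X x =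
      ((Gamma (1 - β) / Gamma β : ℝ) : ℂ) *
        ∑ s, (((b s.succ - b s.castSucc) * |m r s| ^ α : ℝ) : ℂ) * lapInt β β (-(I * z)) (F s) := by
  filter_upwards [hkσ] with x hx r hr
  have hcell : ∀ {p : ℝ → Prop}, (∀ᵐ v ∂Λ, p v) → ∀ s : Fin q,
      ∀ᵐ v ∂volume.restrict (Ioc (b s.castSucc) (b s.succ)), p v := fun hp s =>
    ae_mono (Measure.restrict_mono (h.cell_subset s) le_rfl) hp
  have hInt : ∀ s : Fin q, IntegrableOn (k x) (Ioc (b s.castSucc) (b s.succ)) := fun s =>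
    IntegrableOn.mono_set (hk.integrable x) (h.cell_subset s)
  have hw : ∀ s : Fin q, ∫ v in Ioc (b s.castSucc) (b s.succ), k x v =
      (b s.succ - b s.castSucc) * |m r s| ^ α := fun s => by
    have hb : b s.castSucc < b s.succ := h.strictMono s.castSucc_lt_succ
    rw [integral_eq_lintegral_of_nonneg_ae (.of_forall (hk.nonneg x)) (hInt s).1,
      ← ENNReal.toReal_ofReal (mul_nonneg (sub_pos.2 hb).le (by positivity) : 0 ≤
        (b s.succ - b s.castSucc) * |m r s| ^ α), ← hE r s x hr]
    congr 1
    exact lintegral_congr_ae ((hcell hx s).mono fun v hv => congrArg ofReal hv.symm)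
  have hcong : ∀ s : Fin q, (fun v => (k x v : ℂ) * lapInt β β (-(I * z)) (X v))
      =ᵐ[volume.restrict (Ioc (b s.castSucc) (b s.succ))]
        fun v => (k x v : ℂ) * lapInt β β (-(I * z)) (F s) := fun s => by
    filter_upwards [hcell hX s, ae_restrict_mem measurableSet_Ioc] with v hv hvs
    rw [hv s hvs]
  have hU : Ioc (0 : ℝ) 1 = ⋃ s : Fin q, Ioc (b s.castSucc) (b s.succ) :=
    subset_antisymm (fun v hv => mem_iUnion.2 (h.exists_cell hv)) (iUnion_subset h.cell_subset)
  have hlt : ∀ s t : Fin q, s < t → Disjoint (Ioc (b s.castSucc) (b s.succ))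
      (Ioc (b t.castSucc) (b t.succ)) := fun s t hst =>
    disjoint_left.2 fun v hs ht => absurd (hs.2.trans (h.strictMono.monotone
      (show s.succ ≤ t.castSucc from hst))) (not_le.2 ht.1)
  have hdisj : Pairwise (Function.onFun Disjoint fun s : Fin q => Ioc (b s.castSucc) (b s.succ)) :=
    fun s t hst => (lt_or_gt_of_ne hst).elim (hlt s t) fun h => (hlt t s h).symm
  rw [fieldStep]; congr 1
  rw [unitMeasure, hU, integral_iUnion_fintype (fun s => measurableSet_Ioc) hdisj fun s =>
    ((hInt s).ofReal.mul_const _).congr (hcong s).symm]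
  refine sum_congr rfl fun s _ => ?_
  rw [integral_congr_ae (hcong s), integral_mul_const, integral_complex_ofReal, hw]

/-- By induction both sequences of iterates are almost everywhere constant on the cells, with the
same values, because on such fields a step depends on the kernel only through its cell averages. -/
lemma EquivalentTo.limitTransform_eq (h : EquivalentTo α σ σ') (hk : IsKernel k K)
    (hkσ : IsKernelOf α σ k) (hk' : IsKernel k' K') (hkσ' : IsKernelOf α σ' k') :
    limitTransform β k z = limitTransform β k' z := by
  obtain ⟨q, b, m, hσ', hE⟩ := h
  have hE' : ∀ r s : Fin q, ∀ x ∈ Ioc (b r.castSucc) (b r.succ),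
      ∫⁻ v in Ioc (b s.castSucc) (b s.succ), ofReal (|σ' x v| ^ α) =
        ofReal ((b s.succ - b s.castSucc) * |m r s| ^ α) := fun r s x hx => by
    rw [setLIntegral_congr_fun measurableSet_Ioc fun v hv => by rw [hσ'.eq r s x hx v hv],
      setLIntegral_const, Real.volume_Ioc, mul_comm, ← ENNReal.ofReal_mul]
    exact sub_nonneg.2 (hσ'.strictMono.monotone s.castSucc_lt_succ.le)
  -- The same cell values `F` must serve both kernels, so the two statements are carried through one
  -- induction.
  have hn : ∀ n, ∃ F : Fin q → ℂ,
      (∀ᵐ x ∂Λ, ∀ r, x ∈ Ioc (b r.castSucc) (b r.succ) → fieldIter β k n z x = F r) ∧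
      ∀ᵐ x ∂Λ, ∀ r, x ∈ Ioc (b r.castSucc) (b r.succ) → fieldIter β k' n z x = F r := by
    intro n
    induction n with
    | zero => exact ⟨0, .of_forall fun _ _ _ => rfl, .of_forall fun _ _ _ => rfl⟩
    | succ n ih =>
      obtain ⟨F, h1, h2⟩ := ih
      exact ⟨_, hσ'.fieldStep_eq hk hkσ hE h1, hσ'.fieldStep_eq hk' hkσ' hE' h2⟩
  choose F h1 h2 using hn
  rw [limitTransform, limitTransform]; congr 1
  refine integral_congr_ae ?_
  filter_upwards [ae_all_iff.2 h1, ae_all_iff.2 h2, ae_restrict_mem measurableSet_Ioc]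
    with x h1 h2 hx
  obtain ⟨r, hr⟩ := hσ'.exists_cell hx
  simp only [field, h1 _ r hr, h2 _ r hr]

end Equivalent

/-! ### The limiting measure -/

section LimitMeasure

variable {α K : ℝ} {σ k : ℝ → ℝ → ℝ} {μ : ProbabilityMeasure ℝ}

lemma IsLimitKernel.exists_measure (h : IsLimitKernel α σ k K) (hα0 : 0 < α) (hα2 : α < 2) :
    ∃ μ : ProbabilityMeasure ℝ, EqOn (stieltjes μ) (limitTransform (α / 2) k) upperHalf := by
  obtain ⟨a, ha⟩ := exists_isTailLimit hα0 hα2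
  obtain ⟨μ, hμ, -⟩ := exists_tendsto_meanMeasure (y₀ := 0) hα0 hα2 h.symm h.isKernel
    fun z hz _ => h.tendsto _ a ha z hz
  exact ⟨μ, hμ⟩

/-- Both transforms are limits of the same expected resolvents in the Pareto model. -/
lemma IsLimitKernel.limitTransform_eq (h : IsLimitKernel α σ k K) {k' : ℝ → ℝ → ℝ} {K' : ℝ}
    (h' : IsLimitKernel α σ k' K') (hα0 : 0 < α) (hα2 : α < 2) {z : ℂ} (hz : z ∈ upperHalf) :
    limitTransform (α / 2) k z = limitTransform (α / 2) k' z := by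
  obtain ⟨a, ha⟩ := exists_isTailLimit hα0 hα2
  exact tendsto_nhds_unique (h.tendsto _ a ha z hz) (h'.tendsto _ a ha z hz)

lemma IsLimitKernel.tendsto_integral (h : IsLimitKernel α σ k K) (hα0 : 0 < α) (hα2 : α < 2)
    (hμ : EqOn (stieltjes μ) (limitTransform (α / 2) k) upperHalf) {Ω : Type*} [MeasurableSpace Ω]
    {P : Measure Ω} [IsProbabilityMeasure P] {x : ℕ → ℕ → Ω → ℝ} (hx : IsHeavyTailedArray P α x)
    (f : ℝ →ᵇ ℝ) : Tendsto (fun N : ℕ => ∫ t, f t ∂(expectedSpectralMeasure P x σ N)) atTop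
      (𝓝 (∫ t, f t ∂(μ : Measure ℝ))) := by
  have := Measure.isProbabilityMeasure_map (μ := P) (hx.measurable 0 0 le_rfl).aemeasurable
  obtain ⟨μ', hμ', ht⟩ := exists_tendsto_meanMeasure (y₀ := 0) hα0 hα2 h.symm h.isKernel
    fun z hz _ => h.tendsto _ _ (hx.isTailLimit hα0 hα2) z hz
  have hμμ' : (μ : Measure ℝ) = μ' := ext_of_stieltjes fun z hz => (hμ hz).trans (hμ' hz).symm
  rw [hμμ', ← tendsto_add_atTop_iff_nat 1]
  refine ((ProbabilityMeasure.tendsto_iff_forall_integral_tendsto.1 ht) f).congr fun n => ?_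
  rw [hx.expectedSpectralMeasure_eq n.succ_pos (h.symm _)]; rfl

/-- The reflection symmetry of the limiting transform says that the reflected measure has the same
transform. -/
lemma map_neg_eq_of_stieltjes (hk : IsKernel k K) (hα0 : 0 < α) (hα2 : α < 2)
    (hμ : EqOn (stieltjes μ) (limitTransform (α / 2) k) upperHalf) :
    (μ : Measure ℝ).map (fun t => -t) = μ := by
  have := Measure.isProbabilityMeasure_map (μ := (μ : Measure ℝ)) measurable_neg.aemeasurable
  refine ext_of_stieltjes fun z hz => ?_
  have hz' : -(conj z) ∈ upperHalf := by simpa [upperHalf] using hz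
  have h1 := limitTransform_neg_conj hk (β := α / 2) (by linarith) (by linarith) hz'
  simp only [map_neg, conj_conj, neg_neg] at h1
  rw [hμ hz, h1, ← hμ hz', stieltjes, stieltjes, integral_map measurable_neg.aemeasurable
    (integrable_one_div_sub _ hz).1, ← integral_conj, ← integral_neg]
  refine integral_congr_fun fun t => ?_
  simp only [ofReal_neg, map_div₀, map_one, map_sub, map_neg, conj_conj, conj_ofReal]
  rw [← div_neg]; congr 1; ring

end LimitMeasure

end HeavyTail

end

/-! ### The main theorem -/

theorem mainTheorem2 (α : ℝ) (hα₀ : 0 < α) (hα₂ : α < 2) :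
    ∃ μ : (ℝ → ℝ → ℝ) → ProbabilityMeasure ℝ,
      (∀ σ : ℝ → ℝ → ℝ, IsInF α σ →
        -- weak convergence of the expected spectral measures
        (∀ (Ω : Type*) [MeasurableSpace Ω] (P : Measure Ω) [IsProbabilityMeasure P]
          (x : ℕ → ℕ → Ω → ℝ), IsHeavyTailedArray P α x →
          ∀ f : ℝ →ᵇ ℝ,
            Tendsto (fun N : ℕ => ∫ t, f t ∂(expectedSpectralMeasure P x σ N)) atTop
              (𝓝 (∫ t, f t ∂(μ σ : Measure ℝ)))) ∧
        -- symmetry of the limit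
        (μ σ : Measure ℝ).map (fun t => -t) = (μ σ : Measure ℝ) ∧
        -- the Cauchy-Stieltjes transform and the unique solution
        (∃ (R : ℝ) (Y : ℂ → Lp ℂ ∞ unitMeasure),
          IsSolution α σ R Y ∧
          (∀ Y' : ℂ → Lp ℂ ∞ unitMeasure, IsSolution α σ R Y' → EqOn Y' Y upperHalf) ∧
          ∀ z ∈ upperHalf,
            ∫ t, 1 / (z - (t : ℂ)) ∂(μ σ : Measure ℝ) =
              1 / z * ∫ v, hFun α (Y z v) ∂unitMeasure) ∧
        -- the density off zero
        (∃ ρ : ℝ → ℝ, Measurable ρ ∧ (∀ t, 0 ≤ ρ t) ∧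
          (μ σ : Measure ℝ).restrict {0}ᶜ =
            (volume.restrict {0}ᶜ).withDensity (fun t => ENNReal.ofReal (ρ t)) ∧
          (∀ δ : ℝ, 0 < δ → ∃ M : ℝ, ∀ t : ℝ, δ ≤ |t| → ρ t ≤ M) ∧
          Tendsto (fun t : ℝ => t ^ (α + 1) * ρ t) atTop
            (𝓝 (α / 2 * ∫ x, ∫ v, |σ x v| ^ α ∂unitMeasure ∂unitMeasure)))) ∧
      -- invariance under equivalence
      (∀ σ σ' : ℝ → ℝ → ℝ, IsInF α σ → σ' ∈ CStar → EquivalentTo α σ σ' → μ σ = μ σ') := by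
  -- The measure is chosen from `σ` alone, before any probability space, and serves every limit
  -- kernel of `σ` at once. Profiles without a limit kernel receive the point mass at `0`.
  have hex : ∀ σ : ℝ → ℝ → ℝ, ∃ μ : ProbabilityMeasure ℝ, ∀ k K, IsLimitKernel α σ k K →
      EqOn (stieltjes μ) (limitTransform (α / 2) k) upperHalf := by
    intro σ
    by_cases h : ∃ k K, IsLimitKernel α σ k K
    · obtain ⟨k, K, hk⟩ := h
      obtain ⟨μ, hμ⟩ := hk.exists_measure hα₀ hα₂
      exact ⟨μ, fun k' K' hk' z hz => (hμ hz).trans (hk.limitTransform_eq hk' hα₀ hα₂ hz)⟩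
    · exact ⟨⟨Measure.dirac 0, inferInstance⟩, fun k K hk => absurd ⟨k, K, hk⟩ h⟩
  choose μ hμ using hex
  refine ⟨μ, fun σ hσ => ?_, fun σ σ' hσ hσ' h => ?_⟩
  · obtain ⟨k, K, hk⟩ := hσ.exists_isLimitKernel hα₀ hα₂
    have hμk := hμ σ k K hk
    refine ⟨fun Ω _ P _ x hx f => hk.tendsto_integral hα₀ hα₂ hμk hx f,
      map_neg_eq_of_stieltjes hk.isKernel hα₀ hα₂ hμk, ?_, ?_⟩
    · obtain ⟨R, hR⟩ := exists_unique_isSolution hk.isKernel hα₀ hα₂ hk.ae_eq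
      obtain ⟨Y, hY, hYe⟩ := exists_isSolution hk.isKernel hα₀ hα₂ hk.ae_eq R
      refine ⟨R, Y, hY, fun Y' hY' => hR Y Y' hY hY', fun z hz => (hμk hz).trans ?_⟩
      rw [limitTransform_eq hα₀ hα₂ hz]
      congr 1
      exact integral_congr_ae ((hYe z hz).mono fun v hv => congrArg (hFun α) hv.symm)
    -- The kernel is a version of `|σ|^α`, so it has the same double integral.
    · have hS : ∫ x, ∫ v, |σ x v| ^ α ∂unitMeasure ∂unitMeasure =
          ∫ x, ∫ v, k x v ∂unitMeasure ∂unitMeasure :=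
        integral_congr_ae (hk.ae_eq.mono fun x hx => integral_congr_ae hx)
      set S := ∫ x, ∫ v, k x v ∂unitMeasure ∂unitMeasure
      have hS0 : 0 ≤ S := integral_nonneg fun x => integral_nonneg (hk.isKernel.nonneg x)
      obtain ⟨C, hC⟩ := norm_mul_limitTransform_le hk.isKernel hα₀ hα₂
      obtain ⟨R, C', hR, hC'⟩ := exists_limitTransform_expansion hk.isKernel hα₀ hα₂
      have him := im_tailCoeff hα₀ hα₂ S
      rw [hS, ← him]
      refine exists_density_of_stieltjes hα₀ (μ σ) (fun z hz => by rw [hμk hz]; exact hC z hz) ?_ hR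
        fun z hz hzR => by rw [hμk hz]; exact hC' z hz hzR
      have h0 : 0 ≤ -(tailCoeff α S).im / Real.pi := by rw [him]; positivity
      rw [le_div_iff₀ Real.pi_pos, zero_mul] at h0
      linarith
  · obtain ⟨k, K, hk⟩ := hσ.exists_isLimitKernel hα₀ hα₂
    obtain ⟨k', K', hk'⟩ := exists_isLimitKernel_of_mem_CStar hα₀ hα₂ hσ'
    refine ProbabilityMeasure.toMeasure_injective (ext_of_stieltjes fun z hz => ?_)
    exact (hμ σ k K hk hz).trans ((h.limitTransform_eq hk.isKernel hk.ae_eq hk'.isKernel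
      hk'.ae_eq).trans (hμ σ' k' K' hk' hz).symm)
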